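/- Let $K$ be a finite simplicial complex with $n$ simplices whose edges carry non-negative real weights (unit weights being a special case), and let $d \ge 0$. Homology is taken with coefficients in $\mathbb{Z}_2$. For vertices $p,q$ let $\mathrm{dist}(p,q)\in[0,\infty]$ be the length of a shortest path from $p$ to $q$ in the 1-skeleton of $K$ ($\infty$ if there is none), let $d_p(\sigma)=\max_{q\in\sigma}\mathrm{dist}(p,q)$ for a simplex $\sigma$, and let $B_p^r=\{\sigma\in K : d_p(\sigma)\le r\}$ for $r \in [0,\infty]$ be the geodesic ball. The size of a $d$-cycle $C$ is $\mu(C)=\min\{r : C\subset B_p^r \text{ for some vertex } p \text{ of } K\}$. A minimal homology basis of $H_d(K)$ is a family of $g=\operatorname{rank} H_d(K)$ cycles $C_1,\dots,C_g$ whose classes form a basis of $H_d(K)$ and whose sequence of sizes, sorted in nondecreasing order, is lexicographically smallest among all such families. Computation takes place on a unit-cost random access machine: finitely many registers and arrays, fixed by the program, of integer words that are polynomially bounded in the input parameters (the operations are $+$, truncated $-$, $\times$, integer division, and comparison), and of real numbers, which can only be copied, added and compared. Theorem. Let $\omega>2$ be a real number such that two $m\times m$ matrices over $\mathbb{Z}_2$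 can be multiplied in $O(m^{\omega})$ steps. Then there is one program that, given any such $K$ (its $n\ge 1$ simplices listed in any order as vertex subsets, with the edge weights) and any $d$, outputs a minimal homology basis of $H_d(K)$ in $O(n^{\omega+1})$ steps. The constant in the bound depends neither on $K$, nor on its weights, nor on $d$. -/

import Mathlib

open scoped NNReal ENNReal

/-! ## Simplicial homology over the field with two elements -/

section Homology

variable {V : Type*} [Fintype V] [DecidableEq V]

/-- The `d`-simplices of `K`: the faces with `d + 1` vertices. -/
abbrev Simplex (K : AbstractSimplicialComplex V) (d : ℕ) : Type _ :=
  {s : Finset V // s ∈ K.faces ∧ s.card = d + 1}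

noncomputable instance instFintypeSimplex (K : AbstractSimplicialComplex V) (d : ℕ) :
    Fintype (Simplex K d) :=
  Fintype.ofFinite _

/-- The `d`-chains of `K` with coefficients in `ℤ/2`. -/
abbrev Chain (K : AbstractSimplicialComplex V) (d : ℕ) : Type _ :=
  Simplex K d → ZMod 2

/-- The boundary map `C_{d+1} → C_d`: a simplex is sent to the sum of its `d`-dimensional faces. -/
noncomputable def boundary (K : AbstractSimplicialComplex V) (d : ℕ) :
    Chain K (d + 1) →ₗ[ZMod 2] Chain K d :=
  Matrix.mulVecLin (Matrix.of fun (τ : Simplex K d) (σ : Simplex K (d + 1)) =>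
    if τ.1 ⊆ σ.1 then (1 : ZMod 2) else 0)

/-- The `d`-cycles: chains with empty boundary (every `0`-chain is a cycle). -/
noncomputable def cycles (K : AbstractSimplicialComplex V) :
    (d : ℕ) → Submodule (ZMod 2) (Chain K d)
  | 0 => ⊤
  | d + 1 => LinearMap.ker (boundary K d)

/-- The `d`-boundaries. -/
noncomputable def boundaries (K : AbstractSimplicialComplex V) (d : ℕ) :
    Submodule (ZMod 2) (Chain K d) :=
  LinearMap.range (boundary K d)

/-- The homology group `H_d(K) = Z_d / B_d`. -/
abbrev Homology (K : AbstractSimplicialComplex V) (d : ℕ) : Type _ :=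
  cycles K d ⧸ (boundaries K d).submoduleOf (cycles K d)

/-- The homology class of a cycle. -/
noncomputable def homologyClass (K : AbstractSimplicialComplex V) (d : ℕ) (c : cycles K d) :
    Homology K d :=
  Submodule.Quotient.mk c

/-- A family of cycles is a homology basis if its classes form a basis of `H_d(K)`. -/
def IsHomologyBasis (K : AbstractSimplicialComplex V) (d : ℕ) {g : ℕ}
    (c : Fin g → cycles K d) : Prop :=
  LinearIndependent (ZMod 2) (fun i => homologyClass K d (c i)) ∧
    Submodule.span (ZMod 2) (Set.range fun i => homologyClass K d (c i)) = ⊤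

/-! ## Geodesic distance and the radius size of a cycle -/

/-- The graph formed by the vertices and the edges of `K`. -/
def oneSkeleton (K : AbstractSimplicialComplex V) : SimpleGraph V where
  Adj a b := a ≠ b ∧ ({a, b} : Finset V) ∈ K.faces
  symm := ⟨fun a b h => ⟨h.1.symm, by rw [Finset.pair_comm]; exact h.2⟩⟩
  loopless := ⟨fun _ h => h.1 rfl⟩

/-- The length of a walk; `w` gives the weight of every edge, and its values at the sets that
are not edges of `K` play no role. -/
noncomputable def walkLength (K : AbstractSimplicialComplex V) (w : Finset V → ℝ≥0) {p q : V}
    (π : (oneSkeleton K).Walk p q) : ℝ≥0∞ :=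
  (π.darts.map fun e => ((w {e.fst, e.snd} : ℝ≥0) : ℝ≥0∞)).sum

/-- The length of a shortest path from `p` to `q` (`∞` if there is no path). -/
noncomputable def geodesicDist (K : AbstractSimplicialComplex V) (w : Finset V → ℝ≥0)
    (p q : V) : ℝ≥0∞ :=
  ⨅ π : (oneSkeleton K).Walk p q, walkLength K w π

/-- The geodesic distance from a vertex to a simplex: the maximum over the vertices of the
simplex. -/
noncomputable def simplexDist (K : AbstractSimplicialComplex V) (w : Finset V → ℝ≥0)
    (p : V) (s : Finset V) : ℝ≥0∞ :=
  s.sup fun q => geodesicDist K w p q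

/-- The geodesic ball of radius `r` centered at the vertex `p`, as a set of simplices. -/
def geodesicBall (K : AbstractSimplicialComplex V) (w : Finset V → ℝ≥0)
    (p : V) (r : ℝ≥0∞) : Set (Finset V) :=
  {s | s ∈ K.faces ∧ simplexDist K w p s ≤ r}

/-- The size of a cycle: the least radius of a geodesic ball, centered at some vertex of `K`,
which contains the cycle. -/
noncomputable def cycleSize (K : AbstractSimplicialComplex V) (w : Finset V → ℝ≥0) {d : ℕ}
    (c : cycles K d) : ℝ≥0∞ :=
  sInf {r | ∃ p : V, ∀ s : Simplex K d, c.1 s ≠ 0 → s.1 ∈ geodesicBall K w p r}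

/-- The sizes of a family of cycles, sorted in nondecreasing order, with the lexicographic order
on such sequences. -/
noncomputable def sizeSequence (K : AbstractSimplicialComplex V) (w : Finset V → ℝ≥0) {d g : ℕ}
    (c : Fin g → cycles K d) : Lex (Fin g → ℝ≥0∞) :=
  toLex ((fun i => cycleSize K w (c i)) ∘ Tuple.sort fun i => cycleSize K w (c i))

/-- A minimal homology basis: a homology basis whose sorted sequence of sizes is
lexicographically smallest among all homology bases. -/
def IsMinimalHomologyBasis (K : AbstractSimplicialComplex V) (w : Finset V → ℝ≥0) (d : ℕ)
    {g : ℕ} (c : Fin g → cycles K d) : Prop :=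
  IsHomologyBasis K d c ∧
    ∀ c' : Fin g → cycles K d, IsHomologyBasis K d c' →
      sizeSequence K w c ≤ sizeSequence K w c'

end Homology

/-! ## A random access machine with a step count

The machine has integer registers and arrays, whose contents are machine words, and registers and
arrays for real numbers, on which it can only copy, add and compare. Programs are finite, and so
mention finitely many registers and arrays. Every instruction and every evaluation of a test is
one step. -/

/-- Word operations; subtraction is truncated at zero, division rounds down and gives zero for the
divisor zero. -/
inductive WordOp
  | add
  | sub
  | mul
  | div

/-- The value of a word operation. -/
def WordOp.eval : WordOp → ℕ → ℕ → ℕ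
  | .add, a, b => a + b
  | .sub, a, b => a - b
  | .mul, a, b => a * b
  | .div, a, b => a / b

/-- Tests on two word registers or on two real registers. -/
inductive Test
  | wordLt (a b : ℕ)
  | realLt (a b : ℕ)

/-- Programs. Registers and arrays are named by natural numbers which are fixed in the program;
array positions are read off from word registers. -/
inductive Program
  | skip
  /-- `word r := c` -/
  | const (r c : ℕ)
  /-- `word r := word a (op) word b` -/
  | arith (op : WordOp) (r a b : ℕ)
  /-- `word r := wordArray A [word i]` -/
  | load (r A i : ℕ)
  /-- `wordArray A [word i] := word r` -/
  | store (A i r : ℕ)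
  /-- `real r := real a + real b` -/
  | realAdd (r a b : ℕ)
  /-- `real r := realArray A [word i]` -/
  | realLoad (r A i : ℕ)
  /-- `realArray A [word i] := real r` -/
  | realStore (A i r : ℕ)
  | seq (P Q : Program)
  | ite (b : Test) (P Q : Program)
  | while (b : Test) (P : Program)

/-- The contents of the memory. -/
structure Memory where
  word : ℕ → ℕ
  wordArray : ℕ → ℕ → ℕ
  real : ℕ → ℝ
  realArray : ℕ → ℕ → ℝ

/-- The truth of a test. -/
def Test.Holds : Test → Memory → Prop
  | .wordLt a b, s => s.word a < s.word b
  | .realLt a b, s => s.real a < s.real b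

/-- Memory after writing `x` to the word register `r`. -/
def Memory.setWord (s : Memory) (r x : ℕ) : Memory :=
  { s with word := Function.update s.word r x }

/-- Memory after writing `x` to position `i` of the word array `A`. -/
def Memory.setWordArray (s : Memory) (A i x : ℕ) : Memory :=
  { s with wordArray := Function.update s.wordArray A (Function.update (s.wordArray A) i x) }

/-- Memory after writing `x` to the real register `r`. -/
noncomputable def Memory.setReal (s : Memory) (r : ℕ) (x : ℝ) : Memory :=
  { s with real := Function.update s.real r x }

/-- Memory after writing `x` to position `i` of the real array `A`. -/
noncomputable def Memory.setRealArray (s : Memory) (A i : ℕ) (x : ℝ) : Memory :=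
  { s with realArray := Function.update s.realArray A (Function.update (s.realArray A) i x) }

/-- `Exec W P s s' t`: started on the memory `s`, the program `P` halts with the memory `s'` after
exactly `t` steps, and no word that it computes on the way reaches the bound `W`. A run that would
exceed the word bound is aborted, that is, it has no result. -/
inductive Exec (W : ℕ) : Program → Memory → Memory → ℕ → Prop
  | skip (s : Memory) : Exec W .skip s s 1
  | const (s : Memory) (r c : ℕ) (hc : c < W) : Exec W (.const r c) s (s.setWord r c) 1
  | arith (s : Memory) (op : WordOp) (r a b : ℕ) (h : op.eval (s.word a) (s.word b) < W) :
      Exec W (.arith op r a b) s (s.setWord r (op.eval (s.word a) (s.word b))) 1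
  | load (s : Memory) (r A i : ℕ) :
      Exec W (.load r A i) s (s.setWord r (s.wordArray A (s.word i))) 1
  | store (s : Memory) (A i r : ℕ) :
      Exec W (.store A i r) s (s.setWordArray A (s.word i) (s.word r)) 1
  | realAdd (s : Memory) (r a b : ℕ) :
      Exec W (.realAdd r a b) s (s.setReal r (s.real a + s.real b)) 1
  | realLoad (s : Memory) (r A i : ℕ) :
      Exec W (.realLoad r A i) s (s.setReal r (s.realArray A (s.word i))) 1
  | realStore (s : Memory) (A i r : ℕ) :
      Exec W (.realStore A i r) s (s.setRealArray A (s.word i) (s.real r)) 1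
  | seq {P Q : Program} {s s' s'' : Memory} {t t' : ℕ} (hP : Exec W P s s' t)
      (hQ : Exec W Q s' s'' t') : Exec W (.seq P Q) s s'' (t + t')
  | iteTrue {b : Test} {P Q : Program} {s s' : Memory} {t : ℕ} (hb : b.Holds s)
      (hP : Exec W P s s' t) : Exec W (.ite b P Q) s s' (t + 1)
  | iteFalse {b : Test} {P Q : Program} {s s' : Memory} {t : ℕ} (hb : ¬ b.Holds s)
      (hQ : Exec W Q s s' t) : Exec W (.ite b P Q) s s' (t + 1)
  | whileFalse {b : Test} {P : Program} {s : Memory} (hb : ¬ b.Holds s) :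
      Exec W (.while b P) s s 1
  | whileTrue {b : Test} {P : Program} {s s' s'' : Memory} {t t' : ℕ} (hb : b.Holds s)
      (hP : Exec W P s s' t) (hw : Exec W (.while b P) s' s'' t') :
      Exec W (.while b P) s s'' (t + t' + 1)

/-! ## Inputs and outputs -/

/-- The entry at position `x` of the row by row listing of an `a × b` array of words; positions
past the end of the listing hold zero. -/
def rowMajor (a b : ℕ) (f : Fin a → Fin b → ℕ) (x : ℕ) : ℕ :=
  if h : x / b < a ∧ 0 < b then f ⟨x / b, h.1⟩ ⟨x % b, Nat.mod_lt x h.2⟩ else 0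

/-- Input for the multiplication of two `m × m` matrices over `ℤ/2`: word register `0` holds `m`,
word arrays `0` and `1` hold the matrices row by row, everything else is zero. -/
def matMulInput {m : ℕ} (A B : Matrix (Fin m) (Fin m) (ZMod 2)) : Memory where
  word r := if r = 0 then m else 0
  wordArray a :=
    if a = 0 then rowMajor m m fun i j => (A i j).val
    else if a = 1 then rowMajor m m fun i j => (B i j).val
    else fun _ => 0
  real _ := 0
  realArray _ _ := 0

/-- Two `m × m` matrices over `ℤ/2` can be multiplied in `O(m ^ ω)` steps, by one program which
uses words of `O(log m)` bits and leaves the product, row by row, in word array `0`. -/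
def MatMulInTime (ω : ℝ) : Prop :=
  ∃ (P : Program) (k : ℕ) (C : ℝ), ∀ (m : ℕ) (A B : Matrix (Fin m) (Fin m) (ZMod 2)), 0 < m →
    ∃ (s : Memory) (t : ℕ), Exec ((m + 2) ^ k) P (matMulInput A B) s t ∧
      (t : ℝ) ≤ C * (m : ℝ) ^ ω ∧
      ∀ i j : Fin m, s.wordArray 0 (i * m + j) = ((A * B) i j).val

/-- Input for the homology basis problem in dimension `d`, for a complex `K` with the vertices
`0, …, v - 1` and the simplices `σ 0, …, σ (n - 1)`, listed in any order, and for edge weights `w`: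
word registers `0`, `1`, `2` hold `n`, `v`, `d`; word array `0` holds, row by row, the `n × v`
matrix which tells the vertices of each simplex; position `i` of real array `0` holds the weight of
`σ i` if `σ i` is an edge; everything else is zero. -/
noncomputable def homologyBasisInput {v n : ℕ} (K : AbstractSimplicialComplex (Fin v))
    (σ : Fin n ≃ K.faces) (w : Finset (Fin v) → ℝ≥0) (d : ℕ) : Memory where
  word r := if r = 0 then n else if r = 1 then v else if r = 2 then d else 0
  wordArray a :=
    if a = 0 then rowMajor n v fun i j => if j ∈ (σ i).1 then 1 else 0
    else fun _ => 0
  real _ := 0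
  realArray a x :=
    if h : a = 0 ∧ x < n then
      if (σ ⟨x, h.2⟩).1.card = 2 then ((w (σ ⟨x, h.2⟩).1 : ℝ≥0) : ℝ) else 0
    else 0

/-- The coefficient of an arbitrary simplex of `K` in a `d`-cycle (zero if the simplex is not of
dimension `d`). -/
noncomputable def simplexCoeff {v : ℕ} {K : AbstractSimplicialComplex (Fin v)} {d : ℕ}
    (c : cycles K d) (s : K.faces) : ZMod 2 :=
  if h : s.1.card = d + 1 then c.1 ⟨s.1, s.2, h⟩ else 0

/-- The memory `s` represents the family `c` of `d`-cycles: word register `0` holds the number `g`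
of cycles, and word array `0` holds, row by row, the `g × n` matrix of their coefficients at
`σ 0, …, σ (n - 1)`. -/
def OutputsCycles {v n : ℕ} {K : AbstractSimplicialComplex (Fin v)} (σ : Fin n ≃ K.faces) {d g : ℕ}
    (c : Fin g → cycles K d) (s : Memory) : Prop :=
  s.word 0 = g ∧
    ∀ (j : Fin g) (i : Fin n), s.wordArray 0 (j * n + i) = (simplexCoeff (c j) (σ i)).val

/-!
The theorem combines a matroid argument, an elimination over `ℤ/2` that is as fast as matrix
multiplication, and an implementation of both on the machine.

*Why the greedy basis is minimal.* Let the members `c i` of a homology basis carry keys `key i` that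
bound their sizes, and suppose that the cycles in every ball of radius `r` are generated, in
homology, by the members with keys at most `r`. In any other basis, the members of size at most `r`
are independent and lie in the span of the `c i` with `key i ≤ r`, so there are at most as many of
them; hence the basis is minimal (`isMinimalHomologyBasis_of_span`). Such a basis is built vertex by
vertex. If the balls around the vertices treated so far satisfy the condition, and if a list of at
most `n` cycles generates the cycles in the balls around the next vertex `p` in the same graded
sense, then one sorts these cycles and the old basis by their radii and keeps those that are
independent in homology of the earlier ones (`GreedyBasis.step`).

*The cycles around a vertex.* Relaxing all edges `v` times gives the distances from `p`. Sort the
simplices by their distance from `p` and eliminate the boundary matrix of the `d`-simplices in this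
order. Each column that is not a pivot column yields a fundamental cycle, which consists of its
simplex and of simplices of earlier pivot columns, and the fundamental cycles up to a position
generate all cycles supported up to it (`Elimination.mem_span_fundamentalVec`). As a ball around `p`
is an initial segment of the order, these are the cycles that the greedy step needs. The independent
ones among at most `2 * n` items are then found as the pivot columns of a second elimination, of the
boundaries of the `(d + 1)`-simplices followed by the items.

*Elimination in the time of multiplication.* Column `k` of the matrix determines an elementary map
`x ↦ x + x (p k) • w k`, where `p k` is its pivot row. The composition of the maps of a block of
columns has the same form, so it is stored by as many vectors, and it is applied to a block of
columns by one matrix product for each group of rows. After column `j` has been processed, the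
blocks that end there are merged, or applied to the following columns, as the binary digits of
`j + 1` tell. Blocks of size `2 ^ l` of a matrix of size `2 ^ L` take part in `4 ^ (L - l)` products
of size `2 ^ l`; as `2 < ω`, the largest blocks dominate and the sum is `O((2 ^ L) ^ ω)`
(`RAM.eliminate_spec`, `RAM.exists_eliminateCost_le`). Two eliminations of size at most `6 * n + 1`
for each of at most `n` vertices give the bound.

*The machine.* The multiplication program is given as a black box, which may leave any of its
registers and arrays dirty, while it expects clean ones at the start. It is run in a private part of
the memory, with a log of the positions it writes to; cleaning up after the run then takes no longer
than the run itself (`RAM.Exec.instrument`, `RAM.mulCall_halts`). The other steps are written in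
a small language of expressions and commands with a denotation and a cost, whose compilation to
programs is correct (`RAM.Cmd.compile_halts`).
-/

/-! ### Total correctness triples for the machine -/

/-- From the memory `s` the program `P` halts within `T` steps, in a memory satisfying `Q`. -/
def Halts (W : ℕ) (P : Program) (s : Memory) (T : ℕ) (Q : Memory → Prop) : Prop :=
  ∃ s' t, Exec W P s s' t ∧ t ≤ T ∧ Q s'

namespace Halts

variable {W : ℕ} {P P' : Program} {s : Memory} {T T' : ℕ} {Q Q' : Memory → Prop}

theorem mono (h : Halts W P s T Q) (hT : T ≤ T') (hQ : ∀ s', Q s' → Q' s') :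
    Halts W P s T' Q' := by
  obtain ⟨s', t, h1, h2, h3⟩ := h
  exact ⟨s', t, h1, h2.trans hT, hQ _ h3⟩

theorem seq (h : Halts W P s T Q) (h' : ∀ s', Q s' → Halts W P' s' T' Q') :
    Halts W (.seq P P') s (T + T') Q' := by
  obtain ⟨s', t, h1, h2, h3⟩ := h
  obtain ⟨s'', t', h4, h5, h6⟩ := h' s' h3
  exact ⟨s'', _, h1.seq h4, by omega, h6⟩

theorem seq_wp (h : Halts W P s T fun s' => Halts W P' s' T' Q') :
    Halts W (.seq P P') s (T + T') Q' :=
  h.seq fun _ h => h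

theorem skip (h : Q s) : Halts W .skip s 1 Q := ⟨_, _, .skip s, le_rfl, h⟩

theorem const {r c : ℕ} (hc : c < W) (h : Q (s.setWord r c)) : Halts W (.const r c) s 1 Q :=
  ⟨_, _, .const s r c hc, le_rfl, h⟩

theorem arith {op : WordOp} {r a b : ℕ} (hc : op.eval (s.word a) (s.word b) < W)
    (h : Q (s.setWord r (op.eval (s.word a) (s.word b)))) : Halts W (.arith op r a b) s 1 Q :=
  ⟨_, _, .arith s op r a b hc, le_rfl, h⟩

theorem load {r A i : ℕ} (h : Q (s.setWord r (s.wordArray A (s.word i)))) :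
    Halts W (.load r A i) s 1 Q :=
  ⟨_, _, .load s r A i, le_rfl, h⟩

theorem store {r A i : ℕ} (h : Q (s.setWordArray A (s.word i) (s.word r))) :
    Halts W (.store A i r) s 1 Q :=
  ⟨_, _, .store s A i r, le_rfl, h⟩

theorem realAdd {r a b : ℕ} (h : Q (s.setReal r (s.real a + s.real b))) :
    Halts W (.realAdd r a b) s 1 Q :=
  ⟨_, _, .realAdd s r a b, le_rfl, h⟩

theorem realLoad {r A i : ℕ} (h : Q (s.setReal r (s.realArray A (s.word i)))) :
    Halts W (.realLoad r A i) s 1 Q :=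
  ⟨_, _, .realLoad s r A i, le_rfl, h⟩

theorem realStore {r A i : ℕ} (h : Q (s.setRealArray A (s.word i) (s.real r))) :
    Halts W (.realStore A i r) s 1 Q :=
  ⟨_, _, .realStore s A i r, le_rfl, h⟩

theorem ite {b : Test} (h : b.Holds s → Halts W P s T Q) (h' : ¬ b.Holds s → Halts W P' s T Q) :
    Halts W (.ite b P P') s (T + 1) Q := by
  by_cases hb : b.Holds s
  · obtain ⟨s', t, h1, h2, h3⟩ := h hb
    exact ⟨s', _, .iteTrue hb h1, by omega, h3⟩
  · obtain ⟨s', t, h1, h2, h3⟩ := h' hb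
    exact ⟨s', _, .iteFalse hb h1, by omega, h3⟩

/-- The rule for a loop that runs over `0, …, N - 1`: the counter lies in the register `i`, the
bound in the register `m`, and the body increments the counter. -/
theorem whileLt {i m N : ℕ} (I : ℕ → Memory → Prop) (f : ℕ → ℕ)
    (hI : ∀ k s, I k s → s.word i = k ∧ s.word m = N)
    (step : ∀ k < N, ∀ s, I k s → Halts W P s (f k) (I (k + 1))) (h0 : I 0 s) :
    Halts W (.while (.wordLt i m) P) s (∑ k ∈ Finset.range N, (f k + 1) + 1) (I N) := by
  have key : ∀ l k, k + l = N → ∀ s, I k s →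
      Halts W (.while (.wordLt i m) P) s (∑ j ∈ Finset.Ico k N, (f j + 1) + 1) (I N) := by
    intro l
    induction l with
    | zero =>
      intro k hk s hs
      obtain rfl : k = N := by omega
      obtain ⟨h1, h2⟩ := hI _ _ hs
      exact ⟨s, 1, .whileFalse (by simp [Test.Holds, h1, h2]), by simp, hs⟩
    | succ l ih =>
      intro k hk s hs
      obtain ⟨h1, h2⟩ := hI _ _ hs
      obtain ⟨s', t, e1, e2, e3⟩ := step k (by omega) s hs
      obtain ⟨s'', t', e4, e5, e6⟩ := ih (k + 1) (by omega) s' e3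
      refine ⟨s'', _, .whileTrue (by simp [Test.Holds, h1, h2]; omega) e1 e4, ?_, e6⟩
      rw [Finset.sum_eq_sum_Ico_succ_bot (by omega : k < N)]
      omega
  simpa using key N 0 (by omega) s h0

end Halts

/-! ### Running a foreign program in a private part of the memory -/

/-- A bound for the numbers of the word registers and word arrays which a program mentions. -/
def Program.width : Program → ℕ
  | .skip | .realAdd .. => 0
  | .const r _ => r + 1
  | .arith _ r a b => max (r + 1) (max (a + 1) (b + 1))
  | .load r A i => max (r + 1) (max (A + 1) (i + 1))
  | .store A i r => max (r + 1) (max (A + 1) (i + 1))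
  | .realLoad _ _ _ => 0
  | .realStore _ _ _ => 0
  | .seq P Q => max P.width Q.width
  | .ite (.wordLt a b) P Q => max (max (a + 1) (b + 1)) (max P.width Q.width)
  | .ite (.realLt _ _) P Q => max P.width Q.width
  | .while (.wordLt a b) P => max (max (a + 1) (b + 1)) P.width
  | .while (.realLt _ _) P => P.width

/-- The program `P`, moved to the word registers from `64` on and to the word arrays from `32` on,
and modified to log the positions of its writes to arrays: word array `31` lists these positions,
and word register `60` counts them (register `61` has to hold the number one). All operations on
real numbers are dropped, since `P` will be run only where all reals are zero. -/
def Program.instrument : Program → Program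
  | .const r c => .const (64 + r) c
  | .arith op r a b => .arith op (64 + r) (64 + a) (64 + b)
  | .load r A i => .load (64 + r) (32 + A) (64 + i)
  | .store A i r => .seq (.store 31 60 (64 + i)) (.seq (.arith .add 60 60 61)
      (.store (32 + A) (64 + i) (64 + r)))
  | .seq P Q => .seq P.instrument Q.instrument
  | .ite (.wordLt a b) P Q => .ite (.wordLt (64 + a) (64 + b)) P.instrument Q.instrument
  | .ite (.realLt _ _) _ Q => Q.instrument
  | .while (.wordLt a b) P => .while (.wordLt (64 + a) (64 + b)) P.instrument
  | _ => .skip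

/-- The memory `s'` of an instrumented program represents the memory `s` of the original one. The
private registers and arrays are those below `64 + R` and `32 + R`; outside of them the memory is
as in `u`, and the nonzero entries of the private arrays are at positions below `q` or logged. -/
structure Simulates (R q : ℕ) (u s s' : Memory) : Prop where
  word : ∀ r < R, s'.word (64 + r) = s.word r
  array : ∀ A < R, s'.wordArray (32 + A) = s.wordArray A
  real : ∀ r, s.real r = 0
  realArray : ∀ A i, s.realArray A i = 0
  one : s'.word 61 = 1
  logged : ∀ A x, s'.wordArray (32 + A) x ≠ 0 → x < q ∨ ∃ i < s'.word 60, s'.wordArray 31 i = x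
  frameWord : ∀ r, r < 60 ∨ 64 + R ≤ r → s'.word r = u.word r
  frameArray : ∀ A, A < 31 ∨ 32 + R ≤ A → s'.wordArray A = u.wordArray A
  frameReal : s'.realArray = u.realArray

/-- The simulated program writes to a word register. -/
theorem Simulates.setWord {R q : ℕ} {u s s' : Memory} (h : Simulates R q u s s') {r : ℕ} (x : ℕ)
    (hr : r < R) : Simulates R q u (s.setWord r x) (s'.setWord (64 + r) x) where
  word := by
    intro r' hr'
    by_cases e : r' = r
    · simp [Memory.setWord, e]
    · simp [Memory.setWord, Function.update, e, h.word r' hr']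
  array := h.array
  real := h.real
  realArray := h.realArray
  one := by
    have : (61 : ℕ) ≠ 64 + r := by omega
    simp [Memory.setWord, Function.update, this, h.one]
  logged := by
    have : (60 : ℕ) ≠ 64 + r := by omega
    simpa [Memory.setWord, Function.update, this] using h.logged
  frameWord := by
    intro r' hr'
    have : r' ≠ 64 + r := by omega
    simp [Memory.setWord, Function.update, this, h.frameWord r' hr']
  frameArray := h.frameArray
  frameReal := h.frameReal

/-- A write to a word array is simulated together with the entry of its position into the log. -/
theorem Simulates.setWordArray {R q : ℕ} {u s s' : Memory} (h : Simulates R q u s s')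
    {A : ℕ} (i x : ℕ) (hA : A < R) :
    Simulates R q u (s.setWordArray A i x)
      (((s'.setWordArray 31 (s'.word 60) i).setWord 60 (s'.word 60 + 1)).setWordArray
        (32 + A) i x) where
  word := by
    intro r' hr'
    simp [Memory.setWord, Memory.setWordArray, Function.update, h.word r' hr', show 64 + r' ≠ 60 by omega]
  array := by
    intro B hB
    by_cases e : B = A
    · subst e
      simp [Memory.setWord, Memory.setWordArray, h.array _ hB, Function.update,
        show 32 + B ≠ 31 by omega]
    · have : 32 + B ≠ 32 + A := by omega
      simp [Memory.setWord, Memory.setWordArray, Function.update, e, h.array _ hB,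
        show 32 + B ≠ 31 by omega]
  real := h.real
  realArray := h.realArray
  one := by simpa [Memory.setWord, Memory.setWordArray] using h.one
  logged := by
    intro B y hy
    have h31 : (31 : ℕ) ≠ 32 + A := by omega
    simp only [Memory.setWord, Memory.setWordArray, Function.update_self,
      Function.update_of_ne h31] at hy ⊢
    by_cases hyx : y = i
    · right
      exact ⟨s'.word 60, by omega, by simp [hyx]⟩
    · have : s'.wordArray (32 + B) y ≠ 0 := by
        by_cases e : B = A
        · subst e
          simpa [Function.update, hyx, show 32 + B ≠ 31 by omega] using hy
        · simpa [Function.update, e, show 32 + B ≠ 31 by omega] using hy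
      rcases h.logged B y this with h1 | ⟨k, hk, h1⟩
      · exact Or.inl h1
      · refine Or.inr ⟨k, by omega, ?_⟩
        rw [Function.update_of_ne (by omega)]
        exact h1
  frameWord := by
    intro r' hr'
    simp [Memory.setWord, Memory.setWordArray, Function.update, show r' ≠ 60 by omega, h.frameWord r' hr']
  frameArray := by
    intro B hB
    simp [Memory.setWord, Memory.setWordArray, Function.update, show B ≠ 32 + A by omega,
      show B ≠ 31 by omega, h.frameArray B hB]
  frameReal := h.frameReal

/-- The instrumented program computes what the original one does, with at most three times as many
steps. -/
theorem Exec.instrument {W W' R q : ℕ} {u : Memory} {P : Program} {s s₁ : Memory} {t : ℕ}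
    (h : Exec W P s s₁ t) (hW : W ≤ W') :
    P.width ≤ R → ∀ s', Simulates R q u s s' → s'.word 60 + t < W' →
      Halts W' P.instrument s' (3 * t) fun s₁' =>
        Simulates R q u s₁ s₁' ∧ s₁'.word 60 ≤ s'.word 60 + t := by
  induction h with
  | skip s =>
    intro _ s' hs _
    exact (Halts.skip ⟨hs, by omega⟩).mono (by omega) fun _ h => h
  | const s r c hc =>
    intro hR s' hs _
    simp only [Program.width] at hR
    exact (Halts.const (by omega) ⟨hs.setWord c (by omega), by
      simp [Memory.setWord, Function.update, show (60 : ℕ) ≠ 64 + r by omega]⟩).mono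
        (by omega) fun _ h => h
  | arith s op r a b hc =>
    intro hR s' hs _
    simp only [Program.width] at hR
    have ha := hs.word a (by omega)
    have hb := hs.word b (by omega)
    refine (Halts.arith (by rw [ha, hb]; omega) ⟨?_, ?_⟩).mono (by omega) fun _ h => h
    · rw [ha, hb]
      exact hs.setWord _ (by omega)
    · simp [Memory.setWord, Function.update, show (60 : ℕ) ≠ 64 + r by omega]
  | load s r A i =>
    intro hR s' hs _
    simp only [Program.width] at hR
    have ha := hs.array A (by omega)
    have hb := hs.word i (by omega)
    refine (Halts.load ⟨?_, ?_⟩).mono (by omega) fun _ h => h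
    · rw [ha, hb]
      exact hs.setWord _ (by omega)
    · simp [Memory.setWord, Function.update, show (60 : ℕ) ≠ 64 + r by omega]
  | store s A i r =>
    intro hR s' hs hc
    simp only [Program.width] at hR
    have ha := hs.word i (by omega)
    have hb := hs.word r (by omega)
    have h1 := hs.one
    simp only [Program.instrument]
    refine (Halts.seq_wp (.store (.seq_wp (.arith ?_ (.store ⟨?_, ?_⟩))))).mono (by omega)
      fun _ h => h
    · simp [Memory.setWordArray, WordOp.eval, h1]
      omega
    · have := hs.setWordArray (A := A) (s.word i) (s.word r) (by omega)
      simpa [Memory.setWordArray, Memory.setWord, Function.update, ha, hb, h1, WordOp.eval,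
        show 64 + i ≠ 60 by omega, show 64 + r ≠ 60 by omega] using this
    · simp [Memory.setWordArray, Memory.setWord, WordOp.eval, h1]
  | realAdd s r a b =>
    intro _ s' hs _
    refine (Halts.skip ⟨⟨hs.1, hs.2, ?_, hs.4, hs.5, hs.6, hs.7, hs.8, hs.9⟩, by omega⟩).mono
      (by omega) fun _ h => h
    intro r'
    by_cases e : r' = r <;> simp [Memory.setReal, Function.update, e, hs.real]
  | realLoad s r A i =>
    intro _ s' hs _
    refine (Halts.skip ⟨⟨hs.1, hs.2, ?_, hs.4, hs.5, hs.6, hs.7, hs.8, hs.9⟩, by omega⟩).mono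
      (by omega) fun _ h => h
    intro r'
    by_cases e : r' = r <;> simp [Memory.setReal, Function.update, e, hs.real, hs.realArray]
  | realStore s A i r =>
    intro _ s' hs _
    refine (Halts.skip ⟨⟨hs.1, hs.2, hs.3, ?_, hs.5, hs.6, hs.7, hs.8, hs.9⟩, by omega⟩).mono
      (by omega) fun _ h => h
    intro B x
    by_cases e : B = A
    · subst e
      by_cases e' : x = s.word i <;>
        simp [Memory.setRealArray, Function.update, e', hs.real, hs.realArray]
    · simp [Memory.setRealArray, Function.update, e, hs.realArray]
  | seq hP hQ ihP ihQ =>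
    intro hR s' hs hc
    simp only [Program.width, sup_le_iff] at hR
    refine (Halts.seq (ihP hR.1 s' hs (by omega)) fun s₁ h₁ =>
      (ihQ hR.2 s₁ h₁.1 (by omega)).mono le_rfl fun s₂ h₂ => ⟨h₂.1, ?_⟩).mono (by omega)
        fun _ h => h
    omega
  | @iteTrue b P Q s s₁ t hb hP ih =>
    intro hR s' hs hc
    cases b with
    | wordLt a b =>
      simp only [Program.width, sup_le_iff] at hR
      obtain ⟨s₂, t₂, e1, e2, e3, e4⟩ := ih hR.2.1 s' hs (by omega)
      refine ⟨s₂, _, .iteTrue ?_ e1, by omega, e3, by omega⟩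
      simpa [Test.Holds, hs.word a (by omega), hs.word b (by omega)] using hb
    | realLt a b => simp [Test.Holds, hs.real] at hb
  | @iteFalse b P Q s s₁ t hb hP ih =>
    intro hR s' hs hc
    cases b with
    | wordLt a b =>
      simp only [Program.width, sup_le_iff] at hR
      obtain ⟨s₂, t₂, e1, e2, e3, e4⟩ := ih hR.2.2 s' hs (by omega)
      refine ⟨s₂, _, .iteFalse ?_ e1, by omega, e3, by omega⟩
      simpa [Test.Holds, hs.word a (by omega), hs.word b (by omega)] using hb
    | realLt a b =>
      simp only [Program.width, sup_le_iff] at hR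
      obtain ⟨s₂, t₂, e1, e2, e3, e4⟩ := ih hR.2 s' hs (by omega)
      exact ⟨s₂, _, e1, by omega, e3, by omega⟩
  | @whileFalse b P s hb =>
    intro hR s' hs hc
    cases b with
    | wordLt a b =>
      simp only [Program.width, sup_le_iff] at hR
      refine ⟨s', _, .whileFalse ?_, by omega, hs, by omega⟩
      simpa [Test.Holds, hs.word a (by omega), hs.word b (by omega)] using hb
    | realLt a b => exact ⟨s', _, .skip _, by omega, hs, by omega⟩
  | @whileTrue b P s s₁ s₂ t t' hb hP hw ih ih' =>
    intro hR s' hs hc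
    cases b with
    | wordLt a b =>
      have hR' := hR
      simp only [Program.width, sup_le_iff] at hR
      obtain ⟨s₃, t₃, e1, e2, e3, e4⟩ := ih hR.2 s' hs (by omega)
      obtain ⟨s₄, t₄, f1, f2, f3, f4⟩ := ih' hR' s₃ e3 (by omega)
      refine ⟨s₄, _, .whileTrue ?_ e1 f1, by omega, f3, by omega⟩
      simpa [Test.Holds, hs.word a (by omega), hs.word b (by omega)] using hb
    | realLt a b => simp [Test.Holds, hs.real] at hb

/-! ### Calling the multiplication program -/

theorem Memory.setWord_word_self (s : Memory) (r x : ℕ) : (s.setWord r x).word r = x := by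
  simp [Memory.setWord]

theorem Memory.setWord_word_ne (s : Memory) {r r' : ℕ} (x : ℕ) (h : r' ≠ r) :
    (s.setWord r x).word r' = s.word r' := by
  simp [Memory.setWord, h]

theorem Memory.setWord_wordArray (s : Memory) (r x : ℕ) :
    (s.setWord r x).wordArray = s.wordArray := rfl

theorem Memory.setWord_realArray (s : Memory) (r x : ℕ) :
    (s.setWord r x).realArray = s.realArray := rfl

theorem Memory.setWordArray_word (s : Memory) (A i x : ℕ) :
    (s.setWordArray A i x).word = s.word := rfl

theorem Memory.setWordArray_self (s : Memory) (A i x : ℕ) :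
    (s.setWordArray A i x).wordArray A = Function.update (s.wordArray A) i x := by
  simp [Memory.setWordArray]

theorem Memory.setWordArray_ne (s : Memory) {A B : ℕ} (i x : ℕ) (h : B ≠ A) :
    (s.setWordArray A i x).wordArray B = s.wordArray B := by
  simp [Memory.setWordArray, h]

/-- The program `P` multiplies `m × m` matrices over `ℤ/2` within `μ m` steps. -/
def MultipliesWithin (P : Program) (k : ℕ) (μ : ℕ → ℕ) : Prop :=
  ∀ (m : ℕ) (A B : Matrix (Fin m) (Fin m) (ZMod 2)), 0 < m →
    ∃ (s : Memory) (t : ℕ), Exec ((m + 2) ^ k) P (matMulInput A B) s t ∧ t ≤ μ m ∧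
      ∀ i j : Fin m, s.wordArray 0 (i * m + j) = ((A * B) i j).val

/-- The memory `s'` represents the memory `s`: they agree on the word registers below `60`, on the
word arrays below `31` and on the real arrays, and the word arrays from `32` on are zero in `s'`,
ready for the next call of the multiplication program. -/
structure Represents (s' s : Memory) : Prop where
  word : ∀ r < 60, s'.word r = s.word r
  array : ∀ A < 31, s'.wordArray A = s.wordArray A
  clean : ∀ A, 32 ≤ A → s'.wordArray A = fun _ => 0
  real : s'.realArray = s.realArray

/-- Set the word registers `64, …, 63 + R` to zero. -/
def zeroRegisters : ℕ → Program
  | 0 => .skip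
  | R + 1 => .seq (zeroRegisters R) (.const (64 + R) 0)

theorem zeroRegisters_halts {W : ℕ} (hW : 0 < W) (s : Memory) (R : ℕ) :
    Halts W (zeroRegisters R) s (R + 1) fun s' =>
      s' = { s with word := fun r => if 64 ≤ r ∧ r < 64 + R then 0 else s.word r } := by
  induction R with
  | zero => 
    refine .skip ?_
    have : ∀ r, ¬ (64 ≤ r ∧ r < 64 + 0) := by omega
    simp [this]
  | succ R ih =>
    refine ih.seq ?_
    rintro _ rfl
    refine .const hW ?_
    simp only [Memory.setWord, Memory.mk.injEq, and_true]
    funext r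
    by_cases h : r = 64 + R
    · simp [h]
    · simp only [Function.update_of_ne h]
      congr 1
      simp only [eq_iff_iff]
      omega

/-- Set the entries at position `word i` of the word arrays `32, …, 31 + R` to `word z`. -/
def clearPosition (i z : ℕ) : ℕ → Program
  | 0 => .skip
  | R + 1 => .seq (clearPosition i z R) (.store (32 + R) i z)

theorem clearPosition_halts {W : ℕ} (s : Memory) {i z : ℕ} (hz : s.word z = 0) (R : ℕ) :
    Halts W (clearPosition i z R) s (R + 1) fun s' =>
      s' = { s with wordArray := fun A x =>
        if 32 ≤ A ∧ A < 32 + R ∧ x = s.word i then 0 else s.wordArray A x } := by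
  induction R with
  | zero =>
    refine .skip ?_
    have : ∀ A x, ¬ (32 ≤ A ∧ A < 32 + 0 ∧ x = s.word i) := by omega
    simp [this]
  | succ R ih =>
    refine ih.seq ?_
    rintro _ rfl
    refine .store ?_
    simp only [Memory.setWordArray, Memory.mk.injEq, true_and, and_true, hz]
    funext A x
    by_cases h : A = 32 + R
    · subst h
      by_cases hx : x = s.word i <;> simp [hx]
    · simp only [Function.update_of_ne h]
      congr 1
      simp only [eq_iff_iff]
      omega

/-- The call of the multiplication program `P` for the `b × b` matrices in the word arrays `8` and
`9`; the product is written to word array `10`. Word register `8` holds `b` and word register `9`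
holds `b * b`. The registers from `64 + R + h` on are used for auxiliary values. -/
def mulCall (P : Program) (R h : ℕ) : Program :=
  .seq (.const 60 0) <| .seq (.const 61 1) <| .seq (zeroRegisters R) <|
  .seq (.const (64 + R + h) 0) <| .seq (.arith .add 64 8 (64 + R + h)) <|
  .seq (.while (.wordLt (64 + R + h) 9) <|
    .seq (.load (64 + R + h + 1) 8 (64 + R + h)) <|
    .seq (.store 32 (64 + R + h) (64 + R + h + 1)) <|
    .seq (.load (64 + R + h + 1) 9 (64 + R + h)) <|
    .seq (.store 33 (64 + R + h) (64 + R + h + 1)) <|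
    .arith .add (64 + R + h) (64 + R + h) 61) <|
  .seq P.instrument <|
  .seq (.const (64 + R + h) 0) <|
  .seq (.while (.wordLt (64 + R + h) 9) <|
    .seq (.load (64 + R + h + 1) 32 (64 + R + h)) <|
    .seq (.store 10 (64 + R + h) (64 + R + h + 1)) <|
    .arith .add (64 + R + h) (64 + R + h) 61) <|
  .seq (.const (64 + R + h + 2) 0) <|
  .seq (.const (64 + R + h) 0) <|
  .seq (.while (.wordLt (64 + R + h) 9) <|
    .seq (clearPosition (64 + R + h) (64 + R + h + 2) R) <|
    .arith .add (64 + R + h) (64 + R + h) 61) <|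
  .seq (.const (64 + R + h) 0) <|
  .while (.wordLt (64 + R + h) 60) <|
    .seq (.load (64 + R + h + 1) 31 (64 + R + h)) <|
    .seq (clearPosition (64 + R + h + 1) (64 + R + h + 2) R) <|
    .arith .add (64 + R + h) (64 + R + h) 61

/-- Agreement on everything that an auxiliary computation at level `h` leaves alone. -/
structure Frame (R h : ℕ) (s s' : Memory) : Prop where
  word : ∀ r, r < 60 ∨ (64 + R ≤ r ∧ r < 64 + R + h) → s'.word r = s.word r
  array : ∀ A < 31, s'.wordArray A = s.wordArray A
  real : s'.realArray = s.realArray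

theorem rowMajor_of_le {a b x : ℕ} (f : Fin a → Fin b → ℕ) (hx : a * b ≤ x) :
    rowMajor a b f x = 0 := by
  unfold rowMajor
  rw [dif_neg]
  rintro ⟨h1, h2⟩
  rw [Nat.div_lt_iff_lt_mul h2] at h1
  omega

theorem rowMajor_of_lt {a b x : ℕ} (g : ℕ → ℕ) (hx : x < a * b) :
    rowMajor a b (fun i j => g (i * b + j)) x = g x := by
  have hb : 0 < b := by
    rcases Nat.eq_zero_or_pos b with h | h
    · simp [h] at hx
    · exact h
  unfold rowMajor
  rw [dif_pos ⟨(Nat.div_lt_iff_lt_mul hb).2 hx, hb⟩]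
  exact congrArg g (Nat.div_add_mod' x b)

/-- The call replaces the first `b * b` entries of word array `10` by the product, within the frame,
and leaves the private arrays clean. They can be dirty only at positions below `b * b`, where the
input is stored, and at the logged positions, of which there are at most `μ b`; so the clearing does
not increase the order of the cost. -/
theorem mulCall_halts {W k b R h : ℕ} {μ : ℕ → ℕ} {P : Program} (hP : MultipliesWithin P k μ)
    (hR : P.width ≤ R) (hR2 : 2 ≤ R) (u : Memory) (hu : ∀ A, 32 ≤ A → u.wordArray A = fun _ => 0)
    (hb : u.word 8 = b) (hbb : u.word 9 = b * b) (hb0 : 0 < b)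
    (hX : ∀ x < b * b, u.wordArray 8 x < 2) (hY : ∀ x < b * b, u.wordArray 9 x < 2)
    (hW : (b + 2) ^ k ≤ W) (hW1 : 1 < W) (hWb : b * b < W) (hWμ : μ b < W) :
    Halts W (mulCall P R h) u ((R + 20) * (b * b + μ b + 1)) fun m =>
      Frame R h { u with wordArray := Function.update u.wordArray 10 (fun x =>
        if x < b * b then
          (∑ i ∈ Finset.range b, u.wordArray 8 (x / b * b + i) * u.wordArray 9 (i * b + x % b)) % 2
        else u.wordArray 10 x) } m ∧
      ∀ A, 32 ≤ A → m.wordArray A = fun _ => 0 := by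
  set X := u.wordArray 8 with hXdef
  set Y := u.wordArray 9 with hYdef
  have hbbb : b ≤ b * b := Nat.le_mul_of_pos_left b hb0
  obtain ⟨sf, t, hrun, ht, hres⟩ := hP b (Matrix.of fun i j => (X (i * b + j) : ZMod 2))
    (Matrix.of fun i j => (Y (i * b + j) : ZMod 2)) hb0
  -- `I1` holds while the input is copied, after the private registers have been set to zero
  let I1 : ℕ → Memory → Prop := fun k m => Frame R h u m ∧ m.word 60 = 0 ∧ m.word 61 = 1 ∧
    (∀ r < R, m.word (64 + r) = if r = 0 then b else 0) ∧ m.word (64 + R + h) = k ∧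
    m.wordArray 32 = (fun x => if x < k then X x else 0) ∧
    m.wordArray 33 = (fun x => if x < k then Y x else 0) ∧
    ∀ A, 34 ≤ A → m.wordArray A = fun _ => 0
  let g : ℕ → ℕ → ℕ := fun k x => if x < k then sf.wordArray 0 x else u.wordArray 10 x
  let v : ℕ → Memory := fun k => { u with wordArray := Function.update u.wordArray 10 (g k) }
  -- `I2` holds while the product is copied back, where `m₂` is the memory after the run
  let I2 : Memory → ℕ → Memory → Prop := fun m₂ k m => Frame R h (v k) m ∧ m.word 61 = 1 ∧
    m.word 60 = m₂.word 60 ∧ (∀ A, 31 ≤ A → m.wordArray A = m₂.wordArray A) ∧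
    m.word (64 + R + h) = k
  -- `I3` holds while the positions below `b * b` of the private arrays are cleared
  let I3 : Memory → ℕ → Memory → Prop := fun m₂ k m => Frame R h (v (b * b)) m ∧ m.word 61 = 1 ∧
    m.word 60 = m₂.word 60 ∧ m.word (64 + R + h + 2) = 0 ∧
    m.wordArray 31 = m₂.wordArray 31 ∧
    (∀ A, 32 ≤ A → ∀ x, m.wordArray A x ≠ 0 → A < 32 + R ∧ m₂.wordArray A x ≠ 0 ∧ k ≤ x) ∧
    m.word (64 + R + h) = k
  -- `I4` holds while the logged positions are cleared; the log has `m₂.word 60` entries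
  let I4 : Memory → ℕ → Memory → Prop := fun m₂ k m => Frame R h (v (b * b)) m ∧ m.word 61 = 1 ∧
    m.word 60 = m₂.word 60 ∧ m.word (64 + R + h + 2) = 0 ∧
    m.wordArray 31 = m₂.wordArray 31 ∧
    (∀ A, 32 ≤ A → ∀ x, m.wordArray A x ≠ 0 → A < 32 + R ∧
      ∃ i < m₂.word 60, k ≤ i ∧ m₂.wordArray 31 i = x) ∧
    m.word (64 + R + h) = k
  have step1 : ∀ k < b * b, ∀ m, I1 k m → Halts W
      (.seq (.load (64 + R + h + 1) 8 (64 + R + h)) <|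
        .seq (.store 32 (64 + R + h) (64 + R + h + 1)) <|
        .seq (.load (64 + R + h + 1) 9 (64 + R + h)) <|
        .seq (.store 33 (64 + R + h) (64 + R + h + 1)) <|
        .arith .add (64 + R + h) (64 + R + h) 61) m 5 (I1 (k + 1)) := by
    rintro k hk m ⟨hf, h60, h61, h64, hc, h32, h33, h34⟩
    refine (Halts.seq_wp <| .load <| .seq_wp <| .store <| .seq_wp <| .load <| .seq_wp <| .store <|
      .arith ?_ ⟨⟨?_, ?_, ?_⟩, ?_, ?_, ?_, ?_, ?_, ?_, ?_⟩).mono (by omega) fun _ h => h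
    · simp (disch := omega) only [Memory.setWord_word_self, Memory.setWord_word_ne,
        Memory.setWordArray_word, WordOp.eval, hc, h61]
      omega
    · intro r hr
      simp (disch := omega) only [Memory.setWord_word_ne, Memory.setWordArray_word, hf.word r hr]
    · intro A hA
      simp (disch := omega) only [Memory.setWord_wordArray, Memory.setWordArray_ne, hf.array A hA]
    · exact hf.real
    · simp (disch := omega) only [Memory.setWord_word_ne, Memory.setWordArray_word, h60]
    · simp (disch := omega) only [Memory.setWord_word_ne, Memory.setWordArray_word, h61]
    · intro r hr
      simp (disch := omega) only [Memory.setWord_word_ne, Memory.setWordArray_word, h64 r hr]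
    · simp (disch := omega) only [Memory.setWord_word_self, Memory.setWord_word_ne,
        Memory.setWordArray_word, WordOp.eval, hc, h61]
    · simp (disch := omega) only [Memory.setWord_word_self, Memory.setWord_word_ne,
        Memory.setWordArray_word, Memory.setWord_wordArray, Memory.setWordArray_ne,
        Memory.setWordArray_self, hc, h32, hf.array, ← hXdef]
      funext x
      rcases lt_trichotomy x k with hx | hx | hx
      · rw [Function.update_of_ne (by omega), if_pos hx, if_pos (by omega)]
      · subst hx; simp
      · rw [Function.update_of_ne (by omega), if_neg (by omega), if_neg (by omega)]
    · simp (disch := omega) only [Memory.setWord_word_self, Memory.setWord_word_ne,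
        Memory.setWordArray_word, Memory.setWord_wordArray, Memory.setWordArray_ne,
        Memory.setWordArray_self, hc, h33, hf.array, ← hYdef]
      funext x
      rcases lt_trichotomy x k with hx | hx | hx
      · rw [Function.update_of_ne (by omega), if_pos hx, if_pos (by omega)]
      · subst hx; simp
      · rw [Function.update_of_ne (by omega), if_neg (by omega), if_neg (by omega)]
    · intro A hA
      simp (disch := omega) only [Memory.setWord_wordArray, Memory.setWordArray_ne, h34 A hA]
  have step2 : ∀ m₂, ∀ k < b * b, m₂.wordArray 32 = sf.wordArray 0 → ∀ m, I2 m₂ k m → Halts W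
      (.seq (.load (64 + R + h + 1) 32 (64 + R + h)) <|
        .seq (.store 10 (64 + R + h) (64 + R + h + 1)) <|
        .arith .add (64 + R + h) (64 + R + h) 61) m 3 (I2 m₂ (k + 1)) := by
    rintro m₂ k hk hm₂ m ⟨hf, h61, h60, ha, hc⟩
    refine (Halts.seq_wp <| .load <| .seq_wp <| .store <|
      .arith ?_ ⟨⟨?_, ?_, ?_⟩, ?_, ?_, ?_, ?_⟩).mono (by omega) fun _ h => h
    · simp (disch := omega) only [Memory.setWord_word_self, Memory.setWord_word_ne,
        Memory.setWordArray_word, WordOp.eval, hc, h61]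
      omega
    · intro r hr
      simp (disch := omega) only [Memory.setWord_word_ne, Memory.setWordArray_word, hf.word r hr]
      rfl
    · intro A hA
      by_cases hA' : A = 10
      · subst hA'
        have := hf.array 10 (by omega)
        simp (disch := omega) only [Memory.setWord_word_self, Memory.setWord_word_ne,
          Memory.setWord_wordArray, Memory.setWordArray_self, hc, this, ha, hm₂, v,
          Function.update_self]
        funext x
        simp only [g]
        rcases lt_trichotomy x k with hx | hx | hx
        · rw [Function.update_of_ne (by omega), if_pos hx, if_pos (by omega)]
        · subst hx; simp
        · rw [Function.update_of_ne (by omega), if_neg (by omega), if_neg (by omega)]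
      · simp (disch := omega) only [Memory.setWord_wordArray, Memory.setWordArray_ne,
          hf.array A hA, v, Function.update_of_ne hA']
    · exact hf.real
    · simp (disch := omega) only [Memory.setWord_word_ne, Memory.setWordArray_word, h61]
    · simp (disch := omega) only [Memory.setWord_word_ne, Memory.setWordArray_word, h60]
    · intro A hA
      simp (disch := omega) only [Memory.setWord_wordArray, Memory.setWordArray_ne, ha A hA]
    · simp (disch := omega) only [Memory.setWord_word_self, Memory.setWord_word_ne,
        Memory.setWordArray_word, WordOp.eval, hc, h61]
  have step3 : ∀ m₂, ∀ k < b * b, ∀ m, I3 m₂ k m → Halts W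
      (.seq (clearPosition (64 + R + h) (64 + R + h + 2) R) <|
        .arith .add (64 + R + h) (64 + R + h) 61) m (R + 2) (I3 m₂ (k + 1)) := by
    rintro m₂ k hk m ⟨hf, h61, h60, h0, hl, ha, hc⟩
    refine ((clearPosition_halts m h0 R).seq (T' := 1) ?_).mono (by omega) fun _ h => h
    rintro _ rfl
    refine .arith ?_ ⟨⟨?_, ?_, ?_⟩, ?_, ?_, ?_, ?_, ?_, ?_⟩
    · simp only [WordOp.eval, hc, h61]
      omega
    · intro r hr
      simp (disch := omega) only [Memory.setWord_word_ne, hf.word r hr]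
    · intro A hA
      have : ∀ x, ¬ (32 ≤ A ∧ A < 32 + R ∧ x = m.word (64 + R + h)) := by omega
      simp only [Memory.setWord_wordArray, this, if_false, hf.array A hA]
    · exact hf.real
    · simp (disch := omega) only [Memory.setWord_word_ne, h61]
    · simp (disch := omega) only [Memory.setWord_word_ne, h60]
    · simp (disch := omega) only [Memory.setWord_word_ne, h0]
    · simp [Memory.setWord_wordArray, hl]
    · intro A hA x hx
      simp only [Memory.setWord_wordArray, ne_eq, ite_eq_left_iff, not_forall, hc] at hx
      obtain ⟨h1, h2⟩ := hx
      obtain ⟨h3, h4, h5⟩ := ha A hA x h2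
      exact ⟨h3, h4, by omega⟩
    · simp only [Memory.setWord_word_self, WordOp.eval, hc, h61]
  have step4 : ∀ m₂ : Memory, m₂.word 60 < W → ∀ k < m₂.word 60, ∀ m, I4 m₂ k m → Halts W
      (.seq (.load (64 + R + h + 1) 31 (64 + R + h)) <|
        .seq (clearPosition (64 + R + h + 1) (64 + R + h + 2) R) <|
        .arith .add (64 + R + h) (64 + R + h) 61) m (R + 3) (I4 m₂ (k + 1)) := by
    rintro m₂ hcnt k hk m ⟨hf, h61, h60, h0, hl, ha, hc⟩
    refine (Halts.seq_wp <| .load <| (clearPosition_halts _ ?_ R).seq (T' := 1) ?_).mono (by omega)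
      fun _ h => h
    · simp (disch := omega) only [Memory.setWord_word_ne, h0]
    rintro _ rfl
    refine .arith ?_ ⟨⟨?_, ?_, ?_⟩, ?_, ?_, ?_, ?_, ?_, ?_⟩
    · simp (disch := omega) only [Memory.setWord_word_ne, WordOp.eval, hc, h61]
      omega
    · intro r hr
      simp (disch := omega) only [Memory.setWord_word_ne, hf.word r hr]
    · intro A hA
      have : ∀ x y : ℕ, ¬ (32 ≤ A ∧ A < 32 + R ∧ x = y) := by omega
      simp only [Memory.setWord_wordArray, this, if_false, hf.array A hA]
    · exact hf.real
    · simp (disch := omega) only [Memory.setWord_word_ne, h61]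
    · simp (disch := omega) only [Memory.setWord_word_ne, h60]
    · simp (disch := omega) only [Memory.setWord_word_ne, h0]
    · simp [Memory.setWord_wordArray, hl]
    · intro A hA x hx
      simp only [Memory.setWord_wordArray, ne_eq, ite_eq_left_iff, not_forall, hc,
        Memory.setWord_word_self, hl] at hx
      obtain ⟨h1, h2⟩ := hx
      obtain ⟨h3, i, hi, hki, hx⟩ := ha A hA x h2
      refine ⟨h3, i, hi, ?_, hx⟩
      by_contra hlt
      obtain rfl : i = k := by omega
      exact h1 ⟨hA, h3, hx.symm⟩
    · simp (disch := omega) only [Memory.setWord_word_self, Memory.setWord_word_ne, WordOp.eval,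
        hc, h61]
  have hb60 : ∀ m, Frame R h u m → m.word 9 = b * b := fun m hm => by
    rw [hm.word 9 (by omega), hbb]
  have hv9 : ∀ k m, Frame R h (v k) m → m.word 9 = b * b := fun k m hm => by
    rw [hm.word 9 (by omega)]
    exact hbb
  have hg : g (b * b) = fun x => if x < b * b then
      (∑ i ∈ Finset.range b, X (x / b * b + i) * Y (i * b + x % b)) % 2
      else u.wordArray 10 x := by
    funext x
    simp only [g]
    split_ifs with hx
    · have h1 : x / b < b := (Nat.div_lt_iff_lt_mul hb0).2 hx
      have := hres ⟨x / b, h1⟩ ⟨x % b, Nat.mod_lt x hb0⟩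
      rw [show (⟨x / b, h1⟩ : Fin b).1 * b + (⟨x % b, Nat.mod_lt x hb0⟩ : Fin b).1 = x from
        Nat.div_add_mod' x b] at this
      rw [this, ← ZMod.val_natCast 2 (∑ i ∈ _, _), Matrix.mul_apply, Finset.sum_range]
      push_cast
      rfl
    · rfl
  have hval : ∀ (Z : ℕ → ℕ), (∀ x < b * b, Z x < 2) →
      rowMajor b b (fun i j => ((Z (i * b + j) : ℕ) : ZMod 2).val)
        = fun x => if x < b * b then Z x else 0 := by
    intro Z hZ
    funext x
    split_ifs with hx
    · rw [rowMajor_of_lt (fun y => ((Z y : ℕ) : ZMod 2).val) hx, ZMod.val_natCast,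
        Nat.mod_eq_of_lt (hZ x hx)]
    · exact rowMajor_of_le _ (by omega)
  unfold mulCall
  refine (Halts.seq_wp <| .const (by omega) <| .seq_wp <| .const hW1 <|
    (zeroRegisters_halts (by omega) _ R).seq ?_).mono (T := 1 + (1 + (R + 1 + (1 + (1 +
      (b * b * 6 + 1 + (3 * t + (1 + (b * b * 4 + 1 + (1 + (1 + (b * b * (R + 3) + 1 +
      (1 + (μ b * (R + 4) + 1)))))))))))))) ?_ fun _ h => h
  swap
  · nlinarith [Nat.zero_le R, Nat.zero_le (b * b), Nat.zero_le (μ b)]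
  rintro _ rfl
  refine .seq_wp <| .const (by omega) <| .seq_wp <| .arith ?_ ?_
  · simp (disch := omega) [Memory.setWord_word_ne, Memory.setWord_word_self, WordOp.eval, hb]
    omega
  refine Halts.seq (Q := I1 (b * b)) ((Halts.whileLt I1 (fun _ => 5) ?_ step1 ?_).mono (by simp)
    fun _ h => h) ?_
  · exact fun k m hm => ⟨hm.2.2.2.2.1, hb60 m hm.1⟩
  · refine ⟨⟨?_, ?_, ?_⟩, ?_, ?_, ?_, ?_, ?_, ?_, ?_⟩
    · intro r hr
      simp (disch := omega) only [Memory.setWord_word_ne]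
      rw [if_neg (by omega)]
    · exact fun A hA => rfl
    · rfl
    · simp (disch := omega) [Memory.setWord_word_ne, Memory.setWord_word_self]
    · simp (disch := omega) [Memory.setWord_word_ne, Memory.setWord_word_self]
    · intro r hr
      by_cases h0 : r = 0
      · subst h0
        simp (disch := omega) [Memory.setWord_word_ne, Memory.setWord_word_self, WordOp.eval, hb]
      · simp (disch := omega) only [Memory.setWord_word_ne, h0, if_false]
        rw [if_pos (by omega)]
    · simp (disch := omega) [Memory.setWord_word_ne, Memory.setWord_word_self]
    · simpa [Memory.setWord_wordArray] using hu 32 (by omega)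
    · simpa [Memory.setWord_wordArray] using hu 33 (by omega)
    · intro A hA
      exact hu A (by omega)
  rintro m₁ ⟨hf, h60, h61, h64, hc, h32, h33, h34⟩
  have hsim : Simulates R (b * b) m₁ (matMulInput (m := b)
      (Matrix.of fun i j => (X (i * b + j) : ZMod 2))
      (Matrix.of fun i j => (Y (i * b + j) : ZMod 2))) m₁ := by
    refine ⟨h64, ?_, fun _ => rfl, fun _ _ => rfl, h61, ?_, fun _ _ => rfl, fun _ _ => rfl, rfl⟩
    · intro A hA
      rcases Nat.lt_or_ge A 2 with h | h
      · interval_cases A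
        · rw [h32]
          exact (hval X hX).symm
        · rw [h33]
          exact (hval Y hY).symm
      · rw [h34 _ (by omega)]
        simp [matMulInput, show A ≠ 0 by omega, show A ≠ 1 by omega]
    · intro A x hx
      left
      by_contra hlt
      apply hx
      rcases Nat.lt_or_ge A 2 with h | h
      · interval_cases A
        · simp [h32, hlt]
        · simp [h33, hlt]
      · rw [h34 _ (by omega)]
  refine (hrun.instrument hW hR m₁ hsim (by omega)).seq (T := 3 * t) ?_
  rintro m₂ ⟨hs, hcnt⟩
  have hcnt' : m₂.word 60 ≤ μ b := by omega
  have h2 : ∀ A, 32 + R ≤ A → m₂.wordArray A = fun _ => 0 := fun A hA => by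
    rw [hs.frameArray A (Or.inr hA), h34 A (by omega)]
  have h2w : ∀ r, r < 60 ∨ (64 + R ≤ r ∧ r < 64 + R + h) → m₂.word r = u.word r := fun r hr => by
    rw [hs.frameWord r (by omega), hf.word r hr]
  have hg0 : u.wordArray = (v 0).wordArray := by
    simp [v, g]
  refine .seq_wp <| .const (by omega) <| Halts.seq (Q := I2 m₂ (b * b))
    ((Halts.whileLt (I2 m₂) (fun _ => 3) ?_ (fun k hk => step2 m₂ k hk (hs.array 0 (by omega)))
      ?_).mono (by simp) fun _ h => h) ?_
  · exact fun k m hm => ⟨hm.2.2.2.2, hv9 _ m hm.1⟩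
  · refine ⟨⟨?_, ?_, ?_⟩, ?_, ?_, ?_, ?_⟩
    · intro r hr
      simp (disch := omega) only [Memory.setWord_word_ne, h2w r hr]
      rfl
    · intro A hA
      rw [← hg0, Memory.setWord_wordArray, hs.frameArray A (Or.inl hA), hf.array A hA]
    · rw [Memory.setWord_realArray, hs.frameReal, hf.real]
    · simp (disch := omega) only [Memory.setWord_word_ne, hs.one]
    · simp (disch := omega) only [Memory.setWord_word_ne]
    · exact fun A hA => rfl
    · rw [Memory.setWord_word_self]
  rintro m₃ ⟨hf3, h61', h60', ha3, hc3⟩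
  refine .seq_wp <| .const (by omega) <| .seq_wp <| .const (by omega) <|
    Halts.seq (Q := I3 m₂ (b * b))
    ((Halts.whileLt (I3 m₂) (fun _ => R + 2) ?_ (step3 m₂) ?_).mono (by simp) fun _ h => h) ?_
  · exact fun k m hm => ⟨hm.2.2.2.2.2.2, hv9 _ m hm.1⟩
  · refine ⟨⟨?_, ?_, ?_⟩, ?_, ?_, ?_, ?_, ?_, ?_⟩
    · intro r hr
      simp (disch := omega) only [Memory.setWord_word_ne, hf3.word r hr]
    · intro A hA
      simp only [Memory.setWord_wordArray, hf3.array A hA]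
    · exact hf3.real
    · simp (disch := omega) only [Memory.setWord_word_ne, h61']
    · simp (disch := omega) only [Memory.setWord_word_ne, h60']
    · simp (disch := omega) only [Memory.setWord_word_ne, Memory.setWord_word_self]
    · simp only [Memory.setWord_wordArray, ha3 31 le_rfl]
    · intro A hA x hx
      simp only [Memory.setWord_wordArray, ha3 A (by omega)] at hx
      refine ⟨?_, hx, Nat.zero_le x⟩
      by_contra hlt
      exact hx (by rw [h2 A (by omega)])
    · rw [Memory.setWord_word_self]
  rintro m₄ ⟨hf4, h61', h60', h0, hl, ha4, hc4⟩
  refine .seq_wp <| .const (by omega) <|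
    (Halts.whileLt (I4 m₂) (fun _ => R + 3) ?_ (step4 m₂ (by omega)) ?_).mono ?_ ?_
  · exact fun k m hm => ⟨hm.2.2.2.2.2.2, hm.2.2.1⟩
  · refine ⟨⟨?_, ?_, ?_⟩, ?_, ?_, ?_, ?_, ?_, ?_⟩
    · intro r hr
      simp (disch := omega) only [Memory.setWord_word_ne, hf4.word r hr]
    · intro A hA
      simp only [Memory.setWord_wordArray, hf4.array A hA]
    · exact hf4.real
    · simp (disch := omega) only [Memory.setWord_word_ne, h61']
    · simp (disch := omega) only [Memory.setWord_word_ne, h60']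
    · simp (disch := omega) only [Memory.setWord_word_ne, h0]
    · simp only [Memory.setWord_wordArray, hl]
    · intro A hA x hx
      obtain ⟨h5, h6, h7⟩ := ha4 A hA x hx
      refine ⟨h5, ?_⟩
      have := hs.logged (A - 32) x (by rwa [show 32 + (A - 32) = A by omega])
      rcases this with h | ⟨i, hi, hx⟩
      · omega
      · exact ⟨i, hi, Nat.zero_le i, hx⟩
    · rw [Memory.setWord_word_self]
  · simp only [Finset.sum_const, Finset.card_range, smul_eq_mul]
    gcongr
  · rintro m ⟨hf5, _, _, _, _, ha5, _⟩
    refine ⟨by rw [← hg]; exact hf5, fun A hA => funext fun x => ?_⟩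
    by_contra hx
    obtain ⟨_, i, hi, hi', _⟩ := ha5 A hA x hx
    omega

/-! ### A structured language on top of the machine -/

namespace RAM

/-- Word-valued expressions over the memory. `arr A e` is the entry of word array `A` at position
`e`, `lt` and `rlt` are the truth values of `a < b` for words and for entries of real arrays, and
`sum r m e` is the sum of `e` over all values of the bound variable `r` below `word m`. -/
inductive Expr
  | const (c : ℕ)
  | reg (r : ℕ)
  | arr (A : ℕ) (i : Expr)
  | bin (op : WordOp) (a b : Expr)
  | lt (a b : Expr)
  | rlt (A : ℕ) (i : Expr) (B : ℕ) (j : Expr)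
  | sum (r m : ℕ) (e : Expr)

namespace Expr

/-- The value of an expression. -/
noncomputable def eval : Expr → Memory → ℕ
  | const c, _ => c
  | reg r, s => s.word r
  | arr A i, s => s.wordArray A (i.eval s)
  | bin op a b, s => op.eval (a.eval s) (b.eval s)
  | lt a b, s => if a.eval s < b.eval s then 1 else 0
  | rlt A i B j, s => open Classical in
    if s.realArray A (i.eval s) < s.realArray B (j.eval s) then 1 else 0
  | sum r m e, s => ∑ k ∈ Finset.range (s.word m), e.eval (s.setWord r k)

/-- Expressions use the word registers below `60` and the word arrays below `31`; those below `16`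
serve as bounds of sums and loops and are never bound variables. -/
def WF : Expr → Bool
  | const _ => true
  | reg r => r < 60
  | arr A i => A < 31 && i.WF
  | bin _ a b => a.WF && b.WF
  | lt a b => a.WF && b.WF
  | rlt _ i _ j => i.WF && j.WF
  | sum r m e => 16 ≤ r && r < 60 && m < 16 && e.WF

/-- If all words in the memory are below `M ≥ 2`, then the value of `e` is below `M ^ e.deg`. -/
def deg : Expr → ℕ
  | const c => c + 1
  | reg _ => 1
  | arr _ i => i.deg
  | bin _ a b => a.deg + b.deg
  | lt a b => a.deg + b.deg
  | rlt _ i _ j => i.deg + j.deg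
  | sum _ _ e => e.deg + 1

/-- A bound for the number of steps to evaluate an expression; `β` holds the contents of the
registers used as bounds of sums. -/
def cost (β : ℕ → ℕ) : Expr → ℕ
  | const _ => 1
  | reg _ => 2
  | arr _ i => i.cost β + 1
  | bin _ a b => a.cost β + b.cost β + 1
  | lt a b => a.cost β + b.cost β + 2
  | rlt _ i _ j => i.cost β + j.cost β + 4
  | sum _ m e => β m * (e.cost β + 5) + 8

/-- The program which evaluates an expression into register `t`, using the registers from `t` on
for auxiliary values. -/
def compile : Expr → ℕ → Program
  | const c, t => .const t c
  | reg r, t => .seq (.const t 0) (.arith .add t r t)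
  | arr A i, t => .seq (i.compile t) (.load t A t)
  | bin op a b, t => .seq (a.compile t) (.seq (b.compile (t + 1)) (.arith op t t (t + 1)))
  | lt a b, t => .seq (a.compile t) (.seq (b.compile (t + 1))
      (.ite (.wordLt t (t + 1)) (.const t 1) (.const t 0)))
  | rlt A i B j, t => .seq (i.compile t) (.seq (j.compile (t + 1)) (.seq (.realLoad 0 A t)
      (.seq (.realLoad 1 B (t + 1)) (.ite (.realLt 0 1) (.const t 1) (.const t 0)))))
  | sum r m e, t =>
    .seq (.const t 0) <| .seq (.const (t + 1) 0) <| .seq (.arith .add (t + 4) m t) <|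
    .seq (.arith .add (t + 2) r t) <| .seq (.const (t + 3) 1) <|
    .seq (.while (.wordLt (t + 1) (t + 4)) <|
      .seq (.const r 0) <| .seq (.arith .add r r (t + 1)) <| .seq (e.compile (t + 5)) <|
      .seq (.arith .add t t (t + 5)) <| .arith .add (t + 1) (t + 1) (t + 3)) <|
    .seq (.const r 0) <| .arith .add r r (t + 2)

end Expr

/-- All words in the memory are below `M`. -/
structure Bounded (M : ℕ) (s : Memory) : Prop where
  word : ∀ r, s.word r < M
  array : ∀ A x, s.wordArray A x < M

/-- Agreement on the registers and arrays which expressions can read. -/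
structure Agree (u s : Memory) : Prop where
  word : ∀ r < 60, u.word r = s.word r
  array : ∀ A < 31, u.wordArray A = s.wordArray A
  real : u.realArray = s.realArray

/-- Agreement on everything but the registers from `t` on and the real registers. -/
structure Below (t : ℕ) (u u' : Memory) : Prop where
  word : ∀ r < t, u'.word r = u.word r
  array : u'.wordArray = u.wordArray
  real : u'.realArray = u.realArray

theorem Bounded.setWord {M : ℕ} {s : Memory} (h : Bounded M s) {r x : ℕ} (hx : x < M) :
    Bounded M (s.setWord r x) := by
  refine ⟨fun r' => ?_, h.array⟩
  by_cases e : r' = r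
  · rw [e, Memory.setWord_word_self]
    exact hx
  · rw [Memory.setWord_word_ne _ _ e]
    exact h.word r'

theorem Below.agree {t : ℕ} {u u' s : Memory} (h : Below t u u') (h' : Agree u s) (ht : 60 ≤ t) :
    Agree u' s :=
  ⟨fun r hr => (h.word r (by omega)).trans (h'.word r hr),
    fun A hA => by rw [h.array, h'.array A hA], h.real.trans h'.real⟩

theorem Below.refl (t : ℕ) (u : Memory) : Below t u u := ⟨fun _ _ => rfl, rfl, rfl⟩

theorem Below.trans {t t' : ℕ} {u u' u'' : Memory} (h : Below t u u') (h' : Below t' u' u'')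
    (ht : t ≤ t') : Below t u u'' :=
  ⟨fun r hr => (h'.word r (by omega)).trans (h.word r hr), h'.array.trans h.array,
    h'.real.trans h.real⟩

theorem Below.setWord {t r : ℕ} {u u' : Memory} (h : Below t u u') (x : ℕ) (hr : t ≤ r) :
    Below t u (u'.setWord r x) :=
  ⟨fun r' hr' => by rw [Memory.setWord_word_ne _ _ (by omega), h.word r' hr'], h.array, h.real⟩

theorem Expr.one_le_deg : ∀ e : Expr, 1 ≤ e.deg
  | .const _ => by simp [deg]
  | .reg _ => by simp [deg]
  | .arr _ i => by simpa [deg] using one_le_deg i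
  | .bin _ a b => by have := one_le_deg a; simp only [deg]; omega
  | .lt a b => by have := one_le_deg a; simp only [deg]; omega
  | .rlt _ i _ j => by have := one_le_deg i; simp only [deg]; omega
  | .sum _ _ e => by simp [deg]

theorem two_le_pow {M d : ℕ} (hM : 2 ≤ M) (hd : 1 ≤ d) : 2 ≤ M ^ d :=
  hM.trans (Nat.le_self_pow (by omega) M)

theorem WordOp.eval_lt {op : WordOp} {a b x y : ℕ} (ha : a < x) (hb : b < y) (_ : 2 ≤ x)
    (_ : 2 ≤ y) : op.eval a b < x * y := by
  cases op <;> simp only [WordOp.eval]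
  · nlinarith
  · have : a - b ≤ a := Nat.sub_le a b
    nlinarith
  · exact Nat.mul_lt_mul'' ha hb
  · have : a / b ≤ a := Nat.div_le_self a b
    nlinarith

/-- The value of an expression is polynomially bounded, so a fixed power of the bound `M` for the
contents of the memory bounds all words that occur in its evaluation. -/
theorem Expr.eval_lt {M : ℕ} (hM : 2 ≤ M) (e : Expr) : ∀ {s : Memory}, Bounded M s →
    e.eval s < M ^ e.deg := by
  have h2 := fun e : Expr => two_le_pow hM e.one_le_deg
  induction e with
  | const c =>
    intro s hs
    calc c < 2 ^ c := Nat.lt_two_pow_self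
      _ ≤ M ^ c := Nat.pow_le_pow_left hM c
      _ ≤ M ^ (c + 1) := Nat.pow_le_pow_right (by omega) (by omega)
  | reg r => intro s hs; simpa [eval, deg] using hs.word r
  | arr A i ih =>
    intro s hs
    exact (hs.array A _).trans_le (Nat.le_self_pow (by have := i.one_le_deg; simp [deg]; omega) M)
  | bin op a b iha ihb =>
    intro s hs
    simp only [eval, deg, pow_add]
    exact WordOp.eval_lt (iha hs) (ihb hs) (h2 a) (h2 b)
  | lt a b iha ihb =>
    intro s hs
    have := two_le_pow hM (Expr.one_le_deg (.lt a b))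
    simp only [eval]
    split_ifs <;> omega
  | rlt A i B j iha ihb =>
    intro s hs
    have := two_le_pow hM (Expr.one_le_deg (.rlt A i B j))
    simp only [eval]
    split_ifs <;> omega
  | sum r m e ih =>
    intro s hs
    simp only [eval, deg]
    have hm := hs.word m
    calc ∑ k ∈ Finset.range (s.word m), e.eval (s.setWord r k)
        ≤ ∑ k ∈ Finset.range (s.word m), M ^ e.deg := Finset.sum_le_sum fun k hk =>
          (ih (hs.setWord ((Finset.mem_range.1 hk).trans hm))).le
      _ = s.word m * M ^ e.deg := by simp
      _ < M * M ^ e.deg := Nat.mul_lt_mul_of_pos_right hm (by have := h2 e; omega)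
      _ = M ^ (e.deg + 1) := by ring

/-- Partial sums are bounded like the whole sum. -/
theorem Expr.sum_eval_lt {M : ℕ} (hM : 2 ≤ M) (e : Expr) {s : Memory} (hs : Bounded M s) (r : ℕ)
    {j : ℕ} (hj : j ≤ M) :
    ∑ k ∈ Finset.range j, e.eval (s.setWord r k) ≤ M ^ (e.deg + 1) :=
  calc ∑ k ∈ Finset.range j, e.eval (s.setWord r k)
      ≤ ∑ k ∈ Finset.range j, M ^ e.deg := Finset.sum_le_sum fun k hk =>
        (e.eval_lt hM (hs.setWord ((Finset.mem_range.1 hk).trans_le hj))).le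
    _ = j * M ^ e.deg := by simp
    _ ≤ M * M ^ e.deg := Nat.mul_le_mul_right _ hj
    _ = M ^ (e.deg + 1) := by ring

theorem Expr.cost_congr {β γ : ℕ → ℕ} (h : ∀ m < 16, β m = γ m) :
    ∀ e : Expr, e.WF → e.cost β = e.cost γ
  | .const _, _ => rfl
  | .reg _, _ => rfl
  | .arr _ i, hi => by simp [WF] at hi; simp [cost, cost_congr h i hi.2]
  | .bin _ a b, hi => by simp [WF] at hi; simp [cost, cost_congr h a hi.1, cost_congr h b hi.2]
  | .lt a b, hi => by simp [WF] at hi; simp [cost, cost_congr h a hi.1, cost_congr h b hi.2]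
  | .rlt _ a _ b, hi => by simp [WF] at hi; simp [cost, cost_congr h a hi.1, cost_congr h b hi.2]
  | .sum _ m e, hi => by simp [WF] at hi; simp [cost, cost_congr h e hi.2, h m hi.1.2]

/-- The compiled expression leaves its value in register `t`. Registers below `t` are unchanged, so
nested expressions can be evaluated in the registers from `t` on as on a stack. -/
theorem Expr.compile_halts {M W : ℕ} (hM : 2 ≤ M) (e : Expr) : ∀ {s u : Memory} {t : ℕ},
    64 ≤ t → e.WF → Bounded M s → Agree u s → M ^ (e.deg + 1) < W →
    Halts W (e.compile t) u (e.cost s.word) fun u' => u'.word t = e.eval s ∧ Below t u u' := by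
  induction e with
  | const c =>
    intro s u t ht hwf hs hu hW
    have : c < W := ((Expr.const c).eval_lt hM hs).trans (lt_trans (Nat.pow_lt_pow_right (by omega) (by omega)) hW)
    exact .const this ⟨Memory.setWord_word_self .., (Below.refl t u).setWord _ le_rfl⟩
  | reg r =>
    intro s u t ht hwf hs hu hW
    simp [WF] at hwf
    have h1 : M < M ^ (1 + 1) := by
      calc M = M ^ 1 := (pow_one M).symm
        _ < _ := Nat.pow_lt_pow_right (by omega) (by omega)
    have h2 := hs.word r
    simp only [deg] at hW
    refine .seq_wp <| .const (by omega) <| .arith ?_ ⟨?_, ?_⟩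
    · simp (disch := omega) only [Memory.setWord_word_ne, Memory.setWord_word_self, WordOp.eval, hu.word]
      omega
    · simp (disch := omega) only [Memory.setWord_word_ne, Memory.setWord_word_self, WordOp.eval, hu.word]
      rfl
    · exact ((Below.refl t u).setWord _ le_rfl).setWord _ le_rfl
  | arr A i ih =>
    intro s u t ht hwf hs hu hW
    simp [WF] at hwf
    refine (ih ht hwf.2 hs hu hW).seq fun u' hu' => .load ⟨?_, hu'.2.setWord _ le_rfl⟩
    rw [Memory.setWord_word_self, hu'.1, (hu'.2.agree hu (by omega)).array A hwf.1]
    rfl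
  | bin op a b iha ihb =>
    intro s u t ht hwf hs hu hW
    simp [WF] at hwf
    simp only [deg] at hW
    refine ((iha ht hwf.1 hs hu ((Nat.pow_le_pow_right (by omega) (by omega)).trans_lt hW)).seq
      fun u' hu' => (ihb (t := t + 1) (by omega) hwf.2 hs (hu'.2.agree hu (by omega))
        ((Nat.pow_le_pow_right (by omega) (by omega)).trans_lt hW)).seq fun u'' hu'' =>
          .arith ?_ ⟨?_, ?_⟩).mono ?hcost fun _ h => h
    case hcost => simp only [cost]; omega
    · rw [hu''.1, hu''.2.word t (by omega), hu'.1]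
      exact ((Expr.bin op a b).eval_lt hM hs).trans
        (lt_trans (Nat.pow_lt_pow_right (by omega) (by simp [deg])) hW)
    · rw [hu''.1, hu''.2.word t (by omega), hu'.1, Memory.setWord_word_self]
      rfl
    · exact (hu'.2.trans hu''.2 (by omega)).setWord _ le_rfl
  | lt a b iha ihb =>
    intro s u t ht hwf hs hu hW
    simp [WF] at hwf
    simp only [deg] at hW
    have h1 : 2 ≤ M ^ (a.deg + b.deg + 1) := two_le_pow hM (by omega)
    refine ((iha ht hwf.1 hs hu ((Nat.pow_le_pow_right (by omega) (by omega)).trans_lt hW)).seq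
      fun u' hu' => (ihb (t := t + 1) (by omega) hwf.2 hs (hu'.2.agree hu (by omega))
        ((Nat.pow_le_pow_right (by omega) (by omega)).trans_lt hW)).seq fun u'' hu'' =>
          .ite (T := 1) (fun h => .const (by omega) ⟨?_, ?_⟩) (fun h => .const (by omega) ⟨?_, ?_⟩)).mono ?hcost
            fun _ h => h
    case hcost => simp only [cost]; omega
    · simp only [Test.Holds, hu''.1, hu''.2.word t (by omega), hu'.1] at h
      simp [Memory.setWord_word_self, eval, h]
    · exact (hu'.2.trans hu''.2 (by omega)).setWord _ le_rfl
    · simp only [Test.Holds, hu''.1, hu''.2.word t (by omega), hu'.1] at h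
      simp [Memory.setWord_word_self, eval, h]
    · exact (hu'.2.trans hu''.2 (by omega)).setWord _ le_rfl
  | rlt A a B b iha ihb =>
    intro s u t ht hwf hs hu hW
    simp [WF] at hwf
    simp only [deg] at hW
    have h1 : 2 ≤ M ^ (a.deg + b.deg + 1) := two_le_pow hM (by omega)
    refine ((iha ht hwf.1 hs hu ((Nat.pow_le_pow_right (by omega) (by omega)).trans_lt hW)).seq
      fun u' hu' => (ihb (t := t + 1) (by omega) hwf.2 hs (hu'.2.agree hu (by omega))
        ((Nat.pow_le_pow_right (by omega) (by omega)).trans_lt hW)).seq fun u'' hu'' =>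
          .seq_wp <| .realLoad <| .seq_wp <| .realLoad <|
          .ite (T := 1) (fun h => .const (by omega) ⟨?_, ?_⟩) (fun h => .const (by omega) ⟨?_, ?_⟩)).mono ?hcost
            fun _ h => h
    case hcost => simp only [cost]; omega
    · simp [Test.Holds, Memory.setReal, hu''.1, hu''.2.word t (by omega), hu'.1, hu''.2.real, hu'.2.real, hu.real] at h
      simp [Memory.setWord_word_self, eval, h]
    · exact Below.setWord (u' := Memory.setReal (Memory.setReal _ _ _) _ _)
        ⟨(hu'.2.trans hu''.2 (by omega)).word, (hu'.2.trans hu''.2 (by omega)).array, (hu'.2.trans hu''.2 (by omega)).real⟩ _ le_rfl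
    · simp [Test.Holds, Memory.setReal, hu''.1, hu''.2.word t (by omega), hu'.1, hu''.2.real, hu'.2.real, hu.real] at h
      simp [Memory.setWord_word_self, eval, h]
    · exact Below.setWord (u' := Memory.setReal (Memory.setReal _ _ _) _ _)
        ⟨(hu'.2.trans hu''.2 (by omega)).word, (hu'.2.trans hu''.2 (by omega)).array, (hu'.2.trans hu''.2 (by omega)).real⟩ _ le_rfl
  | sum r m e ih =>
    intro s u t ht hwf hs hu hW
    simp [WF] at hwf
    obtain ⟨⟨⟨hr16, hr60⟩, hm⟩, hwf⟩ := hwf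
    simp only [deg] at hW
    have h1 : M < M ^ (e.deg + 1 + 1) := by
      calc M = M ^ 1 := (pow_one M).symm
        _ < _ := Nat.pow_lt_pow_right (by omega) (by omega)
    have hN := hs.word m
    have hsr := hs.word r
    have hum := hu.word m (by omega)
    have hur := hu.word r (by omega)
    let I : ℕ → Memory → Prop := fun k v => v.word t = ∑ j ∈ Finset.range k, e.eval (s.setWord r j) ∧
      v.word (t + 1) = k ∧ v.word (t + 2) = s.word r ∧ v.word (t + 3) = 1 ∧
      v.word (t + 4) = s.word m ∧ (∀ r' < t, r' ≠ r → v.word r' = u.word r') ∧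
      v.wordArray = u.wordArray ∧ v.realArray = u.realArray
    have step : ∀ k < s.word m, ∀ v, I k v → Halts W
        (.seq (.const r 0) <| .seq (.arith .add r r (t + 1)) <| .seq (e.compile (t + 5)) <|
          .seq (.arith .add t t (t + 5)) <| .arith .add (t + 1) (t + 1) (t + 3)) v
        (e.cost s.word + 4) (I (k + 1)) := by
      rintro k hk v ⟨h0, h1', h2, h3, h4, h5, h6, h7⟩
      have hcost : e.cost (s.setWord r k).word = e.cost s.word :=
        Expr.cost_congr (fun m hm => Memory.setWord_word_ne _ _ (by omega)) e hwf
      refine (Halts.seq_wp <| .const (by omega) <| .seq_wp <| .arith ?_ <|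
        (ih (s := s.setWord r k) (t := t + 5) (by omega) hwf (hs.setWord (by omega)) ?_
          ((Nat.pow_le_pow_right (by omega) (by omega)).trans_lt hW)).seq
          fun v' hv' => .seq_wp <| .arith ?_ <| .arith ?_ ⟨?_, ?_, ?_, ?_, ?_, ?_, ?_, ?_⟩).mono
            (T' := e.cost s.word + 4) ?hcost fun _ h => h
      case hcost => rw [hcost]; omega
      · simp (disch := omega) only [Memory.setWord_word_ne, Memory.setWord_word_self, WordOp.eval, h1']
        omega
      · refine ⟨fun r' hr' => ?_, fun A hA => ?_, ?_⟩
        · by_cases e : r' = r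
          · subst e
            simp (disch := omega) [Memory.setWord_word_ne, Memory.setWord_word_self, WordOp.eval, h1']
          · simp (disch := first | omega | assumption) only [Memory.setWord_word_ne, h5 r' (by omega) e,
              hu.word r' hr']
        · simp only [Memory.setWord_wordArray, h6, hu.array A hA]
        · simp only [Memory.setWord_realArray, h7, hu.real]
      all_goals have hw := hv'.2.word
      · rw [hv'.1, hw t (by omega)]
        simp (disch := omega) only [Memory.setWord_word_ne, h0, WordOp.eval]
        rw [← Finset.sum_range_succ (fun j => e.eval (s.setWord r j))]
        exact (e.sum_eval_lt hM hs r (by omega)).trans_lt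
          ((Nat.pow_lt_pow_right (by omega) (by omega)).trans hW)
      · simp (disch := omega) only [Memory.setWord_word_ne, hw, h1', h3, WordOp.eval]
        omega
      · rw [Memory.setWord_word_ne _ _ (by omega), Memory.setWord_word_self, hv'.1, hw t (by omega)]
        simp (disch := omega) only [Memory.setWord_word_ne, h0, WordOp.eval, Finset.sum_range_succ]
      · simp (disch := omega) only [Memory.setWord_word_self, Memory.setWord_word_ne, hw, h1', h3, WordOp.eval]
      · simp (disch := omega) only [Memory.setWord_word_ne, hw, h2]
      · simp (disch := omega) only [Memory.setWord_word_ne, hw, h3]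
      · simp (disch := omega) only [Memory.setWord_word_ne, hw, h4]
      · intro r' hr' hne
        simp (disch := first | omega | assumption) only [Memory.setWord_word_ne, hw, h5 r' hr' hne]
      · simp only [Memory.setWord_wordArray, hv'.2.array, h6]
      · simp only [Memory.setWord_realArray, hv'.2.real, h7]
    refine (Halts.seq_wp <| .const (by omega) <| .seq_wp <| .const (by omega) <|
      .seq_wp <| .arith ?_ <| .seq_wp <| .arith ?_ <| .seq_wp <| .const (by omega) <|
      (Halts.whileLt I (fun _ => e.cost s.word + 4) (fun k v h => ⟨h.2.1, h.2.2.2.2.1⟩) step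
        ⟨?_, ?_, ?_, ?_, ?_, ?_, ?_, ?_⟩).seq fun v hv => .seq_wp <| .const (by omega) <|
        .arith ?_ ⟨?_, ?_, ?_, ?_⟩).mono (T' := (Expr.sum r m e).cost s.word) ?hcost fun _ h => h
    case hcost =>
      simp only [cost, Finset.sum_const, Finset.card_range, smul_eq_mul]
      linarith
    · simp (disch := omega) only [Memory.setWord_word_self, Memory.setWord_word_ne, WordOp.eval, hum]
      omega
    · simp (disch := omega) only [Memory.setWord_word_self, Memory.setWord_word_ne, WordOp.eval, hur]
      omega
    · simp (disch := omega) [Memory.setWord_word_self, Memory.setWord_word_ne]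
    · simp (disch := omega) [Memory.setWord_word_self, Memory.setWord_word_ne]
    · simp (disch := omega) [Memory.setWord_word_self, Memory.setWord_word_ne, WordOp.eval, hur]
    · simp (disch := omega) [Memory.setWord_word_self, Memory.setWord_word_ne]
    · simp (disch := omega) [Memory.setWord_word_self, Memory.setWord_word_ne, WordOp.eval, hum]
    · intro r' hr' _
      simp (disch := omega) only [Memory.setWord_word_ne]
    · rfl
    · rfl
    all_goals obtain ⟨h0, h1', h2, h3, h4, h5, h6, h7⟩ := hv
    · simp (disch := omega) only [Memory.setWord_word_self, Memory.setWord_word_ne, WordOp.eval, h2]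
      omega
    · simp (disch := omega) only [Memory.setWord_word_ne, h0, eval]
    · intro r' hr'
      by_cases e : r' = r
      · subst e
        simp (disch := omega) [Memory.setWord_word_ne, Memory.setWord_word_self, WordOp.eval, h2, hur]
      · simp (disch := first | omega | assumption) only [Memory.setWord_word_ne, h5 r' hr' e]
    · exact h6
    · exact h7

end RAM

namespace RAM

/-- Commands: assignment to a word register, assignments to entries of word arrays and of real
arrays (the sum of two entries of real arrays), conditionals on whether a word is positive,
sequencing, loops over all values of the local variable `r` below `word m`, and the multiplication
of the `b × b` matrices over `ℤ/2` in the word arrays `8` and `9` into word array `10`, where word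
register `8` holds `b` and word register `9` holds `b * b`. -/
inductive Cmd
  | assign (r : ℕ) (e : Expr)
  | store (A : ℕ) (i e : Expr)
  | radd (A : ℕ) (i : Expr) (B : ℕ) (j : Expr) (C : ℕ) (k : Expr)
  | ite (e : Expr) (c c' : Cmd)
  | seq (c c' : Cmd)
  | loop (r m : ℕ) (c : Cmd)
  | mul

/-- `iter f N s` applies `f 0`, …, `f (N - 1)` to `s`, in this order. -/
def iter {α : Type*} (f : ℕ → α → α) : ℕ → α → α
  | 0, s => s
  | N + 1, s => f N (iter f N s)

/-- Memory after replacing the word array `A`. -/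
def setArr (s : Memory) (A : ℕ) (f : ℕ → ℕ) : Memory :=
  { s with wordArray := Function.update s.wordArray A f }

/-- The row by row listing of the product modulo two of the `b × b` matrices listed in `X` and
`Y`; past the end of the listing it agrees with `Z`. -/
def mulListing (b : ℕ) (X Y Z : ℕ → ℕ) (x : ℕ) : ℕ :=
  if x < b * b then (∑ i ∈ Finset.range b, X (x / b * b + i) * Y (i * b + x % b)) % 2 else Z x

namespace Cmd

/-- The effect of a command. Loop variables are local: their old values are restored. -/
noncomputable def den : Cmd → Memory → Memory
  | assign r e, s => s.setWord r (e.eval s)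
  | store A i e, s => s.setWordArray A (i.eval s) (e.eval s)
  | radd A i B j C k, s =>
    s.setRealArray A (i.eval s) (s.realArray B (j.eval s) + s.realArray C (k.eval s))
  | ite e c c', s => if 0 < e.eval s then c.den s else c'.den s
  | seq c c', s => c'.den (c.den s)
  | loop r m c, s =>
    (iter (fun k s' => c.den (s'.setWord r k)) (s.word m) s).setWord r (s.word r)
  | mul, s => setArr s 10 (mulListing (s.word 8) (s.wordArray 8) (s.wordArray 9) (s.wordArray 10))

/-- All words that the command assigns are below `M`, and the input of every matrix multiplication
has the right format. -/
def Safe (M : ℕ) : Cmd → Memory → Prop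
  | assign _ e, s => e.eval s < M
  | store _ _ e, s => e.eval s < M
  | radd .., _ => True
  | ite e c c', s => if 0 < e.eval s then c.Safe M s else c'.Safe M s
  | seq c c', s => c.Safe M s ∧ c'.Safe M (c.den s)
  | loop r m c, s => ∀ k < s.word m,
    c.Safe M ((iter (fun k s' => c.den (s'.setWord r k)) k s).setWord r k)
  | mul, s => 0 < s.word 8 ∧ s.word 9 = s.word 8 * s.word 8 ∧
    ∀ x < s.word 8 * s.word 8, s.wordArray 8 x < 2 ∧ s.wordArray 9 x < 2

/-- The static side conditions of a command, see `RAM.Expr.WF`. -/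
def WF : Cmd → Bool
  | assign r e => r < 60 && e.WF
  | store A i e => A < 31 && i.WF && e.WF
  | radd _ i _ j _ k => i.WF && j.WF && k.WF
  | ite e c c' => e.WF && c.WF && c'.WF
  | seq c c' => c.WF && c'.WF
  | loop r m c => 16 ≤ r && r < 60 && m < 16 && c.WF
  | mul => true

/-- The largest degree of an expression in the command. -/
def deg : Cmd → ℕ
  | assign _ e => e.deg
  | store _ i e => max i.deg e.deg
  | radd _ i _ j _ k => max i.deg (max j.deg k.deg)
  | ite e c c' => max e.deg (max c.deg c'.deg)
  | seq c c' => max c.deg c'.deg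
  | loop _ _ c => c.deg
  | mul => 1

/-- A bound for the number of steps; `κ b` is a bound for the multiplication of `b × b`
matrices. -/
noncomputable def cost (κ : ℕ → ℕ) : Cmd → Memory → ℕ
  | assign _ e, s => e.cost s.word + 2
  | store _ i e, s => i.cost s.word + e.cost s.word + 1
  | radd _ i _ j _ k, s => i.cost s.word + j.cost s.word + k.cost s.word + 4
  | ite e c c', s => e.cost s.word + 2 + if 0 < e.eval s then c.cost κ s else c'.cost κ s
  | seq c c', s => c.cost κ s + c'.cost κ (c.den s)
  | loop r m c, s => ∑ k ∈ Finset.range (s.word m),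
      (c.cost κ ((iter (fun k s' => c.den (s'.setWord r k)) k s).setWord r k) + 4) + 7
  | mul, s => κ (s.word 8)

/-- The translation to machine programs. `P` is the multiplication program, and the registers from
`64 + R + h` on are used for auxiliary values. -/
def compile (P : Program) (R : ℕ) : Cmd → ℕ → Program
  | assign r e, h => .seq (e.compile (64 + R + h)) <|
    .seq (.const r 0) (.arith .add r r (64 + R + h))
  | store A i e, h => .seq (i.compile (64 + R + h)) <| .seq (e.compile (64 + R + h + 1)) <|
    .store A (64 + R + h) (64 + R + h + 1)
  | radd A i B j C k, h => .seq (i.compile (64 + R + h)) <|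
    .seq (j.compile (64 + R + h + 1)) <| .seq (k.compile (64 + R + h + 2)) <|
    .seq (.realLoad 0 B (64 + R + h + 1)) <| .seq (.realLoad 1 C (64 + R + h + 2)) <|
    .seq (.realAdd 0 0 1) <| .realStore A (64 + R + h) 0
  | ite e c c', h => .seq (e.compile (64 + R + h)) <| .seq (.const (64 + R + h + 1) 0) <|
    .ite (.wordLt (64 + R + h + 1) (64 + R + h)) (c.compile P R h) (c'.compile P R h)
  | seq c c', h => .seq (c.compile P R h) (c'.compile P R h)
  | loop r m c, h => .seq (.const (64 + R + h) 0) <|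
    .seq (.arith .add (64 + R + h + 1) m (64 + R + h)) <|
    .seq (.arith .add (64 + R + h + 2) r (64 + R + h)) <|
    .seq (.const (64 + R + h + 3) 1) <|
    .seq (.while (.wordLt (64 + R + h) (64 + R + h + 1)) <|
      .seq (.const r 0) <| .seq (.arith .add r r (64 + R + h)) <| .seq (c.compile P R (h + 4)) <|
      .arith .add (64 + R + h) (64 + R + h) (64 + R + h + 3)) <|
    .seq (.const r 0) <| .arith .add r r (64 + R + h + 2)
  | mul, h => mulCall P R h

end Cmd

theorem Bounded.setWordArray {M : ℕ} {s : Memory} (h : Bounded M s) (A i : ℕ) {x : ℕ}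
    (hx : x < M) : Bounded M (s.setWordArray A i x) := by
  refine ⟨h.word, fun B y => ?_⟩
  simp only [Memory.setWordArray, Function.update_apply]
  split_ifs with h1
  · by_cases h2 : y = i
    · simpa [h2] using hx
    · simpa [h2] using h.array _ _
  · exact h.array _ _

/-- Words stay bounded along a safe command. -/
theorem Cmd.Safe.bounded {M : ℕ} (hM : 2 ≤ M) {c : Cmd} : ∀ {s : Memory}, c.Safe M s → Bounded M s →
    Bounded M (c.den s) := by
  induction c with
  | assign r e => exact fun h hs => hs.setWord h
  | store A i e => exact fun h hs => hs.setWordArray _ _ h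
  | radd A i B j C k => exact fun h hs => ⟨hs.word, hs.array⟩
  | ite e c c' ih ih' =>
    intro s h hs
    simp only [Safe] at h
    simp only [den]
    split_ifs at h ⊢
    · exact ih h hs
    · exact ih' h hs
  | seq c c' ih ih' => exact fun h hs => ih' h.2 (ih h.1 hs)
  | loop r m c ih =>
    intro s h hs
    have : ∀ k ≤ s.word m, Bounded M (iter (fun k s' => c.den (s'.setWord r k)) k s) := by
      intro k
      induction k with
      | zero => exact fun _ => hs
      | succ k ihk =>
        intro hk
        exact ih (h k (by omega)) ((ihk (by omega)).setWord (by have := hs.word m; omega))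
    exact (this _ le_rfl).setWord (hs.word r)
  | mul =>
    intro s h hs
    refine ⟨hs.word, fun A x => ?_⟩
    simp only [den, setArr, Function.update_apply]
    split_ifs
    · unfold mulListing
      split_ifs
      · have := Nat.mod_lt (∑ i ∈ Finset.range (s.word 8), s.wordArray 8 (x / s.word 8 * s.word 8 + i) *
          s.wordArray 9 (i * s.word 8 + x % s.word 8)) (show 0 < 2 by omega)
        omega
      · exact hs.array _ _
    · exact hs.array _ _

theorem _root_.Represents.agree {u s : Memory} (h : Represents u s) : Agree u s :=
  ⟨h.word, h.array, h.real⟩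

theorem _root_.Represents.below {t : ℕ} {u u' s : Memory} (h : Represents u s) (h' : Below t u u')
    (ht : 60 ≤ t) : Represents u' s :=
  ⟨fun r hr => (h'.word r (by omega)).trans (h.word r hr), fun A hA => by rw [h'.array, h.array A hA],
    fun A hA => by rw [h'.array, h.clean A hA], h'.real.trans h.real⟩

/-- What the translation of a command has to achieve: the memory represents `s'`, and the
auxiliary registers of the context are unchanged. -/
def Reaches (R h : ℕ) (u s' u' : Memory) : Prop :=
  Represents u' s' ∧ ∀ r, 64 + R ≤ r → r < 64 + R + h → u'.word r = u.word r

/-- The assignment `word r := word t` of an auxiliary register. -/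
theorem halts_move {W R h r t : ℕ} {u s : Memory} (hu : Represents u s) (hr : r < 60)
    (ht : 64 + R + h ≤ t) (hW : u.word t < W) :
    Halts W (.seq (.const r 0) (.arith .add r r t)) u 2
      (Reaches R h u (s.setWord r (u.word t))) := by
  have h0 : 0 < W := by omega
  refine .seq_wp <| .const h0 <| .arith ?_ ⟨⟨?_, ?_, ?_, ?_⟩, ?_⟩
  · simp (disch := omega) only [Memory.setWord_word_self, Memory.setWord_word_ne, WordOp.eval]
    omega
  · intro r' hr'
    by_cases e : r' = r
    · subst e
      simp (disch := omega) [Memory.setWord_word_self, Memory.setWord_word_ne, WordOp.eval]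
    · simp only [Memory.setWord_word_ne _ _ e, hu.word r' hr']
  · exact hu.array
  · exact hu.clean
  · exact hu.real
  · intro r' h1 h2
    simp (disch := omega) only [Memory.setWord_word_ne]

theorem _root_.Represents.setWord {u s : Memory} (h : Represents u s) {t : ℕ} (x : ℕ) (ht : 60 ≤ t) :
    Represents (u.setWord t x) s :=
  ⟨fun r hr => by rw [Memory.setWord_word_ne _ _ (by omega), h.word r hr], h.array, h.clean, h.real⟩

/-- The translation of a safe command is correct, and its running time is bounded by the cost of
the command. -/
theorem Cmd.compile_halts {M W R k : ℕ} {μ : ℕ → ℕ} {P : Program} (hP : MultipliesWithin P k μ)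
    (hR : P.width ≤ R) (hR2 : 2 ≤ R) (hM : 2 ≤ M) (hWk : ∀ b < M, (b + 2) ^ k ≤ W)
    (hWμ : ∀ b < M, μ b < W) (c : Cmd) : ∀ {h : ℕ} {s u : Memory}, c.WF → c.Safe M s →
    Bounded M s → Represents u s → M ^ (c.deg + 1) < W →
    Halts W (c.compile P R h) u (c.cost (fun b => (R + 20) * (b * b + μ b + 1)) s)
      (Reaches R h u (c.den s)) := by
  have hMW : ∀ d, M ^ (d + 1) < W → M < W := fun d hd =>
    (Nat.le_self_pow (by omega) M).trans_lt hd
  induction c with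
  | assign r e =>
    intro h s u hwf hsafe hs hu hW
    simp [WF] at hwf
    refine (e.compile_halts hM (by omega) hwf.2 hs hu.agree hW).seq fun u' hu' => ?_
    have h1 := (hu.below hu'.2 (by omega))
    have hlt : u'.word (64 + R + h) < W := by
      rw [hu'.1]
      exact lt_trans hsafe (hMW _ hW)
    refine (halts_move h1 hwf.1 le_rfl hlt).mono le_rfl fun u'' hu'' => ?_
    rw [hu'.1] at hu''
    exact ⟨hu''.1, fun r h2 h3 => by rw [hu''.2 r h2 h3, hu'.2.word r h3]⟩
  | store A i e =>
    intro h s u hwf hsafe hs hu hW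
    simp [WF] at hwf
    simp only [deg] at hW
    refine ((i.compile_halts (t := 64 + R + h) hM (by omega) hwf.1.2 hs hu.agree
      ((Nat.pow_le_pow_right (by omega) (by omega)).trans_lt hW)).seq fun u' hu' =>
      (e.compile_halts (t := 64 + R + h + 1) hM (by omega) hwf.2 hs
        (hu.below hu'.2 (by omega)).agree
        ((Nat.pow_le_pow_right (by omega) (by omega)).trans_lt hW)).seq fun u'' hu'' =>
      .store (W := W) ?_).mono ?hc fun _ h => h
    case hc => simp only [cost]; omega
    have h2 := hu.below (hu'.2.trans hu''.2 (by omega)) (by omega)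
    rw [hu''.1, hu''.2.word (64 + R + h) (by omega), hu'.1]
    refine ⟨⟨h2.word, fun B hB => ?_, fun B hB => ?_, h2.real⟩, fun r h3 h4 => ?_⟩
    · simp only [den, Memory.setWordArray, Function.update_apply, h2.array A hwf.1.1, h2.array B hB]
    · rw [Memory.setWordArray_ne _ _ _ (by omega), h2.clean B hB]
    · rw [Memory.setWordArray_word, hu''.2.word r (by omega), hu'.2.word r (by omega)]
  | radd A i B j C l =>
    intro h s u hwf hsafe hs hu hW
    simp [WF] at hwf
    simp only [deg] at hW
    refine ((i.compile_halts (t := 64 + R + h) hM (by omega) hwf.1.1 hs hu.agree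
      ((Nat.pow_le_pow_right (by omega) (by omega)).trans_lt hW)).seq fun u₁ hu₁ =>
      (j.compile_halts (t := 64 + R + h + 1) hM (by omega) hwf.1.2 hs
        (hu.below hu₁.2 (by omega)).agree
        ((Nat.pow_le_pow_right (by omega) (by omega)).trans_lt hW)).seq fun u₂ hu₂ =>
      (l.compile_halts (t := 64 + R + h + 2) hM (by omega) hwf.2 hs
        ((hu.below hu₁.2 (by omega)).below hu₂.2 (by omega)).agree
        ((Nat.pow_le_pow_right (by omega) (by omega)).trans_lt hW)).seq fun u₃ hu₃ =>
      .seq_wp (W := W) <| .realLoad <| .seq_wp <| .realLoad <| .seq_wp <| .realAdd <|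
      .realStore ?_).mono ?hc fun _ h => h
    case hc => simp only [cost]; omega
    have h2 := hu.below ((hu₁.2.trans hu₂.2 (by omega)).trans hu₃.2 (by omega)) (by omega)
    refine ⟨⟨h2.word, h2.array, h2.clean, ?_⟩, fun r h3 h4 => ?_⟩
    · simp [den, Memory.setRealArray, Memory.setReal, hu₃.1, hu₃.2.word (64 + R + h + 1) (by omega),
        hu₂.1, hu₃.2.word (64 + R + h) (by omega), hu₂.2.word (64 + R + h) (by omega), hu₁.1, h2.real]
    · simp only [Memory.setRealArray, Memory.setReal]
      rw [hu₃.2.word r (by omega), hu₂.2.word r (by omega), hu₁.2.word r (by omega)]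
  | ite e c c' ih ih' =>
    intro h s u hwf hsafe hs hu hW
    simp [WF] at hwf
    simp only [deg] at hW
    have h0 : 0 < W := by omega
    refine ((e.compile_halts (t := 64 + R + h) hM (by omega) hwf.1.1 hs hu.agree
      ((Nat.pow_le_pow_right (by omega) (by omega)).trans_lt hW)).seq fun u' hu' =>
      .seq_wp <| .const h0 <| .ite
        (T := if 0 < e.eval s then c.cost (fun b => (R + 20) * (b * b + μ b + 1)) s
          else c'.cost (fun b => (R + 20) * (b * b + μ b + 1)) s)
        (fun hb => ?_) fun hb => ?_).mono ?hc fun _ h => h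
    case hc => simp only [cost]; omega
    all_goals
      simp only [Test.Holds, Memory.setWord_word_self] at hb
      rw [Memory.setWord_word_ne _ _ (by omega), hu'.1] at hb
      have h2 := (hu.below hu'.2 (by omega)).setWord (t := 64 + R + h + 1) 0 (by omega)
      simp only [Safe, hb, if_true, if_false] at hsafe
      simp only [hb, if_true, if_false, den]
    · refine (ih hwf.1.2 hsafe hs h2 ((Nat.pow_le_pow_right (by omega) (by omega)).trans_lt hW)).mono
        le_rfl fun u'' hu'' => ⟨hu''.1, fun r h3 h4 => ?_⟩
      rw [hu''.2 r h3 h4, Memory.setWord_word_ne _ _ (by omega), hu'.2.word r (by omega)]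
    · refine (ih' hwf.2 hsafe hs h2 ((Nat.pow_le_pow_right (by omega) (by omega)).trans_lt hW)).mono
        le_rfl fun u'' hu'' => ⟨hu''.1, fun r h3 h4 => ?_⟩
      rw [hu''.2 r h3 h4, Memory.setWord_word_ne _ _ (by omega), hu'.2.word r (by omega)]
  | seq c c' ih ih' =>
    intro h s u hwf hsafe hs hu hW
    simp [WF] at hwf
    simp only [deg] at hW
    refine (ih (h := h) hwf.1 hsafe.1 hs hu
      ((Nat.pow_le_pow_right (by omega) (by omega)).trans_lt hW)).seq fun u' hu' =>
      (ih' hwf.2 hsafe.2 (hsafe.1.bounded hM hs) hu'.1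
        ((Nat.pow_le_pow_right (by omega) (by omega)).trans_lt hW)).mono le_rfl
      fun u'' hu'' => ⟨hu''.1, fun r h1 h2 => by rw [hu''.2 r h1 h2, hu'.2 r h1 h2]⟩
  | loop r m c ih =>
    intro h s u hwf hsafe hs hu hW
    simp [WF] at hwf
    obtain ⟨⟨⟨hr16, hr60⟩, hm⟩, hwf⟩ := hwf
    simp only [deg] at hW
    have hMW' := hMW _ hW
    have hN := hs.word m
    have hsr := hs.word r
    have hum := hu.word m (by omega)
    have hur := hu.word r (by omega)
    obtain ⟨F, hF⟩ : ∃ F : ℕ → Memory → Memory, F = fun k s' => c.den (s'.setWord r k) := ⟨_, rfl⟩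
    have hFe : ∀ k x, F k x = c.den (x.setWord r k) := by simp [hF]
    replace hsafe : ∀ k < s.word m, c.Safe M ((iter F k s).setWord r k) := by
      rw [hF]
      exact hsafe
    have hbd : ∀ k ≤ s.word m, Bounded M (iter F k s) := by
      intro k
      induction k with
      | zero => exact fun _ => hs
      | succ k ihk =>
        intro hk
        rw [iter, hFe]
        exact (hsafe k (by omega)).bounded hM ((ihk (by omega)).setWord (by omega))
    let I : ℕ → Memory → Prop := fun k v => Represents v (iter F k s) ∧
      v.word (64 + R + h) = k ∧ v.word (64 + R + h + 1) = s.word m ∧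
      v.word (64 + R + h + 2) = s.word r ∧ v.word (64 + R + h + 3) = 1 ∧
      ∀ r, 64 + R ≤ r → r < 64 + R + h → v.word r = u.word r
    have step : ∀ k < s.word m, ∀ v, I k v → Halts W
        (.seq (.const r 0) <| .seq (.arith .add r r (64 + R + h)) <|
          .seq (c.compile P R (h + 4)) <|
          .arith .add (64 + R + h) (64 + R + h) (64 + R + h + 3)) v
        (c.cost (fun b => (R + 20) * (b * b + μ b + 1)) ((iter F k s).setWord r k) + 3)
        (I (k + 1)) := by
      rintro k hk v ⟨h0, h1, h2, h3, h4, h5⟩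
      refine (Halts.seq_wp <| .const (by omega) <| .seq_wp <| .arith ?_ <|
        (ih (h := h + 4) hwf (hsafe k hk) ((hbd k (by omega)).setWord (by omega)) ?_ hW).seq
          fun v' hv' => .arith ?_ ⟨?_, ?_, ?_, ?_, ?_, ?_⟩).mono ?hc fun _ h => h
      case hc => omega
      · simp (disch := omega) only [Memory.setWord_word_ne, Memory.setWord_word_self, WordOp.eval, h1]
        omega
      · refine ⟨fun r' hr' => ?_, h0.array, h0.clean, h0.real⟩
        by_cases e : r' = r
        · subst e
          simp (disch := omega) [Memory.setWord_word_ne, Memory.setWord_word_self, WordOp.eval, h1]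
        · simp only [Memory.setWord_word_ne _ _ e, h0.word r' hr']
      all_goals
        have hw : ∀ r', 64 + R ≤ r' → r' < 64 + R + h + 4 → v'.word r' = v.word r' := by
          intro r' h6 h7
          rw [hv'.2 r' h6 (by omega)]
          simp (disch := omega) only [Memory.setWord_word_ne]
      · simp (disch := omega) only [hw, h1, h4, WordOp.eval]
        omega
      · rw [iter, hFe]
        exact hv'.1.setWord _ (by omega)
      · simp (disch := omega) only [Memory.setWord_word_self, hw, h1, h4, WordOp.eval]
      · simp (disch := omega) only [Memory.setWord_word_ne, hw, h2]
      · simp (disch := omega) only [Memory.setWord_word_ne, hw, h3]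
      · simp (disch := omega) only [Memory.setWord_word_ne, hw, h4]
      · intro r' h6 h7
        simp (disch := omega) only [Memory.setWord_word_ne, hw, h5]
    refine (Halts.seq_wp <| .const (by omega) <| .seq_wp <| .arith ?_ <| .seq_wp <| .arith ?_ <|
      .seq_wp <| .const (by omega) <|
      (Halts.whileLt I _ (fun k v h => ⟨h.2.1, h.2.2.1⟩) step
        ⟨?_, ?_, ?_, ?_, ?_, ?_⟩).seq fun v hv =>
        (halts_move (R := R) (h := h) (t := 64 + R + h + 2) hv.1 hr60 (by omega) ?_).mono (T' := 2) le_rfl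
          fun v' hv' => ⟨?_, ?_⟩).mono ?hc fun _ h => h
    case hc => 
      simp only [cost, ← hF, Finset.sum_add_distrib, Finset.sum_const, Finset.card_range, smul_eq_mul]
      omega
    · simp (disch := omega) only [Memory.setWord_word_self, Memory.setWord_word_ne, WordOp.eval, hum]
      omega
    · simp (disch := omega) only [Memory.setWord_word_self, Memory.setWord_word_ne, WordOp.eval, hur]
      omega
    · exact (((hu.setWord _ (by omega)).setWord _ (by omega)).setWord _ (by omega)).setWord _
        (by omega)
    · simp (disch := omega) [Memory.setWord_word_self, Memory.setWord_word_ne]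
    · simp (disch := omega) [Memory.setWord_word_self, Memory.setWord_word_ne, WordOp.eval, hum]
    · simp (disch := omega) [Memory.setWord_word_self, Memory.setWord_word_ne, WordOp.eval, hur]
    · simp (disch := omega) [Memory.setWord_word_self, Memory.setWord_word_ne]
    · intro r' hr' _
      simp (disch := omega) only [Memory.setWord_word_ne]
    · rw [hv.2.2.2.1]
      omega
    · have := hv'.1
      simp only [den, ← hF]
      rwa [hv.2.2.2.1] at this
    · intro r' h1 h2
      rw [hv'.2 r' h1 h2, hv.2.2.2.2.2 r' h1 h2]
  | mul =>
    intro h s u hwf hsafe hs hu hW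
    obtain ⟨hb0, hbb, hXY⟩ := hsafe
    have h8 := hu.array 8 (by omega)
    have h9 := hu.array 9 (by omega)
    have h10 := hu.array 10 (by omega)
    have hb := hs.word 8
    have hb2 := hs.word 9
    have hMW' := hMW _ hW
    refine (mulCall_halts (b := s.word 8) hP hR hR2 u hu.clean (hu.word 8 (by omega))
      ((hu.word 9 (by omega)).trans hbb) hb0 (fun x hx => by rw [h8]; exact (hXY x hx).1)
      (fun x hx => by rw [h9]; exact (hXY x hx).2) (hWk _ hb) (by omega) (by omega)
      (hWμ _ hb)).mono le_rfl fun u' hu' => ⟨⟨fun r hr => ?_, fun A hA => ?_, hu'.2, ?_⟩, ?_⟩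
    · exact (hu'.1.word r (Or.inl hr)).trans (hu.word r hr)
    · rw [hu'.1.array A hA]
      simp only [den, setArr, Function.update_apply, h8, h9, h10]
      split_ifs
      · rfl
      · exact hu.array A hA
    · exact hu'.1.real.trans hu.real
    · exact fun r h1 h2 => hu'.1.word r (Or.inr ⟨h1, h2⟩)

end RAM

namespace RAM

/-! ### Reading the memory after writes -/

/-- Memory after replacing the real array `A`. -/
def setRArr (s : Memory) (A : ℕ) (f : ℕ → ℝ) : Memory :=
  { s with realArray := Function.update s.realArray A f }

section Normalization

variable (s : Memory) (r r' x y A B : ℕ) (f g : ℕ → ℕ) (F G : ℕ → ℝ)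

theorem word_setWord : (s.setWord r x).word r' = if r' = r then x else s.word r' := by
  simp [Memory.setWord, Function.update_apply]

theorem wordArray_setWord : (s.setWord r x).wordArray = s.wordArray := rfl

theorem realArray_setWord : (s.setWord r x).realArray = s.realArray := rfl

theorem word_setArr : (setArr s A f).word = s.word := rfl

theorem wordArray_setArr : (setArr s A f).wordArray B = if B = A then f else s.wordArray B := by
  simp [setArr, Function.update_apply]

theorem realArray_setArr : (setArr s A f).realArray = s.realArray := rfl

theorem word_setRArr : (setRArr s A F).word = s.word := rfl

theorem wordArray_setRArr : (setRArr s A F).wordArray = s.wordArray := rfl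

theorem realArray_setRArr : (setRArr s A F).realArray B = if B = A then F else s.realArray B := by
  simp [setRArr, Function.update_apply]

theorem setWord_setArr : (setArr s A f).setWord r x = setArr (s.setWord r x) A f := rfl

theorem setWord_setRArr : (setRArr s A F).setWord r x = setRArr (s.setWord r x) A F := rfl

theorem setArr_setRArr : setArr (setRArr s A F) B f = setRArr (setArr s B f) A F := rfl

theorem setWord_idem : (s.setWord r x).setWord r y = s.setWord r y := by
  simp [Memory.setWord]

theorem setWord_word : s.setWord r (s.word r) = s := by
  simp [Memory.setWord]

theorem setWord_comm (h : r' < r) :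
    (s.setWord r x).setWord r' y = (s.setWord r' y).setWord r x := by
  simp [Memory.setWord, Function.update_comm h.ne]

theorem setArr_idem : setArr (setArr s A f) A g = setArr s A g := by
  simp [setArr]

theorem setArr_self : setArr s A (s.wordArray A) = s := by
  simp [setArr]

theorem setArr_comm (h : B < A) :
    setArr (setArr s A f) B g = setArr (setArr s B g) A f := by
  simp [setArr, Function.update_comm h.ne]

theorem setRArr_comm (h : B < A) :
    setRArr (setRArr s A F) B G = setRArr (setRArr s B G) A F := by
  simp [setRArr, Function.update_comm h.ne]

theorem setWordArray_eq :
    s.setWordArray A x y = setArr s A (Function.update (s.wordArray A) x y) := rfl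

theorem setRealArray_eq (z : ℝ) :
    s.setRealArray A x z = setRArr s A (Function.update (s.realArray A) x z) := rfl

attribute [simp] word_setWord wordArray_setWord realArray_setWord word_setArr wordArray_setArr
  realArray_setArr word_setRArr wordArray_setRArr realArray_setRArr setWord_setArr setWord_setRArr
  setArr_setRArr setWord_idem setWord_word setWord_comm setArr_idem setArr_self setArr_comm
  setRArr_comm

end Normalization

/-! ### Arithmetic notation for expressions -/

namespace Expr

instance : Add Expr := ⟨.bin .add⟩
instance : Sub Expr := ⟨.bin .sub⟩
instance : Mul Expr := ⟨.bin .mul⟩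
instance : Div Expr := ⟨.bin .div⟩

/-- The remainder of a division. -/
def mod (a b : Expr) : Expr := a - a / b * b

/-- The truth value of an equation. -/
def eq (a b : Expr) : Expr := const 1 - (lt a b + lt b a)

variable (a b : Expr) (s : Memory)

theorem eval_const (c : ℕ) : (const c).eval s = c := rfl
theorem eval_reg (r : ℕ) : (reg r).eval s = s.word r := rfl
theorem eval_arr (A : ℕ) : (arr A a).eval s = s.wordArray A (a.eval s) := rfl
theorem eval_add : (a + b).eval s = a.eval s + b.eval s := rfl
theorem eval_sub : (a - b).eval s = a.eval s - b.eval s := rfl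
theorem eval_mul : (a * b).eval s = a.eval s * b.eval s := rfl
theorem eval_div : (a / b).eval s = a.eval s / b.eval s := rfl
theorem eval_lt' : (lt a b).eval s = if a.eval s < b.eval s then 1 else 0 := rfl
theorem eval_sum (r m : ℕ) :
    (sum r m a).eval s = ∑ k ∈ Finset.range (s.word m), a.eval (s.setWord r k) := rfl

theorem eval_rlt (A B : ℕ) : (rlt A a B b).eval s = open Classical in
    if s.realArray A (a.eval s) < s.realArray B (b.eval s) then 1 else 0 := rfl

theorem eval_mod : (mod a b).eval s = a.eval s % b.eval s := by
  simp only [mod, eval_sub, eval_mul, eval_div]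
  have := Nat.div_add_mod' (a.eval s) (b.eval s)
  omega

theorem eval_eq : (eq a b).eval s = if a.eval s = b.eval s then 1 else 0 := by
  simp only [eq, eval_sub, eval_add, eval_lt', eval_const]
  rcases lt_trichotomy (a.eval s) (b.eval s) with h | h | h
  · simp [h, h.ne]
  · simp [h]
  · simp [h, h.ne', h.not_gt]

attribute [simp] eval_const eval_reg eval_arr eval_add eval_sub eval_mul eval_div eval_lt' eval_sum
  eval_rlt eval_mod eval_eq

end Expr

/-! ### Rules for commands -/

/-- The command `c` is safe on the memory `s` and leads to a memory with the property `Q`. -/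
def Ok (M : ℕ) (c : Cmd) (s : Memory) (Q : Memory → Prop) : Prop :=
  c.Safe M s ∧ Q (c.den s)

namespace Ok

variable {M : ℕ} {c c' : Cmd} {s : Memory} {Q Q' : Memory → Prop}

theorem mono (h : Ok M c s Q) (h' : ∀ s', Q s' → Q' s') : Ok M c s Q' := ⟨h.1, h' _ h.2⟩

theorem assign {r : ℕ} {e : Expr} (h : e.eval s < M) (hQ : Q (s.setWord r (e.eval s))) :
    Ok M (.assign r e) s Q := ⟨h, hQ⟩

theorem store {A : ℕ} {i e : Expr} (h : e.eval s < M)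
    (hQ : Q (setArr s A (Function.update (s.wordArray A) (i.eval s) (e.eval s)))) :
    Ok M (.store A i e) s Q := ⟨h, hQ⟩

theorem radd {A B C : ℕ} {i j k : Expr}
    (hQ : Q (setRArr s A (Function.update (s.realArray A) (i.eval s)
      (s.realArray B (j.eval s) + s.realArray C (k.eval s))))) :
    Ok M (.radd A i B j C k) s Q := ⟨trivial, hQ⟩

theorem seq (h : Ok M c s fun s' => Ok M c' s' Q) : Ok M (.seq c c') s Q :=
  ⟨⟨h.1, h.2.1⟩, h.2.2⟩

theorem ite {e : Expr} (h : 0 < e.eval s → Ok M c s Q) (h' : e.eval s = 0 → Ok M c' s Q) :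
    Ok M (.ite e c c') s Q := by
  simp only [Ok, Cmd.Safe, Cmd.den]
  split_ifs with h0
  · exact h h0
  · exact h' (by omega)

/-- The invariant of a loop refers to the memory in which the loop variable has its old value. -/
theorem loop {r m : ℕ} (I : ℕ → Memory → Prop) (h0 : I 0 s)
    (step : ∀ k < s.word m, ∀ s', I k s' →
      Ok M c (s'.setWord r k) fun s'' => I (k + 1) (s''.setWord r (s.word r)))
    (hQ : ∀ s', I (s.word m) s' → Q s') : Ok M (.loop r m c) s Q := by
  have key : ∀ k ≤ s.word m,
      I k ((iter (fun k s' => c.den (s'.setWord r k)) k s).setWord r (s.word r)) := by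
    intro k
    induction k with
    | zero => simpa [iter, setWord_word] using h0
    | succ k ih =>
      intro hk
      have := (step k (by omega) _ (ih (by omega))).2
      rwa [setWord_idem] at this
  refine ⟨fun k hk => ?_, hQ _ (key _ le_rfl)⟩
  have := (step k hk _ (key k hk.le)).1
  rwa [setWord_idem] at this

theorem mul (hb : 0 < s.word 8) (hbb : s.word 9 = s.word 8 * s.word 8)
    (hX : ∀ x < s.word 8 * s.word 8, s.wordArray 8 x < 2 ∧ s.wordArray 9 x < 2)
    (hQ : Q (setArr s 10
      (mulListing (s.word 8) (s.wordArray 8) (s.wordArray 9) (s.wordArray 10)))) :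
    Ok M .mul s Q := ⟨⟨hb, hbb, hX⟩, hQ⟩

end Ok

/-- The loop that stores `e` at the position `i` of word array `A`, for all values of the loop
variable, register `16`, below `word m`. -/
def fillAt (A m : ℕ) (i e : Expr) : Cmd := .loop 16 m (.store A i e)

/-- `fillAt` at the positions `0, …, word m - 1`. -/
def fill (A m : ℕ) (e : Expr) : Cmd := fillAt A m (.reg 16) e

/-- The `k`-th write puts the value `g k` at position `p k`. The expressions are evaluated when the
array has contents `f`, of which only the entries that are still to be written are known to be the
old ones; so an expression may read the entry that it replaces. -/
theorem Ok.fillAt {M A m : ℕ} {i e : Expr} {s : Memory} {Q : Memory → Prop} (p g : ℕ → ℕ)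
    (hp : ∀ k < s.word m, ∀ l < s.word m, p k = p l → k = l)
    (hi : ∀ k < s.word m, ∀ f : ℕ → ℕ, (∀ l, k ≤ l → l < s.word m → f (p l) = s.wordArray A (p l)) →
      i.eval ((setArr s A f).setWord 16 k) = p k)
    (he : ∀ k < s.word m, ∀ f : ℕ → ℕ, (∀ l, k ≤ l → l < s.word m → f (p l) = s.wordArray A (p l)) →
      e.eval ((setArr s A f).setWord 16 k) = g k)
    (hg : ∀ k < s.word m, g k < M)
    (hQ : ∀ f : ℕ → ℕ, (∀ k < s.word m, f (p k) = g k) →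
      (∀ y, (∀ k < s.word m, p k ≠ y) → f y = s.wordArray A y) → Q (setArr s A f)) :
    Ok M (fillAt A m i e) s Q := by
  refine Ok.loop (fun k s' => ∃ f : ℕ → ℕ, s' = setArr s A f ∧ (∀ j < k, f (p j) = g j) ∧
    ∀ y, (∀ j < k, p j ≠ y) → f y = s.wordArray A y)
    ⟨s.wordArray A, (setArr_self s A).symm, by simp, fun _ _ => rfl⟩ ?_ ?_
  · rintro k hk _ ⟨f, rfl, h1, h2⟩
    have hf : ∀ l, k ≤ l → l < s.word m → f (p l) = s.wordArray A (p l) := fun l hl hl' =>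
      h2 _ fun j hj e => by have := hp j (by omega) l hl' e; omega
    refine .store (by rw [he k hk f hf]; exact hg k hk) ?_
    rw [hi k hk f hf, he k hk f hf]
    refine ⟨Function.update f (p k) (g k), ?_, fun j hj => ?_, fun y hy => ?_⟩
    · simp only [setWord_setArr, setArr_idem, setWord_idem, setWord_word, wordArray_setArr, if_true]
    · by_cases hjk : p j = p k
      · rw [hjk, Function.update_self, hp j (by omega) k hk hjk]
      · rw [Function.update_of_ne hjk]
        refine h1 j ?_
        by_contra h
        obtain rfl : j = k := by omega
        exact hjk rfl
    · rw [Function.update_of_ne (hy k (by omega)).symm]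
      exact h2 y fun j hj => hy j (by omega)
  · rintro _ ⟨f, rfl, h1, h2⟩
    exact hQ f h1 h2

/-- The case of `Ok.fillAt` in which the `k`-th write goes to position `k`. -/
theorem Ok.fill {M A m : ℕ} {e : Expr} {s : Memory} {Q : Memory → Prop} (g : ℕ → ℕ)
    (he : ∀ k < s.word m, ∀ f : ℕ → ℕ, (∀ l, k ≤ l → l < s.word m → f l = s.wordArray A l) →
      e.eval ((setArr s A f).setWord 16 k) = g k)
    (hg : ∀ k < s.word m, g k < M)
    (hQ : Q (setArr s A fun x => if x < s.word m then g x else s.wordArray A x)) :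
    Ok M (fill A m e) s Q := by
  refine Ok.fillAt (fun k => k) g (fun _ _ _ _ h => h) ?_ he hg fun f h1 h2 => ?_
  · intro k hk f _
    simp [Expr.eval_reg, word_setWord]
  · convert hQ using 2
    funext x
    split_ifs with hx
    · exact h1 x hx
    · exact h2 x fun k hk e => hx (by omega)

/-! ### Static bounds for the cost -/

namespace Cmd

/-- The command does not assign to the registers below `16`, which bound its loops and sums. -/
def Frozen : Cmd → Bool
  | assign r _ => 16 ≤ r
  | ite _ c c' => c.Frozen && c'.Frozen
  | seq c c' => c.Frozen && c'.Frozen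
  | loop _ _ c => c.Frozen
  | _ => true

/-- The cost of a frozen command, computed from the contents `β` of the bounding registers. -/
def staticCost (κ β : ℕ → ℕ) : Cmd → ℕ
  | assign _ e => e.cost β + 2
  | store _ i e => i.cost β + e.cost β + 1
  | radd _ i _ j _ k => i.cost β + j.cost β + k.cost β + 4
  | ite e c c' => e.cost β + 2 + max (c.staticCost κ β) (c'.staticCost κ β)
  | seq c c' => c.staticCost κ β + c'.staticCost κ β
  | loop _ m c => β m * (c.staticCost κ β + 4) + 7
  | mul => κ (β 8)

theorem staticCost_congr {κ β γ : ℕ → ℕ} (h : ∀ m < 16, β m = γ m) :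
    ∀ c : Cmd, c.WF → c.staticCost κ β = c.staticCost κ γ
  | assign _ e, hc => by simp [WF] at hc; simp [staticCost, e.cost_congr h hc.2]
  | store _ i e, hc => by
    simp [WF] at hc; simp [staticCost, e.cost_congr h hc.2, i.cost_congr h hc.1.2]
  | radd _ i _ j _ k, hc => by
    simp [WF] at hc
    simp [staticCost, i.cost_congr h hc.1.1, j.cost_congr h hc.1.2, k.cost_congr h hc.2]
  | ite e c c', hc => by
    simp [WF] at hc
    simp [staticCost, e.cost_congr h hc.1.1, staticCost_congr h c hc.1.2,
      staticCost_congr h c' hc.2]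
  | seq c c', hc => by
    simp [WF] at hc
    simp [staticCost, staticCost_congr h c hc.1, staticCost_congr h c' hc.2]
  | loop _ m c, hc => by
    simp [WF] at hc
    simp [staticCost, staticCost_congr h c hc.2, h m hc.1.2]
  | mul, _ => by simp [staticCost, h 8 (by omega)]

/-- A frozen command does not change the bounds of its loops and sums, so its cost can be bounded
from their values at the start. -/
theorem cost_le_staticCost {κ : ℕ → ℕ} {c : Cmd} : ∀ {s : Memory}, c.WF → c.Frozen →
    (∀ m < 16, (c.den s).word m = s.word m) ∧ c.cost κ s ≤ c.staticCost κ s.word := by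
  induction c with
  | assign r e =>
    intro s hwf hf
    simp [Frozen] at hf
    exact ⟨fun m hm => by simp only [den, word_setWord]; rw [if_neg (by omega)], le_rfl⟩
  | store A i e => exact fun _ _ => ⟨fun _ _ => rfl, le_rfl⟩
  | radd A i B j C k => exact fun _ _ => ⟨fun _ _ => rfl, le_rfl⟩
  | ite e c c' ih ih' =>
    intro s hwf hf
    simp [Frozen] at hf
    simp [WF] at hwf
    have h1 := ih (s := s) hwf.1.2 hf.1
    have h2 := ih' (s := s) hwf.2 hf.2
    simp only [den, cost, staticCost]
    split_ifs
    · exact ⟨h1.1, by omega⟩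
    · exact ⟨h2.1, by omega⟩
  | seq c c' ih ih' =>
    intro s hwf hf
    simp [Frozen] at hf
    simp [WF] at hwf
    have h1 := ih (s := s) hwf.1 hf.1
    have h2 := ih' (s := c.den s) hwf.2 hf.2
    rw [staticCost_congr h1.1 c' hwf.2] at h2
    exact ⟨fun m hm => (h2.1 m hm).trans (h1.1 m hm), add_le_add h1.2 h2.2⟩
  | loop r m c ih =>
    intro s hwf hf
    simp [Frozen] at hf
    simp [WF] at hwf
    obtain ⟨⟨⟨hr, -⟩, hm⟩, hwf⟩ := hwf
    have key : ∀ k, ∀ j < 16,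
        (iter (fun k s' => c.den (s'.setWord r k)) k s).word j = s.word j := by
      intro k
      induction k with
      | zero => exact fun _ _ => rfl
      | succ k ihk =>
        intro j hj
        simp only [iter]
        rw [(ih hwf hf).1 j hj, word_setWord, if_neg (by omega), ihk j hj]
    refine ⟨fun j hj => ?_, ?_⟩
    · simp only [den, word_setWord]
      rw [if_neg (by omega), key _ j hj]
    · simp only [cost, staticCost]
      refine Nat.add_le_add_right (le_trans (Finset.sum_le_card_nsmul _ _
        (c.staticCost κ s.word + 4) fun k hk => ?_) (by simp)) _
      refine Nat.add_le_add_right (((ih hwf hf).2).trans_eq (staticCost_congr (fun j hj => ?_) c hwf)) _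
      rw [word_setWord, if_neg (by omega), key _ j hj]
  | mul => exact fun _ _ => ⟨fun _ _ => rfl, le_rfl⟩

end Cmd

/-- The order of growth of a bounding register: those which hold squares count twice. -/
def weight (m : ℕ) : ℕ := if m = 7 ∨ m = 9 ∨ m = 11 then 2 else 1

/-- The degree of the cost of an expression as a polynomial in the size of the problem. -/
def Expr.order : Expr → ℕ
  | const _ => 0
  | reg _ => 0
  | arr _ i => i.order
  | bin _ a b => max a.order b.order
  | lt a b => max a.order b.order
  | rlt _ i _ j => max i.order j.order
  | sum _ m e => weight m + e.order

/-- The degree of the cost of a command, apart from matrix multiplications. -/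
def Cmd.order : Cmd → ℕ
  | assign _ e => e.order
  | store _ i e => max i.order e.order
  | radd _ i _ j _ k => max i.order (max j.order k.order)
  | ite e c c' => max e.order (max c.order c'.order)
  | seq c c' => max c.order c'.order
  | loop _ m c => weight m + c.order
  | mul => 0

/-- The command contains no matrix multiplication. -/
def Cmd.MulFree : Cmd → Bool
  | ite _ c c' => c.MulFree && c'.MulFree
  | seq c c' => c.MulFree && c'.MulFree
  | loop _ _ c => c.MulFree
  | mul => false
  | _ => true

/-- If the bounding registers are of the order of `B`, or of its square where their weight is two,
then the cost is of the order `B ^ e.order`. -/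
theorem Expr.exists_cost_le (e : Expr) : ∃ K, ∀ (β : ℕ → ℕ) (B : ℕ), 1 ≤ B →
    (∀ m < 16, β m ≤ B ^ weight m) → e.WF → e.cost β ≤ K * B ^ e.order := by
  have mono : ∀ {K B o p : ℕ}, 1 ≤ B → o ≤ p → K * B ^ o ≤ K * B ^ p := fun hB h =>
    Nat.mul_le_mul_left _ (Nat.pow_le_pow_right hB h)
  have one : ∀ {B o : ℕ}, 1 ≤ B → 1 ≤ B ^ o := fun hB => Nat.one_le_pow _ _ hB
  induction e with
  | const c => exact ⟨1, fun β B hB h _ => by simp [cost, order]⟩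
  | reg c => exact ⟨2, fun β B hB h _ => by simp [cost, order]⟩
  | arr A i ih =>
    obtain ⟨K, hK⟩ := ih
    refine ⟨K + 1, fun β B hB h hwf => ?_⟩
    simp [WF] at hwf
    have := hK β B hB h hwf.2
    have := one (o := i.order) hB
    simp only [cost, order]
    nlinarith
  | bin op a b iha ihb =>
    obtain ⟨K, hK⟩ := iha
    obtain ⟨L, hL⟩ := ihb
    refine ⟨K + L + 1, fun β B hB h hwf => ?_⟩
    simp [WF] at hwf
    have h1 := (hK β B hB h hwf.1).trans (mono hB (le_max_left _ b.order))
    have h2 := (hL β B hB h hwf.2).trans (mono hB (le_max_right a.order _))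
    have := one (o := max a.order b.order) hB
    simp only [cost, order]
    nlinarith
  | lt a b iha ihb =>
    obtain ⟨K, hK⟩ := iha
    obtain ⟨L, hL⟩ := ihb
    refine ⟨K + L + 2, fun β B hB h hwf => ?_⟩
    simp [WF] at hwf
    have h1 := (hK β B hB h hwf.1).trans (mono hB (le_max_left _ b.order))
    have h2 := (hL β B hB h hwf.2).trans (mono hB (le_max_right a.order _))
    have := one (o := max a.order b.order) hB
    simp only [cost, order]
    nlinarith
  | rlt A a A' b iha ihb =>
    obtain ⟨K, hK⟩ := iha
    obtain ⟨L, hL⟩ := ihb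
    refine ⟨K + L + 4, fun β B hB h hwf => ?_⟩
    simp [WF] at hwf
    have h1 := (hK β B hB h hwf.1).trans (mono hB (le_max_left _ b.order))
    have h2 := (hL β B hB h hwf.2).trans (mono hB (le_max_right a.order _))
    have := one (o := max a.order b.order) hB
    simp only [cost, order]
    nlinarith
  | sum r m e ih =>
    obtain ⟨K, hK⟩ := ih
    refine ⟨K + 13, fun β B hB h hwf => ?_⟩
    simp [WF] at hwf
    have h1 := hK β B hB h hwf.2
    have h2 := one (o := e.order) hB
    have h3 := one (o := weight m) hB
    have h4 := h m hwf.1.2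
    simp only [cost, order, pow_add]
    calc β m * (e.cost β + 5) + 8 ≤ B ^ weight m * (K * B ^ e.order + 5 * B ^ e.order)
          + 8 * (B ^ weight m * B ^ e.order) := by
          gcongr
          · omega
          · nlinarith
      _ = _ := by ring

/-- The analogue of `Expr.exists_cost_le` for commands, with a constant that depends on the command
only. -/
theorem Cmd.exists_staticCost_le (c : Cmd) : ∃ K, ∀ (κ β : ℕ → ℕ) (B : ℕ), 1 ≤ B →
    (∀ m < 16, β m ≤ B ^ weight m) → c.WF → c.MulFree → c.staticCost κ β ≤ K * B ^ c.order := by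
  have mono : ∀ {K B o p : ℕ}, 1 ≤ B → o ≤ p → K * B ^ o ≤ K * B ^ p := fun hB h =>
    Nat.mul_le_mul_left _ (Nat.pow_le_pow_right hB h)
  have one : ∀ {B o : ℕ}, 1 ≤ B → 1 ≤ B ^ o := fun hB => Nat.one_le_pow _ _ hB
  induction c with
  | assign r e =>
    obtain ⟨K, hK⟩ := e.exists_cost_le
    refine ⟨K + 2, fun κ β B hB h hwf _ => ?_⟩
    simp [WF] at hwf
    have h1 := hK β B hB h hwf.2
    have := one (o := e.order) hB
    simp only [staticCost, order]
    nlinarith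
  | store A i e =>
    obtain ⟨K, hK⟩ := i.exists_cost_le
    obtain ⟨L, hL⟩ := e.exists_cost_le
    refine ⟨K + L + 1, fun κ β B hB h hwf _ => ?_⟩
    simp [WF] at hwf
    have h1 := (hK β B hB h hwf.1.2).trans (mono hB (le_max_left _ e.order))
    have h2 := (hL β B hB h hwf.2).trans (mono hB (le_max_right i.order _))
    have := one (o := max i.order e.order) hB
    simp only [staticCost, order]
    nlinarith
  | radd A i A' j A'' l =>
    obtain ⟨K, hK⟩ := i.exists_cost_le
    obtain ⟨L, hL⟩ := j.exists_cost_le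
    obtain ⟨N, hN⟩ := l.exists_cost_le
    refine ⟨K + L + N + 4, fun κ β B hB h hwf _ => ?_⟩
    simp [WF] at hwf
    simp only [staticCost, order]
    set p := max i.order (max j.order l.order)
    have h1 := (hK β B hB h hwf.1.1).trans (mono hB (show _ ≤ p by omega))
    have h2 := (hL β B hB h hwf.1.2).trans (mono hB (show _ ≤ p by omega))
    have h3 := (hN β B hB h hwf.2).trans (mono hB (show _ ≤ p by omega))
    have := one (o := p) hB
    nlinarith
  | ite e c c' ih ih' =>
    obtain ⟨K, hK⟩ := e.exists_cost_le
    obtain ⟨L, hL⟩ := ih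
    obtain ⟨N, hN⟩ := ih'
    refine ⟨K + L + N + 2, fun κ β B hB h hwf hm => ?_⟩
    simp [WF] at hwf
    simp [MulFree] at hm
    simp only [staticCost, order]
    set p := max e.order (max c.order c'.order)
    have h1 := (hK β B hB h hwf.1.1).trans (mono hB (show _ ≤ p by omega))
    have h2 := (hL κ β B hB h hwf.1.2 hm.1).trans (mono hB (show _ ≤ p by omega))
    have h3 := (hN κ β B hB h hwf.2 hm.2).trans (mono hB (show _ ≤ p by omega))
    have := one (o := p) hB
    have : max (c.staticCost κ β) (c'.staticCost κ β) ≤ c.staticCost κ β + c'.staticCost κ β := by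
      omega
    nlinarith
  | seq c c' ih ih' =>
    obtain ⟨L, hL⟩ := ih
    obtain ⟨N, hN⟩ := ih'
    refine ⟨L + N, fun κ β B hB h hwf hm => ?_⟩
    simp [WF] at hwf
    simp [MulFree] at hm
    simp only [staticCost, order]
    set p := max c.order c'.order
    have h2 := (hL κ β B hB h hwf.1 hm.1).trans (mono hB (show _ ≤ p by omega))
    have h3 := (hN κ β B hB h hwf.2 hm.2).trans (mono hB (show _ ≤ p by omega))
    nlinarith
  | loop r m c ih =>
    obtain ⟨K, hK⟩ := ih
    refine ⟨K + 11, fun κ β B hB h hwf hm => ?_⟩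
    simp [WF] at hwf
    have h1 := hK κ β B hB h hwf.2 hm
    have h2 := one (o := c.order) hB
    have h3 := one (o := weight m) hB
    have h4 := h m hwf.1.2
    simp only [staticCost, order, pow_add]
    calc β m * (c.staticCost κ β + 4) + 7 ≤ B ^ weight m * (K * B ^ c.order + 4 * B ^ c.order)
          + 7 * (B ^ weight m * B ^ c.order) := by
          gcongr
          · omega
          · nlinarith
      _ = _ := by ring
  | mul => exact ⟨0, fun κ β B hB h hwf hm => by simp [MulFree] at hm⟩

/-- `Ok` together with a bound for the cost. -/
def Spec (M : ℕ) (κ : ℕ → ℕ) (c : Cmd) (s : Memory) (T : ℕ) (Q : Memory → Prop) : Prop :=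
  c.Safe M s ∧ c.cost κ s ≤ T ∧ Q (c.den s)

namespace Spec

variable {M T T' : ℕ} {κ : ℕ → ℕ} {c c' : Cmd} {s : Memory} {Q Q' : Memory → Prop}

theorem of_ok (h : Ok M c s Q) (hwf : c.WF) (hf : c.Frozen)
    (hT : c.staticCost κ s.word ≤ T) : Spec M κ c s T Q :=
  ⟨h.1, (Cmd.cost_le_staticCost hwf hf).2.trans hT, h.2⟩

theorem mono (h : Spec M κ c s T Q) (hT : T ≤ T') (h' : ∀ s', Q s' → Q' s') :
    Spec M κ c s T' Q' := ⟨h.1, h.2.1.trans hT, h' _ h.2.2⟩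

theorem assign {r : ℕ} {e : Expr} (h : e.eval s < M) (hQ : Q (s.setWord r (e.eval s))) :
    Spec M κ (.assign r e) s (e.cost s.word + 2) Q := ⟨h, le_rfl, hQ⟩

theorem seq (h : Spec M κ c s T fun s' => Spec M κ c' s' T' Q) :
    Spec M κ (.seq c c') s (T + T') Q :=
  ⟨⟨h.1, h.2.2.1⟩, add_le_add h.2.1 h.2.2.2.1, h.2.2.2.2⟩

theorem loop {r m : ℕ} (I : ℕ → Memory → Prop) (f : ℕ → ℕ) (h0 : I 0 s)
    (step : ∀ k < s.word m, ∀ s', I k s' →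
      Spec M κ c (s'.setWord r k) (f k) fun s'' => I (k + 1) (s''.setWord r (s.word r)))
    (hQ : ∀ s', I (s.word m) s' → Q s') :
    Spec M κ (.loop r m c) s (∑ k ∈ Finset.range (s.word m), (f k + 4) + 7) Q := by
  have key : ∀ k ≤ s.word m,
      I k ((iter (fun k s' => c.den (s'.setWord r k)) k s).setWord r (s.word r)) := by
    intro k
    induction k with
    | zero => simpa [iter, setWord_word] using h0
    | succ k ih =>
      intro hk
      have := (step k (by omega) _ (ih (by omega))).2.2
      rwa [setWord_idem] at this
  refine ⟨fun k hk => ?_, ?_, hQ _ (key _ le_rfl)⟩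
  · have := (step k hk _ (key k hk.le)).1
    rwa [setWord_idem] at this
  · simp only [Cmd.cost]
    refine Nat.add_le_add_right (Finset.sum_le_sum fun k hk => ?_) _
    rw [Finset.mem_range] at hk
    have := (step k hk _ (key k hk.le)).2.1
    rw [setWord_idem] at this
    omega

end Spec

end RAM

/-! ### Gauss–Jordan elimination over the field with two elements -/

namespace Elimination

/-- The vector space of the columns; rows are numbered by the natural numbers. -/
abbrev Vec : Type := ℕ → ZMod 2

/-- The map `x ↦ x + ∑ x (p k) • w k`, where `k` runs over `a, …, b - 1`. -/
noncomputable def act (w : ℕ → Vec) (p : ℕ → ℕ) (a b : ℕ) : Vec →ₗ[ZMod 2] Vec :=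
  LinearMap.id + ∑ k ∈ Finset.Ico a b, (LinearMap.proj (p k)).smulRight (w k)

theorem act_apply (w : ℕ → Vec) (p : ℕ → ℕ) (a b : ℕ) (x : Vec) :
    act w p a b x = x + ∑ k ∈ Finset.Ico a b, x (p k) • w k := by
  simp [act, LinearMap.sum_apply]

/-- The composition of the elementary maps `act w p k (k + 1)` for `k = a, …, a + n - 1`. -/
noncomputable def comp (w : ℕ → Vec) (p : ℕ → ℕ) (a : ℕ) : ℕ → Vec →ₗ[ZMod 2] Vec
  | 0 => LinearMap.id
  | n + 1 => (act w p (a + n) (a + n + 1)).comp (comp w p a n)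

theorem act_congr {w w' : ℕ → Vec} {p p' : ℕ → ℕ} {a b : ℕ}
    (h : ∀ k, a ≤ k → k < b → w k = w' k ∧ p k = p' k) : act w p a b = act w' p' a b := by
  ext1 x
  rw [act_apply, act_apply]
  congr 1
  refine Finset.sum_congr rfl fun k hk => ?_
  rw [Finset.mem_Ico] at hk
  rw [(h k hk.1 hk.2).1, (h k hk.1 hk.2).2]

theorem comp_congr {w w' : ℕ → Vec} {p p' : ℕ → ℕ} {a n : ℕ}
    (h : ∀ k, a ≤ k → k < a + n → w k = w' k ∧ p k = p' k) : comp w p a n = comp w' p' a n := by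
  induction n with
  | zero => rfl
  | succ n ih =>
    rw [comp, comp, ih fun k h1 h2 => h k h1 (by omega),
      act_congr fun k h1 h2 => h k (by omega) (by omega)]

theorem comp_add (w : ℕ → Vec) (p : ℕ → ℕ) (a m n : ℕ) :
    comp w p a (m + n) = (comp w p (a + m) n).comp (comp w p a m) := by
  induction n with
  | zero => rfl
  | succ n ih =>
    rw [← add_assoc, comp, ih, comp, LinearMap.comp_assoc]
    simp only [add_assoc]

/-- Two adjacent blocks are merged by applying the map of the second one to the vectors of the
first one. -/
theorem act_merge {w w' : ℕ → Vec} {p : ℕ → ℕ} {a b c : ℕ} (hab : a ≤ b) (hbc : b ≤ c)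
    (h1 : ∀ k, a ≤ k → k < b → w' k = act w p b c (w k)) (h2 : ∀ k, b ≤ k → k < c → w' k = w k) :
    act w' p a c = (act w p b c).comp (act w p a b) := by
  ext1 x
  rw [LinearMap.comp_apply, act_apply w p a b, map_add, map_sum, act_apply w p b c x, act_apply,
    ← Finset.sum_Ico_consecutive _ hab hbc, add_assoc, add_comm (∑ k ∈ Finset.Ico a b, _)]
  congr 2
  · refine Finset.sum_congr rfl fun k hk => ?_
    rw [Finset.mem_Ico] at hk
    rw [h2 k hk.1 hk.2]
  · refine Finset.sum_congr rfl fun k hk => ?_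
    rw [Finset.mem_Ico] at hk
    rw [map_smul, h1 k hk.1 hk.2]

/-- The vector of the elementary map of column `k`, whose value is `c k` when it is processed: for
a pivot column, the map sends `c k` to the unit vector of its pivot row `p k`. -/
noncomputable def elementary (c : ℕ → Vec) (p : ℕ → ℕ) (q : ℕ → Prop) (k : ℕ) : Vec :=
  open Classical in if q k then c k + Pi.single (p k) 1 else 0

/-- The result of eliminating the first `N` columns of the matrix `m`: when column `k` is
processed, it has the value `c k`; it is a pivot column, with pivot row `p k`, if `q k` holds, and
vanishes outside the rows of the earlier pivots otherwise. -/
structure IsElimination (N : ℕ) (m c : ℕ → Vec) (p : ℕ → ℕ) (q : ℕ → Prop) : Prop where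
  eq_comp : ∀ k < N, c k = comp (elementary c p q) p 0 k (m k)
  pivot : ∀ k < N, q k → c k (p k) = 1 ∧ ∀ k' < k, q k' → p k' ≠ p k
  zero : ∀ k < N, ¬ q k → ∀ i, c k i ≠ 0 → ∃ k' < k, q k' ∧ p k' = i

namespace IsElimination

variable {N : ℕ} {m c : ℕ → Vec} {p : ℕ → ℕ} {q : ℕ → Prop}

theorem zmod_two_add_self (x : Vec) : x + x = 0 := CharTwo.add_self_eq_zero x

theorem elementary_apply (h : IsElimination N m c p q) {k : ℕ} (hk : k < N) :
    elementary c p q k (p k) = 0 := by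
  unfold elementary
  split_ifs with hq
  · simp [(h.pivot k hk hq).1, CharTwo.add_self_eq_zero]
  · rfl

/-- Every elementary map is an involution. -/
theorem act_act (h : IsElimination N m c p q) {k : ℕ} (hk : k < N) (x : Vec) :
    act (elementary c p q) p k (k + 1) (act (elementary c p q) p k (k + 1) x) = x := by
  simp only [act_apply, Nat.Ico_succ_singleton, Finset.sum_singleton, Pi.add_apply, Pi.smul_apply,
    h.elementary_apply hk, smul_zero, add_zero, add_assoc, zmod_two_add_self]

theorem comp_injective (h : IsElimination N m c p q) {n : ℕ} (hn : n ≤ N) :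
    Function.Injective (comp (elementary c p q) p 0 n) := by
  induction n with
  | zero => exact fun _ _ h => h
  | succ n ih =>
    intro x y hxy
    simp only [comp, LinearMap.comp_apply, zero_add] at hxy
    apply ih (by omega)
    have := congrArg (act (elementary c p q) p n (n + 1)) hxy
    rwa [h.act_act (by omega), h.act_act (by omega)] at this

/-- A vector that vanishes at the pivot rows is fixed by the later elementary maps. -/
theorem comp_eq_self {n k : ℕ} (x : Vec)
    (hx : ∀ k', n ≤ k' → k' < n + k → q k' → x (p k') = 0) :
    comp (elementary c p q) p n k x = x := by
  induction k with
  | zero => rfl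
  | succ k ih =>
    rw [comp, LinearMap.comp_apply, ih fun k' h1 h2 h3 => hx k' h1 (by omega) h3, act_apply,
      Nat.Ico_succ_singleton, Finset.sum_singleton]
    by_cases hq : q (n + k)
    · rw [hx _ (by omega) (by omega) hq, zero_smul, add_zero]
    · simp [elementary, hq]

/-- A pivot column becomes the unit vector of its pivot row, and keeps this value. -/
theorem comp_pivot (h : IsElimination N m c p q) {k n : ℕ} (hk : k < n) (hn : n ≤ N) (hq : q k) :
    comp (elementary c p q) p 0 n (m k) = Pi.single (p k) 1 := by
  obtain ⟨l, rfl⟩ := Nat.exists_eq_add_of_lt hk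
  rw [show k + l + 1 = (k + 1) + l by ring, comp_add, LinearMap.comp_apply, comp,
    LinearMap.comp_apply, ← h.eq_comp k (by omega)]
  simp only [zero_add]
  rw [act_apply, Nat.Ico_succ_singleton, Finset.sum_singleton, (h.pivot k (by omega) hq).1, one_smul]
  rw [show c k + elementary c p q k = Pi.single (p k) 1 by
    rw [elementary, if_pos hq, ← add_assoc, zmod_two_add_self, zero_add]]
  refine comp_eq_self _ fun k' h1 h2 h3 => ?_
  rw [Pi.single_eq_of_ne]
  exact ((h.pivot k' (by omega) h3).2 k (by omega) hq).symm

/-- A column which is no pivot column is not changed by the later maps, as it vanishes in the later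
pivot rows. -/
theorem comp_nonpivot (h : IsElimination N m c p q) {k n : ℕ} (hk : k ≤ n) (hn : n ≤ N)
    (hkN : k < N) (hq : ¬ q k) : comp (elementary c p q) p 0 n (m k) = c k := by
  obtain ⟨l, rfl⟩ := Nat.exists_eq_add_of_le hk
  rw [comp_add, LinearMap.comp_apply, ← h.eq_comp k hkN, zero_add]
  refine comp_eq_self _ fun k' h1 h2 h3 => ?_
  by_contra hne
  obtain ⟨k'', h4, h5, h6⟩ := h.zero k hkN hq _ hne
  exact (h.pivot k' (by omega) h3).2 k'' (by omega) h5 h6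

/-- A column which is not a pivot column is the combination of the earlier pivot columns that its
reduced form describes. -/
theorem eq_sum (h : IsElimination N m c p q) {j : ℕ} (hj : j < N) (hq : ¬ q j) :
    m j = ∑ k ∈ Finset.range j, (open Classical in if q k then c j (p k) else 0) • m k := by
  classical
  apply h.comp_injective hj.le
  rw [h.comp_nonpivot le_rfl hj.le hj hq, map_sum]
  have h1 : ∀ k ∈ Finset.range j,
      comp (elementary c p q) p 0 j ((if q k then c j (p k) else 0) • m k)
        = if q k then (c j (p k)) • Pi.single (p k) 1 else 0 := by
    intro k hk
    rw [Finset.mem_range] at hk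
    rw [map_smul]
    split_ifs with hqk
    · rw [h.comp_pivot hk hj.le hqk]
    · rw [zero_smul]
  rw [Finset.sum_congr rfl h1]
  funext i
  rw [Finset.sum_apply]
  by_cases hi : ∃ k' < j, q k' ∧ p k' = i
  · obtain ⟨k', h2, h3, rfl⟩ := hi
    rw [Finset.sum_eq_single k']
    · simp [h3]
    · intro k hk hne
      rw [Finset.mem_range] at hk
      split_ifs with hqk
      · have : p k ≠ p k' := by
          rcases lt_or_gt_of_ne hne with hlt | hlt
          · exact (h.pivot k' (by omega) h3).2 k hlt hqk
          · exact ((h.pivot k (by omega) hqk).2 k' hlt h3).symm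
        simp [Pi.single_eq_of_ne this.symm]
      · rfl
    · intro hk
      simp at hk
      omega
  · have : c j i = 0 := by
      by_contra hne
      exact hi (h.zero j hj hq i hne)
    rw [this]
    symm
    refine Finset.sum_eq_zero fun k hk => ?_
    rw [Finset.mem_range] at hk
    split_ifs with hqk
    · have : i ≠ p k := fun e => hi ⟨k, hk, hqk, e.symm⟩
      simp [Pi.single_eq_of_ne this]
    · rfl

/-- A pivot column is not a combination of the earlier columns. -/
theorem notMem_span (h : IsElimination N m c p q) {j : ℕ} (hj : j < N) (hq : q j) :
    m j ∉ Submodule.span (ZMod 2) (m '' Set.Iio j) := by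
  intro hmem
  -- the linear form that reads the pivot row after the first `j` steps separates them
  have : m j ∈ LinearMap.ker
      ((LinearMap.proj (p j) : Vec →ₗ[ZMod 2] ZMod 2).comp (comp (elementary c p q) p 0 j)) := by
    refine Submodule.span_le.2 ?_ hmem
    rintro _ ⟨k, hk, rfl⟩
    rw [Set.mem_Iio] at hk
    simp only [SetLike.mem_coe, LinearMap.mem_ker, LinearMap.comp_apply, LinearMap.proj_apply]
    by_cases hqk : q k
    · rw [h.comp_pivot hk hj.le hqk, Pi.single_eq_of_ne]
      exact ((h.pivot j hj hq).2 k hk hqk).symm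
    · rw [h.comp_nonpivot hk.le hj.le (by omega) hqk]
      by_contra hne
      obtain ⟨k', h1, h2, h3⟩ := h.zero k (by omega) hqk _ hne
      exact (h.pivot j hj hq).2 k' (by omega) h2 h3
  simp only [LinearMap.mem_ker, LinearMap.comp_apply, LinearMap.proj_apply,
    ← h.eq_comp j hj, (h.pivot j hj hq).1] at this
  exact one_ne_zero this

/-- The pivot columns among the first `j` columns span the same space as these columns. -/
theorem mem_span (h : IsElimination N m c p q) {j : ℕ} (hj : j < N) :
    m j ∈ Submodule.span (ZMod 2) (m '' {k | k ≤ j ∧ q k}) := by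
  induction j using Nat.strong_induction_on with
  | _ j ih =>
    by_cases hq : q j
    · exact Submodule.subset_span ⟨j, ⟨le_rfl, hq⟩, rfl⟩
    · rw [h.eq_sum hj hq]
      refine Submodule.sum_mem _ fun k hk => Submodule.smul_mem _ _ ?_
      rw [Finset.mem_range] at hk
      exact Submodule.span_mono (Set.image_mono (s := {i | i ≤ k ∧ q i})
        (t := {i | i ≤ j ∧ q i}) fun i hi => ⟨hi.1.trans hk.le, hi.2⟩)
        (ih k hk (by omega))

end IsElimination

end Elimination

namespace RAM

/-! ### What a command leaves unchanged -/

/-- The registers to which a command assigns, apart from its loop variables. -/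
def Cmd.assigns (x : ℕ) : Cmd → Bool
  | assign r _ => r == x
  | ite _ c c' => c.assigns x || c'.assigns x
  | seq c c' => c.assigns x || c'.assigns x
  | loop _ _ c => c.assigns x
  | _ => false

/-- The word arrays to which a command writes. -/
def Cmd.stores (x : ℕ) : Cmd → Bool
  | store A _ _ => A == x
  | ite _ c c' => c.stores x || c'.stores x
  | seq c c' => c.stores x || c'.stores x
  | loop _ _ c => c.stores x
  | mul => x == 10
  | _ => false

/-- The real arrays to which a command writes. -/
def Cmd.rstores (x : ℕ) : Cmd → Bool
  | radd A _ _ _ _ _ => A == x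
  | ite _ c c' => c.rstores x || c'.rstores x
  | seq c c' => c.rstores x || c'.rstores x
  | loop _ _ c => c.rstores x
  | _ => false

/-- The memory `s'` agrees with `s` wherever the command `c` does not write. -/
structure Cmd.Fixes (c : Cmd) (s s' : Memory) : Prop where
  word : ∀ r, c.assigns r = false → s'.word r = s.word r
  arr : ∀ A, c.stores A = false → s'.wordArray A = s.wordArray A
  rarr : ∀ A, c.rstores A = false → s'.realArray A = s.realArray A

theorem Cmd.Fixes.refl (c : Cmd) (s : Memory) : c.Fixes s s :=
  ⟨fun _ _ => rfl, fun _ _ => rfl, fun _ _ => rfl⟩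

/-- A loop restores its counter at the end, so the registers in question are only those to which the
command assigns outside of loop headers. -/
theorem Cmd.fixes_den (c : Cmd) : ∀ s, c.Fixes s (c.den s) := by
  induction c with
  | assign r e =>
    refine fun s => ⟨fun x hx => ?_, fun _ _ => rfl, fun _ _ => rfl⟩
    simp only [assigns, beq_eq_false_iff_ne] at hx
    simp [den, Ne.symm hx]
  | store A i e =>
    refine fun s => ⟨fun _ _ => rfl, fun x hx => ?_, fun _ _ => rfl⟩
    simp only [stores, beq_eq_false_iff_ne] at hx
    simp [den, setWordArray_eq, Ne.symm hx]
  | radd A i B j C k =>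
    refine fun s => ⟨fun _ _ => rfl, fun _ _ => rfl, fun x hx => ?_⟩
    simp only [rstores, beq_eq_false_iff_ne] at hx
    simp [den, setRealArray_eq, Ne.symm hx]
  | ite e c c' ih ih' =>
    intro s
    have h1 := ih s
    have h2 := ih' s
    refine ⟨fun x hx => ?_, fun x hx => ?_, fun x hx => ?_⟩ <;>
    simp only [assigns, stores, rstores, Bool.or_eq_false_iff] at hx <;>
    simp only [den] <;> split_ifs
    exacts [h1.1 x hx.1, h2.1 x hx.2, h1.2 x hx.1, h2.2 x hx.2, h1.3 x hx.1, h2.3 x hx.2]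
  | seq c c' ih ih' =>
    intro s
    have h1 := ih s
    have h2 := ih' (c.den s)
    refine ⟨fun x hx => ?_, fun x hx => ?_, fun x hx => ?_⟩ <;>
    simp only [assigns, stores, rstores, Bool.or_eq_false_iff] at hx
    exacts [(h2.1 x hx.2).trans (h1.1 x hx.1), (h2.2 x hx.2).trans (h1.2 x hx.1),
      (h2.3 x hx.2).trans (h1.3 x hx.1)]
  | loop r m c ih =>
    intro s
    have key : ∀ k, c.Fixes s ((iter (fun k s' => c.den (s'.setWord r k)) k s).setWord r
        (s.word r)) := by
      intro k
      induction k with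
      | zero => simpa [iter] using Fixes.refl c s
      | succ k ihk =>
        have h := ih ((iter (fun k s' => c.den (s'.setWord r k)) k s).setWord r k)
        refine ⟨fun x hx => ?_, fun x hx => (h.2 x hx).trans (ihk.2 x hx),
          fun x hx => (h.3 x hx).trans (ihk.3 x hx)⟩
        have h1 := h.1 x hx
        have h2 := ihk.1 x hx
        simp only [word_setWord] at h1 h2 ⊢
        split_ifs with hxr
        · rw [hxr]
        · rw [if_neg hxr] at h1 h2
          exact h1.trans h2
    exact ⟨(key _).1, (key _).2, (key _).3⟩
  | mul =>
    refine fun s => ⟨fun _ _ => rfl, fun x hx => ?_, fun _ _ => rfl⟩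
    simp only [stores, beq_eq_false_iff_ne] at hx
    simp [den, hx]

section Rules

variable {M T T' : ℕ} {κ : ℕ → ℕ} {c c' : Cmd} {s : Memory} {Q Q' : Memory → Prop}

theorem Ok.fixes (h : Ok M c s Q) : Ok M c s fun s' => c.Fixes s s' ∧ Q s' :=
  ⟨h.1, c.fixes_den s, h.2⟩

theorem Spec.fixes (h : Spec M κ c s T Q) : Spec M κ c s T fun s' => c.Fixes s s' ∧ Q s' :=
  ⟨h.1, h.2.1, c.fixes_den s, h.2.2⟩

theorem Ok.then (h : Ok M c s Q) (h' : ∀ s', c.Fixes s s' → Q s' → Ok M c' s' Q') :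
    Ok M (.seq c c') s Q' := .seq (h.fixes.mono fun s' h1 => h' s' h1.1 h1.2)

theorem Spec.then (h : Spec M κ c s T Q) (h' : ∀ s', c.Fixes s s' → Q s' → Spec M κ c' s' T' Q') :
    Spec M κ (.seq c c') s (T + T') Q' := .seq (h.fixes.mono le_rfl fun s' h1 => h' s' h1.1 h1.2)

theorem Cmd.Fixes.setWord_of_setWord {s s' s'' : Memory} {r k : ℕ} (h : c.Fixes s s')
    (h' : c.Fixes (s'.setWord r k) s'') : c.Fixes s (s''.setWord r (s.word r)) := by
  refine ⟨fun x hx => ?_, fun x hx => (h'.2 x hx).trans (h.2 x hx),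
    fun x hx => (h'.3 x hx).trans (h.3 x hx)⟩
  have h1 := h'.1 x hx
  have h2 := h.1 x hx
  simp only [word_setWord] at h1 h2 ⊢
  split_ifs with hxr
  · rw [hxr]
  · rw [if_neg hxr] at h1
    exact h1.trans h2

/-- The rule for loops, with the invariant that everything is unchanged which the body fixes. -/
theorem Ok.loop' {r m : ℕ} (I : ℕ → Memory → Prop) (h0 : I 0 s)
    (step : ∀ k < s.word m, ∀ s', c.Fixes s s' → I k s' →
      Ok M c (s'.setWord r k) fun s'' => I (k + 1) (s''.setWord r (s.word r)))
    (hQ : ∀ s', c.Fixes s s' → I (s.word m) s' → Q s') : Ok M (.loop r m c) s Q :=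
  Ok.loop (fun k s' => c.Fixes s s' ∧ I k s') ⟨.refl c s, h0⟩
    (fun k hk s' h => (step k hk s' h.1 h.2).fixes.mono fun _ h1 =>
      ⟨h.1.setWord_of_setWord h1.1, h1.2⟩) fun s' h => hQ s' h.1 h.2

/-- The analogue of `Ok.loop'` with costs. -/
theorem Spec.loop' {r m : ℕ} (I : ℕ → Memory → Prop) (f : ℕ → ℕ) (h0 : I 0 s)
    (step : ∀ k < s.word m, ∀ s', c.Fixes s s' → I k s' →
      Spec M κ c (s'.setWord r k) (f k) fun s'' => I (k + 1) (s''.setWord r (s.word r)))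
    (hQ : ∀ s', c.Fixes s s' → I (s.word m) s' → Q s') :
    Spec M κ (.loop r m c) s (∑ k ∈ Finset.range (s.word m), (f k + 4) + 7) Q :=
  Spec.loop (fun k s' => c.Fixes s s' ∧ I k s') f ⟨.refl c s, h0⟩
    (fun k hk s' h => (step k hk s' h.1 h.2).fixes.mono le_rfl fun _ h1 =>
      ⟨h.1.setWord_of_setWord h1.1, h1.2⟩) fun s' h => hQ s' h.1 h.2

end Rules

/-! ### The elimination program -/

section Program

open RAM.Expr

/-- With a block of columns of word array `4` and the corresponding pivot rows in word array `5`,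
apply the map `Elimination.act` to a block of columns of word array `D`, in one group of rows.
Register `8` holds the size of the blocks, the registers `21` and `22` their first columns,
register `32` the number of the group, and word array `9` the pivot rows of the second block. -/
def applyRows (D : ℕ) : Cmd :=
  .seq (fill 8 9 (arr 4 ((reg 32 * reg 8 + reg 16 / reg 8) * reg 3 +
    (reg 21 + mod (reg 16) (reg 8))))) <|
  .seq .mul <|
  fillAt D 9 ((reg 32 * reg 8 + reg 16 / reg 8) * reg 3 + (reg 22 + mod (reg 16) (reg 8)))
    (mod (arr D ((reg 32 * reg 8 + reg 16 / reg 8) * reg 3 + (reg 22 + mod (reg 16) (reg 8))) +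
      arr 10 (reg 16)) (const 2))

/-- The command `applyRows` for all groups of rows. -/
def applyBlock (D : ℕ) : Cmd :=
  .seq (fill 9 9 (arr D (arr 5 (reg 21 + reg 16 / reg 8) * reg 3 +
    (reg 22 + mod (reg 16) (reg 8))))) <|
  .loop 32 10 (applyRows D)

end Program

theorem div_idx {S j : ℕ} (i : ℕ) (h : j < S) : (i * S + j) / S = i := by
  rw [mul_comm, Nat.mul_add_div (by omega), Nat.div_eq_of_lt h, add_zero]

theorem mod_idx {S j : ℕ} (i : ℕ) (h : j < S) : (i * S + j) % S = j := by
  rw [mul_comm, Nat.mul_add_mod, Nat.mod_eq_of_lt h]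

theorem div_lt_of_lt_sq {b t : ℕ} (h : t < b * b) : t / b < b := Nat.div_lt_of_lt_mul h

/-- The listing of an `S × S` matrix after `Elimination.act` has been applied to the columns
`y, …, y + b - 1` in the rows below `N`. -/
def blockUpdate (S b x y : ℕ) (P W D : ℕ → ℕ) (N z : ℕ) : ℕ :=
  if y ≤ z % S ∧ z % S < y + b ∧ z / S < N then
    (D z + ∑ u ∈ Finset.range b, W (z / S * S + (x + u)) * D (P (x + u) * S + z % S)) % 2
  else D z

theorem blockUpdate_zero (S b x y : ℕ) (P W D : ℕ → ℕ) : blockUpdate S b x y P W D 0 = D := by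
  funext z
  simp [blockUpdate]

theorem blockUpdate_of_le {S b x y i j N : ℕ} {P W D : ℕ → ℕ} (hj : j < S) (hi : N ≤ i) :
    blockUpdate S b x y P W D N (i * S + j) = D (i * S + j) := by
  rw [blockUpdate, if_neg]
  rw [div_idx _ hj]
  omega

theorem blockUpdate_of_col {S b x y i j N : ℕ} {P W D : ℕ → ℕ} (hj : j < S)
    (h : j < y ∨ y + b ≤ j) : blockUpdate S b x y P W D N (i * S + j) = D (i * S + j) := by
  rw [blockUpdate, if_neg]
  rw [mod_idx _ hj]
  omega

theorem blockUpdate_of_lt {S b x y i j N : ℕ} {P W D : ℕ → ℕ} (hj : y + j < S) (hjb : j < b)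
    (hi : i < N) : blockUpdate S b x y P W D N (i * S + (y + j)) = (D (i * S + (y + j)) +
      ∑ u ∈ Finset.range b, W (i * S + (x + u)) * D (P (x + u) * S + (y + j))) % 2 := by
  rw [blockUpdate, if_pos]
  · rw [div_idx _ hj, mod_idx _ hj]
  · rw [div_idx _ hj, mod_idx _ hj]
    omega

/-- The positions of the entries of a block are distinct. -/
theorem idx_injective {S b c y t t' : ℕ} (hb : 0 < b) (hy : y + b ≤ S)
    (h : (c * b + t / b) * S + (y + t % b) = (c * b + t' / b) * S + (y + t' % b)) : t = t' := by
  have h1 := Nat.mod_lt t hb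
  have h2 := Nat.mod_lt t' hb
  have h3 : c * b + t / b = c * b + t' / b := by
    rw [← div_idx (c * b + t / b) (show y + t % b < S by omega), h, div_idx _ (by omega)]
  have h4 : y + t % b = y + t' % b := by
    rw [← mod_idx (c * b + t / b) (show y + t % b < S by omega), h, mod_idx _ (by omega)]
  rw [← Nat.div_add_mod t b, ← Nat.div_add_mod t' b, Nat.add_left_cancel h3,
    Nat.add_left_cancel h4]

/-- One group of rows of a block update. -/
theorem applyRows_ok {M D S b x y c : ℕ} {s : Memory} {D₀ W : ℕ → ℕ} (hM : 2 ≤ M)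
    (hD : D = 3 ∨ D = 4) (hS : s.word 3 = S) (hb : s.word 8 = b) (hbb : s.word 9 = b * b)
    (hc : s.word 32 = c) (hx : s.word 21 = x) (hy : s.word 22 = y) (hb0 : 0 < b)
    (hcS : c * b + b ≤ S) (hxS : x + b ≤ S) (hyS : y + b ≤ S)
    (hW : ∀ i < S, ∀ j < b, s.wordArray 4 (i * S + (x + j)) = W (i * S + (x + j)))
    (hWb : ∀ i < S, ∀ j < S, W (i * S + j) < 2)
    (hDb : ∀ i < S, ∀ j < S, D₀ (i * S + j) < 2)
    (hP : ∀ u < b, s.wordArray 5 (x + u) < S)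
    (h9 : ∀ t < b * b, s.wordArray 9 t = D₀ (s.wordArray 5 (x + t / b) * S + (y + t % b)))
    (hs : s.wordArray D = blockUpdate S b x y (s.wordArray 5) W D₀ (c * b)) :
    Ok M (applyRows D) s fun s' =>
      s'.wordArray D = blockUpdate S b x y (s.wordArray 5) W D₀ (c * b + b) := by
  set G := blockUpdate S b x y (s.wordArray 5) W D₀ with hG
  have hrow : ∀ t < b * b, c * b + t / b < S := by
    intro t ht
    have := div_lt_of_lt_sq ht
    omega
  have hcol : ∀ t, y + t % b < S := fun t => by have := Nat.mod_lt t hb0; omega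
  have hcol' : ∀ t, x + t % b < S := fun t => by have := Nat.mod_lt t hb0; omega
  refine Ok.seq (Ok.fill (fun t => W ((c * b + t / b) * S + (x + t % b))) ?_ ?_ ?_)
  · intro k hk f _
    rw [hbb] at hk
    rw [← hW _ (hrow k hk) _ (Nat.mod_lt k hb0)]
    simp [hS, hb, hx, hc]
  · intro k hk
    rw [hbb] at hk
    exact (hWb _ (hrow k hk) _ (hcol' k)).trans_le hM
  refine Ok.seq (Ok.mul ?_ ?_ ?_ ?_)
  · simpa [hb] using hb0
  · simp [hb, hbb]
  · intro t ht
    have ht' : t < b * b := by simpa [hb] using ht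
    have h1 := hDb _ (hP _ (div_lt_of_lt_sq ht')) _ (hcol t)
    rw [← h9 t ht'] at h1
    simp [hbb, ht', hWb _ (hrow t ht') _ (hcol' t), h1]
  refine Ok.fillAt (fun t => (c * b + t / b) * S + (y + t % b))
    (fun t => G (c * b + b) ((c * b + t / b) * S + (y + t % b))) ?_ ?_ ?_ ?_ ?_
  · exact fun t _ t' _ h => idx_injective hb0 hyS h
  · intro k hk f _
    simp [hS, hb, hy, hc]
  · intro k hk f hf
    have hk' : k < b * b := by simpa [hbb] using hk
    have h1 := Nat.mod_lt k hb0
    have h2 := div_lt_of_lt_sq hk'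
    have hDG : f ((c * b + k / b) * S + (y + k % b))
        = D₀ ((c * b + k / b) * S + (y + k % b)) := by
      have h3 := hf k le_rfl hk
      have h4 : D ≠ 10 ∧ D ≠ 8 := by omega
      simp only [wordArray_setArr, h4, if_false, hs] at h3
      rw [h3, hG, blockUpdate_of_le (hcol k) (Nat.le_add_right _ _)]
    have hZ : ∀ i < b, (if k / b * b + i < b * b then
        W ((c * b + (k / b * b + i) / b) * S + (x + (k / b * b + i) % b)) else
        s.wordArray 8 (k / b * b + i)) * s.wordArray 9 (i * b + k % b)
        = W ((c * b + k / b) * S + (x + i)) *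
          D₀ (s.wordArray 5 (x + i) * S + (y + k % b)) := by
      intro i hi
      have h3 : k / b * b + i < b * b := by nlinarith
      have h4 : i * b + k % b < b * b := by nlinarith
      rw [h9 _ h4]
      simp only [h3, if_true, div_idx _ hi, mod_idx _ hi, div_idx _ h1, mod_idx _ h1]
    have hZ' := Finset.sum_congr rfl fun i hi => hZ i (Finset.mem_range.1 hi)
    rw [hG, blockUpdate_of_lt (hcol k) h1 (by omega), ← hZ']
    rcases hD with rfl | rfl <;>
    · simp [hS, hb, hy, hbb, hc, mulListing, hk', hDG]
  · intro k hk
    have hk' : k < b * b := by simpa [hbb] using hk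
    have h1 := Nat.mod_lt k hb0
    rw [hG, blockUpdate_of_lt (hcol k) h1 (by have := div_lt_of_lt_sq hk'; omega)]
    exact (Nat.mod_lt _ (by omega)).trans_le hM
  · intro f hf1 hf2
    rw [wordArray_setArr, if_pos rfl]
    funext z
    by_cases hz : y ≤ z % S ∧ z % S < y + b ∧ c * b ≤ z / S ∧ z / S < c * b + b
    · obtain ⟨h1, h2, h3, h4⟩ := hz
      have h5 : z % S - y < b := by omega
      have h6 : (z / S - c * b) * b + (z % S - y) < b * b := by
        have : z / S - c * b < b := by omega
        nlinarith
      have := hf1 ((z / S - c * b) * b + (z % S - y)) (by simpa [hbb] using h6)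
      rw [div_idx _ h5, mod_idx _ h5, show c * b + (z / S - c * b) = z / S by omega,
        show y + (z % S - y) = z % S by omega, Nat.div_add_mod'] at this
      exact this
    · rw [hf2 z]
      · have h4 : D ≠ 10 ∧ D ≠ 8 := by omega
        simp only [wordArray_setArr, h4, if_false, hs, hG, blockUpdate]
        have : (y ≤ z % S ∧ z % S < y + b ∧ z / S < c * b) ↔
          (y ≤ z % S ∧ z % S < y + b ∧ z / S < c * b + b) := by omega
        simp only [this]
      · rintro t ht rfl
        have ht' : t < b * b := by simpa [hbb] using ht
        have h1 := Nat.mod_lt t hb0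
        have h2 := div_lt_of_lt_sq ht'
        apply hz
        rw [div_idx _ (hcol t), mod_idx _ (hcol t)]
        exact ⟨Nat.le_add_right _ _, Nat.add_lt_add_left h1 y, Nat.le_add_right _ _,
          Nat.add_lt_add_left h2 _⟩

/-- The map of the block of columns from `x` on is applied to the columns from `y` on of the matrix
(`D = 3`) or of the array of vectors itself (`D = 4`). In the latter case the blocks are
disjoint. -/
theorem applyBlock_ok {M D S b x y q : ℕ} {s : Memory} (hM : 2 ≤ M)
    (hD : D = 3 ∨ D = 4) (hS : s.word 3 = S) (hb : s.word 8 = b) (hbb : s.word 9 = b * b)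
    (hq : s.word 10 = q) (hqS : q * b = S) (hx : s.word 21 = x) (hy : s.word 22 = y) (hb0 : 0 < b)
    (hxS : x + b ≤ S) (hyS : y + b ≤ S) (hdisj : D = 4 → x + b ≤ y ∨ y + b ≤ x)
    (hW : ∀ i < S, ∀ j < S, s.wordArray 4 (i * S + j) < 2)
    (hDb : ∀ i < S, ∀ j < S, s.wordArray D (i * S + j) < 2)
    (hP : ∀ u < b, s.wordArray 5 (x + u) < S) :
    Ok M (applyBlock D) s fun s' => s'.wordArray D =
      blockUpdate S b x y (s.wordArray 5) (s.wordArray 4) (s.wordArray D) S := by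
  have hD' : D ≠ 5 ∧ D ≠ 8 ∧ D ≠ 9 ∧ D ≠ 10 := by omega
  have h9 : ∀ t < b * b,
      s.wordArray D (s.wordArray 5 (x + t / b) * S + (y + t % b)) < 2 := fun t ht =>
    hDb _ (hP _ (div_lt_of_lt_sq ht)) _ (by have := Nat.mod_lt t hb0; omega)
  refine Ok.seq (Ok.fill (fun t => s.wordArray D (s.wordArray 5 (x + t / b) * S + (y + t % b)))
    ?_ ?_ ?_)
  · intro k _ f _
    simp [hS, hb, hx, hy, hD']
  · intro k hk
    rw [hbb] at hk
    exact (h9 k hk).trans_le hM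
  refine Ok.loop' (fun c s' => s'.wordArray D =
    blockUpdate S b x y (s.wordArray 5) (s.wordArray 4) (s.wordArray D) (c * b)) ?_ ?_ ?_
  · simp [blockUpdate_zero, hD']
  · intro c hc s' hs' hI
    simp only [word_setArr, hq] at hc
    have hw := fun r => hs'.word r rfl
    have h5 := hs'.arr 5 (by simp [applyRows, fill, fillAt, Cmd.stores, hD'])
    have h9' := hs'.arr 9 (by simp [applyRows, fill, fillAt, Cmd.stores, hD'])
    simp at hw h5 h9'
    refine (applyRows_ok (S := S) (b := b) (x := x) (y := y) (c := c) (D₀ := s.wordArray D)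
      (W := s.wordArray 4) hM hD (by simp [hw, hS]) (by simp [hw, hb])
      (by simp [hw, hbb]) (by simp) (by simp [hw, hx]) (by simp [hw, hy]) hb0 (by rw [← hqS]; nlinarith)
      hxS hyS ?_ hW hDb (by simpa [h5] using hP) (fun t ht => by simp [h9', h5, hbb, ht])
      (by simpa [h5] using hI)).mono fun s'' h => ?_
    · intro i hi j hj
      simp only [wordArray_setWord]
      rcases hD with rfl | rfl
      · rw [hs'.arr 4 rfl]
        simp
      · rw [hI, blockUpdate_of_col (by omega) (by have := hdisj rfl; omega)]
    · simpa [h5, Nat.succ_mul] using h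
  · intro s' _ h
    simpa [hq, hqS] using h

end RAM

namespace Elimination

/-! ### The schedule of the elimination -/

/-- Column `j` of a matrix listed row by row, with rows of length `S`. -/
def col (S : ℕ) (a : ℕ → ℕ) (j : ℕ) : Vec := fun i => if i < S then (a (i * S + j) : ZMod 2) else 0

/-- The number of elementary maps which have been applied to column `y` when `j` columns have been
processed: the greatest number up to `j` that arises from `y` by clearing low binary digits. -/
noncomputable def depth (j y : ℕ) : ℕ :=
  @Nat.findGreatest (fun t => ∃ e, y / 2 ^ e * 2 ^ e = t) (Classical.decPred _) j

theorem depth_le (j y : ℕ) : depth j y ≤ j :=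
  @Nat.findGreatest_le (fun t => ∃ e, y / 2 ^ e * 2 ^ e = t) (Classical.decPred _) j

theorem le_depth {j y t : ℕ} (e : ℕ) (h : y / 2 ^ e * 2 ^ e = t) (ht : t ≤ j) : t ≤ depth j y :=
  @Nat.le_findGreatest _ _ (Classical.decPred _) _ ht ⟨e, h⟩

theorem exists_depth {j y t : ℕ} (e : ℕ) (h : y / 2 ^ e * 2 ^ e = t) (ht : t ≤ j) :
    ∃ e, y / 2 ^ e * 2 ^ e = depth j y :=
  @Nat.findGreatest_spec _ (fun t => ∃ e, y / 2 ^ e * 2 ^ e = t) (Classical.decPred _) _ ht ⟨e, h⟩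

theorem depth_of_le {j y : ℕ} (h : y ≤ j) : depth j y = y := by
  refine le_antisymm ?_ (le_depth 0 (by simp) h)
  obtain ⟨e, he⟩ := exists_depth (j := j) (y := y) 0 (by simp) h
  rw [← he]
  exact Nat.div_mul_le_self y _

theorem le_of_pow_dvd {l e j : ℕ} (h : ¬ 2 ^ (l + 1) ∣ j) (he : 2 ^ e ∣ j) : e ≤ l := by
  by_contra hlt
  exact h ((pow_dvd_pow 2 (by omega)).trans he)

theorem dvd_of_pow_dvd {l e j : ℕ} (h : e ≤ l) (he : 2 ^ l ∣ j) : 2 ^ e ∣ j :=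
  (pow_dvd_pow 2 h).trans he

/-- If `2 ^ l` is the largest power of two that divides `j`, then only the columns in the next block
of this size after `j` are affected when column `j - 1` has been processed. -/
theorem depth_other {l j y : ℕ} (hj : 0 < j) (h1 : ¬ 2 ^ (l + 1) ∣ j)
    (hy : y < j ∨ j + 2 ^ l ≤ y) : depth (j - 1) y = depth j y := by
  rcases hy with hy | hy
  · rw [depth_of_le (by omega), depth_of_le (by omega)]
  · obtain ⟨i, rfl⟩ : ∃ i, j = i + 1 := ⟨j - 1, by omega⟩
    rw [Nat.add_sub_cancel]
    refine (@Nat.findGreatest_of_not (fun t => ∃ e, y / 2 ^ e * 2 ^ e = t) (Classical.decPred _) i ?_).symm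
    rintro ⟨e, he⟩
    have h2 := le_of_pow_dvd h1 (he ▸ Dvd.intro_left _ rfl)
    have h3 : 2 ^ e ≤ 2 ^ l := Nat.pow_le_pow_right (by omega) h2
    have h4 := Nat.div_add_mod' y (2 ^ e)
    have h5 := Nat.mod_lt y (Nat.two_pow_pos e)
    omega

theorem div_mul_eq {b k y : ℕ} (h : b * k ≤ y) (h' : y < b * k + b) : y / b * b = b * k := by
  rw [mul_comm, show y / b = k from
    Nat.div_eq_of_lt_le (by rwa [mul_comm]) (by rw [Nat.add_mul, one_mul, mul_comm k]; exact h')]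

/-- The columns in that block lack exactly the maps of the `2 ^ l` columns before `j`. -/
theorem depth_block {l j y : ℕ} (h0 : 2 ^ l ∣ j) (h1 : ¬ 2 ^ (l + 1) ∣ j)
    (hy : j ≤ y) (hy' : y < j + 2 ^ l) : depth (j - 1) y = j - 2 ^ l ∧ depth j y = j := by
  obtain ⟨k, hk⟩ := h0
  have hodd : k % 2 = 1 := by
    by_contra h
    refine h1 ⟨k / 2, ?_⟩
    have : 2 * (k / 2) = k := by omega
    rw [pow_succ, mul_assoc, this, hk]
  obtain ⟨i, hi⟩ : ∃ i, k = 2 * i + 1 := ⟨k / 2, by omega⟩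
  have hpos := Nat.two_pow_pos l
  have hj2 : j = 2 ^ (l + 1) * i + 2 ^ l := by rw [hk, hi, pow_succ]; ring
  have hlow : y / 2 ^ (l + 1) * 2 ^ (l + 1) = j - 2 ^ l := by
    rw [div_mul_eq (k := i)]
    · omega
    · omega
    · rw [pow_succ] at *
      omega
  constructor
  · refine le_antisymm ?_ (le_depth _ hlow (by omega))
    obtain ⟨e, he⟩ := exists_depth (j := j - 1) _ hlow (by omega)
    have hle := depth_le (j - 1) y
    rcases le_or_gt e l with hel | hel
    · have h3 : 2 ^ e ∣ j := dvd_of_pow_dvd hel ⟨k, hk⟩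
      have h4 : j ≤ y / 2 ^ e * 2 ^ e := by
        obtain ⟨u, rfl⟩ := h3
        rw [mul_comm (y / _)]
        exact Nat.mul_le_mul_left _ ((Nat.le_div_iff_mul_le (Nat.two_pow_pos e)).2 (by rwa [mul_comm]))
      omega
    · rw [← he, ← hlow]
      obtain ⟨r, hr⟩ := pow_dvd_pow 2 (show l + 1 ≤ e by omega)
      rw [hr, ← Nat.div_div_eq_div_mul, mul_comm (2 ^ (l + 1)) r, ← mul_assoc]
      exact Nat.mul_le_mul_right _ (Nat.div_mul_le_self _ _)
  · refine le_antisymm (depth_le j y) (le_depth l ?_ le_rfl)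
    rw [div_mul_eq (k := k) (by omega) (by omega), hk]

theorem act_single (w : ℕ → Vec) (p : ℕ → ℕ) (a : ℕ) : comp w p a 1 = act w p a (a + 1) := by
  simp [comp]

open RAM in
/-- The matrix product of a block update computes the map `act`. -/
theorem col_blockUpdate {S b x y j : ℕ} {P W D : ℕ → ℕ} (hy : y ≤ j) (hyb : j < y + b)
    (hj : j < S) (hP : ∀ u < b, P (x + u) < S) :
    col S (blockUpdate S b x y P W D S) j = act (col S W) P x (x + b) (col S D j) := by
  obtain ⟨i, rfl⟩ := Nat.exists_eq_add_of_le hy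
  rw [act_apply]
  funext r
  simp only [col, Pi.add_apply, Finset.sum_apply, Pi.smul_apply, smul_eq_mul]
  by_cases hr : r < S
  · simp only [hr, if_true]
    rw [blockUpdate_of_lt hj (by omega) hr, ZMod.natCast_mod, Finset.sum_Ico_eq_sum_range]
    push_cast
    rw [Nat.add_sub_cancel_left]
    congr 1
    refine Finset.sum_congr rfl fun u hu => ?_
    rw [if_pos (hP u (Finset.mem_range.1 hu)), mul_comm]
  · simp [hr]

open RAM in
theorem col_blockUpdate_of_notMem {S b x y j : ℕ} {P W D : ℕ → ℕ} (h : j < y ∨ y + b ≤ j)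
    (hj : j < S) : col S (blockUpdate S b x y P W D S) j = col S D j := by
  funext r
  simp only [col]
  rw [blockUpdate_of_col hj h]

end Elimination

namespace RAM

open Elimination

theorem blockUpdate_lt_two {S b x y i j N : ℕ} {P W D : ℕ → ℕ} (h : D (i * S + j) < 2) :
    blockUpdate S b x y P W D N (i * S + j) < 2 := by
  simp only [blockUpdate]
  split_ifs
  · exact Nat.mod_lt _ (by omega)
  · exact h

section Program

open RAM.Expr

/-- Look for a pivot row of the column whose number is in register `30`. -/
def findPivot : Cmd :=
  .seq (.assign 24 (reg 3)) <|
  .loop 33 3 <| .ite (arr 3 (reg 33 * reg 3 + reg 30) * (const 1 - arr 6 (reg 33)))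
    (.assign 24 (reg 33)) (.assign 24 (reg 24))

/-- Store the pivot row found and the vector of the elementary map. -/
def storePivot : Cmd :=
  .ite (lt (reg 24) (reg 3))
    (.seq (.store 5 (reg 30) (reg 24)) <| .seq (.store 6 (reg 24) (const 1)) <|
      .seq (.store 7 (reg 30) (const 1)) <| fillAt 4 3 (reg 16 * reg 3 + reg 30)
        (mod (arr 3 (reg 16 * reg 3 + reg 30) + eq (reg 16) (reg 24)) (const 2)))
    (.seq (.store 5 (reg 30) (const 0)) <| .seq (.store 6 (const 0) (arr 6 (const 0))) <|
      .seq (.store 7 (reg 30) (const 0)) <| fillAt 4 3 (reg 16 * reg 3 + reg 30) (const 0))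

/-- Process a column: decide whether it is a pivot column. -/
def processColumn : Cmd := .seq findPivot storePivot

end Program

/-- Register `24` receives a row with a nonzero entry that is not yet a pivot row, or the number `S`
if there is none. -/
theorem findPivot_ok {M S j : ℕ} {s : Memory} (hS : s.word 3 = S) (hj : s.word 30 = j)
    (hSM : S < M) : Ok M findPivot s fun s' =>
      (s'.word 24 < S ∧ s.wordArray 6 (s'.word 24) = 0 ∧
        s.wordArray 3 (s'.word 24 * S + j) ≠ 0) ∨
      (s'.word 24 = S ∧ ∀ r < S, s.wordArray 3 (r * S + j) ≠ 0 → s.wordArray 6 r ≠ 0) := by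
  refine Ok.seq (Ok.assign (by simpa [hS]) ?_)
  refine Ok.loop' (fun k s' =>
      (s'.word 24 < S ∧ s.wordArray 6 (s'.word 24) = 0 ∧
        s.wordArray 3 (s'.word 24 * S + j) ≠ 0) ∨
      (s'.word 24 = S ∧ ∀ r < k, s.wordArray 3 (r * S + j) ≠ 0 → s.wordArray 6 r ≠ 0)) ?_ ?_ ?_
  · simp [hS]
  · intro k hk s' hs' hI
    have hk : k < S := by simpa [hS] using hk
    have h3 : s'.wordArray 3 = s.wordArray 3 := hs'.arr 3 rfl
    have h6 : s'.wordArray 6 = s.wordArray 6 := hs'.arr 6 rfl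
    have w3 : s'.word 3 = S := (hs'.word 3 rfl).trans (by simp [hS])
    have w30 : s'.word 30 = j := (hs'.word 30 rfl).trans (by simp [hj])
    refine Ok.ite (fun he => Ok.assign (by simp; omega) ?_) fun he => Ok.assign ?_ ?_
    · left
      simp [h3, h6, w3, w30] at he ⊢
      exact ⟨hk, he.2, by omega⟩
    · simp
      omega
    · simp [h3, h6, w3, w30] at he ⊢
      refine hI.imp_right fun h => ⟨h.1, fun r hr hne => ?_⟩
      rcases lt_or_eq_of_le (show r ≤ k by omega) with hr | rfl
      · exact h.2 r hr hne
      · rcases he with he | he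
        · exact absurd he hne
        · omega
  · intro s' _ h
    simpa [hS] using h

/-- The effect of processing column `j`. -/
structure Processed (S j : ℕ) (s s' : Memory) (p q : ℕ) : Prop where
  piv : s'.wordArray 5 = Function.update (s.wordArray 5) j p
  isPiv : s'.wordArray 7 = Function.update (s.wordArray 7) j q
  lt : p < S
  col_ne : ∀ i < S, ∀ k < S, k ≠ j → s'.wordArray 4 (i * S + k) = s.wordArray 4 (i * S + k)
  bit : ∀ i < S, s'.wordArray 4 (i * S + j) < 2
  cases : (q = 1 ∧ s.wordArray 6 p = 0 ∧ s.wordArray 3 (p * S + j) ≠ 0 ∧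
      s'.wordArray 6 = Function.update (s.wordArray 6) p 1 ∧
      col S (s'.wordArray 4) j = col S (s.wordArray 3) j + Pi.single p 1) ∨
    (q = 0 ∧ s'.wordArray 6 = s.wordArray 6 ∧ col S (s'.wordArray 4) j = 0 ∧
      ∀ r < S, s.wordArray 3 (r * S + j) ≠ 0 → s.wordArray 6 r ≠ 0)

theorem idx_inj {S i i' j j' : ℕ} (hj : j < S) (hj' : j' < S) (h : i * S + j = i' * S + j') :
    i = i' ∧ j = j' :=
  ⟨by rw [← div_idx i hj, h, div_idx _ hj'], by rw [← mod_idx i hj, h, mod_idx _ hj']⟩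

theorem processColumn_ok {M S j : ℕ} {s : Memory} (hS : s.word 3 = S) (hj : s.word 30 = j)
    (hSM : S < M) (hM : 2 ≤ M) (hjS : j < S) (hu : ∀ i, s.wordArray 6 i < M) :
    Ok M processColumn s fun s' => ∃ p q, Processed S j s s' p q := by
  refine (findPivot_ok hS hj hSM).then fun s' hs' h => ?_
  have hinj : ∀ k < S, ∀ l < S, k * S + j = l * S + j → k = l := fun k _ l _ h =>
    (idx_inj hjS hjS h).1
  have h3 : s'.wordArray 3 = s.wordArray 3 := hs'.arr 3 rfl
  have h4 : s'.wordArray 4 = s.wordArray 4 := hs'.arr 4 rfl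
  have h5 : s'.wordArray 5 = s.wordArray 5 := hs'.arr 5 rfl
  have h6 : s'.wordArray 6 = s.wordArray 6 := hs'.arr 6 rfl
  have h7 : s'.wordArray 7 = s.wordArray 7 := hs'.arr 7 rfl
  have w3 : s'.word 3 = S := (hs'.word 3 rfl).trans (by simp [hS])
  have w30 : s'.word 30 = j := (hs'.word 30 rfl).trans (by simp [hj])
  refine Ok.ite (fun he => ?_) fun he => ?_
  · obtain ⟨h24, hp6, hp3⟩ : s'.word 24 < S ∧ s.wordArray 6 (s'.word 24) = 0 ∧
        s.wordArray 3 (s'.word 24 * S + j) ≠ 0 := by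
      rcases h with h | h
      · exact h
      · simp [w3, h.1] at he
    refine Ok.seq (Ok.store (by simp; omega) (Ok.seq (Ok.store (by simp; omega)
      (Ok.seq (Ok.store (by simp; omega) ?_)))))
    refine Ok.fillAt (fun k => k * S + j)
      (fun k => (s.wordArray 3 (k * S + j) + if k = s'.word 24 then 1 else 0) % 2) ?_ ?_ ?_ ?_ ?_
    · simpa [w3] using hinj
    · intro k hk f _
      simp [w3, w30]
    · intro k hk f _
      simp [w3, w30, h3]
    · intro k hk
      exact (Nat.mod_lt _ (by omega)).trans_le hM
    · intro f hf1 hf2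
      simp [w3, w30, h4] at hf1 hf2
      refine ⟨s'.word 24, 1, ⟨?_, ?_, h24, ?_, ?_, Or.inl ⟨rfl, hp6, hp3, ?_, ?_⟩⟩⟩
      · simp [w30, h5]
      · simp [w30, h7]
      · intro i hi k hk hkj
        simp only [wordArray_setArr, if_true]
        exact hf2 _ fun l hl e => hkj (idx_inj hjS hk e).2.symm
      · intro i hi
        simp only [wordArray_setArr, if_true, hf1 i hi]
        exact Nat.mod_lt _ (by omega)
      · simp [w30, h6]
      · funext i
        simp only [wordArray_setArr, if_true, col, Pi.add_apply, Pi.single_apply]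
        split_ifs with hi hi2
        · rw [hf1 i hi, if_pos hi2, ZMod.natCast_mod]
          push_cast
          rfl
        · rw [hf1 i hi, if_neg hi2, ZMod.natCast_mod]
          push_cast
          rfl
        · omega
        · simp
  · have hall : ∀ r < S, s.wordArray 3 (r * S + j) ≠ 0 → s.wordArray 6 r ≠ 0 := by
      rcases h with h | h
      · simp [w3] at he
        omega
      · exact h.2
    refine Ok.seq (Ok.store (by simp; omega) (Ok.seq (Ok.store (by simpa [h6] using hu 0)
      (Ok.seq (Ok.store (by simp; omega) ?_)))))
    refine Ok.fillAt (fun k => k * S + j) (fun k => 0) ?_ ?_ ?_ ?_ ?_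
    · simpa [w3] using hinj
    · intro k hk f _
      simp [w3, w30]
    · intro k hk f _
      simp
    · intro k hk
      omega
    · intro f hf1 hf2
      simp [w3, w30, h4] at hf1 hf2
      refine ⟨0, 0, ⟨?_, ?_, by omega, ?_, ?_, Or.inr ⟨rfl, ?_, ?_, hall⟩⟩⟩
      · simp [w30, h5]
      · simp [w30, h7]
      · intro i hi k hk hkj
        simp only [wordArray_setArr, if_true]
        exact hf2 _ fun l hl e => hkj (idx_inj hjS hk e).2.symm
      · intro i hi
        simp only [wordArray_setArr, if_true, hf1 i hi]
        omega
      · simp [h6]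
      · funext i
        simp only [wordArray_setArr, if_true, col]
        split_ifs with hi
        · rw [hf1 i hi]
          rfl
        · rfl

section Cost

variable (β : ℕ → ℕ) (a b : Expr)

theorem Expr.cost_add : (a + b).cost β = a.cost β + b.cost β + 1 := rfl
theorem Expr.cost_sub : (a - b).cost β = a.cost β + b.cost β + 1 := rfl
theorem Expr.cost_mul : (a * b).cost β = a.cost β + b.cost β + 1 := rfl
theorem Expr.cost_div : (a / b).cost β = a.cost β + b.cost β + 1 := rfl

attribute [simp] Expr.cost_add Expr.cost_sub Expr.cost_mul Expr.cost_div

end Cost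

theorem processColumn_staticCost (κ β : ℕ → ℕ) :
    processColumn.staticCost κ β ≤ 100 * β 3 + 200 := by
  simp [processColumn, findPivot, storePivot, fillAt, Cmd.staticCost, Expr.cost, Expr.mod, Expr.eq]
  omega

theorem applyBlock_staticCost (D : ℕ) (κ β : ℕ → ℕ) :
    (applyBlock D).staticCost κ β ≤ β 10 * (200 * β 9 + κ (β 8) + 200) + 100 * β 9 + 100 := by
  simp [applyBlock, applyRows, fill, fillAt, Cmd.staticCost, Expr.cost, Expr.mod]
  nlinarith [Nat.zero_le (β 10 * β 9)]

end RAM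

namespace Elimination

/-- The state of the elimination of `m` when the first `j` columns have been processed, and the
blocks of the columns that end at `j` have been merged up to the size `2 ^ l`. The arrays `A` and
`W` list the columns of the matrix and the vectors whose maps `act` are the compositions of the
elementary maps of a block. -/
structure Scheduled (S j l : ℕ) (m w : ℕ → Vec) (p A W : ℕ → ℕ) : Prop where
  bitA : ∀ i < S, ∀ k < S, A (i * S + k) < 2
  bitW : ∀ i < S, ∀ k < S, W (i * S + k) < 2
  avail : ∀ e x, 2 ^ e ∣ x → ¬ 2 ^ (e + 1) ∣ x → x < j → (l ≤ e ∧ x + 2 ^ e = j) ∨ j < x + 2 ^ e →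
    act (col S W) p (x - 2 ^ e) x = comp w p (x - 2 ^ e) (2 ^ e)
  dvd : 2 ^ l ∣ j → act (col S W) p (j - 2 ^ l) j = comp w p (j - 2 ^ l) (2 ^ l) ∧
    ∀ y < S, col S A y = comp w p 0 (depth (j - 1) y) (m y)
  not_dvd : ¬ 2 ^ l ∣ j → (∀ e, 2 ^ e ∣ j → ¬ 2 ^ (e + 1) ∣ j →
      act (col S W) p (j - 2 ^ e) j = comp w p (j - 2 ^ e) (2 ^ e)) ∧
    ∀ y < S, col S A y = comp w p 0 (depth j y) (m y)

namespace Scheduled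

open RAM

variable {S j l : ℕ} {m w : ℕ → Vec} {p A W : ℕ → ℕ}

/-- No block of size `2 ^ l` ends at `j`, and nothing has to be done. -/
theorem succ_of_not_dvd (h : Scheduled S j l m w p A W) (hl : ¬ 2 ^ l ∣ j) :
    Scheduled S j (l + 1) m w p A W where
  bitA := h.bitA
  bitW := h.bitW
  avail e x h1 h2 h3 h4 := h.avail e x h1 h2 h3 (h4.imp_left fun h5 => ⟨by omega, h5.2⟩)
  dvd h' := absurd (dvd_of_pow_dvd (by omega) h') hl
  not_dvd _ := h.not_dvd hl

/-- The block that ends at `j` is of maximal size; it is applied to the next columns of the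
matrix. -/
theorem succ_of_dvd_not_dvd (h : Scheduled S j l m w p A W) (hj : 0 < j) (hl : 2 ^ l ∣ j)
    (hl' : ¬ 2 ^ (l + 1) ∣ j) (hp : ∀ u < j, p u < S) :
    Scheduled S j (l + 1) m w p (blockUpdate S (2 ^ l) (j - 2 ^ l) j p W A S) W where
  bitA i hi k hk := blockUpdate_lt_two (h.bitA i hi k hk)
  bitW := h.bitW
  avail e x h1 h2 h3 h4 := h.avail e x h1 h2 h3 (h4.imp_left fun h5 => ⟨by omega, h5.2⟩)
  dvd h' := absurd h' hl'
  not_dvd _ := by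
    have hle := Nat.le_of_dvd hj hl
    refine ⟨fun e h1 h2 => ?_, fun y hy => ?_⟩
    · rw [le_antisymm (le_of_pow_dvd hl' h1) (le_of_pow_dvd h2 hl)]
      exact (h.dvd hl).1
    · by_cases hyj : j ≤ y ∧ y < j + 2 ^ l
      · obtain ⟨h1, h2⟩ := depth_block hl hl' hyj.1 hyj.2
        rw [col_blockUpdate hyj.1 hyj.2 hy fun u hu => hp _ (by omega),
          (h.dvd hl).2 y hy, h1, h2, show j - 2 ^ l + 2 ^ l = j by omega, (h.dvd hl).1]
        conv_rhs => rw [show j = (j - 2 ^ l) + 2 ^ l by omega, comp_add]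
        rw [zero_add, LinearMap.comp_apply]
      · rw [col_blockUpdate_of_notMem (by omega) hy, (h.dvd hl).2 y hy,
          depth_other hj hl' (by omega)]

/-- Two blocks of size `2 ^ l` end at `j - 2 ^ l` and at `j`, and are merged. -/
theorem succ_of_dvd (h : Scheduled S j l m w p A W) (hj : 0 < j) (hjS : j ≤ S)
    (hl : 2 ^ (l + 1) ∣ j) (hp : ∀ u < j, p u < S) :
    Scheduled S j (l + 1) m w p A
      (blockUpdate S (2 ^ l) (j - 2 ^ l) (j - (2 ^ l + 2 ^ l)) p W W S) where
  bitA := h.bitA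
  bitW i hi k hk := blockUpdate_lt_two (h.bitW i hi k hk)
  avail e x h1 h2 h3 h4 := by
    have hpos := Nat.two_pow_pos l
    -- the block that ends at `x` is not changed, since it ends before `j - 2 ^ (l + 1)`
    have hx : x ≤ j - (2 ^ l + 2 ^ l) := by
      rcases h4 with h4 | h4
      · have : 2 ^ (l + 1) ≤ 2 ^ e := Nat.pow_le_pow_right (by omega) h4.1
        rw [pow_succ] at this
        omega
      · have hle : l + 1 ≤ e := by
          by_contra hlt
          obtain ⟨c, hc⟩ : 2 ^ e ∣ j := dvd_of_pow_dvd (by omega) hl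
          obtain ⟨c', hc'⟩ := h1
          have : c' < c := by
            by_contra hge
            have : 2 ^ e * c ≤ 2 ^ e * c' := Nat.mul_le_mul_left _ (by omega)
            omega
          have : 2 ^ e * (c' + 1) ≤ 2 ^ e * c := Nat.mul_le_mul_left _ (by omega)
          rw [Nat.mul_succ] at this
          omega
        obtain ⟨c, hc⟩ := hl
        obtain ⟨c', hc'⟩ : 2 ^ (l + 1) ∣ x := dvd_of_pow_dvd hle h1
        have : c' < c := by
          by_contra hge
          have : 2 ^ (l + 1) * c ≤ 2 ^ (l + 1) * c' := Nat.mul_le_mul_left _ (by omega)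
          omega
        have : 2 ^ (l + 1) * (c' + 1) ≤ 2 ^ (l + 1) * c := Nat.mul_le_mul_left _ (by omega)
        rw [Nat.mul_succ] at this
        have h6 := pow_succ 2 l
        omega
    rw [← h.avail e x h1 h2 h3 (h4.imp_left fun h5 => ⟨by omega, h5.2⟩)]
    exact act_congr fun k _ hk => ⟨col_blockUpdate_of_notMem (by omega) (by omega), rfl⟩
  dvd _ := by
    have hl0 : 2 ^ l ∣ j := dvd_of_pow_dvd (by omega) hl
    refine ⟨?_, (h.dvd hl0).2⟩
    have hle := Nat.le_of_dvd hj hl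
    have hpos := Nat.two_pow_pos l
    have h6 : 2 ^ (l + 1) = 2 ^ l + 2 ^ l := by rw [pow_succ]; omega
    have h1 : 2 ^ l ∣ j - 2 ^ l := Nat.dvd_sub hl0 dvd_rfl
    have h2 : ¬ 2 ^ (l + 1) ∣ j - 2 ^ l := by
      intro h3
      have h4 := Nat.dvd_sub hl h3
      rw [Nat.sub_sub_self (by omega)] at h4
      have := Nat.le_of_dvd hpos h4
      omega
    have h3 := h.avail l (j - 2 ^ l) h1 h2 (by omega) (Or.inl ⟨le_rfl, by omega⟩)
    have h5 : j - 2 ^ l - 2 ^ l = j - 2 ^ (l + 1) := by omega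
    rw [h5] at h3
    rw [act_merge (w := col S W) (b := j - 2 ^ l) (by omega) (by omega), (h.dvd hl0).1, h3]
    · conv_rhs => rw [h6, comp_add, ← h6, show j - 2 ^ (l + 1) + 2 ^ l = j - 2 ^ l by omega]
    · intro k hk hk'
      rw [col_blockUpdate (by omega) (by omega) (by omega) fun u hu => hp _ (by omega),
        show j - 2 ^ l + 2 ^ l = j by omega]
    · intro k hk hk'
      exact col_blockUpdate_of_notMem (by omega) (by omega)
  not_dvd h' := absurd hl h'

end Scheduled

end Elimination

namespace RAM

open Elimination

section Program

open RAM.Expr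

/-- Merge the blocks of size `word 8` that end at the column after column `word 30`, or, if there
is only one, apply the block to the following columns of the matrix. -/
def processBlock : Cmd :=
  .seq (.assign 9 (reg 8 * reg 8)) <| .seq (.assign 10 (reg 3 / reg 8)) <|
  .seq (.ite (mod (reg 30 + const 1) (reg 8)) (.assign 21 (const 0)) <|
    .ite (mod (reg 30 + const 1) (reg 8 + reg 8))
      (.seq (.assign 21 (reg 30 + const 1 - reg 8)) <| .seq (.assign 22 (reg 30 + const 1))
        (applyBlock 3))
      (.seq (.assign 21 (reg 30 + const 1 - reg 8)) <|
        .seq (.assign 22 (reg 30 + const 1 - (reg 8 + reg 8))) (applyBlock 4)))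
  (.assign 8 (reg 8 + reg 8))

/-- The elimination of the `S × S` matrix in word array `3`, where register `3` holds `S = 2 ^ L`
and register `4` holds `L`. -/
def eliminate : Cmd :=
  .seq (fill 6 3 (const 0)) <| .loop 30 3 <| .seq processColumn <|
    .seq (.assign 8 (const 1)) <| .loop 31 4 processBlock

end Program

theorem Spec.ite_pos {M T : ℕ} {κ : ℕ → ℕ} {c c' : Cmd} {s : Memory} {Q : Memory → Prop} {e : Expr}
    (he : 0 < e.eval s) (h : Spec M κ c s T Q) :
    Spec M κ (.ite e c c') s (e.cost s.word + 2 + T) Q := by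
  simp only [Spec, Cmd.Safe, Cmd.den, Cmd.cost, if_pos he]
  exact ⟨h.1, Nat.add_le_add_left h.2.1 _, h.2.2⟩

theorem Spec.ite_neg {M T : ℕ} {κ : ℕ → ℕ} {c c' : Cmd} {s : Memory} {Q : Memory → Prop} {e : Expr}
    (he : e.eval s = 0) (h : Spec M κ c' s T Q) :
    Spec M κ (.ite e c c') s (e.cost s.word + 2 + T) Q := by
  simp only [Spec, Cmd.Safe, Cmd.den, Cmd.cost, he, lt_irrefl, if_false]
  exact ⟨h.1, Nat.add_le_add_left h.2.1 _, h.2.2⟩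

/-- The cost is that of a block update, `2 ^ (L - l)` products of size `2 ^ l`, if a block of size
`2 ^ l` ends at column `j`, and constant otherwise. -/
theorem processBlock_spec {M S L j l : ℕ} {κ : ℕ → ℕ} {s : Memory} {m w : ℕ → Vec} (hM : 2 ≤ M)
    (hS : s.word 3 = S) (hSL : S = 2 ^ L) (hSM : S * S < M) (hl : l < L) (h8 : s.word 8 = 2 ^ l)
    (hj : s.word 30 = j) (hjS : j < S) (hp : ∀ u < j + 1, s.wordArray 5 u < S)
    (h : Scheduled S (j + 1) l m w (s.wordArray 5) (s.wordArray 3) (s.wordArray 4)) :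
    Spec M κ processBlock s
      (if 2 ^ l ∣ j + 1 then 2 ^ (L - l) * (500 * 2 ^ l * 2 ^ l + κ (2 ^ l) + 500) else 100)
      fun s' => s'.word 8 = 2 ^ (l + 1) ∧
        Scheduled S (j + 1) (l + 1) m w (s'.wordArray 5) (s'.wordArray 3) (s'.wordArray 4) := by
  have hpos := Nat.two_pow_pos l
  have hlS : 2 ^ l + 2 ^ l ≤ S := by
    have : 2 ^ (l + 1) ≤ 2 ^ L := Nat.pow_le_pow_right (by omega) hl
    rw [pow_succ] at this
    omega
  have hq : S = 2 ^ (L - l) * 2 ^ l := by rw [hSL, ← pow_add]; congr 1; omega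
  have hq' : S / 2 ^ l = 2 ^ (L - l) := by rw [hq, Nat.mul_div_cancel _ hpos]
  have hSS : S ≤ S * S := Nat.le_mul_self S
  have hbb : 2 ^ l * 2 ^ l < M := by nlinarith
  have hpow : 2 ^ (l + 1) = 2 ^ l + 2 ^ l := by rw [pow_succ]; omega
  have hlM : 2 ^ (L - l) < M := by
    have : 2 ^ (L - l) ≤ 2 ^ L := Nat.pow_le_pow_right (by omega) (by omega)
    omega
  by_cases hd : 2 ^ l ∣ j + 1
  · have hmod : (j + 1) % 2 ^ l = 0 := Nat.mod_eq_zero_of_dvd hd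
    have hle := Nat.le_of_dvd (by omega) hd
    rw [if_pos hd]
    -- two blocks are merged in the first case, and one is applied to the matrix in the second case
    by_cases hd' : 2 ^ (l + 1) ∣ j + 1
    · have hmod' : (j + 1) % (2 ^ l + 2 ^ l) = 0 := hpow ▸ Nat.mod_eq_zero_of_dvd hd'
      have hle' := Nat.le_of_dvd (by omega) hd'
      refine Spec.mono (Spec.seq (Spec.assign ?h9 (Spec.seq (Spec.assign ?h10 (Spec.then (T' := 7)
        (Spec.ite_neg ?e1 (Spec.ite_neg ?e2 (Spec.seq (Spec.assign ?h21 (Spec.seq (Spec.assign ?h22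
        (Spec.of_ok (Ok.fixes (applyBlock_ok (S := S) (b := 2 ^ l) (q := 2 ^ (L - l))
          (x := j + 1 - 2 ^ l) (y := j + 1 - (2 ^ l + 2 ^ l)) hM (.inr rfl)
          ?a1 ?a2 ?a3 ?a4 hq.symm ?a5 ?a6 hpos ?a7 ?a8 ?a9 ?a10 ?a11 ?a12))
          rfl rfl (applyBlock_staticCost _ _ _))))))))
        fun s' hs' hI => Spec.assign ?h8 ?hQ))))) ?hT fun _ h => h
      case h9 => simpa [h8] using hbb
      case h10 => simpa [h8, hS, hq'] using hlM
      case e1 => simp [hj, h8, hmod]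
      case e2 => simp [hj, h8, hmod']
      case h21 => simp [hj, h8]; omega
      case h22 => simp [hj, h8]; omega
      case a1 => simp [hS]
      case a2 => simp [h8]
      case a3 => simp [h8]
      case a4 => simp [h8, hS, hq']
      case a5 => simp [h8, hj]
      case a6 => simp [h8, hj]
      case a7 => omega
      case a8 => omega
      case a9 => intro _; omega
      case a10 => simpa using h.bitW
      case a11 => simpa using h.bitW
      case a12 => simpa using fun u hu => hp _ (by omega)
      case h8 =>
        have w8 := hs'.word 8 rfl
        simp [h8] at w8
        simp [w8]
        omega
      case hQ =>
        have w8 := hs'.word 8 rfl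
        have a3 := hI.1.arr 3 rfl
        have a5 := hs'.arr 5 rfl
        replace hI := hI.2
        simp [h8] at w8 a3 a5 hI
        have := h.succ_of_dvd (by omega) (by omega) hd' hp
        simpa [w8, a3, a5, hI, hpow] using this
      case hT =>
        simp [Expr.cost, Expr.mod, hS, h8, hq']
        nlinarith [Nat.two_pow_pos (L - l), Nat.zero_le (2 ^ (L - l) * (2 ^ l * 2 ^ l)),
          Nat.mul_le_mul (Nat.two_pow_pos (L - l)) (Nat.mul_le_mul hpos hpos)]
    · have hmod' : (j + 1) % (2 ^ l + 2 ^ l) ≠ 0 := fun h => hd' (hpow ▸ Nat.dvd_of_mod_eq_zero h)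
      -- the next block of columns is within the matrix
      have hnext : j + 1 + 2 ^ l ≤ S := by
        obtain ⟨c, hc⟩ := hd
        have hcq : c < 2 ^ (L - l) := by
          by_contra hge
          have h1 : 2 ^ l * 2 ^ (L - l) ≤ 2 ^ l * c := Nat.mul_le_mul_left _ (by omega)
          rw [mul_comm, ← hq] at h1
          have h2 : j + 1 = S := by omega
          exact hd' (h2 ▸ hSL ▸ pow_dvd_pow 2 (by omega))
        have h1 : 2 ^ l * (c + 1) ≤ 2 ^ l * 2 ^ (L - l) := Nat.mul_le_mul_left _ hcq
        rw [mul_comm _ (2 ^ (L - l)), ← hq, Nat.mul_succ] at h1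
        omega
      refine Spec.mono (Spec.seq (Spec.assign ?h9 (Spec.seq (Spec.assign ?h10 (Spec.then (T' := 7)
        (Spec.ite_neg ?e1 (Spec.ite_pos ?e2 (Spec.seq (Spec.assign ?h21 (Spec.seq (Spec.assign ?h22
        (Spec.of_ok (Ok.fixes (applyBlock_ok (S := S) (b := 2 ^ l) (q := 2 ^ (L - l))
          (x := j + 1 - 2 ^ l) (y := j + 1) hM (.inl rfl)
          ?a1 ?a2 ?a3 ?a4 hq.symm ?a5 ?a6 hpos ?a7 ?a8 ?a9 ?a10 ?a11 ?a12))
          rfl rfl (applyBlock_staticCost _ _ _))))))))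
        fun s' hs' hI => Spec.assign ?h8 ?hQ))))) ?hT fun _ h => h
      case h9 => simpa [h8] using hbb
      case h10 => simpa [h8, hS, hq'] using hlM
      case e1 => simp [hj, h8, hmod]
      case e2 => simpa [hj, h8] using Nat.pos_of_ne_zero hmod'
      case h21 => simp [hj, h8]; omega
      case h22 => simp [hj]; omega
      case a1 => simp [hS]
      case a2 => simp [h8]
      case a3 => simp [h8]
      case a4 => simp [h8, hS, hq']
      case a5 => simp [h8, hj]
      case a6 => simp [hj]
      case a7 => omega
      case a8 => omega
      case a9 => intro h; omega
      case a10 => simpa using h.bitW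
      case a11 => simpa using h.bitA
      case a12 => simpa using fun u hu => hp _ (by omega)
      case h8 =>
        have w8 := hs'.word 8 rfl
        simp [h8] at w8
        simp [w8]
        omega
      case hQ =>
        have w8 := hs'.word 8 rfl
        have a4 := hI.1.arr 4 rfl
        have a5 := hs'.arr 5 rfl
        replace hI := hI.2
        simp [h8] at w8 a4 a5 hI
        have := h.succ_of_dvd_not_dvd (by omega) hd hd' hp
        simpa [w8, a4, a5, hI, hpow] using this
      case hT =>
        simp [Expr.cost, Expr.mod, hS, h8, hq']
        nlinarith [Nat.two_pow_pos (L - l), Nat.zero_le (2 ^ (L - l) * (2 ^ l * 2 ^ l)),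
          Nat.mul_le_mul (Nat.two_pow_pos (L - l)) (Nat.mul_le_mul hpos hpos)]
  · have hmod : (j + 1) % 2 ^ l ≠ 0 := fun h => hd (Nat.dvd_of_mod_eq_zero h)
    rw [if_neg hd]
    refine Spec.mono (Spec.seq (Spec.assign ?h9 (Spec.seq (Spec.assign ?h10 (Spec.seq
      (Spec.ite_pos ?e1 (Spec.assign ?h21 (Spec.assign ?h8 ?hQ)))))))) ?hT fun _ h => h
    case h9 => simpa [h8] using hbb
    case h10 => simpa [h8, hS, hq'] using hlM
    case e1 => simpa [hj, h8] using Nat.pos_of_ne_zero hmod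
    case h21 => simp; omega
    case h8 => simp [h8]; omega
    case hQ => simpa [h8, hpow] using h.succ_of_not_dvd hd
    case hT => simp [Expr.cost, Expr.mod]

end RAM

namespace RAM

open Elimination

theorem elementary_congr {c c' : ℕ → Vec} {p p' : ℕ → ℕ} {q q' : ℕ → Prop} {k : ℕ}
    (hc : c k = c' k) (hp : p k = p' k) (hq : q k ↔ q' k) :
    elementary c p q k = elementary c' p' q' k := by
  unfold elementary
  by_cases h : q k
  · rw [if_pos h, if_pos (hq.1 h), hc, hp]
  · rw [if_neg h, if_neg fun h' => h (hq.2 h')]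

/-- The state of the elimination when `j` columns have been processed. -/
structure Progress (S j : ℕ) (m w : ℕ → Vec) (s : Memory) : Prop where
  bitA : ∀ i < S, ∀ k < S, s.wordArray 3 (i * S + k) < 2
  bitW : ∀ i < S, ∀ k < S, s.wordArray 4 (i * S + k) < 2
  piv : ∀ k < j, s.wordArray 5 k < S
  isPiv : ∀ k < j, s.wordArray 7 k < 2
  used_lt : ∀ r, s.wordArray 6 r < 2 ∨ S ≤ r
  used : ∀ r < S, s.wordArray 6 r ≠ 0 ↔ ∃ k < j, s.wordArray 7 k = 1 ∧ s.wordArray 5 k = r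
  cols : ∀ y < S, col S (s.wordArray 3) y = comp w (s.wordArray 5) 0 (depth j y) (m y)
  elem : ∀ k < j, w k =
    elementary (col S (s.wordArray 3)) (s.wordArray 5) (fun k => s.wordArray 7 k = 1) k
  elim : IsElimination j m (col S (s.wordArray 3)) (s.wordArray 5) (fun k => s.wordArray 7 k = 1)
  avail : ∀ e x, 2 ^ e ∣ x → ¬ 2 ^ (e + 1) ∣ x → x ≤ j → j < x + 2 ^ e → x < S →
    act (col S (s.wordArray 4)) (s.wordArray 5) (x - 2 ^ e) x =
      comp w (s.wordArray 5) (x - 2 ^ e) (2 ^ e)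

section Step

variable {S L j p q : ℕ} {m w : ℕ → Vec} {s s₁ s₂ : Memory}

/-- After a column has been processed, its elementary map is a block of size one. -/
theorem Processed.scheduled (hP : Processed S j s s₁ p q) (h : Progress S j m w s) (hj : j < S)
    (h3 : s₁.wordArray 3 = s.wordArray 3) :
    Scheduled S (j + 1) 0 m (Function.update w j (col S (s₁.wordArray 4) j))
      (s₁.wordArray 5) (s₁.wordArray 3) (s₁.wordArray 4) := by
  have hcol : ∀ k < S, k ≠ j → col S (s₁.wordArray 4) k = col S (s.wordArray 4) k := by
    intro k hk hkj
    funext i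
    simp only [col]
    split_ifs with hi
    · rw [hP.col_ne i hi k hk hkj]
    · rfl
  constructor
  case bitA => rw [h3]; exact h.bitA
  case bitW =>
    intro i hi k hk
    by_cases hkj : k = j
    · rw [hkj]
      exact hP.bit i hi
    · rw [hP.col_ne i hi k hk hkj]
      exact h.bitW i hi k hk
  case avail =>
    intro e x h1 h2 h4 h5
    have hpos := Nat.two_pow_pos e
    have h6 := h.avail e x h1 h2 (by omega) (by omega) (by omega)
    have hx : 0 < x := by
      rcases Nat.eq_zero_or_pos x with rfl | hx
      · simp at h2
      · exact hx
    have h7 := Nat.le_of_dvd hx h1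
    rw [act_congr (w' := col S (s.wordArray 4)) (p' := s.wordArray 5), h6]
    · refine comp_congr fun k hk hk' => ?_
      rw [Function.update_of_ne (by omega), hP.piv, Function.update_of_ne (by omega)]
      exact ⟨rfl, rfl⟩
    · intro k hk hk'
      rw [hcol k (by omega) (by omega), hP.piv, Function.update_of_ne (by omega)]
      exact ⟨rfl, rfl⟩
  case dvd =>
    intro _
    refine ⟨?_, fun y hy => ?_⟩
    · simp only [pow_zero, Nat.add_sub_cancel, act_single]
      refine act_congr fun k hk hk' => ?_
      obtain rfl : k = j := by omega
      simp
    · rw [h3, h.cols y hy, Nat.add_sub_cancel]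
      have := depth_le j y
      refine LinearMap.congr_fun (comp_congr fun k _ hk => ?_) _
      rw [Function.update_of_ne (by omega), hP.piv, Function.update_of_ne (by omega)]
      exact ⟨rfl, rfl⟩
  case not_dvd => simp

/-- When the blocks that end at column `j` have been merged and applied, the next column has
received all of its maps. -/
theorem Processed.progress (hP : Processed S j s s₁ p q) (h : Progress S j m w s) (hj : j < S)
    (h3 : s₁.wordArray 3 = s.wordArray 3) (hSL : S = 2 ^ L) (h5 : s₂.wordArray 5 = s₁.wordArray 5)
    (h6 : s₂.wordArray 6 = s₁.wordArray 6) (h7 : s₂.wordArray 7 = s₁.wordArray 7)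
    (h' : Scheduled S (j + 1) L m (Function.update w j (col S (s₁.wordArray 4) j))
      (s₂.wordArray 5) (s₂.wordArray 3) (s₂.wordArray 4)) :
    Progress S (j + 1) m (Function.update w j (col S (s₁.wordArray 4) j)) s₂ := by
  have h0 := hP.scheduled h hj h3
  set w₁ := Function.update w j (col S (s₁.wordArray 4) j) with hw
  have hcols : ∀ y < S, col S (s₂.wordArray 3) y =
      comp w₁ (s₂.wordArray 5) 0 (depth (j + 1) y) (m y) := by
    intro y hy
    by_cases hd : 2 ^ L ∣ j + 1
    · have := Nat.le_of_dvd (by omega) hd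
      rw [(h'.dvd hd).2 y hy, Nat.add_sub_cancel, depth_of_le (by omega), depth_of_le (by omega)]
    · exact (h'.not_dvd hd).2 y hy
  -- the columns that have been processed do not change any more
  have hold : ∀ k ≤ j, col S (s₂.wordArray 3) k = col S (s.wordArray 3) k := by
    intro k hk
    have h1 := (h0.dvd (by simp)).2 k (by omega)
    rw [Nat.add_sub_cancel, depth_of_le hk] at h1
    rw [hcols k (by omega), depth_of_le (by omega), ← h3, h1, h5]
  have p5 : ∀ k < j, s₂.wordArray 5 k = s.wordArray 5 k := fun k hk => by
    rw [h5, hP.piv, Function.update_of_ne (by omega)]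
  have p5j : s₂.wordArray 5 j = p := by rw [h5, hP.piv, Function.update_self]
  have p7 : ∀ k < j, s₂.wordArray 7 k = s.wordArray 7 k := fun k hk => by
    rw [h7, hP.isPiv, Function.update_of_ne (by omega)]
  have p7j : s₂.wordArray 7 j = q := by rw [h7, hP.isPiv, Function.update_self]
  have hq2 : q < 2 := by
    rcases hP.cases with h | h <;> omega
  have hel : ∀ k < j + 1, w₁ k = elementary (col S (s₂.wordArray 3)) (s₂.wordArray 5)
      (fun k => s₂.wordArray 7 k = 1) k := by
    intro k hk
    rcases lt_or_eq_of_le (show k ≤ j by omega) with hk | rfl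
    · rw [hw, Function.update_of_ne (by omega), h.elem k hk]
      exact elementary_congr (hold k hk.le).symm (p5 k hk).symm (by rw [p7 k hk])
    · rw [hw, Function.update_self, elementary, p7j, p5j, hold k le_rfl]
      rcases hP.cases with hc | hc
      · rw [if_pos hc.1, hc.2.2.2.2]
      · rw [if_neg (by omega), hc.2.2.1]
  refine ⟨h'.bitA, h'.bitW, ?_, ?_, ?_, ?_, hcols, hel, ⟨?_, ?_, ?_⟩, ?_⟩
  · intro k hk
    rcases lt_or_eq_of_le (show k ≤ j by omega) with hk | rfl
    · rw [p5 k hk]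
      exact h.piv k hk
    · rw [p5j]
      exact hP.lt
  · intro k hk
    rcases lt_or_eq_of_le (show k ≤ j by omega) with hk | rfl
    · rw [p7 k hk]
      exact h.isPiv k hk
    · rwa [p7j]
  · intro r
    rcases hP.cases with hc | hc
    · rw [h6, hc.2.2.2.1]
      by_cases hr : r = p
      · simp [hr]
      · rw [Function.update_of_ne hr]
        exact h.used_lt r
    · rw [h6, hc.2.1]
      exact h.used_lt r
  · intro r hr
    have hsplit : (∃ k < j + 1, s₂.wordArray 7 k = 1 ∧ s₂.wordArray 5 k = r) ↔
        (∃ k < j, s.wordArray 7 k = 1 ∧ s.wordArray 5 k = r) ∨ (q = 1 ∧ p = r) := by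
      constructor
      · rintro ⟨k, hk, h1, h2⟩
        rcases lt_or_eq_of_le (show k ≤ j by omega) with hk | rfl
        · exact Or.inl ⟨k, hk, by rwa [← p7 k hk], by rwa [← p5 k hk]⟩
        · exact Or.inr ⟨by rwa [← p7j], by rwa [← p5j]⟩
      · rintro (⟨k, hk, h1, h2⟩ | ⟨h1, h2⟩)
        · exact ⟨k, by omega, by rwa [p7 k hk], by rwa [p5 k hk]⟩
        · exact ⟨j, by omega, by rwa [p7j], by rwa [p5j]⟩
    rw [hsplit, ← h.used r hr, h6]
    rcases hP.cases with hc | hc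
    · rw [hc.2.2.2.1]
      by_cases hrp : r = p
      · simp [hrp, hc.1]
      · rw [Function.update_of_ne hrp]
        simp [Ne.symm hrp]
    · rw [hc.2.1]
      simp [hc.1]
  · intro k hk
    have : col S (s₂.wordArray 3) k = comp w₁ (s₂.wordArray 5) 0 k (m k) := by
      rw [hcols k (by omega), depth_of_le (by omega)]
    rw [this, comp_congr fun k' _ hk' => ⟨hel k' (by omega), rfl⟩]
  · intro k hk hqk
    rcases lt_or_eq_of_le (show k ≤ j by omega) with hk | rfl
    · rw [p7 k hk] at hqk
      rw [hold k hk.le, p5 k hk]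
      refine ⟨(h.elim.pivot k hk hqk).1, fun k' hk' hq' => ?_⟩
      rw [p7 k' (by omega)] at hq'
      rw [p5 k' (by omega)]
      exact (h.elim.pivot k hk hqk).2 k' hk' hq'
    · rw [p7j] at hqk
      rw [hold k le_rfl, p5j]
      rcases hP.cases with hc | hc
      · refine ⟨?_, fun k' hk' hq' hp' => ?_⟩
        · have h1 := h.bitA p hP.lt k hj
          have h2 := hc.2.2.1
          have h4 : s.wordArray 3 (p * S + k) = 1 := by omega
          simp [col, hP.lt, h4]
        · rw [p7 k' hk'] at hq'
          rw [p5 k' hk'] at hp'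
          exact (h.used p hP.lt).2 ⟨k', hk', hq', hp'⟩ hc.2.1
      · omega
  · intro k hk hqk i hi
    rcases lt_or_eq_of_le (show k ≤ j by omega) with hk | rfl
    · rw [p7 k hk] at hqk
      rw [hold k hk.le] at hi
      obtain ⟨k', h1, h2, h4⟩ := h.elim.zero k hk hqk i hi
      exact ⟨k', h1, by rwa [p7 k' (by omega)], by rwa [p5 k' (by omega)]⟩
    · rw [p7j] at hqk
      rw [hold k le_rfl] at hi
      rcases hP.cases with hc | hc
      · exact absurd hc.1 hqk
      · have hiS : i < S := by
          by_contra h1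
          simp [col, h1] at hi
        have h1 : s.wordArray 3 (i * S + k) ≠ 0 := by
          intro h1
          simp [col, h1] at hi
        obtain ⟨k', h2, h4, h8⟩ := (h.used i hiS).1 (hc.2.2.2 i hiS h1)
        exact ⟨k', h2, by rwa [p7 k' h2], by rwa [p5 k' h2]⟩
  · intro e x h1 h2 h4 h8 hx
    rcases lt_or_eq_of_le h4 with h4 | rfl
    · exact h'.avail e x h1 h2 h4 (Or.inr h8)
    · refine (h'.not_dvd fun hd => ?_).1 e h1 h2
      have := Nat.le_of_dvd (by omega) hd
      omega

end Step

/-- The result of the elimination of the matrix that the array `a` lists. -/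
structure Eliminated (S : ℕ) (a : ℕ → ℕ) (s : Memory) : Prop where
  bitA : ∀ i < S, ∀ k < S, s.wordArray 3 (i * S + k) < 2
  bitW : ∀ i < S, ∀ k < S, s.wordArray 4 (i * S + k) < 2
  piv : ∀ k < S, s.wordArray 5 k < S
  isPiv : ∀ k < S, s.wordArray 7 k < 2
  elim : IsElimination S (col S a) (col S (s.wordArray 3)) (s.wordArray 5)
    (fun k => s.wordArray 7 k = 1)

/-- A bound for the cost of `eliminate`. -/
def eliminateCost (κ : ℕ → ℕ) (S L : ℕ) : ℕ :=
  100 * S + 100 + ∑ j ∈ Finset.range S, (100 * S + 300 + ∑ l ∈ Finset.range L,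
    (104 + if 2 ^ l ∣ j + 1 then 2 ^ (L - l) * (500 * 2 ^ l * 2 ^ l + κ (2 ^ l) + 500) else 0))

/-- The cost of the elimination. Its result does not depend on the old contents of word array `4`,
which only have to be bits. -/
theorem eliminate_spec {M S L : ℕ} {κ : ℕ → ℕ} {s : Memory} (hM : 2 ≤ M) (hS : s.word 3 = S)
    (hL : s.word 4 = L) (hSL : S = 2 ^ L) (hSM : S * S < M) (h6 : ∀ i, s.wordArray 6 i < M)
    (hA : ∀ i < S, ∀ j < S, s.wordArray 3 (i * S + j) < 2)
    (hW : ∀ i < S, ∀ j < S, s.wordArray 4 (i * S + j) < 2) :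
    Spec M κ eliminate s (eliminateCost κ S L) fun s' => Eliminated S (s.wordArray 3) s' := by
  have hSS : S ≤ S * S := Nat.le_mul_self S
  have hS0 : 0 < S := hSL ▸ Nat.two_pow_pos L
  refine Spec.mono (Spec.then (Q := fun s' => s'.wordArray 6 = fun x => if x < S then 0 else
    s.wordArray 6 x) (Spec.of_ok (T := 100 * S + 50) ?_ rfl rfl ?_)
    (T' := 50 + ∑ j ∈ Finset.range S, (100 * S + 300 + ∑ l ∈ Finset.range L,
      (104 + if 2 ^ l ∣ j + 1 then 2 ^ (L - l) * (500 * 2 ^ l * 2 ^ l + κ (2 ^ l) + 500) else 0)))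
    fun s₀ hs₀ h₀ => ?_) ?_ fun _ h => h
  · refine Ok.fill (fun _ => 0) (fun _ _ _ _ => rfl) (fun _ _ => by omega) ?_
    simp [hS]
  · simp [fill, fillAt, Cmd.staticCost, Expr.cost, hS]
    omega
  · have a3 : s₀.wordArray 3 = s.wordArray 3 := hs₀.arr 3 rfl
    have a4 : s₀.wordArray 4 = s.wordArray 4 := hs₀.arr 4 rfl
    have w3 : s₀.word 3 = S := (hs₀.word 3 rfl).trans hS
    have w4 : s₀.word 4 = L := (hs₀.word 4 rfl).trans hL
    refine Spec.mono (Spec.loop' (fun j s' => (∃ w, Progress S j (col S (s.wordArray 3)) w s') ∧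
        ∀ i, s'.wordArray 6 i < M)
      (fun j => 100 * S + 296 + ∑ l ∈ Finset.range L, (104 + if 2 ^ l ∣ j + 1 then
        2 ^ (L - l) * (500 * 2 ^ l * 2 ^ l + κ (2 ^ l) + 500) else 0)) ?_ ?_ ?_) ?_ fun _ h => h
    · refine ⟨⟨fun _ => 0, ?_⟩, fun i => ?_⟩
      · refine ⟨by rwa [a3], by rwa [a4], by simp, by simp, fun r => ?_, fun r hr => ?_,
          fun y hy => ?_, by simp, ⟨by simp, by simp, by simp⟩, fun e x _ h2 h3 _ => ?_⟩
        · rw [h₀]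
          by_cases hr : r < S
          · simp [hr]
          · omega
        · simp [h₀, hr]
        · rw [Nat.le_zero.1 (depth_le 0 y), a3]
          rfl
        · rw [Nat.le_zero.1 h3] at h2
          simp at h2
      · simp only [h₀]
        split_ifs
        · omega
        · exact h6 i
    · rintro j hj s' hs' ⟨⟨w, hw⟩, hM6⟩
      have hj : j < S := by simpa [w3] using hj
      have v3 : s'.word 3 = S := (hs'.word 3 rfl).trans w3
      have v4 : s'.word 4 = L := (hs'.word 4 rfl).trans w4
      refine Spec.mono (Spec.then (Spec.of_ok (processColumn_ok (S := S) (j := j) (by simp [v3])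
        (by simp) (by omega) hM hj (by simpa using hM6)) rfl rfl (processColumn_staticCost _ _))
        (T' := 10 + ∑ l ∈ Finset.range L, (104 + if 2 ^ l ∣ j + 1 then
          2 ^ (L - l) * (500 * 2 ^ l * 2 ^ l + κ (2 ^ l) + 500) else 0))
        fun s₁ hs₁ ⟨p, q, hP⟩ => ?_) ?_ fun _ h => h
      · have hP' : Processed S j s' s₁ p q := ⟨hP.1, hP.2, hP.3, hP.4, hP.5, hP.6⟩
        have b3 : s₁.wordArray 3 = s'.wordArray 3 := hs₁.arr 3 rfl
        have u3 : s₁.word 3 = S := (hs₁.word 3 rfl).trans (by simp [v3])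
        have u4 : s₁.word 4 = L := (hs₁.word 4 rfl).trans (by simp [v4])
        have u30 : s₁.word 30 = j := (hs₁.word 30 rfl).trans (by simp)
        have hsch := hP'.scheduled hw hj b3
        refine Spec.mono (Spec.seq (Spec.assign (by simp; omega) (Spec.loop' (fun l s₂ =>
            s₂.word 8 = 2 ^ l ∧ Scheduled S (j + 1) l (col S (s.wordArray 3))
              (Function.update w j (col S (s₁.wordArray 4) j))
              (s₂.wordArray 5) (s₂.wordArray 3) (s₂.wordArray 4))
          (fun l => 100 + if 2 ^ l ∣ j + 1 then
            2 ^ (L - l) * (500 * 2 ^ l * 2 ^ l + κ (2 ^ l) + 500) else 0) ?_ ?_ ?_))) ?_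
          fun _ h => h
        · simpa using hsch
        · rintro l hl s₂ hs₂ ⟨h8, hI⟩
          have hl : l < L := by simpa [u4] using hl
          have t3 : s₂.word 3 = S := (hs₂.word 3 rfl).trans (by simp [u3])
          have t30 : s₂.word 30 = j := (hs₂.word 30 rfl).trans (by simp [u30])
          have t5 : s₂.wordArray 5 = s₁.wordArray 5 := (hs₂.arr 5 rfl).trans (by simp)
          refine Spec.mono (processBlock_spec (S := S) (L := L) (j := j) (l := l) hM (by simp [t3])
            hSL hSM hl (by simp [h8]) (by simp [t30]) hj ?_ (by simpa using hI)) ?_ ?_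
          · intro u hu
            simp only [wordArray_setWord, t5, hP.piv]
            rcases lt_or_eq_of_le (show u ≤ j by omega) with hu | rfl
            · rw [Function.update_of_ne (by omega)]
              exact hw.piv u hu
            · rw [Function.update_self]
              exact hP.lt
          · split_ifs <;> omega
          · intro s₃ h₃
            simpa using h₃
        · rintro s₂ hs₂ ⟨-, hI⟩
          simp only [word_setWord, u4] at hI
          have c5 : s₂.wordArray 5 = s₁.wordArray 5 := (hs₂.arr 5 rfl).trans (by simp)
          have c6 : s₂.wordArray 6 = s₁.wordArray 6 := (hs₂.arr 6 rfl).trans (by simp)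
          have c7 : s₂.wordArray 7 = s₁.wordArray 7 := (hs₂.arr 7 rfl).trans (by simp)
          have hpr := hP'.progress (s₂ := s₂) hw hj b3 hSL c5 c6 c7 (by simpa using hI)
          refine ⟨⟨_, ⟨hpr.1, hpr.2, hpr.3, hpr.4, hpr.5, hpr.6, hpr.7, hpr.8, hpr.9, hpr.10⟩⟩,
            fun i => ?_⟩
          simp only [wordArray_setWord, c6]
          rcases hP'.cases with hc | hc
          · rw [hc.2.2.2.1, Function.update_apply]
            split_ifs
            · omega
            · exact hM6 i
          · rw [hc.2.1]
            exact hM6 i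
        · simp only [word_setWord, u4, Expr.cost]
          simp only [show ¬ (4 = 8) by omega, if_false]
          rw [Finset.sum_congr rfl fun l _ => show (100 + if 2 ^ l ∣ j + 1 then
            2 ^ (L - l) * (500 * 2 ^ l * 2 ^ l + κ (2 ^ l) + 500) else 0) + 4 = 104 + if 2 ^ l ∣ j + 1
            then 2 ^ (L - l) * (500 * 2 ^ l * 2 ^ l + κ (2 ^ l) + 500) else 0 by ring]
          omega
      · simp only [word_setWord, v3]
        simp only [show ¬ (3 = 30) by omega, if_false]
        omega
    · rintro s' hs' ⟨⟨w, hw⟩, -⟩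
      rw [w3] at hw
      exact ⟨hw.bitA, hw.bitW, hw.piv, hw.isPiv, hw.elim⟩
    · rw [w3]
      rw [Finset.sum_congr rfl fun j _ => show 100 * S + 296 + ∑ l ∈ Finset.range L, (104 +
        if 2 ^ l ∣ j + 1 then 2 ^ (L - l) * (500 * 2 ^ l * 2 ^ l + κ (2 ^ l) + 500) else 0) + 4 =
        100 * S + 300 + ∑ l ∈ Finset.range L, (104 +
        if 2 ^ l ∣ j + 1 then 2 ^ (L - l) * (500 * 2 ^ l * 2 ^ l + κ (2 ^ l) + 500) else 0) by ring]
      omega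
  · rw [eliminateCost]
    omega

end RAM

namespace RAM

/-- The elimination takes `O(S ^ ω)` steps if the matrix products take `O(b ^ ω)` steps: since
`2 < ω`, the products with the greatest blocks dominate. -/
theorem exists_eliminateCost_le {ω c : ℝ} (hω : 2 < ω) (hc : 0 ≤ c) :
    ∃ K : ℝ, 0 ≤ K ∧ ∀ κ : ℕ → ℕ, (∀ b, 0 < b → (κ b : ℝ) ≤ c * (b : ℝ) ^ ω) →
      ∀ L, (eliminateCost κ (2 ^ L) L : ℝ) ≤ K * ((2 ^ L : ℕ) : ℝ) ^ ω := by
  set r : ℝ := 2 ^ (ω - 2) with hr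
  have hr1 : 1 < r := Real.one_lt_rpow (by norm_num) (by linarith)
  have hr0 : 0 < r := by linarith
  have hpow : ∀ l : ℕ, ((2 ^ l : ℕ) : ℝ) ^ ω = 4 ^ l * r ^ l := by
    intro l
    have h1 : (2 : ℝ) ^ ω = 4 * r := by
      rw [hr, Real.rpow_sub (by norm_num)]
      norm_num
      ring
    push_cast
    rw [← Real.rpow_natCast_mul (by norm_num), mul_comm, Real.rpow_mul_natCast (by norm_num), h1,
      mul_pow]
  refine ⟨1000 + (1000 + c) / (r - 1), ?_, fun κ hκ L => ?_⟩
  · have : 0 ≤ (1000 + c) / (r - 1) := div_nonneg (by linarith) (by linarith)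
    linarith
  have hL : (L : ℝ) ≤ 2 ^ L := by exact_mod_cast Nat.lt_two_pow_self.le
  have h1L : (1 : ℝ) ≤ 2 ^ L := one_le_pow₀ (by norm_num)
  -- the number of products with blocks of the size `2 ^ l`
  have hcount : ∀ l ∈ Finset.range L, ∑ j ∈ Finset.range (2 ^ L), (if 2 ^ l ∣ j + 1 then
      2 ^ (L - l) * (500 * 2 ^ l * 2 ^ l + κ (2 ^ l) + 500) else 0) =
      2 ^ (L - l) * (2 ^ (L - l) * (500 * 2 ^ l * 2 ^ l + κ (2 ^ l) + 500)) := by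
    intro l hl
    rw [Finset.mem_range] at hl
    rw [← Finset.sum_filter, Finset.sum_const, Nat.card_multiples, smul_eq_mul,
      Nat.pow_div hl.le (by norm_num)]
  have hsplit : eliminateCost κ (2 ^ L) L = 100 * 2 ^ L + 100 +
      (2 ^ L * (100 * 2 ^ L + 300 + L * 104) + ∑ l ∈ Finset.range L,
        2 ^ (L - l) * (2 ^ (L - l) * (500 * 2 ^ l * 2 ^ l + κ (2 ^ l) + 500))) := by
    simp only [eliminateCost, Finset.sum_add_distrib, Finset.sum_const, Finset.card_range,
      smul_eq_mul, mul_add]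
    rw [Finset.sum_comm, Finset.sum_congr rfl fun l hl => by
      have := hcount l hl
      simp only [mul_add] at this
      exact this]
    simp only [Finset.sum_add_distrib]
    ring
  have hterm : ∀ l ∈ Finset.range L,
      (((2 ^ (L - l) * (2 ^ (L - l) * (500 * 2 ^ l * 2 ^ l + κ (2 ^ l) + 500)) : ℕ)) : ℝ) ≤
        (1000 + c) * 4 ^ L * r ^ l := by
    intro l hl
    rw [Finset.mem_range] at hl
    have h1 := hκ (2 ^ l) (Nat.two_pow_pos l)
    rw [hpow] at h1
    have h2 : (1 : ℝ) ≤ r ^ l := one_le_pow₀ hr1.le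
    have h3 : (1 : ℝ) ≤ 4 ^ l := one_le_pow₀ (by norm_num)
    have h4 : (2 : ℝ) ^ l * 2 ^ l = 4 ^ l := by rw [← mul_pow]; norm_num
    have h5 : (4 : ℝ) ^ L = 2 ^ (L - l) * 2 ^ (L - l) * 4 ^ l := by
      rw [← mul_pow, show (2 : ℝ) * 2 = 4 by norm_num, ← pow_add]
      congr 1
      omega
    have h6 : (500 : ℝ) * 2 ^ l * 2 ^ l + κ (2 ^ l) + 500 ≤ (1000 + c) * (4 ^ l * r ^ l) := by
      have : (4 : ℝ) ^ l ≤ 4 ^ l * r ^ l := le_mul_of_one_le_right (by positivity) h2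
      rw [mul_assoc, h4]
      nlinarith
    push_cast
    rw [h5, ← mul_assoc]
    calc _ ≤ (2 : ℝ) ^ (L - l) * 2 ^ (L - l) * ((1000 + c) * (4 ^ l * r ^ l)) := by gcongr
      _ = _ := by ring
  have hsum : ((∑ l ∈ Finset.range L,
      2 ^ (L - l) * (2 ^ (L - l) * (500 * 2 ^ l * 2 ^ l + κ (2 ^ l) + 500)) : ℕ) : ℝ) ≤
        (1000 + c) / (r - 1) * (4 ^ L * r ^ L) := by
    rw [Nat.cast_sum]
    refine (Finset.sum_le_sum hterm).trans ?_
    rw [← Finset.mul_sum, geom_sum_eq hr1.ne', mul_div_assoc', div_mul_eq_mul_div]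
    refine div_le_div_of_nonneg_right ?_ (by linarith)
    have : (0 : ℝ) ≤ (1000 + c) * 4 ^ L := by positivity
    nlinarith
  have h4 : (2 : ℝ) ^ L * 2 ^ L = 4 ^ L := by rw [← mul_pow]; norm_num
  have h5 : (4 : ℝ) ^ L ≤ 4 ^ L * r ^ L :=
    le_mul_of_one_le_right (by positivity) (one_le_pow₀ hr1.le)
  rw [hpow, hsplit]
  push_cast at hsum ⊢
  nlinarith [mul_le_mul_of_nonneg_left hL (show (0:ℝ) ≤ 2 ^ L by positivity)]

end RAM

/-! ### Minimality of a greedy basis -/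

section Minimality

variable {V : Type*} [Fintype V] [DecidableEq V] {K : AbstractSimplicialComplex V}
  {w : Finset V → ℝ≥0} {d g : ℕ}

theorem cycleSize_le {z : cycles K d} {p : V} {r : ℝ≥0∞}
    (h : ∀ s : Simplex K d, z.1 s ≠ 0 → simplexDist K w p s.1 ≤ r) : cycleSize K w z ≤ r :=
  sInf_le ⟨p, fun s hs => ⟨s.2.1, h s hs⟩⟩

/-- A cycle lies in some ball whose radius is the size of the cycle. -/
theorem exists_simplexDist_le_cycleSize [Nonempty V] (z : cycles K d) :
    ∃ p : V, ∀ s : Simplex K d, z.1 s ≠ 0 → simplexDist K w p s.1 ≤ cycleSize K w z := by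
  classical
  let f : V → ℝ≥0∞ := fun p => (Finset.univ.filter fun s : Simplex K d => z.1 s ≠ 0).sup
    fun s => simplexDist K w p s.1
  obtain ⟨p, -, hp⟩ := Finset.exists_min_image Finset.univ f Finset.univ_nonempty
  refine ⟨p, fun s hs => le_sInf ?_⟩
  rintro r ⟨p', hp'⟩
  calc simplexDist K w p s.1 ≤ f p := by
        exact Finset.le_sup (f := fun s : Simplex K d => simplexDist K w p s.1)
          (by simpa using hs)
    _ ≤ f p' := hp p' (Finset.mem_univ _)
    _ ≤ r := Finset.sup_le fun s hs => (hp' s (by simpa using hs)).2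

/-- If more than `i` of the values are at most `r`, so is the `i`-th in sorted order. -/
theorem sort_le_of_lt_card {α : Type*} [LinearOrder α] {f : Fin g → α} {r : α} {i : Fin g}
    (h : (i : ℕ) < (Finset.univ.filter fun j => f j ≤ r).card) : f (Tuple.sort f i) ≤ r := by
  by_contra hlt
  rw [not_le] at hlt
  have hmono := Tuple.monotone_sort f
  have hsub : (Finset.univ.filter fun j => f j ≤ r) ⊆ (Finset.Iio i).map (Tuple.sort f).toEmbedding := by
    intro j hj
    rw [Finset.mem_filter] at hj
    refine Finset.mem_map.2 ⟨(Tuple.sort f).symm j, ?_, by simp⟩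
    rw [Finset.mem_Iio]
    by_contra hge
    have := hmono (not_lt.1 hge)
    simp only [Function.comp_apply, Equiv.apply_symm_apply] at this
    exact absurd (hlt.trans_le this) (not_lt.2 hj.2)
  have := Finset.card_le_card hsub
  rw [Finset.card_map, Fin.card_Iio] at this
  omega

theorem lt_card_of_sort {α : Type*} [LinearOrder α] (f : Fin g → α) (i : Fin g) :
    (i : ℕ) < (Finset.univ.filter fun j => f j ≤ f (Tuple.sort f i)).card := by
  have hmono := Tuple.monotone_sort f
  have hsub : (Finset.Iic i).map (Tuple.sort f).toEmbedding ⊆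
      Finset.univ.filter fun j => f j ≤ f (Tuple.sort f i) := by
    intro j hj
    obtain ⟨k, hk, rfl⟩ := Finset.mem_map.1 hj
    simpa using hmono (Finset.mem_Iic.1 hk)
  have := Finset.card_le_card hsub
  rw [Finset.card_map, Fin.card_Iic] at this
  omega

/-- A basis such that the cycles in each ball of radius `r` are generated by those of its members
that are certified to have size at most `r` is minimal: among the members of size at most `r` of
any other basis, there are at most as many. -/
theorem isMinimalHomologyBasis_of_span (c : Fin g → cycles K d) (key : Fin g → ℝ≥0∞)
    (hind : LinearIndependent (ZMod 2) fun i => homologyClass K d (c i))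
    (hkey : ∀ i, cycleSize K w (c i) ≤ key i)
    (hspan : ∀ (p : V) (r : ℝ≥0∞) (z : cycles K d),
      (∀ s : Simplex K d, z.1 s ≠ 0 → simplexDist K w p s.1 ≤ r) →
      homologyClass K d z ∈ Submodule.span (ZMod 2)
        ((fun i => homologyClass K d (c i)) '' {i | key i ≤ r})) :
    IsMinimalHomologyBasis K w d c := by
  classical
  rcases isEmpty_or_nonempty V with hV | hV
  · -- there are no simplices
    have hS : IsEmpty (Simplex K d) := ⟨fun s => by
      obtain ⟨s, hs, hc⟩ := s
      rw [Finset.eq_empty_of_isEmpty s] at hc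
      simp at hc⟩
    have hH : Subsingleton (Homology K d) := by
      have : Subsingleton (cycles K d) := inferInstance
      exact Quot.Subsingleton
    have hg : g = 0 := by
      rcases g with _ | g
      · rfl
      · exact absurd (Subsingleton.elim _ _) (hind.ne_zero (0 : Fin (g + 1)))
    subst hg
    refine ⟨⟨hind, Subsingleton.elim _ _⟩, fun c' _ => le_of_eq ?_⟩
    congr 1
    funext i
    exact i.elim0
  · refine ⟨⟨hind, ?_⟩, fun c' hc' => ?_⟩
    · rw [eq_top_iff]
      intro x _
      obtain ⟨z, rfl⟩ := Submodule.Quotient.mk_surjective _ x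
      exact Submodule.span_mono (Set.image_subset_range _ _)
        (hspan (Classical.arbitrary V) ⊤ z fun _ _ => le_top)
    · have hle : ∀ i, cycleSize K w (c (Tuple.sort (fun i => cycleSize K w (c i)) i)) ≤
          cycleSize K w (c' (Tuple.sort (fun i => cycleSize K w (c' i)) i)) := fun i => ?_
      · exact Pi.toLex_monotone (ι := Fin g) (β := fun _ => ℝ≥0∞) hle
      set f := fun i => cycleSize K w (c i)
      set f' := fun i => cycleSize K w (c' i)
      set r := f' (Tuple.sort f' i) with hr
      refine sort_le_of_lt_card (f := f) (r := r) (i := i) ((lt_card_of_sort f' i).trans_le ?_)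
      -- the classes of the members of size at most `r` of the other basis are independent
      have h1 : LinearIndependent (ZMod 2)
          (fun j : {j // f' j ≤ r} => homologyClass K d (c' j)) :=
        hc'.1.comp _ Subtype.val_injective
      have h2 : Set.range (fun j : {j // f' j ≤ r} => homologyClass K d (c' j)) ⊆
          Submodule.span (ZMod 2) ((fun i => homologyClass K d (c i)) '' {i | key i ≤ r}) := by
        rintro _ ⟨⟨j, hj⟩, rfl⟩
        obtain ⟨p, hp⟩ := exists_simplexDist_le_cycleSize (w := w) (c' j)
        exact hspan p r (c' j) fun s hs => (hp s hs).trans hj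
      have h3 := linearIndependent_le_span_aux' _ h1
        (((Finset.univ.filter fun j => key j ≤ r).image fun i => homologyClass K d (c i) :
          Finset (Homology K d)) : Set (Homology K d))
        (by rw [Finset.coe_image, Finset.coe_filter]; simpa only [Finset.mem_univ, true_and] using h2)
      simp only [Finset.coe_sort_coe, Fintype.card_coe] at h3
      rw [Fintype.card_subtype] at h3
      refine (h3.trans Finset.card_image_le).trans (Finset.card_le_card fun j hj => ?_)
      rw [Finset.mem_filter] at hj ⊢
      exact ⟨hj.1, (hkey j).trans hj.2⟩

end Minimality

/-! ### Positions in a sorted list -/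

section Rank

variable {α : Type*} [LinearOrder α]

/-- The order of the natural numbers by their keys, where ties are broken by the numbers. -/
def Precedes (key : ℕ → α) (i j : ℕ) : Prop := key i < key j ∨ (¬ key j < key i ∧ i < j)

/-- The position of `i` if `0, …, N - 1` are sorted by their keys. -/
noncomputable def rank (N : ℕ) (key : ℕ → α) (i : ℕ) : ℕ :=
  open Classical in ((Finset.range N).filter fun j => Precedes key j i).card

variable {N : ℕ} {key : ℕ → α} {i j k : ℕ}

theorem Precedes.irrefl : ¬ Precedes key i i := fun h => h.elim (lt_irrefl _) fun h => lt_irrefl _ h.2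

theorem Precedes.trans (h : Precedes key i j) (h' : Precedes key j k) : Precedes key i k := by
  unfold Precedes at *
  rw [not_lt] at *
  rcases h with h | h <;> rcases h' with h' | h'
  · exact Or.inl (h.trans h')
  · exact Or.inl (h.trans_le h'.1)
  · exact Or.inl (h.1.trans_lt h')
  · exact Or.inr ⟨h.1.trans h'.1, h.2.trans h'.2⟩

theorem precedes_or (hij : i ≠ j) : Precedes key i j ∨ Precedes key j i := by
  unfold Precedes
  rcases lt_trichotomy (key i) (key j) with h | h | h
  · exact Or.inl (Or.inl h)
  · rcases lt_or_gt_of_ne hij with h' | h'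
    · exact Or.inl (Or.inr ⟨h.not_gt, h'⟩)
    · exact Or.inr (Or.inr ⟨h.symm.not_gt, h'⟩)
  · exact Or.inr (Or.inl h)

theorem rank_lt_rank (hi : i < N) (h : Precedes key i j) : rank N key i < rank N key j := by
  classical
  refine Finset.card_lt_card ⟨fun k hk => ?_, fun hsub => ?_⟩
  · simp only [Finset.mem_filter] at hk ⊢
    exact ⟨hk.1, hk.2.trans h⟩
  · have := hsub (Finset.mem_filter.2 ⟨Finset.mem_range.2 hi, h⟩)
    exact Precedes.irrefl (Finset.mem_filter.1 this).2

theorem rank_lt (hi : i < N) : rank N key i < N := by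
  classical
  have : rank N key i < (Finset.range N).card := by
    refine Finset.card_lt_card ⟨Finset.filter_subset _ _, fun hsub => ?_⟩
    exact Precedes.irrefl (Finset.mem_filter.1 (hsub (Finset.mem_range.2 hi))).2
  simpa using this

theorem rank_injective (hi : i < N) (hj : j < N) (h : rank N key i = rank N key j) : i = j := by
  by_contra hij
  rcases precedes_or (key := key) hij with h' | h'
  · exact absurd h (rank_lt_rank hi h').ne
  · exact absurd h (rank_lt_rank hj h').ne'

theorem key_le_of_rank_le (hj : j < N) (h : rank N key i ≤ rank N key j) : key i ≤ key j := by
  by_contra hlt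
  exact absurd (rank_lt_rank (i := j) (j := i) hj (Or.inl (not_le.1 hlt))) (not_lt.2 h)

/-- An array which inverts the ranks lists all numbers below `N` in the order of their keys. -/
theorem rank_inverse {f : ℕ → ℕ} (hf : ∀ i < N, f (rank N key i) = i) (hj : j < N) :
    f j < N ∧ rank N key (f j) = j := by
  obtain ⟨i, hi, rfl⟩ : ∃ i ∈ Finset.range N, rank N key i = j := by
    have h1 : (Finset.range N).image (rank N key) = Finset.range N := by
      refine Finset.eq_of_subset_of_card_le (fun k hk => ?_) ?_
      · obtain ⟨i, hi, rfl⟩ := Finset.mem_image.1 hk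
        exact Finset.mem_range.2 (rank_lt (Finset.mem_range.1 hi))
      · rw [Finset.card_image_of_injOn fun i hi j hj h => rank_injective (Finset.mem_range.1 hi)
          (Finset.mem_range.1 hj) h]
    rw [← Finset.mem_range, ← h1] at hj
    exact Finset.mem_image.1 hj
  rw [Finset.mem_range] at hi
  rw [hf i hi]
  exact ⟨hi, rfl⟩

end Rank

/-! ### Chains as vectors -/

section Bridge

open Elimination

variable {v n d : ℕ} {K : AbstractSimplicialComplex (Fin v)} (σ : Fin n ≃ K.faces)

/-- The number of vertices of the simplex `k`, where the simplices are numbered by `σ`. -/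
noncomputable def numVertices (k : ℕ) : ℕ := if h : k < n then (σ ⟨k, h⟩).1.card else 0

/-- The vector of the coefficients of a chain; its entries are numbered by all simplices. -/
noncomputable def chainVec : Chain K d →ₗ[ZMod 2] Vec where
  toFun x k := if h : k < n then
    if hc : (σ ⟨k, h⟩).1.card = d + 1 then x ⟨(σ ⟨k, h⟩).1, (σ ⟨k, h⟩).2, hc⟩ else 0 else 0
  map_add' x y := by
    funext k
    simp only [Pi.add_apply]
    split_ifs <;> simp
  map_smul' a x := by
    funext k
    simp only [Pi.smul_apply, RingHom.id_apply]
    split_ifs <;> simp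

/-- The simplex `i` is a facet of the simplex `k`. -/
def IsFacet (i k : ℕ) : Prop :=
  ∃ (hi : i < n) (hk : k < n), (σ ⟨i, hi⟩).1.card + 1 = (σ ⟨k, hk⟩).1.card ∧
    (σ ⟨i, hi⟩).1 ⊆ (σ ⟨k, hk⟩).1

/-- The vector of the boundary of the simplex `k`. -/
noncomputable def facetVec (k : ℕ) : Vec := fun i => open Classical in if IsFacet σ i k then 1 else 0

/-- The number of a simplex. -/
def simplexIndex (s : Simplex K d) : Fin n := σ.symm ⟨s.1, s.2.1⟩

variable {σ}

theorem simplexIndex_injective : Function.Injective (simplexIndex σ : Simplex K d → Fin n) := by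
  intro s t h
  have := σ.symm.injective h
  exact Subtype.ext (congrArg (fun x : K.faces => x.1) this)

theorem chainVec_simplexIndex (x : Chain K d) (s : Simplex K d) :
    chainVec σ x (simplexIndex σ s) = x s := by
  have h1 : σ ⟨(simplexIndex σ s : ℕ), (simplexIndex σ s).2⟩ = ⟨s.1, s.2.1⟩ := by
    simp [simplexIndex]
  simp only [chainVec, LinearMap.coe_mk, AddHom.coe_mk]
  rw [dif_pos (simplexIndex σ s).2]
  have h2 : (σ ⟨(simplexIndex σ s : ℕ), (simplexIndex σ s).2⟩).1.card = d + 1 := by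
    rw [h1]
    exact s.2.2
  rw [dif_pos h2]
  congr 1
  exact Subtype.ext (congrArg (fun x : K.faces => x.1) h1)

theorem exists_simplexIndex {k : ℕ} (hk : k < n) (h : numVertices σ k = d + 1) :
    ∃ s : Simplex K d, (simplexIndex σ s : ℕ) = k ∧ s.1 = (σ ⟨k, hk⟩).1 := by
  rw [numVertices, dif_pos hk] at h
  refine ⟨⟨(σ ⟨k, hk⟩).1, (σ ⟨k, hk⟩).2, h⟩, ?_, rfl⟩
  simp [simplexIndex]

theorem chainVec_eq_zero {x : Chain K d} {k : ℕ} (h : n ≤ k ∨ numVertices σ k ≠ d + 1) :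
    chainVec σ x k = 0 := by
  simp only [chainVec, LinearMap.coe_mk, AddHom.coe_mk]
  split_ifs with h1 h2
  · rw [numVertices, dif_pos h1] at h
    omega
  · rfl
  · rfl

theorem numVertices_of_chainVec_ne {x : Chain K d} {k : ℕ} (h : chainVec σ x k ≠ 0) :
    k < n ∧ numVertices σ k = d + 1 := by
  by_contra h'
  exact h (chainVec_eq_zero (by omega))

theorem chainVec_injective : Function.Injective (chainVec σ : Chain K d → Vec) := by
  intro x y h
  funext s
  rw [← chainVec_simplexIndex (σ := σ) x s, h, chainVec_simplexIndex]

/-- Every vector that is supported on the `d`-simplices is the vector of a chain. -/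
theorem exists_chainVec_eq {x : Vec} (h : ∀ k, x k ≠ 0 → k < n ∧ numVertices σ k = d + 1) :
    ∃ y : Chain K d, chainVec σ y = x := by
  refine ⟨fun s => x (simplexIndex σ s), ?_⟩
  funext k
  by_cases hk : x k = 0
  · rw [hk]
    by_contra hne
    obtain ⟨h1, h2⟩ := numVertices_of_chainVec_ne hne
    obtain ⟨s, hs, -⟩ := exists_simplexIndex h1 h2
    rw [← hs, chainVec_simplexIndex, hs] at hne
    exact hne hk
  · obtain ⟨h1, h2⟩ := h k hk
    obtain ⟨s, hs, -⟩ := exists_simplexIndex h1 h2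
    rw [← hs, chainVec_simplexIndex]

theorem sum_chainVec (x : Chain K d) (f : ℕ → ZMod 2) :
    ∑ k ∈ Finset.range n, chainVec σ x k * f k = ∑ s, x s * f (simplexIndex σ s) := by
  rw [Finset.sum_range]
  refine (Fintype.sum_of_injective (simplexIndex σ) simplexIndex_injective _ _ ?_ ?_).symm
  · intro k hk
    rw [chainVec_eq_zero, zero_mul]
    right
    intro h
    obtain ⟨s, hs, -⟩ := exists_simplexIndex k.2 h
    exact hk ⟨s, Fin.ext hs⟩
  · intro s
    rw [chainVec_simplexIndex]

/-- The linear combination of the boundaries of the simplices with the entries of a vector as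
coefficients. -/
noncomputable def boundaryVec (σ : Fin n ≃ K.faces) : Vec →ₗ[ZMod 2] Vec :=
  ∑ k ∈ Finset.range n, (LinearMap.proj k).smulRight (facetVec σ k)

theorem boundaryVec_apply (x : Vec) (i : ℕ) :
    boundaryVec σ x i = ∑ k ∈ Finset.range n, x k * facetVec σ k i := by
  simp [boundaryVec, LinearMap.sum_apply]

theorem isFacet_simplexIndex (t : Simplex K d) (s : Simplex K (d + 1)) :
    IsFacet σ (simplexIndex σ t) (simplexIndex σ s) ↔ t.1 ⊆ s.1 := by
  simp only [IsFacet, Fin.is_lt, Fin.eta, exists_true_left]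
  simp only [simplexIndex, Equiv.apply_symm_apply]
  rw [t.2.2, s.2.2]
  simp

theorem chainVec_boundary (x : Chain K (d + 1)) :
    chainVec σ (boundary K d x) = boundaryVec σ (chainVec σ x) := by
  classical
  funext i
  rw [boundaryVec_apply]
  by_cases hi : i < n ∧ numVertices σ i = d + 1
  · obtain ⟨t, rfl, -⟩ := exists_simplexIndex hi.1 hi.2
    rw [chainVec_simplexIndex, sum_chainVec x fun k => facetVec σ k (simplexIndex σ t)]
    simp only [boundary, Matrix.mulVecLin_apply, Matrix.mulVec, dotProduct, Matrix.of_apply,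
      facetVec, isFacet_simplexIndex]
    refine Finset.sum_congr rfl fun s _ => ?_
    rw [mul_comm]
  · rw [chainVec_eq_zero (by omega)]
    refine (Finset.sum_eq_zero fun k _ => ?_).symm
    by_contra hne
    obtain ⟨hk, hk2⟩ := numVertices_of_chainVec_ne (left_ne_zero_of_mul hne)
    have h1 := right_ne_zero_of_mul hne
    simp only [facetVec, ne_eq, ite_eq_right_iff, one_ne_zero, imp_false, not_not] at h1
    obtain ⟨h2, h3, h4, -⟩ := h1
    apply hi
    rw [numVertices, dif_pos h3] at hk2
    rw [numVertices, dif_pos h2]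
    omega

/-- This includes `d = 0`, where every chain is a cycle, as the empty set is not a simplex. -/
theorem mem_cycles_iff (x : Chain K d) : x ∈ cycles K d ↔ boundaryVec σ (chainVec σ x) = 0 := by
  cases d with
  | zero =>
    refine ⟨fun _ => ?_, fun _ => trivial⟩
    funext i
    rw [boundaryVec_apply]
    refine Finset.sum_eq_zero fun k _ => ?_
    by_contra hne
    obtain ⟨hk, hk2⟩ := numVertices_of_chainVec_ne (left_ne_zero_of_mul hne)
    have h1 := right_ne_zero_of_mul hne
    simp only [facetVec, ne_eq, ite_eq_right_iff, one_ne_zero, imp_false, not_not] at h1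
    obtain ⟨h2, h3, h4, -⟩ := h1
    rw [numVertices, dif_pos h3] at hk2
    have h5 : (σ ⟨i, h2⟩).1 = ∅ := Finset.card_eq_zero.1 (by omega)
    have h6 := (K.isRelLowerSet_faces (σ ⟨i, h2⟩).2).1
    rw [h5] at h6
    simp at h6
  | succ d =>
    rw [← chainVec_boundary, show (0 : Vec) = chainVec σ (0 : Chain K d) by simp,
      chainVec_injective.eq_iff]
    rfl

/-- The vectors of the boundaries are generated by the boundaries of simplices. -/
theorem map_boundaries : (boundaries K d).map (chainVec σ) =
    Submodule.span (ZMod 2) (facetVec σ '' {k | k < n ∧ numVertices σ k = d + 2}) := by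
  classical
  refine le_antisymm ?_ (Submodule.span_le.2 ?_)
  · rintro _ ⟨_, ⟨y, rfl⟩, rfl⟩
    rw [chainVec_boundary, boundaryVec, LinearMap.sum_apply]
    refine Submodule.sum_mem _ fun k hk => ?_
    simp only [LinearMap.smulRight_apply, LinearMap.proj_apply]
    by_cases h : chainVec σ y k = 0
    · rw [h, zero_smul]
      exact Submodule.zero_mem _
    · exact Submodule.smul_mem _ _ (Submodule.subset_span ⟨k, numVertices_of_chainVec_ne h, rfl⟩)
  · rintro _ ⟨k, ⟨hk, hk2⟩, rfl⟩
    obtain ⟨s, rfl, -⟩ := exists_simplexIndex hk hk2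
    refine ⟨boundary K d (Pi.single s 1), ⟨_, rfl⟩, ?_⟩
    rw [chainVec_boundary]
    funext i
    rw [boundaryVec_apply, sum_chainVec _ fun k => facetVec σ k i, Finset.sum_eq_single s]
    · simp
    · intro t _ ht
      rw [Pi.single_eq_of_ne ht, zero_mul]
    · simp

variable (σ) in
/-- The homology group embeds into the vectors modulo the boundaries. -/
noncomputable def homologyVec (d : ℕ) : Homology K d →ₗ[ZMod 2] Vec ⧸ (boundaries K d).map (chainVec σ) :=
  Submodule.mapQ _ _ ((chainVec σ).comp (cycles K d).subtype) fun x hx =>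
    ⟨x.1, hx, rfl⟩

theorem homologyVec_homologyClass (z : cycles K d) :
    homologyVec σ d (homologyClass K d z) = Submodule.Quotient.mk (chainVec σ z.1) := rfl

theorem homologyVec_injective : Function.Injective (homologyVec σ d) := by
  rw [← LinearMap.ker_eq_bot, LinearMap.ker_eq_bot']
  intro x hx
  obtain ⟨z, rfl⟩ := Submodule.Quotient.mk_surjective _ x
  rw [show Submodule.Quotient.mk z = homologyClass K d z from rfl, homologyVec_homologyClass,
    Submodule.Quotient.mk_eq_zero] at hx
  obtain ⟨y, hy, hyz⟩ := hx
  rw [Submodule.Quotient.mk_eq_zero]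
  rw [chainVec_injective hyz] at hy
  exact hy

/-- Membership of a homology class in the span of other classes is decided by vectors. -/
theorem homologyClass_mem_span_iff (z : cycles K d) {ι : Type*} (c : ι → cycles K d) (I : Set ι) :
    homologyClass K d z ∈ Submodule.span (ZMod 2) ((fun i => homologyClass K d (c i)) '' I) ↔
      chainVec σ z.1 ∈ Submodule.span (ZMod 2)
        (facetVec σ '' {k | k < n ∧ numVertices σ k = d + 2} ∪ (fun i => chainVec σ (c i).1) '' I) := by
  have h1 : homologyClass K d z ∈ Submodule.span (ZMod 2) ((fun i => homologyClass K d (c i)) '' I) ↔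
      homologyVec σ d (homologyClass K d z) ∈
        (Submodule.span (ZMod 2) ((fun i => homologyClass K d (c i)) '' I)).map (homologyVec σ d) := by
    constructor
    · exact fun h => ⟨_, h, rfl⟩
    · rintro ⟨y, hy, hyz⟩
      rwa [homologyVec_injective hyz] at hy
  rw [h1, Submodule.map_span, Submodule.span_union, ← map_boundaries, ← Submodule.comap_map_mkQ,
    Submodule.mem_comap, Submodule.map_span, ← Set.image_comp, ← Set.image_comp]
  rfl

end Bridge

/-! ### Candidates for the basis cycles -/

section Candidates

open Elimination

variable {v n d : ℕ} {K : AbstractSimplicialComplex (Fin v)} (σ : Fin n ≃ K.faces)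

/-- The vector of the fundamental cycle of a column `j` which is no pivot column: the simplices are
numbered in the order in which their columns are eliminated by `pos`, the vector `c` is the reduced
column, and `p` tells the pivot rows and `q` the pivot columns. -/
noncomputable def fundamentalVec (n : ℕ) (pos : ℕ → ℕ) (c : Vec) (p : ℕ → ℕ) (q : ℕ → Prop) (j : ℕ) :
    Vec := fun i => open Classical in
  if i < n then if pos i = j then 1 else if pos i < j ∧ q (pos i) then c (p (pos i)) else 0 else 0

/-- The columns of the boundary map of the `d`-simplices, in the order `o` of the simplices. -/
noncomputable def sortedBoundary (d : ℕ) (o : ℕ → ℕ) (j : ℕ) : Vec :=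
  open Classical in if j < n ∧ numVertices σ (o j) = d + 1 then facetVec σ (o j) else 0

variable {σ} {S : ℕ} {o pos p : ℕ → ℕ} {c : ℕ → Vec} {q : ℕ → Prop}

theorem boundaryVec_eq_sum (ho : ∀ j < n, o j < n ∧ pos (o j) = j)
    (hpos : ∀ i < n, pos i < n ∧ o (pos i) = i) (x : Vec) :
    boundaryVec σ x = ∑ j ∈ Finset.range n, x (o j) • facetVec σ (o j) := by
  funext i
  rw [boundaryVec_apply, Finset.sum_apply]
  refine Finset.sum_nbij' pos o ?_ ?_ ?_ ?_ ?_
  · exact fun k hk => Finset.mem_range.2 (hpos k (Finset.mem_range.1 hk)).1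
  · exact fun k hk => Finset.mem_range.2 (ho k (Finset.mem_range.1 hk)).1
  · exact fun k hk => (hpos k (Finset.mem_range.1 hk)).2
  · exact fun k hk => (ho k (Finset.mem_range.1 hk)).2
  · intro k hk
    rw [(hpos k (Finset.mem_range.1 hk)).2]
    rfl

theorem numVertices_of_pivot (h : IsElimination S (sortedBoundary σ d o) c p q) {j : ℕ} (hj : j < S)
    (hq : q j) : j < n ∧ numVertices σ (o j) = d + 1 := by
  classical
  by_contra hne
  have h1 := h.eq_comp j hj
  have h2 : sortedBoundary σ d o j = 0 := by rw [sortedBoundary, if_neg hne]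
  rw [h2, map_zero] at h1
  have h3 := (h.pivot j hj hq).1
  rw [h1] at h3
  exact zero_ne_one h3

/-- The fundamental cycle is supported on the simplices of its own position and of earlier ones. -/
theorem fundamentalVec_support (h : IsElimination S (sortedBoundary σ d o) c p q) (hnS : n ≤ S)
    (hpos : ∀ i < n, pos i < n ∧ o (pos i) = i) {j i : ℕ} (hj : numVertices σ (o j) = d + 1)
    (hi : fundamentalVec n pos (c j) p q j i ≠ 0) :
    i < n ∧ numVertices σ i = d + 1 ∧ pos i ≤ j := by
  unfold fundamentalVec at hi
  split_ifs at hi with h1 h2 h3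
  · refine ⟨h1, ?_, h2.le⟩
    rwa [← h2, (hpos i h1).2] at hj
  · refine ⟨h1, ?_, h3.1.le⟩
    have := (numVertices_of_pivot h ((hpos i h1).1.trans_le hnS) h3.2).2
    rwa [(hpos i h1).2] at this
  · exact absurd rfl hi
  · exact absurd rfl hi

/-- By `IsElimination.eq_sum`, the column is the sum of the earlier pivot columns which the entries
of the reduced column in the pivot rows select; this makes the fundamental cycle a cycle. -/
theorem boundaryVec_fundamentalVec (h : IsElimination S (sortedBoundary σ d o) c p q) (hnS : n ≤ S)
    (ho : ∀ j < n, o j < n ∧ pos (o j) = j) (hpos : ∀ i < n, pos i < n ∧ o (pos i) = i) {j : ℕ}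
    (hjn : j < n) (hj : numVertices σ (o j) = d + 1) (hq : ¬ q j) :
    boundaryVec σ (fundamentalVec n pos (c j) p q j) = 0 := by
  classical
  rw [boundaryVec_eq_sum ho hpos]
  have hterm : ∀ k ∈ Finset.range n, fundamentalVec n pos (c j) p q j (o k) • facetVec σ (o k) =
      (if k = j then sortedBoundary σ d o j else 0) +
      if k < j then (if q k then c j (p k) else 0) • sortedBoundary σ d o k else 0 := by
    intro k hk
    rw [Finset.mem_range] at hk
    simp only [fundamentalVec, (ho k hk).1, (ho k hk).2, if_true]
    by_cases h1 : k = j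
    · subst h1
      simp [sortedBoundary, hjn, hj]
    · by_cases h2 : k < j ∧ q k
      · have := (numVertices_of_pivot h (by omega) h2.2).2
        simp [h1, h2, sortedBoundary, hk, this]
      · by_cases h3 : k < j
        · have : ¬ q k := fun h4 => h2 ⟨h3, h4⟩
          simp [h1, this]
        · simp [h1, h3]
  rw [Finset.sum_congr rfl hterm, Finset.sum_add_distrib, Finset.sum_ite_eq', if_pos (by simpa),
    ← Finset.sum_filter, show (Finset.range n).filter (· < j) = Finset.range j by
      ext k; simp; omega]
  have h1 := h.eq_sum (j := j) (by omega) hq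
  conv_lhs => rw [h1]
  rw [IsElimination.zmod_two_add_self]

theorem zmod_two_eq_one {a : ZMod 2} (h : a ≠ 0) : a = 1 := by
  revert a
  decide

/-- The fundamental cycles up to a position generate all cycles that are supported up to it. -/
theorem mem_span_fundamentalVec (h : IsElimination S (sortedBoundary σ d o) c p q) (hnS : n ≤ S)
    (ho : ∀ j < n, o j < n ∧ pos (o j) = j) (hpos : ∀ i < n, pos i < n ∧ o (pos i) = i) {J : ℕ}
    (hJ : J ≤ n) : ∀ x : Vec, boundaryVec σ x = 0 →
    (∀ i, x i ≠ 0 → i < n ∧ numVertices σ i = d + 1 ∧ pos i < J) →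
    x ∈ Submodule.span (ZMod 2) ((fun j => fundamentalVec n pos (c j) p q j) ''
      {j | j < J ∧ numVertices σ (o j) = d + 1 ∧ ¬ q j}) := by
  classical
  induction J with
  | zero =>
    intro x _ hx
    rw [show x = 0 from funext fun i => by by_contra hi; exact absurd (hx i hi).2.2 (by omega)]
    exact Submodule.zero_mem _
  | succ J ih =>
    intro x hx0 hx
    have hmono : ({j | j < J ∧ numVertices σ (o j) = d + 1 ∧ ¬ q j} : Set ℕ) ⊆
        {j | j < J + 1 ∧ numVertices σ (o j) = d + 1 ∧ ¬ q j} := fun j hj =>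
      ⟨by have := hj.1; omega, hj.2⟩
    by_cases hxJ : x (o J) = 0
    · refine Submodule.span_mono (Set.image_mono hmono) (ih (by omega) x hx0 fun i hi => ?_)
      obtain ⟨h1, h2, h3⟩ := hx i hi
      refine ⟨h1, h2, lt_of_le_of_ne (by omega) fun h4 => hi ?_⟩
      rw [← (hpos i h1).2, h4, hxJ]
    · have hd := (hx _ hxJ).2.1
      -- the column of the last simplex is the sum of the earlier ones, hence no pivot column
      have hq : ¬ q J := by
        intro hq
        refine h.notMem_span (by omega) hq ?_
        have h1 := boundaryVec_eq_sum (σ := σ) ho hpos x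
        rw [hx0, ← Finset.add_sum_erase _ _ (Finset.mem_range.2 (show J < n by omega)),
          zmod_two_eq_one hxJ, one_smul] at h1
        have h2 : sortedBoundary σ d o J = facetVec σ (o J) := by
          rw [sortedBoundary, if_pos ⟨by omega, hd⟩]
        rw [h2, eq_neg_of_add_eq_zero_left h1.symm]
        refine Submodule.neg_mem _ (Submodule.sum_mem _ fun k hk => ?_)
        rw [Finset.mem_erase, Finset.mem_range] at hk
        by_cases hk0 : x (o k) = 0
        · rw [hk0, zero_smul]
          exact Submodule.zero_mem _
        · obtain ⟨-, h3, h4⟩ := hx _ hk0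
          rw [(ho k hk.2).2] at h4
          refine Submodule.smul_mem _ _ (Submodule.subset_span ⟨k, ?_, ?_⟩)
          · exact lt_of_le_of_ne (by omega) hk.1
          · rw [sortedBoundary, if_pos ⟨hk.2, h3⟩]
      set y := fundamentalVec n pos (c J) p q J with hy
      have hyJ : y (o J) = 1 := by
        rw [hy, fundamentalVec, if_pos (ho J (by omega)).1, if_pos (ho J (by omega)).2]
      have hx1 : x = (x + y) + y := by rw [add_assoc, IsElimination.zmod_two_add_self, add_zero]
      rw [hx1]
      refine Submodule.add_mem _ (Submodule.span_mono (Set.image_mono hmono)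
        (ih (by omega) (x + y) ?_ fun i hi => ?_)) (Submodule.subset_span ⟨J, ⟨by omega, hd, hq⟩, rfl⟩)
      · rw [map_add, hx0, boundaryVec_fundamentalVec h hnS ho hpos (by omega) hd hq, add_zero]
      · have h5 : i < n ∧ numVertices σ i = d + 1 ∧ pos i ≤ J := by
          by_cases hxi : x i = 0
          · refine fundamentalVec_support h hnS hpos hd (i := i) fun h6 => hi ?_
            rw [Pi.add_apply, hxi, zero_add]
            exact h6
          · obtain ⟨h6, h7, h8⟩ := hx i hxi
            exact ⟨h6, h7, by omega⟩
        refine ⟨h5.1, h5.2.1, lt_of_le_of_ne h5.2.2 fun h6 => hi ?_⟩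
        rw [← (hpos i h5.1).2, h6, Pi.add_apply, hyJ, zmod_two_eq_one hxJ]
        rfl

end Candidates

/-! ### The invariant of the greedy construction -/

section Greedy

open Elimination

variable {v n d : ℕ} {K : AbstractSimplicialComplex (Fin v)} (σ : Fin n ≃ K.faces)
  (w : Finset (Fin v) → ℝ≥0)

/-- The distance from the vertex `p` to the simplex with number `i`. -/
noncomputable def simplexKey (p : Fin v) (i : ℕ) : ℝ≥0∞ :=
  if h : i < n then simplexDist K w p (σ ⟨i, h⟩).1 else 0

/-- The chain with the vector `x` lies in the ball of radius `r` around `p`. -/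
def InBall (p : Fin v) (r : ℝ≥0∞) (x : Vec) : Prop := ∀ i, x i ≠ 0 → simplexKey σ w p i ≤ r

variable {σ w}

theorem inBall_iff {p : Fin v} {r : ℝ≥0∞} {z : Chain K d} :
    InBall σ w p r (chainVec σ z) ↔ ∀ s : Simplex K d, z s ≠ 0 → simplexDist K w p s.1 ≤ r := by
  have hkey : ∀ s : Simplex K d, simplexKey σ w p (simplexIndex σ s) = simplexDist K w p s.1 := by
    intro s
    rw [simplexKey, dif_pos (simplexIndex σ s).2]
    simp [simplexIndex]
  constructor
  · intro h s hs
    rw [← hkey]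
    exact h _ (by rwa [chainVec_simplexIndex])
  · intro h i hi
    obtain ⟨h1, h2⟩ := numVertices_of_chainVec_ne hi
    obtain ⟨s, rfl, -⟩ := exists_simplexIndex h1 h2
    rw [chainVec_simplexIndex] at hi
    rw [hkey]
    exact h s hi

variable (σ w) in
/-- The invariant of the greedy construction when the balls around the vertices in `P` have been
taken into account: the `g` cycles `c i` are independent, each of them lies in a ball of radius
`key i`, and they generate the cycles in the balls around the vertices in `P` as
`isMinimalHomologyBasis_of_span` demands. -/
structure GreedyBasis (P : Set (Fin v)) (g : ℕ) (c : ℕ → cycles K d) (key : ℕ → ℝ≥0∞) : Prop where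
  indep : LinearIndependent (ZMod 2) fun i : Fin g => homologyClass K d (c i)
  small : ∀ i < g, ∃ p, InBall σ w p (key i) (chainVec σ (c i).1)
  span : ∀ p ∈ P, ∀ r, ∀ z : cycles K d, InBall σ w p r (chainVec σ z.1) →
    homologyClass K d z ∈ Submodule.span (ZMod 2)
      ((fun i => homologyClass K d (c i)) '' {i | i < g ∧ key i ≤ r})

theorem GreedyBasis.isMinimal {g : ℕ} {c : ℕ → cycles K d} {key : ℕ → ℝ≥0∞}
    (h : GreedyBasis σ w Set.univ g c key) : IsMinimalHomologyBasis K w d fun i : Fin g => c i := by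
  refine isMinimalHomologyBasis_of_span _ (fun i => key i) h.indep (fun i => ?_)
    fun p r z hz => ?_
  · obtain ⟨p, hp⟩ := h.small i i.2
    exact cycleSize_le (inBall_iff.1 hp)
  · refine Submodule.span_mono ?_ (h.span p (Set.mem_univ p) r z (inBall_iff.2 hz))
    rintro _ ⟨i, ⟨hi, hr⟩, rfl⟩
    exact ⟨⟨i, hi⟩, hr, rfl⟩

/-- The basis has at most as many members as there are simplices, so `n` rows suffice to store
it. -/
theorem GreedyBasis.le {P : Set (Fin v)} {g : ℕ} {c : ℕ → cycles K d} {key : ℕ → ℝ≥0∞}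
    (h : GreedyBasis σ w P g c key) : g ≤ n := by
  have h1 := h.indep.fintype_card_le_finrank
  have h2 := ((boundaries K d).submoduleOf (cycles K d)).finrank_quotient_le
  have h3 := (cycles K d).finrank_le
  rw [Module.finrank_fintype_fun_eq_card] at h3
  have h4 := Fintype.card_le_of_injective _ (simplexIndex_injective (σ := σ) (d := d))
  rw [Fintype.card_fin] at h1 h4
  exact h1.trans (h2.trans (h3.trans h4))

theorem linearIndependent_of_notMem_span {M : Type*} [AddCommGroup M] [Module (ZMod 2) M]
    {f : ℕ → M} {g : ℕ} (h : ∀ i < g, f i ∉ Submodule.span (ZMod 2) (f '' Set.Iio i)) :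
    LinearIndependent (ZMod 2) fun i : Fin g => f i := by
  induction g with
  | zero => exact linearIndependent_empty_type
  | succ g ih =>
    rw [linearIndependent_finSucc']
    refine ⟨ih fun i hi => h i (by omega), fun hmem => h g (by omega) ?_⟩
    refine Submodule.span_mono ?_ hmem
    rintro _ ⟨i, rfl⟩
    exact ⟨i, i.2, rfl⟩

/-- The columns of the second elimination: the boundaries, followed by the items. -/
noncomputable def itemColumn (σ : Fin n ≃ K.faces) (d N : ℕ) (x : ℕ → Vec) (k : ℕ) : Vec :=
  open Classical in if k < n then if numVertices σ k = d + 2 then facetVec σ k else 0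
    else if k < n + N then x (k - n) else 0

/-- The greedy step: from the items, which include the old basis and generate the cycles in the
balls around a further vertex, and which are sorted by their keys, those are selected which are
independent of the earlier ones. -/
theorem GreedyBasis.step {P : Set (Fin v)} {g g' N S : ℕ} {c c' : ℕ → cycles K d}
    {key key' : ℕ → ℝ≥0∞} {item : ℕ → cycles K d} {ikey : ℕ → ℝ≥0∞} {p₀ : Fin v} {e : ℕ → Vec}
    {pv : ℕ → ℕ} {q : ℕ → Prop} {se : ℕ → ℕ}
    (h : GreedyBasis σ w P g c key)
    (hold : ∀ i < g, ∃ t < N, item t = c i ∧ ikey t = key i)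
    (hsmall : ∀ t < N, ∃ p, InBall σ w p (ikey t) (chainVec σ (item t).1))
    (hnew : ∀ r, ∀ z : cycles K d, InBall σ w p₀ r (chainVec σ z.1) →
      homologyClass K d z ∈ Submodule.span (ZMod 2)
        ((fun t => homologyClass K d (item t)) '' {t | t < N ∧ ikey t ≤ r}))
    (hmono : ∀ t t', t ≤ t' → t' < N → ikey t ≤ ikey t')
    (helim : IsElimination S (itemColumn σ d N fun t => chainVec σ (item t).1) e pv q)
    (hS : n + N ≤ S)
    (hse : ∀ i < g', se i < N ∧ q (n + se i) ∧ c' i = item (se i) ∧ key' i = ikey (se i))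
    (hse' : ∀ t < N, q (n + t) → ∃ i < g', se i = t) (hsm : ∀ i j, i < j → j < g' → se i < se j) :
    GreedyBasis σ w (insert p₀ P) g' c' key' := by
  classical
  have hcol : ∀ t < N, itemColumn σ d N (fun t => chainVec σ (item t).1) (n + t) =
      chainVec σ (item t).1 := by
    intro t ht
    rw [itemColumn, if_neg (by omega), if_pos (by omega), Nat.add_sub_cancel_left]
  -- the selected items generate all earlier items
  have hgen : ∀ t < N, ∀ r, ikey t ≤ r → homologyClass K d (item t) ∈ Submodule.span (ZMod 2)
      ((fun i => homologyClass K d (c' i)) '' {i | i < g' ∧ key' i ≤ r}) := by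
    intro t ht r hr
    rw [homologyClass_mem_span_iff (σ := σ), ← hcol t ht]
    refine Submodule.span_le.2 ?_ (helim.mem_span (show n + t < S by omega))
    rintro _ ⟨k, ⟨hk, hqk⟩, rfl⟩
    by_cases hkn : k < n
    · by_cases hk2 : numVertices σ k = d + 2
      · rw [itemColumn, if_pos hkn, if_pos hk2]
        exact Submodule.subset_span (Or.inl ⟨k, ⟨hkn, hk2⟩, rfl⟩)
      · rw [itemColumn, if_pos hkn, if_neg hk2]
        exact Submodule.zero_mem _
    · obtain ⟨u, rfl⟩ := Nat.exists_eq_add_of_le (not_lt.1 hkn)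
      obtain ⟨i, hi, rfl⟩ := hse' u (by omega) hqk
      obtain ⟨h1, h2, h3, h4⟩ := hse i hi
      rw [hcol _ h1]
      refine Submodule.subset_span (Or.inr ⟨i, ⟨hi, ?_⟩, ?_⟩)
      · rw [h4]
        exact (hmono _ t (by omega) ht).trans hr
      · simp only [h3]
  have hgen' : ∀ r, Submodule.span (ZMod 2)
      ((fun t => homologyClass K d (item t)) '' {t | t < N ∧ ikey t ≤ r}) ≤
      Submodule.span (ZMod 2) ((fun i => homologyClass K d (c' i)) '' {i | i < g' ∧ key' i ≤ r}) := by
    intro r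
    refine Submodule.span_le.2 ?_
    rintro _ ⟨t, ⟨ht, hr⟩, rfl⟩
    exact hgen t ht r hr
  refine ⟨linearIndependent_of_notMem_span (f := fun i => homologyClass K d (c' i))
    fun i hi hmem => ?_, fun i hi => ?_, fun p hp r z hz => ?_⟩
  · obtain ⟨h1, h2, h3, h4⟩ := hse i hi
    rw [homologyClass_mem_span_iff (σ := σ), h3, ← hcol _ h1] at hmem
    refine helim.notMem_span (by omega) h2 (Submodule.span_le.2 ?_ hmem)
    rintro _ (⟨k, ⟨hk, hk2⟩, rfl⟩ | ⟨j, hj, rfl⟩)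
    · refine Submodule.subset_span ⟨k, by simp; omega, ?_⟩
      rw [itemColumn, if_pos hk, if_pos hk2]
    · rw [Set.mem_Iio] at hj
      obtain ⟨h5, h6, h7, -⟩ := hse j (by omega)
      refine Submodule.subset_span ⟨n + se j, ?_, ?_⟩
      · rw [Set.mem_Iio]
        have := hsm j i hj hi
        omega
      · simp only [h7, hcol _ h5]
  · obtain ⟨h1, h2, h3, h4⟩ := hse i hi
    rw [h3, h4]
    exact hsmall _ h1
  · rcases hp with rfl | hp
    · exact hgen' r (hnew r z hz)
    · refine hgen' r (Submodule.span_mono ?_ (h.span p hp r z hz))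
      rintro _ ⟨i, ⟨hi, hr⟩, rfl⟩
      obtain ⟨t, ht, h1, h2⟩ := hold i hi
      exact ⟨t, ⟨ht, by rwa [h2]⟩, by simp only [h1]⟩

end Greedy

/-! ### Shortest paths -/

section Distance

variable {V : Type*} [DecidableEq V] {K : AbstractSimplicialComplex V}
  {w : Finset V → ℝ≥0} {p q a b : V}

theorem walkLength_cons (h : (oneSkeleton K).Adj p a) (π : (oneSkeleton K).Walk a q) :
    walkLength K w (.cons h π) = w {p, a} + walkLength K w π := by
  simp [walkLength]

theorem walkLength_append (π : (oneSkeleton K).Walk p a) (π' : (oneSkeleton K).Walk a q) :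
    walkLength K w (π.append π') = walkLength K w π + walkLength K w π' := by
  simp [walkLength]

theorem walkLength_bypass_le (π : (oneSkeleton K).Walk p q) :
    walkLength K w π.bypass ≤ walkLength K w π := by
  induction π with
  | nil => exact le_rfl
  | @cons u a q h π ih =>
    rw [walkLength_cons]
    simp only [SimpleGraph.Walk.bypass]
    split_ifs with hs
    · refine le_trans ?_ (ih.trans le_add_self)
      conv_rhs => rw [← π.bypass.take_spec hs, walkLength_append]
      exact le_add_self
    · rw [walkLength_cons]
      gcongr

theorem geodesicDist_self : geodesicDist K w p p = 0 :=
  le_antisymm (iInf_le_of_le .nil (by simp [walkLength])) zero_le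

theorem geodesicDist_le_add (h : (oneSkeleton K).Adj a b) :
    geodesicDist K w p b ≤ geodesicDist K w p a + w {a, b} := by
  rw [geodesicDist, geodesicDist, ENNReal.iInf_add]
  refine le_iInf fun π => (iInf_le _ (π.append (.cons h .nil))).trans_eq ?_
  rw [walkLength_append, walkLength_cons]
  simp [walkLength]

theorem walkLength_concat (π : (oneSkeleton K).Walk p a) (h : (oneSkeleton K).Adj a q) :
    walkLength K w (π.concat h) = walkLength K w π + w {a, q} := by
  rw [SimpleGraph.Walk.concat, walkLength_append, walkLength_cons]
  simp [walkLength]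

/-- One round of the algorithm of Bellman and Ford: if all edges have been used to improve the
upper bounds `E` to `E'`, then walks with one edge more are taken into account. -/
theorem le_walkLength_succ {E E' : V → ℝ≥0∞} {k : ℕ}
    (h : ∀ q (π : (oneSkeleton K).Walk p q), π.length ≤ k → E q ≤ walkLength K w π)
    (hle : ∀ q, E' q ≤ E q) (hstep : ∀ a b, (oneSkeleton K).Adj a b → E' b ≤ E a + w {a, b}) (q : V)
    (π : (oneSkeleton K).Walk p q) (hπ : π.length ≤ k + 1) : E' q ≤ walkLength K w π := by
  cases π with
  | nil => exact (hle p).trans (h p .nil (by simp))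
  | cons h' π =>
    obtain ⟨a, π', h'', he⟩ := SimpleGraph.Walk.exists_cons_eq_concat h' π
    rw [he, SimpleGraph.Walk.length_concat] at hπ
    rw [he, walkLength_concat]
    calc E' q ≤ E a + w {a, q} := hstep a q h''
      _ ≤ walkLength K w π' + w {a, q} := by gcongr; exact h a π' (by omega)

/-- Walks with at most as many edges as there are vertices determine the distances. -/
theorem eq_geodesicDist [Fintype V] {E : V → ℝ≥0∞} (hE : ∀ q, geodesicDist K w p q ≤ E q)
    (h : ∀ q (π : (oneSkeleton K).Walk p q), π.length ≤ Fintype.card V → E q ≤ walkLength K w π)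
    (q : V) : E q = geodesicDist K w p q :=
  le_antisymm (le_iInf fun π => (h q π.bypass π.bypass_isPath.length_lt.le).trans
    (walkLength_bypass_le π)) (hE q)

end Distance

namespace RAM

/-! ### The distances from a vertex to the simplices -/

section Program

open RAM.Expr

/-- Improve the distance of an end of the edge in register `42` by way of its other end; the word
arrays `e` and `e'` hold the ends of the edges. -/
def relax (e e' : ℕ) : Cmd :=
  .ite (arr 13 (arr e (reg 42))) (.assign 24 (const 0)) <|
  .seq (.radd 3 (const 0) 1 (arr e (reg 42)) 0 (reg 42)) <|
  .ite (arr 13 (arr e' (reg 42)) + rlt 3 (const 0) 1 (arr e' (reg 42)))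
    (.seq (.radd 1 (arr e' (reg 42)) 3 (const 0) 4 (const 0)) (.store 13 (arr e' (reg 42)) (const 0)))
    (.assign 24 (const 0))

/-- Use all edges to improve the distances. -/
def relaxAll : Cmd :=
  .loop 42 0 <| .ite (eq (arr 1 (reg 42)) (const 2)) (.seq (relax 11 12) (relax 12 11))
    (.assign 24 (const 0))

/-- The distances of the vertices from the vertex in register `40`. -/
def distances : Cmd :=
  .seq (.loop 43 1 (.radd 1 (reg 43) 4 (const 0) 4 (const 0))) <|
  .seq (fill 13 1 (const 1 - eq (reg 16) (reg 40))) <| .loop 41 1 relaxAll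

/-- Take the distance of the vertex in register `43` into account for the distance of the simplex
in register `42`. -/
def maxDistance : Cmd :=
  .ite (arr 0 (reg 42 * reg 1 + reg 43))
    (.ite (arr 13 (reg 43)) (.store 14 (reg 40 * reg 0 + reg 42) (const 1)) <|
      .ite (rlt 2 (reg 40 * reg 0 + reg 42) 1 (reg 43))
        (.radd 2 (reg 40 * reg 0 + reg 42) 1 (reg 43) 4 (const 0)) (.assign 24 (const 0)))
    (.assign 24 (const 0))

/-- The distance of the simplex in register `42`. -/
def simplexDistance : Cmd :=
  .seq (.store 14 (reg 40 * reg 0 + reg 42) (const 0)) <|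
  .seq (.radd 2 (reg 40 * reg 0 + reg 42) 4 (const 0) 4 (const 0)) <| .loop 43 1 maxDistance

/-- The distances of all simplices from the vertex in register `40`. -/
def simplexDistances : Cmd := .seq distances (.loop 42 0 simplexDistance)

end Program

/-- The extended non-negative real number with the value `x`, or infinity if the flag is set. -/
noncomputable def flagged (f : ℕ) (x : ℝ) : ℝ≥0∞ := if f = 0 then ENNReal.ofReal x else ⊤

/-- The current distance of the vertex `q`. -/
noncomputable def distVal (s : Memory) (q : ℕ) : ℝ≥0∞ := flagged (s.wordArray 13 q) (s.realArray 1 q)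

/-- The distance at position `x` of the table of all distances between vertices and simplices. -/
noncomputable def keyVal (s : Memory) (x : ℕ) : ℝ≥0∞ := flagged (s.wordArray 14 x) (s.realArray 2 x)

/-- The tables which describe the complex. -/
structure Describes {v n : ℕ} {K : AbstractSimplicialComplex (Fin v)} (σ : Fin n ≃ K.faces)
    (w : Finset (Fin v) → ℝ≥0) (d : ℕ) (s : Memory) : Prop where
  n_eq : s.word 0 = n
  v_eq : s.word 1 = v
  d_eq : s.word 2 = d
  zero : ∀ x, s.realArray 4 x = 0
  inc : ∀ (i : Fin n) (q : Fin v), s.wordArray 0 (i * v + q) = if q ∈ (σ i).1 then 1 else 0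
  weight : ∀ i : Fin n, (σ i).1.card = 2 → s.realArray 0 i = w (σ i).1
  card : ∀ i < n, s.wordArray 1 i = numVertices σ i
  ends : ∀ i : Fin n, (σ i).1.card = 2 → ∃ a b : Fin v, a ≠ b ∧ (σ i).1 = {a, b} ∧
    s.wordArray 11 i = a ∧ s.wordArray 12 i = b
  facet : ∀ i < n, ∀ k < n, s.wordArray 2 (i * n + k) = open Classical in
    if IsFacet σ i k then 1 else 0

theorem Describes.congr {v n d : ℕ} {K : AbstractSimplicialComplex (Fin v)} {σ : Fin n ≃ K.faces}
    {w : Finset (Fin v) → ℝ≥0} {s s' : Memory} (h : Describes σ w d s)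
    (hw : ∀ r < 3, s'.word r = s.word r) (ha : ∀ A, A < 3 ∨ A = 11 ∨ A = 12 →
      s'.wordArray A = s.wordArray A) (h0 : s'.realArray 0 = s.realArray 0)
    (h4 : s'.realArray 4 = s.realArray 4) : Describes σ w d s' where
  n_eq := (hw 0 (by omega)).trans h.n_eq
  v_eq := (hw 1 (by omega)).trans h.v_eq
  d_eq := (hw 2 (by omega)).trans h.d_eq
  zero := by rw [h4]; exact h.zero
  inc := by rw [ha 0 (by omega)]; exact h.inc
  weight := by rw [h0]; exact h.weight
  card := by rw [ha 1 (by omega)]; exact h.card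
  ends := by rw [ha 11 (by omega), ha 12 (by omega)]; exact h.ends
  facet := by rw [ha 2 (by omega)]; exact h.facet

/-- A command that does not write to the tables preserves them. -/
theorem Describes.fixes {v n d : ℕ} {K : AbstractSimplicialComplex (Fin v)} {σ : Fin n ≃ K.faces}
    {w : Finset (Fin v) → ℝ≥0} {s s' : Memory} {c : Cmd} (h : Describes σ w d s) (hf : c.Fixes s s')
    (h1 : ∀ r < 3, c.assigns r = false := by decide)
    (h2 : ∀ A, A < 13 → A < 3 ∨ A = 11 ∨ A = 12 → c.stores A = false := by decide)
    (h3 : c.rstores 0 = false := by decide) (h4 : c.rstores 4 = false := by decide) :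
    Describes σ w d s' :=
  h.congr (fun r hr => hf.1 r (h1 r hr)) (fun A hA => hf.2 A (h2 A (by omega) hA)) (hf.3 0 h3)
    (hf.3 4 h4)

theorem Describes.setWord {v n d : ℕ} {K : AbstractSimplicialComplex (Fin v)} {σ : Fin n ≃ K.faces}
    {w : Finset (Fin v) → ℝ≥0} {s : Memory} (h : Describes σ w d s) {r : ℕ} (x : ℕ) (hr : 3 ≤ r) :
    Describes σ w d (s.setWord r x) :=
  h.congr (fun r' hr' => by rw [word_setWord, if_neg (by omega)]) (fun _ _ => rfl) rfl rfl

/-- The improvement respects infinite distances, which are marked by flags. -/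
theorem relax_ok {M e e' i a b : ℕ} {x : ℝ≥0} {s : Memory} (hM : 2 ≤ M) (he : e = 11 ∨ e = 12)
    (he' : e' = 11 ∨ e' = 12) (hi : s.word 42 = i) (ha : s.wordArray e i = a)
    (hb : s.wordArray e' i = b) (hx : s.realArray 0 i = x) (hz : s.realArray 4 0 = 0)
    (hD : ∀ q, 0 ≤ s.realArray 1 q) :
    Ok M (relax e e') s fun s' => (∀ q, 0 ≤ s'.realArray 1 q) ∧
      distVal s' b = min (distVal s b) (distVal s a + x) ∧
      ∀ q, q ≠ b → distVal s' q = distVal s q := by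
  have h13 : e ≠ 13 ∧ e' ≠ 13 := by omega
  refine Ok.ite (fun h => ?_) fun h => ?_
  · refine Ok.assign (by simp; omega) ⟨by simpa using hD, ?_, fun q _ => rfl⟩
    simp [hi, ha] at h
    have : distVal s a = ⊤ := by rw [distVal, flagged, if_neg (by omega)]
    rw [this, top_add, min_top_right]
    rfl
  · simp [hi, ha] at h
    have hva : distVal s a + x = ENNReal.ofReal (s.realArray 1 a + x) := by
      rw [distVal, flagged, if_pos h, ENNReal.ofReal_add (hD a) x.coe_nonneg, ENNReal.ofReal_coe_nnreal]
    rw [hva]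
    refine Ok.seq (Ok.radd (Ok.ite (fun h' => ?_) fun h' => ?_))
    · simp [hi, ha, hb, hx] at h'
      refine Ok.seq (Ok.radd (Ok.store (by simp; omega) ?_))
      simp [hi, ha, hb, hx, hz, distVal, flagged]
      refine ⟨fun q => ?_, ?_, fun q hq => ?_⟩
      · rw [Function.update_apply]
        split_ifs
        · exact add_nonneg (hD a) x.coe_nonneg
        · exact hD q
      · split_ifs with h1
        · refine ENNReal.ofReal_le_ofReal ?_
          rcases h' with h' | h'
          · omega
          · split_ifs at h' with h2
            · exact h2.le
            · omega
        · exact le_top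
      · simp [hq]
    · simp [hi, ha, hb, hx] at h'
      refine Ok.assign (by simp; omega) ?_
      simp [distVal, flagged]
      refine ⟨hD, ?_⟩
      rw [if_pos h'.1]
      refine ENNReal.ofReal_le_ofReal ?_
      exact h'.2

section

variable {v n d : ℕ} {K : AbstractSimplicialComplex (Fin v)} {σ : Fin n ≃ K.faces}
  {w : Finset (Fin v) → ℝ≥0} {s : Memory} {M : ℕ} {p : Fin v}

theorem adj_iff_exists {a b : Fin v} : (oneSkeleton K).Adj a b ↔
    ∃ i : Fin n, a ≠ b ∧ (σ i).1 = {a, b} := by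
  constructor
  · rintro ⟨h1, h2⟩
    exact ⟨σ.symm ⟨_, h2⟩, h1, by simp⟩
  · rintro ⟨i, h1, h2⟩
    exact ⟨h1, h2 ▸ (σ i).2⟩

/-- The distances stored remain upper bounds, and satisfy the hypothesis of `le_walkLength_succ`
afterwards. -/
theorem relaxAll_ok (hM : 2 ≤ M) (hs : Describes σ w d s) (hD : ∀ q, 0 ≤ s.realArray 1 q)
    (hle : ∀ q : Fin v, geodesicDist K w p q ≤ distVal s q) :
    Ok M relaxAll s fun s' => (∀ q, 0 ≤ s'.realArray 1 q) ∧
      (∀ q : Fin v, geodesicDist K w p q ≤ distVal s' q) ∧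
      (∀ q : Fin v, distVal s' q ≤ distVal s q) ∧
      ∀ a b : Fin v, (oneSkeleton K).Adj a b → distVal s' b ≤ distVal s a + w {a, b} := by
  refine Ok.loop' (fun k s' => (∀ q, 0 ≤ s'.realArray 1 q) ∧
      (∀ q : Fin v, geodesicDist K w p q ≤ distVal s' q) ∧
      (∀ q : Fin v, distVal s' q ≤ distVal s q) ∧
      ∀ i : Fin n, (i : ℕ) < k → ∀ a b : Fin v, a ≠ b → (σ i).1 = {a, b} →
        distVal s' b ≤ distVal s a + w {a, b}) ?_ ?_ ?_
  · exact ⟨hD, hle, fun q => le_rfl, fun i hi => absurd hi (by omega)⟩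
  · rintro k hk s' hs' ⟨h1, h2, h3, h4⟩
    rw [hs.n_eq] at hk
    have hd := hs.fixes hs'
    have hcard : s'.wordArray 1 k = (σ ⟨k, hk⟩).1.card := by
      rw [hd.card k hk, numVertices, dif_pos hk]
    refine Ok.ite (fun he => ?_) fun he => ?_
    · have h2c : (σ ⟨k, hk⟩).1.card = 2 := by
        by_contra hne
        simp [hcard, hne] at he
      obtain ⟨a, b, hab, hs2, ha, hb⟩ := hd.ends ⟨k, hk⟩ h2c
      have hw := hd.weight ⟨k, hk⟩ h2c
      have hadj : (oneSkeleton K).Adj a b := adj_iff_exists.2 ⟨⟨k, hk⟩, hab, hs2⟩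
      refine (relax_ok (x := w {a, b}) (a := a) (b := b) (i := k) hM (.inl rfl) (.inr rfl)
        (by simp) (by simpa using ha) (by simpa using hb) (by simp [hw, hs2])
        (by simpa using hd.zero 0) (by simpa using h1)).then fun s₁ hs₁ ⟨g1, g2, g3⟩ => ?_
      have hd₁ : Describes σ w d s₁ := (hd.setWord k (by omega)).fixes hs₁
      refine (relax_ok (x := w {a, b}) (a := b) (b := a) (i := k) hM (.inr rfl) (.inl rfl)
        ((hs₁.word 42 rfl).trans (by simp)) (by rw [hs₁.arr 12 rfl]; simpa using hb)
        (by rw [hs₁.arr 11 rfl]; simpa using ha) (by rw [hs₁.rarr 0 rfl]; simp [hw, hs2])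
        (hd₁.zero 0) g1).mono fun s₂ ⟨e1, e2, e3⟩ => ?_
      have hba : (b : ℕ) ≠ a := fun h => hab (Fin.ext h.symm)
      have g3' : ∀ q : ℕ, q ≠ b → distVal s₁ q = distVal s' q := g3
      have g2' : distVal s₁ b = min (distVal s' b) (distVal s' a + w {a, b}) := g2
      have v2b : distVal s₂ b = distVal s₁ b := e3 b hba
      have v1a : distVal s₁ a = distVal s' a := g3' a hba.symm
      have v2a : distVal s₂ a ≤ distVal s' a := by rw [e2, v1a]; exact min_le_left _ _
      have mono : ∀ q : Fin v, distVal s₂ q ≤ distVal s' q := by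
        intro q
        by_cases hqa : q = a
        · rw [hqa]
          exact v2a
        · have hqa' : (q : ℕ) ≠ a := fun h => hqa (Fin.ext h)
          rw [e3 q hqa']
          by_cases hqb : q = b
          · rw [hqb, g2']
            exact min_le_left _ _
          · rw [g3' q fun h => hqb (Fin.ext h)]
      change (∀ q, 0 ≤ s₂.realArray 1 q) ∧ (∀ q : Fin v, geodesicDist K w p q ≤ distVal s₂ q) ∧
        (∀ q : Fin v, distVal s₂ q ≤ distVal s q) ∧ ∀ i : Fin n, (i : ℕ) < k + 1 → ∀ a b : Fin v,
          a ≠ b → (σ i).1 = {a, b} → distVal s₂ b ≤ distVal s a + w {a, b}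
      have low1 : ∀ q : Fin v, geodesicDist K w p q ≤ distVal s₁ q := by
        intro q
        by_cases hqb : q = b
        · rw [hqb, g2']
          exact le_min (h2 b) ((geodesicDist_le_add hadj).trans (by gcongr; exact h2 a))
        · rw [g3' q fun h => hqb (Fin.ext h)]
          exact h2 q
      refine ⟨e1, fun q => ?_, fun q => (mono q).trans (h3 q), fun i hi a' b' hab' hs' => ?_⟩
      · by_cases hqa : q = a
        · rw [hqa, e2]
          refine le_min (low1 a) ((geodesicDist_le_add hadj.symm).trans ?_)
          rw [Finset.pair_comm b a]
          gcongr
          exact low1 b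
        · rw [e3 q fun h => hqa (Fin.ext h)]
          exact low1 q
      · rcases lt_or_eq_of_le (show (i : ℕ) ≤ k by omega) with hi | hi
        · exact (mono b').trans (h4 i hi a' b' hab' hs')
        · have : (σ i).1 = {a, b} := by
            rw [show i = ⟨k, hk⟩ from Fin.ext hi, hs2]
          rw [this] at hs'
          have hmem : a' = a ∧ b' = b ∨ a' = b ∧ b' = a := by
            have m1 : a' ∈ ({a, b} : Finset (Fin v)) := by rw [hs']; simp
            have m2 : b' ∈ ({a, b} : Finset (Fin v)) := by rw [hs']; simp
            simp only [Finset.mem_insert, Finset.mem_singleton] at m1 m2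
            rcases m1 with rfl | rfl <;> rcases m2 with rfl | rfl
            · exact absurd rfl hab'
            · exact .inl ⟨rfl, rfl⟩
            · exact .inr ⟨rfl, rfl⟩
            · exact absurd rfl hab'
          rcases hmem with ⟨rfl, rfl⟩ | ⟨rfl, rfl⟩
          · rw [v2b, g2']
            refine (min_le_right _ _).trans ?_
            gcongr
            exact h3 a'
          · rw [e2, Finset.pair_comm a' b']
            refine (min_le_right _ _).trans ?_
            gcongr
            rw [g2']
            exact (min_le_left _ _).trans (h3 a')
    · refine Ok.assign (by simp; omega) ⟨h1, h2, h3, fun i hi a b hab hi2 => ?_⟩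
      rcases lt_or_eq_of_le (show (i : ℕ) ≤ k by omega) with hi | hi
      · exact h4 i hi a b hab hi2
      · have h5 : (σ i).1.card = 2 := by rw [hi2]; exact Finset.card_pair hab
        rw [show i = ⟨k, hk⟩ from Fin.ext hi, ← hcard] at h5
        simp [h5] at he
  · rintro s' _ ⟨h1, h2, h3, h4⟩
    refine ⟨h1, h2, h3, fun a b hab => ?_⟩
    obtain ⟨i, h5, h6⟩ := (adj_iff_exists (σ := σ)).1 hab
    exact h4 i (by rw [hs.n_eq]; exact i.2) a b h5 h6

end

end RAM

namespace RAM

section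

variable {v n d : ℕ} {K : AbstractSimplicialComplex (Fin v)} {σ : Fin n ≃ K.faces}
  {w : Finset (Fin v) → ℝ≥0} {s : Memory} {M : ℕ} {p : Fin v}

theorem distances_ok (hM : 2 ≤ M) (hs : Describes σ w d s) (hp : s.word 40 = p)
    (hD : ∀ q, 0 ≤ s.realArray 1 q) :
    Ok M distances s fun s' => (∀ q, 0 ≤ s'.realArray 1 q) ∧
      ∀ q : Fin v, distVal s' q = geodesicDist K w p q := by
  have h1 : Ok M (.loop 43 1 (.radd 1 (.reg 43) 4 (.const 0) 4 (.const 0))) s fun s' =>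
      (∀ q, 0 ≤ s'.realArray 1 q) ∧ ∀ q < v, s'.realArray 1 q = 0 := by
    refine Ok.loop' (fun k s' => (∀ q, 0 ≤ s'.realArray 1 q) ∧ ∀ q < k, s'.realArray 1 q = 0)
      ⟨hD, by simp⟩ ?_ ?_
    · rintro k _ s' hs' ⟨h1, h2⟩
      have h4 : s'.realArray 4 0 = 0 := by rw [hs'.rarr 4 rfl]; exact hs.zero 0
      refine Ok.radd ?_
      simp only [realArray_setWord, realArray_setRArr, Expr.eval_reg, Expr.eval_const, word_setWord,
        if_true, setWord_setRArr, h4, add_zero]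
      refine ⟨fun q => ?_, fun q hq => ?_⟩
      · rw [Function.update_apply]
        split_ifs
        · exact le_rfl
        · exact h1 q
      · rw [Function.update_apply]
        split_ifs with h
        · rfl
        · exact h2 q (by omega)
    · rintro s' _ ⟨h1, h2⟩
      exact ⟨h1, by rwa [hs.v_eq] at h2⟩
  refine h1.then fun s₁ hs₁ ⟨hD₁, hz₁⟩ => ?_
  have d₁ := hs.fixes hs₁
  have h40 : s₁.word 40 = p := (hs₁.word 40 rfl).trans hp
  refine (Ok.fill (fun q => if q = p then 0 else 1) ?_ ?_ rfl).then fun s₂ hs₂ h₂ => ?_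
  · intro q _ f _
    simp [h40]
    split_ifs <;> rfl
  · intro q _
    split_ifs <;> omega
  have d₂ := d₁.fixes hs₂
  have r₂ : s₂.realArray 1 = s₁.realArray 1 := hs₂.rarr 1 rfl
  have hval : ∀ q : Fin v, distVal s₂ q = if q = p then 0 else ⊤ := by
    intro q
    have h13 : s₂.wordArray 13 q = if (q : ℕ) = p then 0 else 1 := by
      rw [← h₂]
      simp [d₁.v_eq]
    by_cases hqp : q = p
    · rw [distVal, h13, r₂, hz₁ q q.2, if_pos hqp, if_pos (by rw [hqp]), flagged, if_pos rfl,
        ENNReal.ofReal_zero]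
    · rw [distVal, h13, if_neg hqp, if_neg fun h => hqp (Fin.ext h), flagged, if_neg (by omega)]
  refine Ok.loop' (fun k s' => (∀ q, 0 ≤ s'.realArray 1 q) ∧
    (∀ q : Fin v, geodesicDist K w p q ≤ distVal s' q) ∧
    ∀ q (π : (oneSkeleton K).Walk p q), π.length ≤ k → distVal s' q ≤ walkLength K w π) ?_ ?_ ?_
  · refine ⟨by rwa [r₂], fun q => ?_, fun q π hπ => ?_⟩
    · rw [hval]
      split_ifs with h
      · rw [h, geodesicDist_self]
      · exact le_top
    · cases π with
      | nil => rw [hval, if_pos rfl]; exact zero_le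
      | cons h π => simp at hπ
  · rintro k _ s' hs' ⟨h1, h2, h3⟩
    refine (relaxAll_ok (p := p) hM ((d₂.fixes hs').setWord k (by omega)) (by simpa using h1) h2).mono
      fun s'' ⟨g1, g2, g3, g4⟩ => ⟨g1, g2, fun q π hπ => ?_⟩
    exact le_walkLength_succ (E := fun q : Fin v => distVal s' q)
      (E' := fun q : Fin v => distVal s'' q) h3 g3 g4 q π hπ
  · rintro s' _ ⟨h1, h2, h3⟩
    refine ⟨h1, fun q => ?_⟩
    refine eq_geodesicDist (E := fun q : Fin v => distVal s' q) h2 (fun q π hπ => h3 q π ?_) q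
    rw [d₂.v_eq]
    simpa using hπ

theorem maxDistance_ok {i x : ℕ} {q : Fin v} (hi : i < n) (hM : 2 ≤ M) (hs : Describes σ w d s)
    (h40 : s.word 40 * n + i = x) (h42 : s.word 42 = i) (h43 : s.word 43 = q)
    (hD : ∀ q, 0 ≤ s.realArray 1 q) (hR : ∀ y, 0 ≤ s.realArray 2 y) (hF : ∀ y, s.wordArray 14 y < 2) :
    Ok M maxDistance s fun s' => (∀ y, 0 ≤ s'.realArray 2 y) ∧ (∀ y, s'.wordArray 14 y < 2) ∧
      (∀ y, y ≠ x → s'.wordArray 14 y = s.wordArray 14 y ∧ s'.realArray 2 y = s.realArray 2 y) ∧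
      keyVal s' x = if q ∈ (σ ⟨i, hi⟩).1 then max (keyVal s x) (distVal s q) else keyVal s x := by
  have hinc := hs.inc ⟨i, hi⟩ q
  have hz := hs.zero 0
  simp only at hinc
  by_cases hq : q ∈ (σ ⟨i, hi⟩).1
  · rw [if_pos hq] at hinc ⊢
    refine Ok.ite (fun h => Ok.ite (fun h' => ?_) fun h' => Ok.ite (fun h'' => ?_) fun h'' => ?_)
      fun h => absurd h (by simp [h42, h43, hs.v_eq, hinc])
    · refine Ok.store (by simp; omega) ?_
      simp [h43] at h'
      have hd : distVal s q = ⊤ := by rw [distVal, flagged, if_neg (by omega)]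
      simp only [Expr.eval_add, Expr.eval_mul, Expr.eval_reg, Expr.eval_const, hs.n_eq, h40, h42, hd]
      refine ⟨hR, fun y => ?_, fun y hy => by simp [hy], ?_⟩
      · rw [wordArray_setArr, if_pos rfl, Function.update_apply]
        split_ifs
        · omega
        · exact hF y
      · simp [keyVal, flagged]
    · simp [h43] at h'
      refine Ok.radd ?_
      simp [hs.n_eq, h40, h42, h43] at h''
      simp only [Expr.eval_add, Expr.eval_mul, Expr.eval_reg, Expr.eval_const, hs.n_eq, h40, h42,
        h43, hz, add_zero]
      refine ⟨fun y => ?_, hF, fun y hy => by simp [hy], ?_⟩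
      · rw [realArray_setRArr, if_pos rfl, Function.update_apply]
        split_ifs
        · exact hD _
        · exact hR y
      · have hlt : s.realArray 2 x < s.realArray 1 q := by
          by_contra hn
          simp [hn] at h''
        simp only [keyVal, distVal, flagged, h', wordArray_setRArr, realArray_setRArr, if_true,
          Function.update_self]
        split_ifs with hf
        · rw [max_eq_right]
          exact ENNReal.ofReal_le_ofReal hlt.le
        · rw [max_eq_left le_top]
    · simp [h43] at h'
      refine Ok.assign (by simp; omega) ?_
      simp [hs.n_eq, h40, h42, h43] at h''
      refine ⟨hR, hF, fun y _ => ⟨rfl, rfl⟩, ?_⟩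
      rw [max_eq_left]
      · rfl
      · simp only [keyVal, distVal, flagged, h', if_true]
        split_ifs with hf
        · exact ENNReal.ofReal_le_ofReal h''
        · exact le_top
  · rw [if_neg hq] at hinc ⊢
    refine Ok.ite (fun h => absurd h (by simp [h42, h43, hs.v_eq, hinc])) fun h => ?_
    exact Ok.assign (by simp; omega) ⟨hR, hF, fun y _ => ⟨rfl, rfl⟩, rfl⟩

/-- The maximum of the distances of the vertices of a simplex, written to one position of the
table. -/
theorem simplexDistance_ok {i x : ℕ} (hi : i < n) (hM : 2 ≤ M) (hs : Describes σ w d s)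
    (h40 : s.word 40 * n + i = x) (h42 : s.word 42 = i) (hD : ∀ q, 0 ≤ s.realArray 1 q)
    (hR : ∀ y, 0 ≤ s.realArray 2 y) (hF : ∀ y, s.wordArray 14 y < 2)
    (hdist : ∀ q : Fin v, distVal s q = geodesicDist K w p q) :
    Ok M simplexDistance s fun s' => (∀ y, 0 ≤ s'.realArray 2 y) ∧ (∀ y, s'.wordArray 14 y < 2) ∧
      (∀ y, y ≠ x → s'.wordArray 14 y = s.wordArray 14 y ∧ s'.realArray 2 y = s.realArray 2 y) ∧
      keyVal s' x = simplexKey σ w p i := by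
  have hz := hs.zero 0
  refine Ok.seq (Ok.store (by simp; omega) (Ok.seq (Ok.radd ?_)))
  simp only [Expr.eval_add, Expr.eval_mul, Expr.eval_reg, Expr.eval_const, word_setArr,
    hs.n_eq, h42, h40, realArray_setArr, hz, add_zero]
  set s₁ := setRArr (setArr s 14 (Function.update (s.wordArray 14) x 0)) 2
    (Function.update (s.realArray 2) x 0) with h₁
  have d₁ : Describes σ w d s₁ := hs.congr (fun _ _ => rfl) (fun A hA => by
    rw [h₁, wordArray_setRArr, wordArray_setArr, if_neg (by omega)]) rfl rfl
  have r1 : s₁.realArray 1 = s.realArray 1 := rfl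
  have a13 : s₁.wordArray 13 = s.wordArray 13 := rfl
  have hR₁ : ∀ y, 0 ≤ s₁.realArray 2 y := by
    intro y
    simp only [h₁, realArray_setRArr, if_true, Function.update_apply]
    split_ifs
    · exact le_rfl
    · exact hR y
  have hF₁ : ∀ y, s₁.wordArray 14 y < 2 := by
    intro y
    simp only [h₁, wordArray_setRArr, wordArray_setArr, if_true, Function.update_apply]
    split_ifs
    · omega
    · exact hF y
  have hy₁ : ∀ y, y ≠ x → s₁.wordArray 14 y = s.wordArray 14 y ∧
      s₁.realArray 2 y = s.realArray 2 y := by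
    intro y hy
    simp [h₁, hy]
  have hx₁ : keyVal s₁ x = 0 := by simp [h₁, keyVal, flagged]
  refine Ok.loop' (fun k s' => (∀ y, 0 ≤ s'.realArray 2 y) ∧ (∀ y, s'.wordArray 14 y < 2) ∧
      (∀ y, y ≠ x → s'.wordArray 14 y = s.wordArray 14 y ∧ s'.realArray 2 y = s.realArray 2 y) ∧
      keyVal s' x = ((σ ⟨i, hi⟩).1.filter fun q : Fin v => (q : ℕ) < k).sup fun q => geodesicDist K w p q)
      ?_ ?_ ?_
  · exact ⟨hR₁, hF₁, hy₁, by simp [hx₁]⟩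
  · rintro k hk s' hs' ⟨h1, h2, h3, h4⟩
    rw [d₁.v_eq] at hk
    have e1 : s'.realArray 1 = s.realArray 1 := (hs'.rarr 1 rfl).trans r1
    have e13 : s'.wordArray 13 = s.wordArray 13 := (hs'.arr 13 rfl).trans a13
    have w40 : s'.word 40 = s.word 40 := hs'.word 40 rfl
    have w42 : s'.word 42 = i := (hs'.word 42 rfl).trans h42
    have hdk : distVal s' k = geodesicDist K w p ⟨k, hk⟩ := by
      rw [← hdist]
      simp [distVal, e1, e13]
    refine (maxDistance_ok (x := x) (q := ⟨k, hk⟩) hi hM ((d₁.fixes hs').setWord k (by omega))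
      (by simp [w40, h40]) (by simp [w42]) (by simp) (by simpa [e1] using hD) (by simpa using h1)
      (by simpa using h2)).mono fun s'' ⟨g1, g2, g3, g4⟩ => ⟨g1, g2, fun y hy => ?_, ?_⟩
    · have g5 := g3 y hy
      have g6 := h3 y hy
      exact ⟨g5.1.trans g6.1, g5.2.trans g6.2⟩
    · have g4' : keyVal s'' x = if (⟨k, hk⟩ : Fin v) ∈ (σ ⟨i, hi⟩).1 then
        max (keyVal s' x) (distVal s' k) else keyVal s' x := g4
      refine Eq.trans g4' ?_
      rw [h4, hdk]
      have hfil : ((σ ⟨i, hi⟩).1.filter fun q : Fin v => (q : ℕ) < k + 1) =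
          if (⟨k, hk⟩ : Fin v) ∈ (σ ⟨i, hi⟩).1 then
            insert ⟨k, hk⟩ ((σ ⟨i, hi⟩).1.filter fun q : Fin v => (q : ℕ) < k)
          else (σ ⟨i, hi⟩).1.filter fun q : Fin v => (q : ℕ) < k := by
        ext q
        split_ifs with hm
        · simp only [Finset.mem_filter, Finset.mem_insert, Fin.ext_iff]
          constructor
          · rintro ⟨h5, h6⟩
            rcases lt_or_eq_of_le (show (q : ℕ) ≤ k by omega) with h7 | h7
            · exact .inr ⟨h5, h7⟩
            · exact .inl h7
          · rintro (h5 | h5)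
            · rw [show q = ⟨k, hk⟩ from Fin.ext h5]
              exact ⟨hm, by simp⟩
            · exact ⟨h5.1, by omega⟩
        · simp only [Finset.mem_filter]
          refine and_congr_right fun h5 => ?_
          have : (q : ℕ) ≠ k := fun h => hm (by rwa [show q = ⟨k, hk⟩ from Fin.ext h] at h5)
          omega
      rw [hfil]
      split_ifs
      · rw [Finset.sup_insert, max_comm]
      · rfl
  · rintro s' _ ⟨h1, h2, h3, h4⟩
    refine ⟨h1, h2, h3, h4.trans ?_⟩
    rw [simplexKey, dif_pos hi, simplexDist, d₁.v_eq, Finset.filter_true_of_mem fun q _ => q.2]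

/-- The table of distances has been computed for the vertex `p`. -/
theorem simplexDistances_ok (hM : 2 ≤ M) (hs : Describes σ w d s) (hp : s.word 40 = p)
    (hD : ∀ q, 0 ≤ s.realArray 1 q) (hR : ∀ y, 0 ≤ s.realArray 2 y)
    (hF : ∀ y, s.wordArray 14 y < 2) :
    Ok M simplexDistances s fun s' => (∀ q, 0 ≤ s'.realArray 1 q) ∧ (∀ y, 0 ≤ s'.realArray 2 y) ∧
      (∀ y, s'.wordArray 14 y < 2) ∧ (∀ y < p * n, keyVal s' y = keyVal s y) ∧
      ∀ i < n, keyVal s' (p * n + i) = simplexKey σ w p i := by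
  refine (distances_ok hM hs hp hD).then fun s₁ hs₁ ⟨hD₁, hdist⟩ => ?_
  have d₁ := hs.fixes hs₁
  have h40 : s₁.word 40 = p := (hs₁.word 40 rfl).trans hp
  have e14 : s₁.wordArray 14 = s.wordArray 14 := hs₁.arr 14 rfl
  have e2 : s₁.realArray 2 = s.realArray 2 := hs₁.rarr 2 rfl
  refine Ok.loop' (fun k s' => (∀ y, 0 ≤ s'.realArray 2 y) ∧
      (∀ y, s'.wordArray 14 y < 2) ∧ (∀ y < p * n, keyVal s' y = keyVal s y) ∧
      ∀ i < n, i < k → keyVal s' (p * n + i) = simplexKey σ w p i) ?_ ?_ ?_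
  · refine ⟨by rwa [e2], by rwa [e14], fun y _ => ?_, fun i _ hi => absurd hi (by omega)⟩
    rw [keyVal, keyVal, e2, e14]
  · rintro k hk s' hs' ⟨h1, h2, h3, h4⟩
    rw [d₁.n_eq] at hk
    have w40 : s'.word 40 = p := (hs'.word 40 rfl).trans h40
    have f1 : s'.realArray 1 = s₁.realArray 1 := hs'.rarr 1 rfl
    have f13 : s'.wordArray 13 = s₁.wordArray 13 := hs'.arr 13 rfl
    refine (simplexDistance_ok (p := p) (x := p * n + k) hk hM ((d₁.fixes hs').setWord k (by omega))
      (by simp [w40]) (by simp) (by simpa [f1] using hD₁) (by simpa using h1) (by simpa using h2)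
      fun q => ?_).mono fun s'' ⟨g1, g2, g3, g4⟩ => ⟨g1, g2, fun y hy => ?_, fun i hi hik => ?_⟩
    · rw [← hdist q]
      simp [distVal, f1, f13]
    · rw [← h3 y hy]
      obtain ⟨g5, g6⟩ := g3 y (by omega)
      simp only [wordArray_setWord, realArray_setWord] at g5 g6
      simp only [keyVal, wordArray_setWord, realArray_setWord, g5, g6]
    · rcases lt_or_eq_of_le (show i ≤ k by omega) with h | rfl
      · rw [← h4 i hi h]
        obtain ⟨g5, g6⟩ := g3 (p * n + i) (by omega)
        simp only [wordArray_setWord, realArray_setWord] at g5 g6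
        simp only [keyVal, wordArray_setWord, realArray_setWord, g5, g6]
      · exact g4
  · rintro s' hs' ⟨h1, h2, h3, h4⟩
    refine ⟨by rw [hs'.rarr 1 rfl]; exact hD₁, h1, h2, h3, fun i hi => h4 i hi ?_⟩
    rwa [d₁.n_eq]

end

end RAM

namespace RAM

open Elimination

/-! ### Sorting -/

section Program

open RAM.Expr

/-- The truth value of the comparison of two distances at given positions of the table. -/
def less (a b : Expr) : Expr :=
  (const 1 - arr 14 a) * (arr 14 b + (const 1 - arr 14 b) * rlt 2 a 2 b)

/-- Sort the numbers below `word m`, where the distance which belongs to the number in register `r`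
is at the position `ptr r` of the table. Word array `D` receives the ranks of the numbers, word
array `D'` the sorted list. -/
def sortBy (D D' m : ℕ) (ptr : ℕ → Expr) : Cmd :=
  .seq (fill D m (sum 17 m (less (ptr 17) (ptr 16) + (const 1 - less (ptr 17) (ptr 16)) *
    (const 1 - less (ptr 16) (ptr 17)) * lt (reg 17) (reg 16))))
  (fillAt D' m (arr D (reg 16)) (reg 16))

end Program

theorem less_eval {s : Memory} {a b : Expr} (hF : ∀ y, s.wordArray 14 y < 2)
    (hR : ∀ y, 0 ≤ s.realArray 2 y) : (less a b).eval s = open Classical in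
      if keyVal s (a.eval s) < keyVal s (b.eval s) then 1 else 0 := by
  have ha := hF (a.eval s)
  have hb := hF (b.eval s)
  have hRa := hR (a.eval s)
  have hRb := hR (b.eval s)
  simp only [less, Expr.eval_mul, Expr.eval_sub, Expr.eval_add, Expr.eval_arr, Expr.eval_const,
    Expr.eval_rlt, keyVal, flagged]
  have h1 : s.wordArray 14 (a.eval s) = 0 ∨ s.wordArray 14 (a.eval s) = 1 := by omega
  have h2 : s.wordArray 14 (b.eval s) = 0 ∨ s.wordArray 14 (b.eval s) = 1 := by omega
  rcases h1 with h1 | h1 <;> rcases h2 with h2 | h2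
  · simp only [h1, h2]
    simp only [tsub_zero, one_mul, zero_add, if_true]
    exact if_congr (ENNReal.ofReal_lt_ofReal_iff_of_nonneg hRa).symm rfl rfl
  · simp [h1, h2]
  · simp [h1, h2]
  · simp [h1, h2]

/-- The key of the number `i` is the distance at position `a i`. Equal keys are ordered by the
numbers, as in `rank`, so the ranks are distinct. -/
theorem sortBy_ok {M D D' m N : ℕ} {ptr : ℕ → Expr} {a : ℕ → ℕ} {s : Memory} (hN : s.word m = N)
    (hm : m < 16) (hD : D ≠ 14) (hDD : D ≠ D') (hNM : N < M) (hF : ∀ y, s.wordArray 14 y < 2)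
    (hR : ∀ y, 0 ≤ s.realArray 2 y)
    (hptr : ∀ f k l, (ptr 16).eval (((setArr s D f).setWord 16 k).setWord 17 l) = a k ∧
      (ptr 17).eval (((setArr s D f).setWord 16 k).setWord 17 l) = a l) :
    Ok M (sortBy D D' m ptr) s fun s' =>
      (∀ i < N, s'.wordArray D i = rank N (fun i => keyVal s (a i)) i) ∧
      ∀ i < N, s'.wordArray D' (rank N (fun i => keyVal s (a i)) i) = i := by
  set key : ℕ → ℝ≥0∞ := fun i => keyVal s (a i) with hkey
  refine (Ok.fill (fun k => rank N key k) ?_ ?_ rfl).then fun s' hs' h => ?_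
  · intro k hk f _
    simp only [Expr.eval_sum]
    rw [rank, Finset.card_filter]
    refine Finset.sum_congr (by simp [hN, show m ≠ 16 by omega]) fun l hl => ?_
    have hp := hptr f k l
    set u := ((setArr s D f).setWord 16 k).setWord 17 l with hu
    have hk : ∀ x, keyVal u x = keyVal s x := by
      intro x
      simp [hu, keyVal, hD.symm]
    have hF' : ∀ y, u.wordArray 14 y < 2 := by
      intro y
      have := hF y
      simpa [hu, hD.symm] using this
    simp only [Expr.eval_add, Expr.eval_mul, Expr.eval_sub, Expr.eval_const, Expr.eval_lt',
      Expr.eval_reg, less_eval hF' (show ∀ y, 0 ≤ u.realArray 2 y from hR), hp.1, hp.2, hk]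
    have w16 : u.word 16 = k := by simp [hu]
    have w17 : u.word 17 = l := by simp [hu]
    simp only [w16, w17, Precedes, hkey]
    by_cases h1 : keyVal s (a l) < keyVal s (a k)
    · simp [h1]
    · by_cases h2 : keyVal s (a k) < keyVal s (a l)
      · simp [h1, h2]
      · by_cases h3 : l < k
        · simp [h1, h2, h3]
        · simp [h1, h2, h3]
  · intro k hk
    rw [hN] at hk
    exact (rank_lt hk).trans hNM
  · rw [hN] at h
    subst h
    refine Ok.fillAt (fun k => rank N key k) (fun k => k) ?_ ?_ ?_ ?_ ?_
    · intro k hk l hl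
      rw [word_setArr, hN] at hk hl
      exact rank_injective hk hl
    · intro k hk f _
      rw [word_setArr, hN] at hk
      simp [hDD, hk]
    · intro k hk f _
      simp
    · intro k hk
      rw [word_setArr, hN] at hk
      exact hk.trans hNM
    · intro f hf _
      rw [word_setArr, hN] at hf
      refine ⟨fun i hi => ?_, fun i hi => ?_⟩
      · simp [hDD, hi]
      · simpa using hf i hi

/-! ### The matrices and the candidates -/

section Program

open RAM.Expr

/-- Store the columns of the boundary map of the `d`-simplices in the order of word array `16`. -/
def storeBoundary : Cmd :=
  fill 3 11 (lt (reg 16 / reg 3) (reg 0) * lt (mod (reg 16) (reg 3)) (reg 0) *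
    eq (arr 1 (arr 16 (mod (reg 16) (reg 3)))) (reg 2 + const 1) *
    arr 2 (reg 16 / reg 3 * reg 0 + arr 16 (mod (reg 16) (reg 3))))

/-- Store the fundamental cycles in the second half of the table of items in word array `17`. -/
def storeCandidates : Cmd :=
  fillAt 17 7 (reg 7 + reg 16) ((const 1 - arr 7 (reg 16 / reg 0)) *
    eq (arr 1 (arr 16 (reg 16 / reg 0))) (reg 2 + const 1) *
    (eq (arr 15 (mod (reg 16) (reg 0))) (reg 16 / reg 0) +
      lt (arr 15 (mod (reg 16) (reg 0))) (reg 16 / reg 0) * arr 7 (arr 15 (mod (reg 16) (reg 0))) *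
      arr 3 (arr 5 (arr 15 (mod (reg 16) (reg 0))) * reg 3 + reg 16 / reg 0)))

/-- Store the positions of the distances which belong to the candidates. -/
def storePointers : Cmd := fillAt 19 0 (reg 0 + reg 16) (reg 40 * reg 0 + arr 16 (reg 16))

/-- Store the boundaries of the `(d + 1)`-simplices, followed by the sorted items. -/
def storeItems : Cmd :=
  fill 3 11 (lt (reg 16 / reg 3) (reg 0) *
    (lt (mod (reg 16) (reg 3)) (reg 0) * eq (arr 1 (mod (reg 16) (reg 3))) (reg 2 + const 2) *
      arr 2 (reg 16 / reg 3 * reg 0 + mod (reg 16) (reg 3)) +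
    (const 1 - lt (mod (reg 16) (reg 3)) (reg 0)) * lt (mod (reg 16) (reg 3)) (reg 5) *
      arr 17 (arr 22 (mod (reg 16) (reg 3) - reg 0) * reg 0 + reg 16 / reg 3)))

end Program

theorem lt_sq_iff {S x : ℕ} (h : x < S * S) : x / S < S ∧ x % S < S ∧ x / S * S + x % S = x :=
  ⟨div_lt_of_lt_sq h, Nat.mod_lt _ (Nat.pos_of_ne_zero (by rintro rfl; simp at h)), Nat.div_add_mod' x S⟩

theorem idx_lt_sq {S i j : ℕ} (hi : i < S) (hj : j < S) : i * S + j < S * S := by nlinarith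

section

variable {v n d : ℕ} {K : AbstractSimplicialComplex (Fin v)} {σ : Fin n ≃ K.faces}
  {w : Finset (Fin v) → ℝ≥0} {s : Memory} {M S : ℕ}

/-- The columns of simplices of other dimensions, and the columns from `n` on, are zero. -/
theorem storeBoundary_ok (hM : 2 ≤ M) (hs : Describes σ w d s) (hS : s.word 3 = S)
    (h11 : s.word 11 = S * S) (hnS : n ≤ S) (ho : ∀ j < n, s.wordArray 16 j < n) :
    Ok M storeBoundary s fun s' =>
      (∀ i < S, ∀ j < S, s'.wordArray 3 (i * S + j) < 2) ∧
      ∀ j < S, col S (s'.wordArray 3) j = sortedBoundary σ d (s.wordArray 16) j := by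
  classical
  refine Ok.fill (fun x => if x / S < n ∧ x % S < n ∧ numVertices σ (s.wordArray 16 (x % S)) = d + 1
    then s.wordArray 2 (x / S * n + s.wordArray 16 (x % S)) else 0) ?_ ?_ ?_
  · intro k hk f _
    simp only [Expr.eval_mul, Expr.eval_lt', Expr.eval_div, Expr.eval_mod, Expr.eval_eq,
      Expr.eval_arr, Expr.eval_add, Expr.eval_reg, Expr.eval_const, word_setWord, word_setArr,
      wordArray_setWord, wordArray_setArr]
    simp only [hS, hs.n_eq, hs.d_eq, if_true, Nat.reduceEqDiff, if_false]
    by_cases h1 : k / S < n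
    · by_cases h2 : k % S < n
      · simp [h1, h2, hs.card _ (ho _ h2)]
      · simp [h1, h2]
    · simp [h1]
  · intro k hk
    split_ifs with h
    · rw [hs.facet _ h.1 _ (ho _ h.2.1)]
      split_ifs <;> omega
    · omega
  · have hcell : ∀ i < S, ∀ j < S, (setArr s 3 fun x => if x < s.word 11 then
        if x / S < n ∧ x % S < n ∧ numVertices σ (s.wordArray 16 (x % S)) = d + 1
        then s.wordArray 2 (x / S * n + s.wordArray 16 (x % S)) else 0 else s.wordArray 3 x).wordArray 3
        (i * S + j) = if i < n ∧ j < n ∧ numVertices σ (s.wordArray 16 j) = d + 1 ∧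
          IsFacet σ i (s.wordArray 16 j) then 1 else 0 := by
      intro i hi j hj
      rw [wordArray_setArr, if_pos rfl, h11, if_pos (idx_lt_sq hi hj), div_idx _ hj, mod_idx _ hj]
      by_cases h : i < n ∧ j < n ∧ numVertices σ (s.wordArray 16 j) = d + 1
      · rw [if_pos h, hs.facet _ h.1 _ (ho _ h.2.1)]
        simp [h]
      · rw [if_neg h, if_neg fun h' => h ⟨h'.1, h'.2.1, h'.2.2.1⟩]
    refine ⟨fun i hi j hj => ?_, fun j hj => ?_⟩
    · rw [hcell i hi j hj]
      split_ifs <;> omega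
    · funext i
      rw [col]
      by_cases hi : i < S
      · rw [if_pos hi, hcell i hi j hj, sortedBoundary]
        by_cases h : j < n ∧ numVertices σ (s.wordArray 16 j) = d + 1
        · rw [if_pos h, facetVec]
          by_cases h' : IsFacet σ i (s.wordArray 16 j)
          · rw [if_pos h', if_pos ⟨h'.1, h.1, h.2, h'⟩, Nat.cast_one]
          · rw [if_neg h', if_neg fun h2 => h' h2.2.2.2, Nat.cast_zero]
        · rw [if_neg h, if_neg fun h2 => h ⟨h2.2.1, h2.2.2.1⟩, Nat.cast_zero]
          rfl
      · rw [if_neg hi, sortedBoundary]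
        split_ifs with h
        · rw [facetVec, if_neg]
          rintro ⟨h1, -⟩
          omega
        · rfl

/-- Pivot columns, and simplices of other dimensions, give zero rows. -/
theorem storeCandidates_ok {q : ℕ → Prop} (hM : 2 ≤ M) (hs : Describes σ w d s)
    (hS : s.word 3 = S) (h7 : s.word 7 = n * n) (hnS : n ≤ S)
    (ho : ∀ j < n, s.wordArray 16 j < n) (hpos : ∀ i < n, s.wordArray 15 i < n)
    (hA : ∀ i < S, ∀ j < S, s.wordArray 3 (i * S + j) < 2) (hp : ∀ k < S, s.wordArray 5 k < S)
    (h72 : ∀ k < S, s.wordArray 7 k < 2) (hq : ∀ k, q k ↔ s.wordArray 7 k = 1) :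
    Ok M storeCandidates s fun s' =>
      (∀ x < n * n, s'.wordArray 17 x = s.wordArray 17 x) ∧
      (∀ x, n * n + n * n ≤ x → s'.wordArray 17 x = s.wordArray 17 x) ∧
      ∀ j < n, ∀ i < n, s'.wordArray 17 ((n + j) * n + i) < 2 ∧
        (s'.wordArray 17 ((n + j) * n + i) : ZMod 2) = open Classical in
          if numVertices σ (s.wordArray 16 j) = d + 1 ∧ ¬ q j then
            fundamentalVec n (s.wordArray 15) (col S (s.wordArray 3) j) (s.wordArray 5) q j i else 0 := by
  classical
  set g : ℕ → ℕ := fun x => (1 - s.wordArray 7 (x / n)) *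
    (if s.wordArray 1 (s.wordArray 16 (x / n)) = d + 1 then 1 else 0) *
    ((if s.wordArray 15 (x % n) = x / n then 1 else 0) +
      (if s.wordArray 15 (x % n) < x / n then 1 else 0) * s.wordArray 7 (s.wordArray 15 (x % n)) *
      s.wordArray 3 (s.wordArray 5 (s.wordArray 15 (x % n)) * S + x / n)) with hg
  have hgv : ∀ x < n * n, g x < 2 ∧ (g x : ZMod 2) =
      if numVertices σ (s.wordArray 16 (x / n)) = d + 1 ∧ ¬ q (x / n) then
        fundamentalVec n (s.wordArray 15) (col S (s.wordArray 3) (x / n)) (s.wordArray 5) q (x / n)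
          (x % n) else 0 := by
    intro x hx
    obtain ⟨h1, h2, -⟩ := lt_sq_iff hx
    have h3 := hpos _ h2
    have h4 := h72 (x / n) (by omega)
    have h5 := h72 (s.wordArray 15 (x % n)) (by omega)
    have h6 := hp (s.wordArray 15 (x % n)) (by omega)
    have h8 := hA _ h6 (x / n) (by omega)
    simp only [hg, hs.card _ (ho _ h1), fundamentalVec, if_pos h2, hq, col, if_pos h6]
    generalize s.wordArray 3 (s.wordArray 5 (s.wordArray 15 (x % n)) * S + x / n) = y at *
    generalize s.wordArray 15 (x % n) = pos at *
    generalize s.wordArray 7 (x / n) = q1 at *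
    generalize s.wordArray 7 pos = q2 at *
    have hq1 : q1 = 0 ∨ q1 = 1 := by omega
    have hq2 : q2 = 0 ∨ q2 = 1 := by omega
    by_cases e1 : numVertices σ (s.wordArray 16 (x / n)) = d + 1
    · rcases hq1 with rfl | rfl
      · by_cases e2 : pos = x / n
        · simp [e1, e2]
        · by_cases e3 : pos < x / n
          · rcases hq2 with rfl | rfl
            · simp [e1, e2]
            · simp [e1, e2, e3]
              omega
          · simp [e1, e2, e3]
      · simp
    · simp [e1]
  refine Ok.fillAt (fun x => n * n + x) g ?_ ?_ ?_ ?_ ?_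
  · intro k _ l _ h
    omega
  · intro k _ f _
    simp [h7]
  · intro k hk f _
    simp only [Expr.eval_mul, Expr.eval_lt', Expr.eval_div, Expr.eval_mod, Expr.eval_eq,
      Expr.eval_arr, Expr.eval_add, Expr.eval_sub, Expr.eval_reg, Expr.eval_const, word_setWord,
      word_setArr, wordArray_setWord, wordArray_setArr]
    simp only [hS, hs.n_eq, hs.d_eq, if_true, Nat.reduceEqDiff, if_false, hg]
  · intro k hk
    rw [h7] at hk
    exact (hgv k hk).1.trans_le hM
  · intro f hf1 hf2
    rw [h7] at hf1 hf2
    simp only [wordArray_setArr, if_true]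
    refine ⟨fun x hx => hf2 x fun k _ => by omega, fun x hx => hf2 x fun k _ => by omega,
      fun j hj i hi => ?_⟩
    rw [show (n + j) * n + i = n * n + (j * n + i) by ring, hf1 _ (idx_lt_sq hj hi)]
    have := hgv _ (idx_lt_sq hj hi)
    rwa [div_idx _ hi, mod_idx _ hi] at this

theorem storePointers_ok {p : ℕ} (hs : Describes σ w d s) (h40 : s.word 40 = p)
    (ho : ∀ j < n, s.wordArray 16 j < n) (hpM : p * n + n < M) :
    Ok M storePointers s fun s' => (∀ t < n, s'.wordArray 19 t = s.wordArray 19 t) ∧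
      ∀ j < n, s'.wordArray 19 (n + j) = p * n + s.wordArray 16 j := by
  refine Ok.fillAt (fun x => n + x) (fun x => p * n + s.wordArray 16 x) ?_ ?_ ?_ ?_ ?_
  · intro k _ l _ h
    omega
  · intro k _ f _
    simp [hs.n_eq]
  · intro k _ f _
    simp [hs.n_eq, h40]
  · intro k hk
    rw [hs.n_eq] at hk
    have := ho k hk
    omega
  · intro f hf1 hf2
    rw [hs.n_eq] at hf1 hf2
    simp only [wordArray_setArr, if_true]
    exact ⟨fun t ht => hf2 t fun k _ => by omega, hf1⟩

theorem storeItems_ok {x : ℕ → Vec} (hM : 2 ≤ M) (hs : Describes σ w d s)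
    (hS : s.word 3 = S) (h11 : s.word 11 = S * S) (h5 : s.word 5 = 3 * n) (hnS : 3 * n ≤ S)
    (hx : ∀ t < 2 * n, ∀ i < n, s.wordArray 17 (s.wordArray 22 t * n + i) < 2 ∧
      (s.wordArray 17 (s.wordArray 22 t * n + i) : ZMod 2) = x t i)
    (hx0 : ∀ t < 2 * n, ∀ i, n ≤ i → x t i = 0) :
    Ok M storeItems s fun s' =>
      (∀ i < S, ∀ j < S, s'.wordArray 3 (i * S + j) < 2) ∧
      ∀ j < S, col S (s'.wordArray 3) j = itemColumn σ d (2 * n) x j := by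
  classical
  set g : ℕ → ℕ → ℕ := fun i j => if i < n then if j < n then
    if numVertices σ j = d + 2 then s.wordArray 2 (i * n + j) else 0
    else if j < 3 * n then s.wordArray 17 (s.wordArray 22 (j - n) * n + i) else 0 else 0 with hg
  have hgv : ∀ i j, g i j < 2 ∧ (g i j : ZMod 2) = itemColumn σ d (2 * n) x j i := by
    intro i j
    simp only [hg, itemColumn]
    by_cases hi : i < n
    · by_cases hj : j < n
      · by_cases h1 : numVertices σ j = d + 2
        · simp only [hi, hj, h1, if_true, hs.facet i hi j hj, facetVec]
          split_ifs <;> simp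
        · simp [hi, hj, h1]
      · by_cases hj3 : j < 3 * n
        · have := hx (j - n) (by omega) i hi
          simpa [hi, hj, hj3, show j < n + 2 * n by omega] using this
        · simp [hi, hj, hj3, show ¬ j < n + 2 * n by omega]
    · simp only [hi, if_false, Nat.cast_zero]
      refine ⟨by omega, ?_⟩
      split_ifs with h1 h2 h3
      · rw [facetVec, if_neg]
        rintro ⟨h, -⟩
        exact hi h
      · rfl
      · exact (hx0 _ (by omega) i (by omega)).symm
      · rfl
  refine Ok.fill (fun y => g (y / S) (y % S)) ?_ ?_ ?_
  · intro k hk f _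
    simp only [Expr.eval_mul, Expr.eval_lt', Expr.eval_div, Expr.eval_mod, Expr.eval_eq,
      Expr.eval_arr, Expr.eval_add, Expr.eval_sub, Expr.eval_reg, Expr.eval_const, word_setWord,
      word_setArr, wordArray_setWord, wordArray_setArr]
    simp only [hS, hs.n_eq, hs.d_eq, h5, if_true, Nat.reduceEqDiff, if_false, hg]
    by_cases h1 : k / S < n
    · by_cases h2 : k % S < n
      · simp [h1, h2, hs.card _ h2]
      · by_cases h3 : k % S < 3 * n
        · simp [h1, h2, h3]
        · simp [h1, h2, h3]
    · simp [h1]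
  · intro k _
    exact (hgv _ _).1.trans_le hM
  · have hcell : ∀ i < S, ∀ j < S, (setArr s 3 fun y => if y < s.word 11 then g (y / S) (y % S)
        else s.wordArray 3 y).wordArray 3 (i * S + j) = g i j := by
      intro i hi j hj
      rw [wordArray_setArr, if_pos rfl, h11, if_pos (idx_lt_sq hi hj), div_idx _ hj, mod_idx _ hj]
    refine ⟨fun i hi j hj => ?_, fun j hj => ?_⟩
    · rw [hcell i hi j hj]
      exact (hgv i j).1
    · funext i
      rw [col]
      split_ifs with hi
      · rw [hcell i hi j hj]
        exact (hgv i j).2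
      · rw [← (hgv i j).2]
        simp [hg, show ¬ i < n by omega]

end

end RAM

/-! ### The candidates around a vertex -/

section Candidates

open Elimination

variable {v n d : ℕ} {K : AbstractSimplicialComplex (Fin v)} {σ : Fin n ≃ K.faces}
  {w : Finset (Fin v) → ℝ≥0}

variable (σ w) in
/-- The arrays `o` and `pos` list the simplices in the order of their distances from `p`, and tell
the positions of the simplices in this list. -/
structure IsDistanceOrder (p : Fin v) (o pos : ℕ → ℕ) : Prop where
  order : ∀ j < n, o j < n ∧ pos (o j) = j
  position : ∀ i < n, pos i < n ∧ o (pos i) = i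
  mono : ∀ i < n, ∀ j < n, pos i ≤ pos j → simplexKey σ w p i ≤ simplexKey σ w p j

variable {S : ℕ} {o pos pv : ℕ → ℕ} {c : ℕ → Vec} {q : ℕ → Prop} {p : Fin v}

/-- A fundamental cycle lies in the ball whose radius is the distance of its last simplex. -/
theorem IsDistanceOrder.inBall (ho : IsDistanceOrder σ w p o pos) (hnS : n ≤ S)
    (h : IsElimination S (sortedBoundary σ d o) c pv q) {j : ℕ} (hjn : j < n)
    (hj : numVertices σ (o j) = d + 1) :
    InBall σ w p (simplexKey σ w p (o j)) (fundamentalVec n pos (c j) pv q j) := by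
  intro i hi
  obtain ⟨h1, -, h2⟩ := fundamentalVec_support h hnS ho.position hj hi
  refine ho.mono i h1 _ (ho.order j hjn).1 ?_
  rwa [(ho.order j hjn).2]

theorem IsDistanceOrder.exists_cycle (ho : IsDistanceOrder σ w p o pos) (hnS : n ≤ S)
    (h : IsElimination S (sortedBoundary σ d o) c pv q) {j : ℕ} (hjn : j < n)
    (hj : numVertices σ (o j) = d + 1) (hq : ¬ q j) :
    ∃ z : cycles K d, chainVec σ z.1 = fundamentalVec n pos (c j) pv q j := by
  obtain ⟨y, hy⟩ := exists_chainVec_eq (K := K) (d := d) (σ := σ)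
    (x := fundamentalVec n pos (c j) pv q j) fun k hk => by
      obtain ⟨h1, h2, -⟩ := fundamentalVec_support h hnS ho.position hj hk
      exact ⟨h1, h2⟩
  refine ⟨⟨y, (mem_cycles_iff (σ := σ) y).2 ?_⟩, hy⟩
  rw [hy]
  exact boundaryVec_fundamentalVec h hnS ho.order ho.position hjn hj hq

/-- Every cycle in a ball around `p` is generated by the fundamental cycles in this ball. -/
theorem IsDistanceOrder.mem_span (ho : IsDistanceOrder σ w p o pos) (hnS : n ≤ S)
    (h : IsElimination S (sortedBoundary σ d o) c pv q) {r : ℝ≥0∞} {z : cycles K d}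
    (hz : InBall σ w p r (chainVec σ z.1)) {ι : Type*} (item : ι → cycles K d) (I : Set ι)
    (hitem : ∀ j < n, numVertices σ (o j) = d + 1 → ¬ q j → simplexKey σ w p (o j) ≤ r →
      ∃ t ∈ I, chainVec σ (item t).1 = fundamentalVec n pos (c j) pv q j) :
    homologyClass K d z ∈ Submodule.span (ZMod 2) ((fun t => homologyClass K d (item t)) '' I) := by
  classical
  rw [homologyClass_mem_span_iff (σ := σ)]
  set x := chainVec σ z.1 with hx
  set J := ((Finset.range n).filter fun i => x i ≠ 0).sup fun i => pos i + 1 with hJ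
  have hsup : ∀ i, x i ≠ 0 → i < n ∧ numVertices σ i = d + 1 := fun i hi =>
    numVertices_of_chainVec_ne hi
  have hJn : J ≤ n := by
    refine Finset.sup_le fun i hi => ?_
    rw [Finset.mem_filter, Finset.mem_range] at hi
    exact (ho.position i hi.1).1
  refine Submodule.span_le.2 ?_ (mem_span_fundamentalVec h hnS ho.order ho.position hJn x
    ((mem_cycles_iff z.1).1 z.2) fun i hi => ⟨(hsup i hi).1, (hsup i hi).2, ?_⟩)
  · rintro _ ⟨j, ⟨hj, hd, hq⟩, rfl⟩
    obtain ⟨i, hi, hji⟩ := Finset.lt_sup_iff.1 hj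
    rw [Finset.mem_filter, Finset.mem_range] at hi
    have hkey : simplexKey σ w p (o j) ≤ r := by
      refine (ho.mono _ (ho.order j (by omega)).1 i hi.1 ?_).trans (hz i hi.2)
      rw [(ho.order j (by omega)).2]
      omega
    obtain ⟨t, ht, he⟩ := hitem j (by omega) hd hq hkey
    exact Submodule.subset_span (Or.inr ⟨t, ht, he⟩)
  · have hmem : i ∈ (Finset.range n).filter fun i => x i ≠ 0 :=
      Finset.mem_filter.2 ⟨Finset.mem_range.2 (hsup i hi).1, hi⟩
    exact Finset.le_sup (f := fun i => pos i + 1) hmem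

end Candidates

namespace RAM

open Elimination

/-! ### The cost of commands with few bounding registers -/

/-- The register `x` bounds a sum in the expression. -/
def Expr.bounds (x : ℕ) : Expr → Bool
  | const _ => false
  | reg _ => false
  | arr _ i => i.bounds x
  | bin _ a b => a.bounds x || b.bounds x
  | lt a b => a.bounds x || b.bounds x
  | rlt _ i _ j => i.bounds x || j.bounds x
  | sum _ m e => m == x || e.bounds x

/-- The register `x` bounds a loop or a sum in the command. -/
def Cmd.bounds (x : ℕ) : Cmd → Bool
  | assign _ e => e.bounds x
  | store _ i e => i.bounds x || e.bounds x
  | radd _ i _ j _ k => i.bounds x || j.bounds x || k.bounds x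
  | ite e c c' => e.bounds x || c.bounds x || c'.bounds x
  | seq c c' => c.bounds x || c'.bounds x
  | loop _ m c => m == x || c.bounds x
  | mul => x == 8

theorem Expr.cost_congr_of_bounds {β γ : ℕ → ℕ} (e : Expr)
    (h : ∀ m, e.bounds m = true → β m = γ m) : e.cost β = e.cost γ := by
  induction e with
  | const | reg => rfl
  | arr A i ih => simp only [cost, ih h]
  | bin _ a b iha ihb | lt a b iha ihb | rlt _ a _ b iha ihb =>
    simp only [bounds, Bool.or_eq_true] at h
    simp only [cost, iha fun m hm => h m (.inl hm), ihb fun m hm => h m (.inr hm)]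
  | sum r m e ih =>
    simp only [bounds, Bool.or_eq_true, beq_iff_eq] at h
    simp only [cost, ih fun m hm => h m (.inr hm), h m (.inl rfl)]

theorem Cmd.staticCost_congr_of_bounds {κ β γ : ℕ → ℕ} (c : Cmd)
    (h : ∀ m, c.bounds m = true → β m = γ m) : c.staticCost κ β = c.staticCost κ γ := by
  induction c with
  | assign r e => simp only [staticCost, e.cost_congr_of_bounds h]
  | store A i e =>
    simp only [bounds, Bool.or_eq_true] at h
    simp only [staticCost, i.cost_congr_of_bounds fun m hm => h m (.inl hm),
      e.cost_congr_of_bounds fun m hm => h m (.inr hm)]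
  | radd A i B j C k =>
    simp only [bounds, Bool.or_eq_true] at h
    simp only [staticCost, i.cost_congr_of_bounds fun m hm => h m (.inl (.inl hm)),
      j.cost_congr_of_bounds fun m hm => h m (.inl (.inr hm)),
      k.cost_congr_of_bounds fun m hm => h m (.inr hm)]
  | ite e c c' ih ih' =>
    simp only [bounds, Bool.or_eq_true] at h
    simp only [staticCost, e.cost_congr_of_bounds fun m hm => h m (.inl (.inl hm)),
      ih fun m hm => h m (.inl (.inr hm)), ih' fun m hm => h m (.inr hm)]
  | seq c c' ih ih' =>
    simp only [bounds, Bool.or_eq_true] at h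
    simp only [staticCost, ih fun m hm => h m (.inl hm), ih' fun m hm => h m (.inr hm)]
  | loop r m c ih =>
    simp only [bounds, Bool.or_eq_true, beq_iff_eq] at h
    simp only [staticCost, ih fun m hm => h m (.inr hm), h m (.inl rfl)]
  | mul => simp only [staticCost, h 8 (by simp [bounds])]

/-- A bound for the cost of a command without multiplications by a power of the size of the
problem. -/
theorem Cmd.exists_spec (c : Cmd) {o : ℕ} (hwf : c.WF) (hf : c.Frozen) (hm : c.MulFree)
    (ho : c.order ≤ o) : ∃ C, ∀ {M : ℕ} {κ : ℕ → ℕ} {s : Memory} {B : ℕ} {Q : Memory → Prop}, 1 ≤ B →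
      (∀ m < 16, c.bounds m = true → s.word m ≤ B ^ weight m) → Ok M c s Q →
      Spec M κ c s (C * B ^ o) Q := by
  obtain ⟨C, hC⟩ := c.exists_staticCost_le
  refine ⟨C, fun {M κ s B Q} hB hs h => Spec.of_ok h hwf hf ?_⟩
  set β : ℕ → ℕ := fun m => if c.bounds m then s.word m else 0 with hβ
  rw [c.staticCost_congr_of_bounds (γ := β) fun m hm => by simp [hβ, hm]]
  refine (hC κ β B hB (fun m hm16 => ?_) hwf hm).trans
    (Nat.mul_le_mul_left _ (Nat.pow_le_pow_right hB ho))
  simp only [hβ]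
  split_ifs with h1
  · exact hs m hm16 h1
  · exact Nat.zero_le _

theorem Spec.of_cost {M T : ℕ} {κ : ℕ → ℕ} {c : Cmd} {s : Memory} {Q : Memory → Prop}
    (h : Ok M c s Q) (hT : c.cost κ s ≤ T) : Spec M κ c s T Q := ⟨h.1, hT, h.2⟩

theorem Ok.bounded {M : ℕ} {c : Cmd} {s : Memory} {Q : Memory → Prop} (hM : 2 ≤ M)
    (h : Ok M c s Q) (hb : Bounded M s) : Ok M c s fun s' => Bounded M s' ∧ Q s' :=
  ⟨h.1, h.1.bounded hM hb, h.2⟩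

theorem Spec.bounded {M T : ℕ} {κ : ℕ → ℕ} {c : Cmd} {s : Memory} {Q : Memory → Prop} (hM : 2 ≤ M)
    (h : Spec M κ c s T Q) (hb : Bounded M s) : Spec M κ c s T fun s' => Bounded M s' ∧ Q s' :=
  ⟨h.1, h.2.1, h.1.bounded hM hb, h.2.2⟩

/-! ### The order of the simplices and their boundaries -/

/-- The layout of the memory during the computation. The registers `0`, `1`, `2` hold `n`, `v` and
`d`; the sizes of the matrices are in the registers `3` to `11`, and the current vertex is in
register `40`. Real array `0` holds the weights. Real array `1` and word array `13` hold the
distances from the current vertex, real array `2` and word array `14` those of the simplices from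
all vertices, where the words are the flags for infinity. Word array `0` holds the incidences, `1`
the cardinalities, `2` the facets, `11` and `12` the ends of the edges; `3` and `4` the matrix and
the vectors of the elementary maps, `5`, `6` and `7` the pivot rows, the rows in use and the pivot
columns, `8` to `10` the factors and products; `15` and `16` the order of the simplices, `17` and
`19` the items and the positions of their radii, `21` and `22` the order of the items. -/
structure Layout {v n : ℕ} {K : AbstractSimplicialComplex (Fin v)} (σ : Fin n ≃ K.faces)
    (w : Finset (Fin v) → ℝ≥0) (d M L : ℕ) (s : Memory) : Prop where
  describes : Describes σ w d s
  size : s.word 3 = 2 ^ L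
  log : s.word 4 = L
  three : s.word 5 = 3 * n
  two : s.word 6 = 2 * n
  square : s.word 7 = n * n
  area : s.word 11 = 2 ^ L * 2 ^ L
  le : 3 * n ≤ 2 ^ L
  lt : 2 ^ L * 2 ^ L < M

/-- The distances which are stored are nonnegative, and the flags for infinite distances are
truth values. -/
structure Distances (s : Memory) : Prop where
  dist_nonneg : ∀ q, 0 ≤ s.realArray 1 q
  key_nonneg : ∀ y, 0 ≤ s.realArray 2 y
  flag : ∀ y, s.wordArray 14 y < 2

theorem Distances.fixes {s s' : Memory} {c : Cmd} (h : Distances s) (hf : c.Fixes s s')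
    (h1 : c.rstores 1 = false := by rfl) (h2 : c.rstores 2 = false := by rfl)
    (h3 : c.stores 14 = false := by rfl) : Distances s' := by
  refine ⟨?_, ?_, ?_⟩
  · rw [hf.rarr 1 h1]
    exact h.dist_nonneg
  · rw [hf.rarr 2 h2]
    exact h.key_nonneg
  · rw [hf.arr 14 h3]
    exact h.flag

theorem keyVal_fixes {s s' : Memory} {c : Cmd} (hf : c.Fixes s s')
    (h2 : c.rstores 2 = false := by rfl) (h3 : c.stores 14 = false := by rfl) :
    keyVal s' = keyVal s := by
  funext x
  rw [keyVal, keyVal, hf.rarr 2 h2, hf.arr 14 h3]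

section Program

open RAM.Expr

/-- Compute the distances of the simplices from the vertex in register `40`, sort the simplices,
and store their boundaries. -/
def orderSimplices : Cmd :=
  .seq simplexDistances <| .seq (sortBy 15 16 0 fun r => reg 40 * reg 0 + reg r) storeBoundary

end Program

section

variable {v n d : ℕ} {K : AbstractSimplicialComplex (Fin v)} {σ : Fin n ≃ K.faces}
  {w : Finset (Fin v) → ℝ≥0} {s : Memory} {M L : ℕ}

theorem Layout.fixes {s' : Memory} {c : Cmd} (h : Layout σ w d M L s) (hf : c.Fixes s s')
    (h1 : ∀ r < 12, r < 8 ∨ r = 11 → c.assigns r = false := by decide)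
    (h2 : ∀ A, A < 13 → A < 3 ∨ A = 11 ∨ A = 12 → c.stores A = false := by decide)
    (h3 : c.rstores 0 = false := by decide) (h4 : c.rstores 4 = false := by decide) :
    Layout σ w d M L s' where
  describes := h.describes.fixes hf (fun r hr => h1 r (by omega) (by omega)) h2 h3 h4
  size := (hf.word 3 (h1 3 (by omega) (by omega))).trans h.size
  log := (hf.word 4 (h1 4 (by omega) (by omega))).trans h.log
  three := (hf.word 5 (h1 5 (by omega) (by omega))).trans h.three
  two := (hf.word 6 (h1 6 (by omega) (by omega))).trans h.two
  square := (hf.word 7 (h1 7 (by omega) (by omega))).trans h.square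
  area := (hf.word 11 (h1 11 (by omega) (by omega))).trans h.area
  le := h.le
  lt := h.lt

/-- The command establishes the hypotheses of the first elimination, and adds the distances from `p`
to the table of all distances. -/
theorem orderSimplices_ok {p : Fin v} (hM : 2 ≤ M) (h : Layout σ w d M L s) (hd : Distances s)
    (h40 : s.word 40 = p) : Ok M orderSimplices s fun s' =>
      Distances s' ∧ (∀ y < p * n, keyVal s' y = keyVal s y) ∧
      (∀ i < n, keyVal s' (p * n + i) = simplexKey σ w p i) ∧
      IsDistanceOrder σ w p (s'.wordArray 16) (s'.wordArray 15) ∧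
      (∀ i < 2 ^ L, ∀ j < 2 ^ L, s'.wordArray 3 (i * 2 ^ L + j) < 2) ∧
      ∀ j < 2 ^ L, col (2 ^ L) (s'.wordArray 3) j = sortedBoundary σ d (s'.wordArray 16) j := by
  have hle := h.le
  have hlt := h.lt
  have hSS : 2 ^ L ≤ 2 ^ L * 2 ^ L := Nat.le_mul_self _
  refine (simplexDistances_ok hM h.describes h40 hd.1 hd.2 hd.3).then
    fun s₁ hs₁ ⟨h1, h2, h3, h4, h5⟩ => ?_
  have l₁ := h.fixes hs₁
  have w40 : s₁.word 40 = p := (hs₁.word 40 rfl).trans h40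
  refine (sortBy_ok (N := n) (a := fun k => p * n + k) l₁.describes.n_eq (by omega) (by omega)
    (by omega) (by omega) h3 h2 ?_).then fun s₂ hs₂ ⟨h6, h7⟩ => ?_
  · intro f k l
    simp [l₁.describes.n_eq, w40]
  have l₂ := l₁.fixes hs₂
  have ho : IsDistanceOrder σ w p (s₂.wordArray 16) (s₂.wordArray 15) := by
    refine ⟨fun j hj => ?_, fun i hi => ?_, fun i hi j hj hij => ?_⟩
    · obtain ⟨h8, h9⟩ := rank_inverse h7 hj
      refine ⟨h8, ?_⟩
      rw [h6 _ h8, h9]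
    · rw [h6 i hi]
      exact ⟨rank_lt hi, h7 i hi⟩
    · rw [h6 i hi, h6 j hj] at hij
      have := key_le_of_rank_le hj hij
      simpa only [h5 i hi, h5 j hj] using this
  refine ((storeBoundary_ok hM l₂.describes l₂.size l₂.area (by omega) fun j hj =>
    (ho.order j hj).1).fixes).mono fun s₃ ⟨hs₃, h8, h9⟩ => ?_
  have e16 : s₃.wordArray 16 = s₂.wordArray 16 := hs₃.arr 16 rfl
  have e15 : s₃.wordArray 15 = s₂.wordArray 15 := hs₃.arr 15 rfl
  have ek : keyVal s₃ = keyVal s₁ := (keyVal_fixes hs₃).trans (keyVal_fixes hs₂)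
  rw [ek, e16, e15]
  exact ⟨((Distances.mk h1 h2 h3).fixes hs₂).fixes hs₃, h4, h5, ho, h8, h9⟩

end

end RAM

namespace RAM

open Elimination

/-! ### The items from which the basis is selected -/

section

variable {v n d : ℕ} {K : AbstractSimplicialComplex (Fin v)} {σ : Fin n ≃ K.faces}
  {w : Finset (Fin v) → ℝ≥0} {s : Memory} {M L : ℕ}

variable (σ w) in
/-- The first `n` rows of word array `17` hold the basis that has been found for the vertices below
`p`, and word array `19` the positions of the radii of its cycles in the table of distances. -/
structure StoresBasis (d p : ℕ) (s : Memory) (g : ℕ) (c : ℕ → cycles K d) (key : ℕ → ℝ≥0∞) :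
    Prop where
  greedy : GreedyBasis σ w {p' | (p' : ℕ) < p} g c key
  count : s.word 25 = g
  row : ∀ t < n, ∀ i < n, s.wordArray 17 (t * n + i) < 2 ∧
    (s.wordArray 17 (t * n + i) : ZMod 2) = if t < g then chainVec σ (c t).1 i else 0
  pointer : ∀ t < g, s.wordArray 19 t < p * n ∧ keyVal s (s.wordArray 19 t) = key t

variable (σ w) in
/-- The first `2 * n` rows of word array `17` hold the cycles `item`, from which the basis for the
vertices up to `p` is to be selected: the old basis, the fundamental cycles of the balls around
`p`, and zeros. -/
structure StoresItems (d : ℕ) (p : Fin v) (s : Memory) (g : ℕ) (c : ℕ → cycles K d) (key : ℕ → ℝ≥0∞)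
    (item : ℕ → cycles K d) : Prop where
  row : ∀ t < 2 * n, ∀ i < n, s.wordArray 17 (t * n + i) < 2 ∧
    (s.wordArray 17 (t * n + i) : ZMod 2) = chainVec σ (item t).1 i
  pointer : ∀ t < 2 * n, item t ≠ 0 → s.wordArray 19 t < (p + 1) * n
  small : ∀ t < 2 * n, ∃ p', InBall σ w p' (keyVal s (s.wordArray 19 t)) (chainVec σ (item t).1)
  old : ∀ t < g, item t = c t ∧ keyVal s (s.wordArray 19 t) = key t
  new : ∀ r, ∀ z : cycles K d, InBall σ w p r (chainVec σ z.1) →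
    homologyClass K d z ∈ Submodule.span (ZMod 2)
      ((fun t => homologyClass K d (item t)) '' {t | t < 2 * n ∧ keyVal s (s.wordArray 19 t) ≤ r})

theorem StoresItems.congr {p : Fin v} {s s' : Memory} {g : ℕ} {c item : ℕ → cycles K d}
    {key : ℕ → ℝ≥0∞} (h : StoresItems σ w d p s g c key item)
    (h1 : s'.wordArray 17 = s.wordArray 17) (h2 : s'.wordArray 19 = s.wordArray 19)
    (h3 : keyVal s' = keyVal s) : StoresItems σ w d p s' g c key item := by
  refine ⟨?_, ?_, ?_, ?_, ?_⟩
  · rw [h1]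
    exact h.row
  · rw [h2]
    exact h.pointer
  · rw [h2, h3]
    exact h.small
  · rw [h2, h3]
    exact h.old
  · rw [h2, h3]
    exact h.new

theorem StoresBasis.fixes {p : ℕ} {s s' : Memory} {g : ℕ} {c : ℕ → cycles K d}
    {key : ℕ → ℝ≥0∞} (h : StoresBasis σ w d p s g c key) {cmd : Cmd} (hf : cmd.Fixes s s')
    (hk : ∀ y < p * n, keyVal s' y = keyVal s y) (h1 : cmd.assigns 25 = false := by rfl)
    (h2 : cmd.stores 17 = false := by rfl) (h3 : cmd.stores 19 = false := by rfl) :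
    StoresBasis σ w d p s' g c key := by
  refine ⟨h.greedy, (hf.word 25 h1).trans h.count, ?_, fun t ht => ?_⟩
  · rw [hf.arr 17 h2]
    exact h.row
  · rw [hf.arr 19 h3, hk _ (h.pointer t ht).1]
    exact h.pointer t ht

/-- The commands `storeCandidates` and `storePointers` complete the list of items. -/
theorem storeCandidates_then_ok {p : Fin v} {g : ℕ} {c : ℕ → cycles K d} {key : ℕ → ℝ≥0∞}
    (hM : 2 ≤ M) (h : Layout σ w d M L s) (hvn : v ≤ n) (h40 : s.word 40 = p)
    (hk : ∀ i < n, keyVal s (p * n + i) = simplexKey σ w p i)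
    (ho : IsDistanceOrder σ w p (s.wordArray 16) (s.wordArray 15))
    {a : ℕ → ℕ} (ha : ∀ j < 2 ^ L, col (2 ^ L) a j = sortedBoundary σ d (s.wordArray 16) j)
    (he : Eliminated (2 ^ L) a s) (hb : StoresBasis σ w d p s g c key) :
    Ok M (.seq storeCandidates storePointers) s fun s' =>
      ∃ item, StoresItems σ w d p s' g c key item := by
  classical
  have hle := h.le
  have hlt := h.lt
  have hSS : 2 ^ L ≤ 2 ^ L * 2 ^ L := Nat.le_mul_self _
  have hnn : n * n + n * n ≤ 2 ^ L * 2 ^ L := by nlinarith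
  have hpn : p * n + n ≤ n * n := by
    have := p.2
    nlinarith
  have helim : IsElimination (2 ^ L) (sortedBoundary σ d (s.wordArray 16)) (col (2 ^ L) (s.wordArray 3))
      (s.wordArray 5) fun k => s.wordArray 7 k = 1 :=
    ⟨fun k hk => by rw [← ha k hk]; exact he.elim.eq_comp k hk, he.elim.pivot, he.elim.zero⟩
  refine (storeCandidates_ok hM h.describes h.size h.square (by omega) (fun j hj => (ho.order j hj).1)
    (fun i hi => (ho.position i hi).1) he.bitA he.piv he.isPiv fun k => Iff.rfl).then
    fun s₁ hs₁ ⟨h1, _, h3⟩ => ?_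
  have l₁ := h.fixes hs₁
  have e16 : s₁.wordArray 16 = s.wordArray 16 := hs₁.arr 16 rfl
  refine (storePointers_ok l₁.describes ((hs₁.word 40 rfl).trans h40)
    (fun j hj => by rw [e16]; exact (ho.order j hj).1) (by omega)).fixes.mono
    fun s₂ ⟨hs₂, h4, h5⟩ => ?_
  have e17 : s₂.wordArray 17 = s₁.wordArray 17 := hs₂.arr 17 rfl
  have e19 : s₁.wordArray 19 = s.wordArray 19 := hs₁.arr 19 rfl
  have ek : keyVal s₂ = keyVal s := (keyVal_fixes hs₂).trans (keyVal_fixes hs₁)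
  rw [e19] at h4
  rw [e16] at h5
  have hg := hb.greedy.le
  -- the fundamental cycles
  have hz : ∀ j, ∃ z : cycles K d, j < n → chainVec σ z.1 =
      if numVertices σ (s.wordArray 16 j) = d + 1 ∧ ¬ s.wordArray 7 j = 1 then
        fundamentalVec n (s.wordArray 15) (col (2 ^ L) (s.wordArray 3) j) (s.wordArray 5)
          (fun k => s.wordArray 7 k = 1) j else 0 := by
    intro j
    by_cases hj : j < n ∧ numVertices σ (s.wordArray 16 j) = d + 1 ∧ ¬ s.wordArray 7 j = 1
    · obtain ⟨z, hz⟩ := ho.exists_cycle (by omega) helim hj.1 hj.2.1 hj.2.2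
      exact ⟨z, fun _ => by rw [if_pos hj.2, hz]⟩
    · refine ⟨0, fun hjn => ?_⟩
      rw [if_neg fun h' => hj ⟨hjn, h'⟩, Submodule.coe_zero, map_zero]
  choose z hz using hz
  set item : ℕ → cycles K d := fun t => if t < n then if t < g then c t else 0 else z (t - n) with hitem
  have hin : ∀ j, item (n + j) = z j := by
    intro j
    simp [hitem]
  have hik : ∀ j < n, keyVal s₂ (s₂.wordArray 19 (n + j)) = simplexKey σ w p (s.wordArray 16 j) := by
    intro j hj
    rw [ek, h5 j hj, hk _ (ho.order j hj).1]
  refine ⟨item, fun t ht i hi => ?_, fun t ht h0 => ?_, fun t ht => ?_, fun t ht => ?_,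
    fun r x hx => ?_⟩
  · rw [e17]
    by_cases htn : t < n
    · rw [h1 _ (idx_lt_sq htn hi)]
      refine ⟨(hb.row t htn i hi).1, (hb.row t htn i hi).2.trans ?_⟩
      simp only [hitem, htn, if_true]
      split_ifs
      · rfl
      · rw [Submodule.coe_zero, map_zero]
        rfl
    · obtain ⟨j, rfl⟩ := Nat.exists_eq_add_of_le (not_lt.1 htn)
      rw [hin, hz j (by omega)]
      have := h3 j (by omega) i hi
      refine ⟨this.1, this.2.trans ?_⟩
      split_ifs <;> rfl
  · by_cases htn : t < n
    · have htg : t < g := by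
        by_contra htg
        simp [hitem, htn, htg] at h0
      rw [h4 t htn]
      have := (hb.pointer t htg).1
      nlinarith
    · obtain ⟨j, rfl⟩ := Nat.exists_eq_add_of_le (not_lt.1 htn)
      rw [h5 j (by omega)]
      have := (ho.order j (by omega)).1
      nlinarith
  · by_cases htn : t < n
    · simp only [hitem, htn, if_true]
      by_cases htg : t < g
      · rw [if_pos htg, h4 t htn, ek, (hb.pointer t htg).2]
        exact hb.greedy.small t htg
      · rw [if_neg htg]
        exact ⟨p, fun i hi => absurd (by rw [Submodule.coe_zero, map_zero]; rfl) hi⟩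
    · obtain ⟨j, rfl⟩ := Nat.exists_eq_add_of_le (not_lt.1 htn)
      rw [hik j (by omega), hin, hz j (by omega)]
      refine ⟨p, ?_⟩
      split_ifs with hj
      · exact ho.inBall (by omega) helim (by omega) hj.1
      · exact fun i hi => absurd rfl hi
  · have htn : t < n := by omega
    refine ⟨by simp [hitem, htn, ht], ?_⟩
    rw [h4 t htn, ek, (hb.pointer t ht).2]
  · refine ho.mem_span (by omega) helim hx item _ fun j hj hd hq hr => ⟨n + j, ⟨by omega, ?_⟩, ?_⟩
    · rwa [hik j hj]
    · rw [hin, hz j hj, if_pos ⟨hd, hq⟩]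

section Program

open RAM.Expr

/-- Collect the items, sort them by their radii, and store them as the columns of a matrix. -/
def collectItems : Cmd :=
  .seq (.seq storeCandidates storePointers) <| .seq (sortBy 21 22 6 fun r => arr 19 (reg r)) storeItems

end Program

/-- Word array `22` lists the items by their radii, and the matrix has the columns that
`GreedyBasis.step` requires. -/
theorem collectItems_ok {p : Fin v} {g : ℕ} {c : ℕ → cycles K d} {key : ℕ → ℝ≥0∞}
    (hM : 2 ≤ M) (h : Layout σ w d M L s) (hD : Distances s) (hvn : v ≤ n) (h40 : s.word 40 = p)
    (hk : ∀ i < n, keyVal s (p * n + i) = simplexKey σ w p i)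
    (ho : IsDistanceOrder σ w p (s.wordArray 16) (s.wordArray 15))
    {a : ℕ → ℕ} (ha : ∀ j < 2 ^ L, col (2 ^ L) a j = sortedBoundary σ d (s.wordArray 16) j)
    (he : Eliminated (2 ^ L) a s) (hb : StoresBasis σ w d p s g c key) :
    Ok M collectItems s fun s' => ∃ item, StoresItems σ w d p s' g c key item ∧
      (∀ t < 2 * n, ∃ u < 2 * n, s'.wordArray 22 u = t) ∧
      (∀ u < 2 * n, s'.wordArray 22 u < 2 * n) ∧
      (∀ u u', u ≤ u' → u' < 2 * n → keyVal s' (s'.wordArray 19 (s'.wordArray 22 u)) ≤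
        keyVal s' (s'.wordArray 19 (s'.wordArray 22 u'))) ∧
      (∀ i < 2 ^ L, ∀ j < 2 ^ L, s'.wordArray 3 (i * 2 ^ L + j) < 2) ∧
      ∀ j < 2 ^ L, col (2 ^ L) (s'.wordArray 3) j =
        itemColumn σ d (2 * n) (fun u => chainVec σ (item (s'.wordArray 22 u)).1) j := by
  have hle := h.le
  have hlt := h.lt
  have hSS : 2 ^ L ≤ 2 ^ L * 2 ^ L := Nat.le_mul_self _
  refine (storeCandidates_then_ok hM h hvn h40 hk ho ha he hb).then fun s₁ hs₁ ⟨item, hi⟩ => ?_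
  have l₁ := h.fixes hs₁
  have hD₁ := hD.fixes hs₁
  refine (sortBy_ok (N := 2 * n) (a := s₁.wordArray 19) l₁.two (by omega) (by omega)
    (by omega) (by omega) hD₁.flag hD₁.key_nonneg ?_).then fun s₂ hs₂ ⟨h6, h7⟩ => ?_
  · intro f k l
    simp
  have l₂ := l₁.fixes hs₂
  have hi₂ := hi.congr (hs₂.arr 17 rfl) (hs₂.arr 19 rfl) (keyVal_fixes hs₂)
  have h22 : ∀ u < 2 * n, s₂.wordArray 22 u < 2 * n := fun u hu => (rank_inverse h7 hu).1
  refine (storeItems_ok (x := fun u => chainVec σ (item (s₂.wordArray 22 u)).1) hM l₂.describes l₂.size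
    l₂.area l₂.three hle (fun u hu i hin => hi₂.row _ (h22 u hu) i hin) fun u _ i hin =>
      chainVec_eq_zero (.inl hin)).fixes.mono fun s₃ ⟨hs₃, h8, h9⟩ => ?_
  have e22 : s₃.wordArray 22 = s₂.wordArray 22 := hs₃.arr 22 rfl
  have e19 : s₃.wordArray 19 = s₁.wordArray 19 := (hs₃.arr 19 rfl).trans (hs₂.arr 19 rfl)
  have ek : keyVal s₃ = keyVal s₁ := (keyVal_fixes hs₃).trans (keyVal_fixes hs₂)
  refine ⟨item, hi₂.congr (hs₃.arr 17 rfl) (hs₃.arr 19 rfl) (keyVal_fixes hs₃), fun t ht =>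
    ⟨rank (2 * n) (fun i => keyVal s₁ (s₁.wordArray 19 i)) t, rank_lt ht, ?_⟩, ?_, fun u u' hu hu' => ?_, h8, ?_⟩
  · rw [e22]
    exact h7 t ht
  · rw [e22]
    exact h22
  · rw [e22, e19, ek]
    refine key_le_of_rank_le (key := fun i => keyVal s₁ (s₁.wordArray 19 i)) (h22 u' hu') ?_
    rw [(rank_inverse h7 (hu.trans_lt hu')).2, (rank_inverse h7 hu').2]
    exact hu
  · rw [e22]
    exact h9

end

end RAM

namespace RAM

open Elimination

/-! ### The selection of the basis -/

section Program

open RAM.Expr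

/-- List the items which have been selected, in register `25` and word array `23`. -/
def selectPositions : Cmd :=
  .seq (fill 24 6 (arr 7 (reg 0 + reg 16) * sum 17 6 (lt (reg 17) (reg 16) * arr 7 (reg 0 + reg 17)) +
    (const 1 - arr 7 (reg 0 + reg 16)) * (reg 6 + reg 16))) <|
  .seq (fillAt 23 6 (arr 24 (reg 16)) (reg 16)) (.assign 25 (sum 17 6 (arr 7 (reg 0 + reg 17))))

/-- Replace the basis by the selected items. -/
def storeSelection : Cmd :=
  .seq (fill 18 7 (lt (reg 16 / reg 0) (reg 25) *
    arr 17 (arr 22 (arr 23 (reg 16 / reg 0)) * reg 0 + mod (reg 16) (reg 0)))) <|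
  .seq (fill 20 0 (lt (reg 16) (reg 25) * arr 19 (arr 22 (arr 23 (reg 16))))) <|
  .seq (fill 17 7 (arr 18 (reg 16))) (fill 19 0 (arr 20 (reg 16)))

end Program

theorem count_eq_sum {f : ℕ → ℕ} {N u : ℕ} (hf : ∀ k < N, f k < 2) (hu : u ≤ N) :
    Nat.count (fun k => f k = 1) u = ∑ l ∈ Finset.range N, (if l < u then 1 else 0) * f l := by
  have h1 : ∀ l ∈ Finset.range N, (if l < u then 1 else 0) * f l = if l < u ∧ f l = 1 then 1 else 0 := by
    intro l hl
    have h2 := hf l (Finset.mem_range.1 hl)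
    have h3 : f l = 0 ∨ f l = 1 := by omega
    rcases h3 with h3 | h3 <;> simp [h3]
  rw [Finset.sum_congr rfl h1, Nat.count_eq_card_filter_range, ← Finset.card_filter]
  congr 1
  ext l
  simp only [Finset.mem_filter, Finset.mem_range]
  omega

theorem exists_count_eq {q : ℕ → Prop} [DecidablePred q] {N i : ℕ} (h : i < Nat.count q N) :
    ∃ u < N, q u ∧ Nat.count q u = i := by
  induction N with
  | zero => simp at h
  | succ N ih =>
    by_cases hi : i < Nat.count q N
    · obtain ⟨u, h1, h2⟩ := ih hi
      exact ⟨u, by omega, h2⟩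
    · rw [Nat.count_succ] at h
      split_ifs at h with hq
      · exact ⟨N, by omega, hq, by omega⟩
      · omega

section

variable {v n d : ℕ} {K : AbstractSimplicialComplex (Fin v)} {σ : Fin n ≃ K.faces}
  {w : Finset (Fin v) → ℝ≥0} {s : Memory} {M L : ℕ}

/-- The `k`-th selected item is written to position `k`; the others go to positions from `2 * n` on,
so that the positions of all writes are distinct. -/
theorem selectPositions_ok (h : Layout σ w d M L s) (h7 : ∀ k < 2 ^ L, s.wordArray 7 k < 2) :
    Ok M selectPositions s fun s' =>
      s'.word 25 = Nat.count (fun u => s.wordArray 7 (n + u) = 1) (2 * n) ∧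
      ∀ u < 2 * n, s.wordArray 7 (n + u) = 1 →
        s'.wordArray 23 (Nat.count (fun u => s.wordArray 7 (n + u) = 1) u) = u := by
  have hle := h.le
  have hlt := h.lt
  have hSS : 2 ^ L ≤ 2 ^ L * 2 ^ L := Nat.le_mul_self _
  have hnM : 4 * n < M := by
    have h1 : n ≤ n * n := Nat.le_mul_self n
    have h2 : 3 * n * (3 * n) ≤ 2 ^ L * 2 ^ L := Nat.mul_le_mul hle hle
    nlinarith
  set q : ℕ → Prop := fun u => s.wordArray 7 (n + u) = 1 with hq
  have hf : ∀ k < 2 * n, s.wordArray 7 (n + k) < 2 := fun k hk => h7 _ (by omega)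
  have hcount : ∀ u ≤ 2 * n, Nat.count q u =
      ∑ l ∈ Finset.range (2 * n), (if l < u then 1 else 0) * s.wordArray 7 (n + l) := fun u hu =>
    count_eq_sum hf hu
  have hcle : ∀ u, Nat.count q u ≤ u := fun u => Nat.count_le q
  set g : ℕ → ℕ := fun u => if q u then Nat.count q u else 2 * n + u with hg
  refine Ok.then (Q := fun s' => ∀ u < 2 * n, s'.wordArray 24 u = g u)
    (Ok.fill g ?_ ?_ ?_) fun s₁ hs₁ h1 => ?_
  · intro k hk f _
    rw [h.two] at hk
    simp only [Expr.eval_mul, Expr.eval_lt', Expr.eval_sum,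
      Expr.eval_arr, Expr.eval_add, Expr.eval_sub, Expr.eval_reg, Expr.eval_const, word_setWord,
      word_setArr, wordArray_setWord, wordArray_setArr]
    simp only [h.describes.n_eq, h.two, if_true, Nat.reduceEqDiff, if_false, ← hcount k hk.le, hg]
    have h3 := hf k hk
    by_cases h4 : s.wordArray 7 (n + k) = 1
    · simp [hq, h4]
    · have h5 : s.wordArray 7 (n + k) = 0 := by omega
      simp [hq, h5]
  · intro k hk
    rw [h.two] at hk
    have := hcle k
    simp only [hg]
    split_ifs <;> omega
  · intro u hu
    simp [h.two, hu]
  have l₁ := h.fixes hs₁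
  refine Ok.then (Q := fun s' => ∀ u < 2 * n, s'.wordArray 23 (g u) = u)
    (Ok.fillAt g (fun u => u) ?_ ?_ ?_ ?_ ?_) fun s₂ hs₂ h2 => ?_
  · intro k hk l hl hkl
    rw [l₁.two] at hk hl
    have h4 := hcle k
    have h5 := hcle l
    simp only [hg] at hkl
    split_ifs at hkl with h6 h7 h7
    · exact Nat.count_injective h6 h7 hkl
    all_goals omega
  · intro k hk f _
    rw [l₁.two] at hk
    simp [h1 k hk]
  · intro k _ f _
    simp
  · intro k hk
    rw [l₁.two] at hk
    omega
  · intro f hf1 _ u hu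
    rw [l₁.two] at hf1
    simpa using hf1 u hu
  have l₂ := l₁.fixes hs₂
  have e7 : s₂.wordArray 7 = s.wordArray 7 := (hs₂.arr 7 rfl).trans (hs₁.arr 7 rfl)
  have heval : (Expr.sum 17 6 (.arr 7 (.reg 0 + .reg 17))).eval s₂ = Nat.count q (2 * n) := by
    rw [hcount _ le_rfl]
    simp only [Expr.eval_sum, Expr.eval_arr, Expr.eval_add, Expr.eval_reg, word_setWord,
      wordArray_setWord, l₂.two, l₂.describes.n_eq, e7, if_true, Nat.reduceEqDiff, if_false]
    refine Finset.sum_congr rfl fun l hl => ?_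
    rw [if_pos (Finset.mem_range.1 hl), one_mul]
  refine Ok.assign ?_ ⟨?_, fun u hu hqu => ?_⟩
  · rw [heval]
    have := hcle (2 * n)
    omega
  · rw [heval, word_setWord, if_pos rfl]
  · have := h2 u hu
    simp only [hg, if_pos (show q u from hqu)] at this
    simpa using this

/-- The new basis is assembled in the arrays `18` and `20` first, as the selected rows may overlap
with the rows that they replace. -/
theorem storeSelection_ok {g : ℕ} (hM : 2 ≤ M) (hB : Bounded M s) (h : Layout σ w d M L s)
    (h25 : s.word 25 = g)
    (hrow : ∀ t < g, ∀ i < n, s.wordArray 17 (s.wordArray 22 (s.wordArray 23 t) * n + i) < 2) :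
    Ok M storeSelection s fun s' =>
      (∀ t < n, ∀ i < n, s'.wordArray 17 (t * n + i) =
        if t < g then s.wordArray 17 (s.wordArray 22 (s.wordArray 23 t) * n + i) else 0) ∧
      ∀ t < n, t < g → s'.wordArray 19 t = s.wordArray 19 (s.wordArray 22 (s.wordArray 23 t)) := by
  refine Ok.then (Q := fun s' => ∀ t < n, ∀ i < n, s'.wordArray 18 (t * n + i) =
      if t < g then s.wordArray 17 (s.wordArray 22 (s.wordArray 23 t) * n + i) else 0)
    (Ok.fill (fun x => if x / n < g then
      s.wordArray 17 (s.wordArray 22 (s.wordArray 23 (x / n)) * n + x % n) else 0) ?_ ?_ ?_)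
    fun s₁ hs₁ h1 => ?_
  · intro k hk f _
    by_cases hk : k / n < g <;> simp [h.describes.n_eq, h25, hk]
  · intro k hk
    rw [h.square] at hk
    split_ifs with h1
    · exact (hrow _ h1 _ (lt_sq_iff hk).2.1).trans_le hM
    · omega
  · intro t ht i hi
    simp [h.square, idx_lt_sq ht hi, div_idx _ hi, mod_idx _ hi]
  have l₁ := h.fixes hs₁
  have e25 : s₁.word 25 = g := (hs₁.word 25 rfl).trans h25
  have e19 : s₁.wordArray 19 = s.wordArray 19 := hs₁.arr 19 rfl
  have e22 : s₁.wordArray 22 = s.wordArray 22 := hs₁.arr 22 rfl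
  have e23 : s₁.wordArray 23 = s.wordArray 23 := hs₁.arr 23 rfl
  refine Ok.then (Q := fun s' => ∀ t < n, s'.wordArray 20 t =
      if t < g then s.wordArray 19 (s.wordArray 22 (s.wordArray 23 t)) else 0)
    (Ok.fill (fun t => if t < g then s.wordArray 19 (s.wordArray 22 (s.wordArray 23 t)) else 0) ?_ ?_ ?_)
    fun s₂ hs₂ h2 => ?_
  · intro k hk f _
    by_cases hk : k < g <;> simp [e19, e22, e23, e25, hk]
  · intro k hk
    split_ifs with h1
    · exact hB.array _ _
    · omega
  · intro t ht
    simp [l₁.describes.n_eq, ht]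
  have l₂ := l₁.fixes hs₂
  have e18 : s₂.wordArray 18 = s₁.wordArray 18 := hs₂.arr 18 rfl
  rw [← e18] at h1
  refine Ok.then (Q := fun s' => ∀ t < n, ∀ i < n, s'.wordArray 17 (t * n + i) =
      if t < g then s.wordArray 17 (s.wordArray 22 (s.wordArray 23 t) * n + i) else 0)
    (Ok.fill (fun x => s₂.wordArray 18 x) ?_ ?_ ?_) fun s₃ hs₃ h3 => ?_
  · intro k hk f _
    simp
  · intro k hk
    rw [l₂.square] at hk
    obtain ⟨h4, h5, h6⟩ := lt_sq_iff hk
    rw [← h6, h1 _ h4 _ h5]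
    split_ifs with h7
    · exact (hrow _ h7 _ h5).trans_le hM
    · omega
  · intro t ht i hi
    rw [← h1 t ht i hi]
    simp [l₂.square, idx_lt_sq ht hi]
  have l₃ := l₂.fixes hs₃
  have e20 : s₃.wordArray 20 = s₂.wordArray 20 := hs₃.arr 20 rfl
  rw [← e20] at h2
  refine Ok.fill (fun t => s₃.wordArray 20 t) ?_ ?_ ⟨fun t ht i hi => ?_, fun t ht htg => ?_⟩
  · intro k hk f _
    simp
  · intro k hk
    rw [l₃.describes.n_eq] at hk
    rw [h2 k hk]
    split_ifs with h1
    · exact hB.array _ _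
    · omega
  · rw [← h3 t ht i hi]
    simp
  · simp [l₃.describes.n_eq, ht, h2 t ht, htg]

/-- The items whose columns are pivot columns form the new basis. -/
theorem select_ok {p : Fin v} {g : ℕ} {c item : ℕ → cycles K d} {key : ℕ → ℝ≥0∞}
    (hM : 2 ≤ M) (hB : Bounded M s) (h : Layout σ w d M L s)
    (hb : GreedyBasis σ w {p' | (p' : ℕ) < p} g c key) (hi : StoresItems σ w d p s g c key item)
    (hsurj : ∀ t < 2 * n, ∃ u < 2 * n, s.wordArray 22 u = t)
    (hmaps : ∀ u < 2 * n, s.wordArray 22 u < 2 * n)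
    (hmono : ∀ u u', u ≤ u' → u' < 2 * n → keyVal s (s.wordArray 19 (s.wordArray 22 u)) ≤
      keyVal s (s.wordArray 19 (s.wordArray 22 u')))
    {a : ℕ → ℕ} (ha : ∀ j < 2 ^ L, col (2 ^ L) a j =
      itemColumn σ d (2 * n) (fun u => chainVec σ (item (s.wordArray 22 u)).1) j)
    (he : Eliminated (2 ^ L) a s) :
    Ok M (.seq selectPositions storeSelection) s fun s' =>
      ∃ g c key, StoresBasis σ w d (p + 1) s' g c key := by
  have hle := h.le
  have hg := hb.le
  have helim : IsElimination (2 ^ L)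
      (itemColumn σ d (2 * n) (fun u => chainVec σ (item (s.wordArray 22 u)).1))
      (col (2 ^ L) (s.wordArray 3)) (s.wordArray 5) fun k => s.wordArray 7 k = 1 :=
    ⟨fun k hk => by rw [← ha k hk]; exact he.elim.eq_comp k hk, he.elim.pivot, he.elim.zero⟩
  refine ((selectPositions_ok h he.isPiv).bounded hM hB).then fun s₁ hs₁ ⟨hB₁, h1, h2⟩ => ?_
  set q : ℕ → Prop := fun u => s.wordArray 7 (n + u) = 1 with hq
  set g' := Nat.count q (2 * n) with hg'
  have hse : ∀ i < g', s₁.wordArray 23 i < 2 * n ∧ q (s₁.wordArray 23 i) ∧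
      Nat.count q (s₁.wordArray 23 i) = i := by
    intro i hi
    obtain ⟨u, hu, hqu, rfl⟩ := exists_count_eq hi
    rw [h2 u hu hqu]
    exact ⟨hu, hqu, rfl⟩
  set c' : ℕ → cycles K d := fun i => item (s.wordArray 22 (s₁.wordArray 23 i)) with hc'
  set key' : ℕ → ℝ≥0∞ := fun i => keyVal s (s.wordArray 19 (s.wordArray 22 (s₁.wordArray 23 i))) with hk'
  have hnew : GreedyBasis σ w (insert p {p' | (p' : ℕ) < p}) g' c' key' := by
    refine hb.step (item := fun u => item (s.wordArray 22 u))
      (ikey := fun u => keyVal s (s.wordArray 19 (s.wordArray 22 u))) (N := 2 * n) ?_ ?_ ?_ hmono helim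
      (by omega) (fun i hi => ⟨(hse i hi).1, (hse i hi).2.1, rfl, rfl⟩) ?_ ?_
    · intro i hig
      obtain ⟨u, hu, rfl⟩ := hsurj i (by omega)
      exact ⟨u, hu, hi.old _ hig⟩
    · exact fun u hu => hi.small _ (hmaps u hu)
    · intro r z hz
      refine Submodule.span_mono ?_ (hi.new r z hz)
      rintro _ ⟨t, ⟨ht, hr⟩, rfl⟩
      obtain ⟨u, hu, rfl⟩ := hsurj t ht
      exact ⟨u, ⟨hu, hr⟩, rfl⟩
    · exact fun t ht hqt => ⟨_, Nat.count_strict_mono (show q t from hqt) ht, h2 t ht hqt⟩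
    · intro i j hij hj
      by_contra hlt
      have := Nat.count_monotone q (not_lt.1 hlt)
      rw [(hse i (by omega)).2.2, (hse j hj).2.2] at this
      omega
  have hg'n := hnew.le
  have l₁ := h.fixes hs₁
  have e17 : s₁.wordArray 17 = s.wordArray 17 := hs₁.arr 17 rfl
  have e19 : s₁.wordArray 19 = s.wordArray 19 := hs₁.arr 19 rfl
  have e22 : s₁.wordArray 22 = s.wordArray 22 := hs₁.arr 22 rfl
  have hrow : ∀ t < g', ∀ i < n, _ := fun t ht i hin => hi.row _ (hmaps _ (hse t ht).1) i hin
  refine ((storeSelection_ok hM hB₁ l₁ h1 fun t ht i hin => ?_).fixes).mono fun s₂ ⟨hs₂, h3, h4⟩ =>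
    ⟨g', c', key', ?_, (hs₂.word 25 rfl).trans h1, fun t ht i hin => ?_, fun t ht => ?_⟩
  · rw [e17, e22]
    exact (hrow t ht i hin).1
  · have : insert p {p' : Fin v | (p' : ℕ) < p} = {p' : Fin v | (p' : ℕ) < p + 1} := by
      ext p'
      simp only [Set.mem_insert_iff, Set.mem_ofPred_eq, Fin.ext_iff]
      omega
    rwa [← this]
  · rw [h3 t ht i hin, e17, e22]
    split_ifs with htg
    · exact hrow t htg i hin
    · exact ⟨by omega, by simp⟩
  · rw [h4 t (by omega) ht, e19, e22, keyVal_fixes hs₂, keyVal_fixes hs₁]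
    refine ⟨hi.pointer _ (hmaps _ (hse t ht).1) fun h0 => ?_, rfl⟩
    have := hnew.indep.ne_zero ⟨t, ht⟩
    refine this ?_
    simp only [hc', h0]
    exact Submodule.Quotient.mk_zero _

end

end RAM

namespace RAM

open Elimination

/-! ### The passage to the next vertex -/

/-- Extend the basis by the cycles in the balls around the vertex in register `40`. -/
def augment : Cmd :=
  .seq orderSimplices <| .seq eliminate <| .seq collectItems <| .seq eliminate <|
    .seq selectPositions storeSelection

/-- The state of the memory when the balls around the vertices below `p` have been taken into
account. -/
structure State {v n : ℕ} {K : AbstractSimplicialComplex (Fin v)} (σ : Fin n ≃ K.faces)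
    (w : Finset (Fin v) → ℝ≥0) (d M L p : ℕ) (s : Memory) : Prop where
  layout : Layout σ w d M L s
  bounded : Bounded M s
  distances : Distances s
  bit : ∀ i < 2 ^ L, ∀ j < 2 ^ L, s.wordArray 4 (i * 2 ^ L + j) < 2
  basis : ∃ g c key, StoresBasis σ w d p s g c key

theorem State.of_word {v n d M L p : ℕ} {K : AbstractSimplicialComplex (Fin v)} {σ : Fin n ≃ K.faces}
    {w : Finset (Fin v) → ℝ≥0} {s : Memory} (h : State σ w d M L p s) {x : ℕ} (hx : x < M) :
    State σ w d M L p (s.setWord 40 x) := by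
  obtain ⟨g, c, key, hb⟩ := h.basis
  have hw : ∀ r < 40, (s.setWord 40 x).word r = s.word r := by
    intro r hr
    rw [word_setWord, if_neg (by omega)]
  refine ⟨⟨h.layout.describes.setWord x (by omega), ?_, ?_, ?_, ?_, ?_, ?_, h.layout.le, h.layout.lt⟩,
    h.bounded.setWord hx, ⟨h.distances.1, h.distances.2, h.distances.3⟩, h.bit, g, c, key, hb.greedy, ?_,
    hb.row, hb.pointer⟩
  all_goals rw [hw _ (by omega)]
  exacts [h.layout.size, h.layout.log, h.layout.three, h.layout.two, h.layout.square, h.layout.area,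
    hb.count]

/-- The cost for each vertex is that of two eliminations, up to a quadratic term. -/
theorem exists_augment_spec : ∃ C : ℕ, ∀ {v n d M L : ℕ} {K : AbstractSimplicialComplex (Fin v)}
    {σ : Fin n ≃ K.faces} {w : Finset (Fin v) → ℝ≥0} {κ : ℕ → ℕ} {s : Memory} {p : Fin v}, 2 ≤ M →
    v ≤ n → 2 ^ L ≤ 6 * n + 1 → State σ w d M L p s → s.word 40 = p →
    Spec M κ augment s (C * (6 * n + 1) ^ 2 + 2 * eliminateCost κ (2 ^ L) L)
      fun s' => State σ w d M L (p + 1) s' := by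
  obtain ⟨C₁, h₁⟩ := orderSimplices.exists_spec (o := 2) rfl rfl rfl (by decide)
  obtain ⟨C₂, h₂⟩ := collectItems.exists_spec (o := 2) rfl rfl rfl (by decide)
  obtain ⟨C₃, h₃⟩ := (Cmd.seq selectPositions storeSelection).exists_spec (o := 2) rfl rfl rfl (by decide)
  refine ⟨C₁ + C₂ + C₃, fun {v n d M L K σ w κ s p} hM hvn hL hs h40 => ?_⟩
  have hreg : ∀ {s : Memory}, Layout σ w d M L s → ∀ m, m = 0 ∨ m = 1 ∨ m = 5 ∨ m = 6 ∨ m = 7 ∨ m = 11 →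
      s.word m ≤ (6 * n + 1) ^ weight m := by
    rintro s hl m (rfl | rfl | rfl | rfl | rfl | rfl)
    · simp [weight, hl.describes.n_eq]
      omega
    · simp [weight, hl.describes.v_eq]
      omega
    · simp [weight, hl.three]
      omega
    · simp [weight, hl.two]
      omega
    · simp only [weight, hl.square]
      simp
      nlinarith
    · simp only [weight, hl.area]
      simpa [sq] using Nat.mul_le_mul hL hL
  have hB : 1 ≤ 6 * n + 1 := by omega
  obtain ⟨g, c, key, hb⟩ := hs.basis
  have hl := hs.layout
  refine Spec.mono (Spec.then (T := C₁ * (6 * n + 1) ^ 2)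
    (T' := eliminateCost κ (2 ^ L) L + (C₂ * (6 * n + 1) ^ 2 + (eliminateCost κ (2 ^ L) L +
      C₃ * (6 * n + 1) ^ 2)))
    ((h₁ hB (fun m hm hmb => hreg hl m (by revert m; decide))
      (orderSimplices_ok hM hl hs.distances h40)).bounded hM hs.bounded)
    fun s₁ hs₁ ⟨hB₁, hD₁, hk₁, hk₁', ho, hbit₁, hcol₁⟩ => ?_) (by ring_nf; omega) fun _ h => h
  have l₁ := hl.fixes hs₁
  have w₁ : s₁.word 40 = p := (hs₁.word 40 rfl).trans h40
  have hb₁ := hb.fixes hs₁ hk₁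
  refine Spec.then ((eliminate_spec hM l₁.size l₁.log rfl l₁.lt (hB₁.array 6) hbit₁
    (by rw [hs₁.arr 4 rfl]; exact hs.bit)).bounded hM hB₁) fun s₂ hs₂ ⟨hB₂, he₂⟩ => ?_
  have l₂ := l₁.fixes hs₂
  have w₂ : s₂.word 40 = p := (hs₂.word 40 rfl).trans w₁
  have hD₂ := hD₁.fixes hs₂
  have k₂ : keyVal s₂ = keyVal s₁ := keyVal_fixes hs₂
  have hb₂ := hb₁.fixes hs₂ fun y _ => by rw [k₂]
  have e15 : s₂.wordArray 15 = s₁.wordArray 15 := hs₂.arr 15 rfl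
  have e16 : s₂.wordArray 16 = s₁.wordArray 16 := hs₂.arr 16 rfl
  rw [← k₂] at hk₁'
  rw [← e15, ← e16] at ho
  rw [← e16] at hcol₁
  refine Spec.then ((h₂ hB (fun m hm hmb => hreg l₂ m (by revert m; decide))
    (collectItems_ok hM l₂ hD₂ hvn w₂ hk₁' ho hcol₁ he₂ hb₂)).bounded hM hB₂)
    fun s₃ hs₃ ⟨hB₃, item, hi, hsurj, hmaps, hmono, hbit₃, hcol₃⟩ => ?_
  have l₃ := l₂.fixes hs₃
  have hD₃ := hD₂.fixes hs₃
  refine Spec.then ((eliminate_spec hM l₃.size l₃.log rfl l₃.lt (hB₃.array 6) hbit₃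
    (by rw [hs₃.arr 4 rfl]; exact he₂.bitW)).bounded hM hB₃) fun s₄ hs₄ ⟨hB₄, he₄⟩ => ?_
  have l₄ := l₃.fixes hs₄
  have hD₄ := hD₃.fixes hs₄
  have k₄ : keyVal s₄ = keyVal s₃ := keyVal_fixes hs₄
  have hi₄ := hi.congr (hs₄.arr 17 rfl) (hs₄.arr 19 rfl) k₄
  have e22 : s₄.wordArray 22 = s₃.wordArray 22 := hs₄.arr 22 rfl
  have e19 : s₄.wordArray 19 = s₃.wordArray 19 := hs₄.arr 19 rfl
  rw [← k₄, ← e19, ← e22] at hmono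
  rw [← e22] at hsurj hmaps hcol₃
  refine (((h₃ hB (fun m hm hmb => hreg l₄ m (by revert m; decide))
    (select_ok hM hB₄ l₄ hb.greedy hi₄ hsurj hmaps hmono hcol₃ he₄)).bounded hM hB₄).fixes).mono le_rfl
    fun s₅ ⟨hs₅, hB₅, hb₅⟩ => ⟨l₄.fixes hs₅, hB₅, hD₄.fixes hs₅, ?_, hb₅⟩
  rw [hs₅.arr 4 rfl]
  exact he₄.bitW

end RAM

namespace RAM

open Elimination

/-! ### The preparation of the tables -/

section Program

open RAM.Expr

/-- Compute the registers which bound the loops. -/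
def prepareSizes : Cmd :=
  .seq (.assign 5 (const 3 * reg 0)) <| .seq (.assign 6 (const 2 * reg 0)) <|
  .seq (.assign 7 (reg 0 * reg 0)) <| .seq (.assign 3 (const 1)) <|
  .seq (.loop 33 5 (.seq (.assign 4 (reg 4 + lt (reg 3) (reg 5)))
    (.assign 3 (reg 3 + reg 3 * lt (reg 3) (reg 5))))) <|
  .assign 11 (reg 3 * reg 3)

/-- Compute the cardinalities of the simplices, the relation between simplices and their facets,
and the end points of the edges. -/
def prepareTables : Cmd :=
  .seq (fill 1 0 (sum 17 1 (arr 0 (reg 16 * reg 1 + reg 17)))) <|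
  .seq (fill 2 7 (eq (arr 1 (reg 16 / reg 0) + const 1) (arr 1 (mod (reg 16) (reg 0))) *
    eq (sum 17 1 (arr 0 (reg 16 / reg 0 * reg 1 + reg 17) *
      (const 1 - arr 0 (mod (reg 16) (reg 0) * reg 1 + reg 17)))) (const 0))) <|
  .seq (fill 11 0 (sum 17 1 (sum 18 1 (reg 17 * (arr 0 (reg 16 * reg 1 + reg 17) *
    (arr 0 (reg 16 * reg 1 + reg 18) * lt (reg 17) (reg 18))))))) <|
  fill 12 0 (sum 17 1 (sum 18 1 (reg 18 * (arr 0 (reg 16 * reg 1 + reg 17) *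
    (arr 0 (reg 16 * reg 1 + reg 18) * lt (reg 17) (reg 18))))))

end Program

section

variable {v n d : ℕ} {K : AbstractSimplicialComplex (Fin v)} {σ : Fin n ≃ K.faces}
  {w : Finset (Fin v) → ℝ≥0} {s : Memory} {M : ℕ}

/-- There are at most as many vertices as simplices, as each vertex is a simplex. -/
theorem card_le_of_equiv (σ : Fin n ≃ K.faces) : v ≤ n := by
  have h : Function.Injective fun q : Fin v => σ.symm ⟨{q}, K.singleton_mem q⟩ := by
    intro a b hab
    have := σ.symm.injective hab
    exact Finset.singleton_injective (congrArg Subtype.val this)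
  simpa using Fintype.card_le_of_injective _ h

/-- The size `2 ^ L` of the matrices is found by doubling while it is less than `3 * n`. -/
theorem prepareSizes_ok (hM : 2 ≤ M) (h0 : s.word 0 = n) (h4 : s.word 4 = 0)
    (hnM : (6 * n + 1) * (6 * n + 1) < M) : Ok M prepareSizes s fun s' => ∃ L, s'.word 3 = 2 ^ L ∧
      s'.word 4 = L ∧ s'.word 5 = 3 * n ∧ s'.word 6 = 2 * n ∧ s'.word 7 = n * n ∧
      s'.word 11 = 2 ^ L * 2 ^ L ∧ 3 * n ≤ 2 ^ L ∧ 2 ^ L ≤ 6 * n + 1 := by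
  have hlt : ∀ x ≤ 6 * n + 1, x < M := fun x hx => by nlinarith
  have hnn : n * n < M := by nlinarith
  refine .seq (.assign ?_ (.seq (.assign ?_ (.seq (.assign ?_ (.seq (.assign ?_ ?_)))))))
  · simp only [Expr.eval_mul, Expr.eval_const, Expr.eval_reg, h0]
    exact hlt _ (by omega)
  · simp [h0]
    exact hlt _ (by omega)
  · simp [h0]
    exact hnn
  · simp
    omega
  refine .seq (Ok.loop' (fun k s' => s'.word 5 = 3 * n ∧ s'.word 3 = 2 ^ s'.word 4 ∧
    s'.word 3 ≤ 6 * n + 1 ∧ (3 * n ≤ s'.word 3 ∨ k < s'.word 3)) ?_ ?_ ?_)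
  · simp [h0, h4]
  · rintro k hk s' hs' ⟨h1, h2, h3, h5⟩
    have hp : s'.word 4 < 2 ^ s'.word 4 := Nat.lt_two_pow_self
    refine .seq (.assign ?_ (.assign ?_ ?_))
    · simp
      split_ifs <;> exact hlt _ (by omega)
    · simp only [Expr.eval_add, Expr.eval_mul, Expr.eval_lt', Expr.eval_reg, word_setWord]
      simp [h1]
      split_ifs <;> exact hlt _ (by omega)
    · simp [h1]
      split_ifs with h6
      · refine ⟨?_, by omega, by omega⟩
        rw [pow_succ, ← h2]
        omega
      · refine ⟨by simpa using h2, by omega, by omega⟩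
  · rintro s' hs' ⟨h1, h2, h3, h5⟩
    have e6 : s'.word 6 = 2 * n := (hs'.word 6 rfl).trans (by simp [h0])
    have e7 : s'.word 7 = n * n := (hs'.word 7 rfl).trans (by simp [h0])
    refine .assign ?_ ⟨s'.word 4, ?_⟩
    · simp
      nlinarith
    · simp [h1, h2, e6, e7] at h3 h5 ⊢
      simp [h0] at h5
      omega

/-- The only nonzero summand belongs to the ends of the edge in increasing order; this is how the
program finds them. -/
theorem sum_pair {a b : Fin v} (hab : a < b) {S : Finset (Fin v)} (hS : S = {a, b})
    (f : ℕ → ℕ → ℕ) (g : ℕ → ℕ) (hg : ∀ q : Fin v, g q = if q ∈ S then 1 else 0) :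
    ∑ q ∈ Finset.range v, ∑ q' ∈ Finset.range v, f q q' * (g q * (g q' * if q < q' then 1 else 0)) =
      f a b := by
  rw [Finset.sum_range, Finset.sum_eq_single a, Finset.sum_range, Finset.sum_eq_single b]
  · simp [hg, hS, hab]
  · intro q _ hq
    by_cases h : q ∈ S
    · rw [hS, Finset.mem_insert, Finset.mem_singleton] at h
      obtain rfl : q = a := h.resolve_right hq
      simp
    · simp [hg, h]
  · simp
  · intro q _ hq
    refine Finset.sum_eq_zero fun q' hq' => ?_
    obtain ⟨q', rfl⟩ : ∃ x : Fin v, (x : ℕ) = q' := ⟨⟨q', Finset.mem_range.1 hq'⟩, rfl⟩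
    by_cases h : q ∈ S
    · rw [hS, Finset.mem_insert, Finset.mem_singleton] at h
      obtain rfl : q = b := h.resolve_left hq
      by_cases h' : q' ∈ S
      · rw [hS, Finset.mem_insert, Finset.mem_singleton] at h'
        have : ¬ (q : ℕ) < q' := by
          rcases h' with rfl | rfl
          · have : (q' : ℕ) < q := hab
            omega
          · omega
        simp [this]
      · simp [hg, h']
    · simp [hg, h]
  · simp

theorem sum_pair_le {f : ℕ → ℕ → ℕ} {g : ℕ → ℕ} (hg : ∀ q < v, g q < 2)
    (hf : ∀ q < v, ∀ q' < v, f q q' ≤ v) :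
    ∑ q ∈ Finset.range v, ∑ q' ∈ Finset.range v, f q q' * (g q * (g q' * if q < q' then 1 else 0)) ≤
      v * (v * v) := by
  refine (Finset.sum_le_card_nsmul _ _ (v * v) fun q hq => ?_).trans (by simp)
  refine (Finset.sum_le_card_nsmul _ _ v fun q' hq' => ?_).trans (by simp)
  rw [Finset.mem_range] at hq hq'
  have h1 := hg q hq
  have h2 := hg q' hq'
  refine (Nat.mul_le_mul_left (f q q') (?_ : _ ≤ 1)).trans ((mul_one _).trans_le (hf q hq q' hq'))
  have h3 : g q = 0 ∨ g q = 1 := by omega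
  have h4 : g q' = 0 ∨ g q' = 1 := by omega
  rcases h3 with h3 | h3 <;> rcases h4 with h4 | h4 <;> simp [h3, h4]
  split_ifs <;> omega

theorem prepareTables_ok (hM : 2 ≤ M) (h0 : s.word 0 = n) (h1 : s.word 1 = v) (h2 : s.word 2 = d)
    (h7 : s.word 7 = n * n) (hz : ∀ x, s.realArray 4 x = 0)
    (hinc : ∀ (i : Fin n) (q : Fin v), s.wordArray 0 (i * v + q) = if q ∈ (σ i).1 then 1 else 0)
    (hw : ∀ i : Fin n, (σ i).1.card = 2 → s.realArray 0 i = w (σ i).1)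
    (hvM : v * (v * v) < M) : Ok M prepareTables s fun s' => Describes σ w d s' := by
  classical
  have hinc2 : ∀ i < n, ∀ q < v, s.wordArray 0 (i * v + q) < 2 := by
    intro i hi q hq
    rw [hinc ⟨i, hi⟩ ⟨q, hq⟩]
    split_ifs <;> omega
  have hvv : v ≤ v * (v * v) := by
    rcases Nat.eq_zero_or_pos v with rfl | hv
    · omega
    · exact Nat.le_mul_of_pos_right _ (Nat.mul_pos hv hv)
  refine Ok.then (Q := fun s' => ∀ i < n, s'.wordArray 1 i = numVertices σ i)
    (Ok.fill (numVertices σ) ?_ ?_ ?_) fun s₁ hs₁ hcard => ?_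
  · intro k hk f _
    rw [h0] at hk
    simp only [Expr.eval_sum, Expr.eval_arr, Expr.eval_add, Expr.eval_mul, Expr.eval_reg, word_setWord,
      word_setArr, wordArray_setWord, wordArray_setArr]
    simp only [h1, if_true, Nat.reduceEqDiff, if_false, Nat.zero_ne_one, OfNat.one_ne_ofNat]
    rw [Finset.sum_range, numVertices, dif_pos hk, Finset.sum_congr rfl fun q _ => hinc ⟨k, hk⟩ q]
    simp
  · intro k hk
    rw [h0] at hk
    rw [numVertices, dif_pos hk]
    have := Finset.card_le_univ (σ ⟨k, hk⟩).1
    rw [Fintype.card_fin] at this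
    omega
  · intro i hi
    simp [h0, hi]
  have e0 : s₁.wordArray 0 = s.wordArray 0 := hs₁.arr 0 rfl
  have w0 : s₁.word 0 = n := (hs₁.word 0 rfl).trans h0
  have w1 : s₁.word 1 = v := (hs₁.word 1 rfl).trans h1
  have w7 : s₁.word 7 = n * n := (hs₁.word 7 rfl).trans h7
  refine Ok.then (Q := fun s' => ∀ i < n, ∀ k < n, s'.wordArray 2 (i * n + k) =
      if IsFacet σ i k then 1 else 0)
    (Ok.fill (fun x => if IsFacet σ (x / n) (x % n) then 1 else 0) ?_ ?_ ?_) fun s₂ hs₂ hfacet => ?_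
  · intro x hx f _
    rw [w7] at hx
    obtain ⟨hi, hk, -⟩ := lt_sq_iff hx
    simp only [Expr.eval_sum, Expr.eval_arr, Expr.eval_add, Expr.eval_mul, Expr.eval_sub, Expr.eval_div,
      Expr.eval_mod, Expr.eval_eq, Expr.eval_const, Expr.eval_reg, word_setWord,
      word_setArr, wordArray_setWord, wordArray_setArr]
    simp only [w0, w1, e0, if_true, Nat.reduceEqDiff, if_false, OfNat.one_ne_ofNat,
      OfNat.zero_ne_ofNat, hcard _ hi, hcard _ hk]
    have hsub : (∑ q ∈ Finset.range v, s.wordArray 0 (x / n * v + q) *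
        (1 - s.wordArray 0 (x % n * v + q)) = 0) ↔ (σ ⟨x / n, hi⟩).1 ⊆ (σ ⟨x % n, hk⟩).1 := by
      rw [Finset.sum_eq_zero_iff]
      constructor
      · intro h q hq
        have := h q (Finset.mem_range.2 q.2)
        rw [hinc ⟨x / n, hi⟩ q, hinc ⟨x % n, hk⟩ q, if_pos hq] at this
        by_contra hq'
        simp [hq'] at this
      · intro h q hq
        have h3 := hinc ⟨x / n, hi⟩ ⟨q, Finset.mem_range.1 hq⟩
        have h4 := hinc ⟨x % n, hk⟩ ⟨q, Finset.mem_range.1 hq⟩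
        simp only at h3 h4
        rw [h3, h4]
        by_cases hq' : (⟨q, Finset.mem_range.1 hq⟩ : Fin v) ∈ (σ ⟨x / n, hi⟩).1
        · simp [h hq']
        · simp [hq']
    have hiff : IsFacet σ (x / n) (x % n) ↔ numVertices σ (x / n) + 1 = numVertices σ (x % n) ∧
        (σ ⟨x / n, hi⟩).1 ⊆ (σ ⟨x % n, hk⟩).1 := by
      rw [numVertices, dif_pos hi, numVertices, dif_pos hk]
      exact ⟨fun ⟨_, _, h⟩ => h, fun h => ⟨hi, hk, h⟩⟩
    simp only [hsub, hiff]
    by_cases h3 : numVertices σ (x / n) + 1 = numVertices σ (x % n)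
    · simp [h3]
    · simp [h3]
  · intro x _
    split_ifs <;> omega
  · intro i hi k hk
    simp [w7, idx_lt_sq hi hk, div_idx _ hk, mod_idx _ hk]
  have f0 : s₂.wordArray 0 = s.wordArray 0 := (hs₂.arr 0 rfl).trans e0
  have x0 : s₂.word 0 = n := (hs₂.word 0 rfl).trans w0
  have x1 : s₂.word 1 = v := (hs₂.word 1 rfl).trans w1
  refine Ok.then (Q := fun s' => ∀ (i : Fin n) (a b : Fin v), a < b → (σ i).1 = {a, b} →
      s'.wordArray 11 i = a)
    (Ok.fill (fun k => ∑ q ∈ Finset.range v, ∑ q' ∈ Finset.range v, q * (s.wordArray 0 (k * v + q) *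
      (s.wordArray 0 (k * v + q') * if q < q' then 1 else 0))) ?_ ?_ ?_) fun s₃ hs₃ hfst => ?_
  · intro k hk f _
    simp only [Expr.eval_sum, Expr.eval_arr, Expr.eval_add, Expr.eval_mul, Expr.eval_lt', Expr.eval_reg,
      word_setWord, word_setArr, wordArray_setWord, wordArray_setArr]
    simp [x1, f0]
  · intro k hk
    rw [x0] at hk
    exact (sum_pair_le (f := fun q _ => q) (hinc2 k hk) fun q hq _ _ => hq.le).trans_lt hvM
  · intro i a b hab hS
    have := sum_pair hab hS (fun q _ => q) (fun q => s.wordArray 0 (i * v + q)) (hinc i)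
    simpa [x0] using this
  have g0 : s₃.wordArray 0 = s.wordArray 0 := (hs₃.arr 0 rfl).trans f0
  have y0 : s₃.word 0 = n := (hs₃.word 0 rfl).trans x0
  have y1 : s₃.word 1 = v := (hs₃.word 1 rfl).trans x1
  refine ((Ok.fill (Q := fun s' => ∀ (i : Fin n) (a b : Fin v), a < b → (σ i).1 = {a, b} →
      s'.wordArray 12 i = b) (fun k => ∑ q ∈ Finset.range v, ∑ q' ∈ Finset.range v, q' *
      (s.wordArray 0 (k * v + q) * (s.wordArray 0 (k * v + q') * if q < q' then 1 else 0)))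
      ?_ ?_ ?_).fixes).mono fun s₄ ⟨hs₄, hsnd⟩ => ?_
  · intro k hk f _
    simp only [Expr.eval_sum, Expr.eval_arr, Expr.eval_add, Expr.eval_mul, Expr.eval_lt', Expr.eval_reg,
      word_setWord, word_setArr, wordArray_setWord, wordArray_setArr]
    simp [y1, g0]
  · intro k hk
    rw [y0] at hk
    exact (sum_pair_le (f := fun _ q' => q') (hinc2 k hk) fun _ _ q hq => hq.le).trans_lt hvM
  · intro i a b hab hS
    have := sum_pair hab hS (fun _ q' => q') (fun q => s.wordArray 0 (i * v + q)) (hinc i)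
    simpa [y0] using this
  have r0 : s₄.realArray 0 = s.realArray 0 :=
    (hs₄.rarr 0 rfl).trans ((hs₃.rarr 0 rfl).trans ((hs₂.rarr 0 rfl).trans (hs₁.rarr 0 rfl)))
  have r4 : s₄.realArray 4 = s.realArray 4 :=
    (hs₄.rarr 4 rfl).trans ((hs₃.rarr 4 rfl).trans ((hs₂.rarr 4 rfl).trans (hs₁.rarr 4 rfl)))
  have a0 : s₄.wordArray 0 = s.wordArray 0 := (hs₄.arr 0 rfl).trans g0
  have a1 : s₄.wordArray 1 = s₁.wordArray 1 :=
    (hs₄.arr 1 rfl).trans ((hs₃.arr 1 rfl).trans (hs₂.arr 1 rfl))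
  have a2 : s₄.wordArray 2 = s₂.wordArray 2 := (hs₄.arr 2 rfl).trans (hs₃.arr 2 rfl)
  have a11 : s₄.wordArray 11 = s₃.wordArray 11 := hs₄.arr 11 rfl
  refine ⟨(hs₄.word 0 rfl).trans y0, (hs₄.word 1 rfl).trans y1, ?_, ?_, ?_, ?_, ?_, ?_, ?_⟩
  · exact (hs₄.word 2 rfl).trans ((hs₃.word 2 rfl).trans ((hs₂.word 2 rfl).trans
      ((hs₁.word 2 rfl).trans h2)))
  · rwa [r4]
  · rwa [a0]
  · rwa [r0]
  · rwa [a1]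
  · intro i hi
    obtain ⟨a, b, hab, hS⟩ := Finset.card_eq_two.1 hi
    rw [a11]
    rcases lt_or_gt_of_ne hab with h | h
    · exact ⟨a, b, hab, hS, hfst i a b h hS, hsnd i a b h hS⟩
    · rw [Finset.pair_comm] at hS
      exact ⟨b, a, hab.symm, hS, hfst i b a h hS, hsnd i b a h hS⟩
  · intro i hi k hk
    rw [a2, hfacet i hi k hk]

end

end RAM

namespace RAM

open Elimination

/-! ### The program for homology bases -/

section Program

open RAM.Expr

/-- Write the basis to the output. -/
def writeBasis : Cmd := .seq (fill 0 7 (arr 17 (reg 16))) (.assign 0 (reg 25))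

/-- Compute a minimal homology basis. -/
def homologyBasis : Cmd :=
  .seq prepareSizes <| .seq prepareTables <| .seq (.loop 40 1 augment) writeBasis

end Program

theorem homologyBasisInput_represents {v n d : ℕ} {K : AbstractSimplicialComplex (Fin v)}
    (σ : Fin n ≃ K.faces) (w : Finset (Fin v) → ℝ≥0) :
    Represents (homologyBasisInput K σ w d) (homologyBasisInput K σ w d) :=
  ⟨fun _ _ => rfl, fun _ _ => rfl, fun A hA => by
    simp only [homologyBasisInput]
    rw [if_neg (by omega)], rfl⟩

section

variable {v n d : ℕ} {K : AbstractSimplicialComplex (Fin v)} {σ : Fin n ≃ K.faces}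
  {w : Finset (Fin v) → ℝ≥0} {s : Memory} {M L : ℕ}

theorem homologyBasisInput_incidence (i : Fin n) (q : Fin v) :
    (homologyBasisInput K σ w d).wordArray 0 (i * v + q) = if q ∈ (σ i).1 then 1 else 0 := by
  simp only [homologyBasisInput, if_true, rowMajor]
  rw [dif_pos ⟨by rw [div_idx _ q.2]; exact i.2, by have := q.2; omega⟩]
  simp only [div_idx _ q.2, mod_idx _ q.2]

theorem homologyBasisInput_weight (i : Fin n) (hi : (σ i).1.card = 2) :
    (homologyBasisInput K σ w d).realArray 0 i = w (σ i).1 := by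
  simp [homologyBasisInput, hi]

theorem homologyBasisInput_realArray {A : ℕ} (hA : A ≠ 0) (x : ℕ) :
    (homologyBasisInput K σ w d).realArray A x = 0 := by
  simp [homologyBasisInput, hA]

theorem homologyBasisInput_wordArray {A : ℕ} (hA : A ≠ 0) (x : ℕ) :
    (homologyBasisInput K σ w d).wordArray A x = 0 := by
  simp [homologyBasisInput, hA]

theorem homologyBasisInput_bounded (hM : 2 ≤ M) (hn : n < M) (hv : v < M) (hd : d < M) :
    Bounded M (homologyBasisInput K σ w d) := by
  refine ⟨fun r => ?_, fun A x => ?_⟩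
  · simp only [homologyBasisInput]
    split_ifs <;> omega
  · simp only [homologyBasisInput]
    split_ifs
    · simp only [rowMajor]
      split_ifs <;> omega
    · show 0 < M
      omega

/-- For no vertices, the empty basis is a greedy basis. -/
theorem State.init (h : Layout σ w d M L s) (hB : Bounded M s) (h1 : ∀ x, s.realArray 1 x = 0)
    (h2 : ∀ x, s.realArray 2 x = 0) (h4 : ∀ x, s.wordArray 4 x = 0) (h14 : ∀ x, s.wordArray 14 x = 0)
    (h17 : ∀ x, s.wordArray 17 x = 0) (h25 : s.word 25 = 0) : State σ w d M L 0 s := by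
  refine ⟨h, hB, ⟨fun q => (h1 q).ge, fun q => (h2 q).ge, fun q => by rw [h14]; omega⟩,
    fun i _ j _ => by rw [h4]; omega, 0, fun _ => 0, fun _ => 0, ⟨linearIndependent_empty_type,
      fun i hi => absurd hi (by omega), fun p hp => absurd hp (Nat.not_lt_zero _)⟩, h25, fun t _ i _ => ?_,
      fun t ht => absurd ht (by omega)⟩
  rw [h17, if_neg (by omega)]
  exact ⟨by omega, rfl⟩

/-- When all vertices have been taken into account, the basis that is stored is minimal. -/
theorem writeBasis_ok (h : State σ w d M L v s) : Ok M writeBasis s fun s' =>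
    ∃ (g : ℕ) (c : Fin g → cycles K d), IsMinimalHomologyBasis K w d c ∧ OutputsCycles σ c s' := by
  obtain ⟨g, c, key, hb⟩ := h.basis
  have hg := hb.greedy.le
  have hP : {p' : Fin v | (p' : ℕ) < v} = Set.univ := Set.eq_univ_of_forall fun p' => p'.2
  refine .seq (Ok.fill (fun x => s.wordArray 17 x) ?_ ?_ (.assign ?_
    ⟨g, fun i => c i, (hP ▸ hb.greedy).isMinimal, ?_, fun j i => ?_⟩))
  · intro k _ f _
    simp
  · exact fun k _ => h.bounded.array _ _
  · exact h.bounded.word 25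
  · simp [hb.count]
  · have hj : (j : ℕ) < n := j.2.trans_le hg
    obtain ⟨h1, h2⟩ := hb.row j hj i i.2
    rw [if_pos j.2] at h2
    have h3 : simplexCoeff (c j) (σ i) = chainVec σ (c j).1 i := by
      simp only [simplexCoeff, chainVec, LinearMap.coe_mk, AddHom.coe_mk]
      rw [dif_pos i.2]
    rw [h3, ← h2, ZMod.val_natCast_of_lt h1]
    simp [h.layout.square, idx_lt_sq hj i.2]

end

/-- The cost is that of two eliminations for each vertex, up to a cubic term. -/
theorem exists_homologyBasis_spec : ∃ C : ℕ, ∀ {v n d M : ℕ} {K : AbstractSimplicialComplex (Fin v)}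
    (σ : Fin n ≃ K.faces) (w : Finset (Fin v) → ℝ≥0) (κ : ℕ → ℕ),
    (6 * n + 1) * (6 * n + 1) < M → n * (n * n) < M → d < M → ∃ L, 2 ^ L ≤ 6 * n + 1 ∧
      Spec M κ homologyBasis (homologyBasisInput K σ w d)
        (C * (6 * n + 1) ^ 3 + n * (2 * eliminateCost κ (2 ^ L) L)) fun s' =>
          ∃ (g : ℕ) (c : Fin g → cycles K d), IsMinimalHomologyBasis K w d c ∧ OutputsCycles σ c s' := by
  obtain ⟨C₁, h₁⟩ := exists_augment_spec
  obtain ⟨C₂, h₂⟩ := prepareTables.exists_spec (o := 3) rfl rfl rfl (by decide)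
  refine ⟨300 + C₂ + (C₁ + 200), fun {v n d M K} σ w κ hnM hnnM hdM => ?_⟩
  have hM : 2 ≤ M := by nlinarith
  have hvn : v ≤ n := card_le_of_equiv σ
  have hsn : n < M := by nlinarith
  have hvv : v * (v * v) < M :=
    (Nat.mul_le_mul hvn (Nat.mul_le_mul hvn hvn)).trans_lt hnnM
  have hB : 1 ≤ 6 * n + 1 := by omega
  set s := homologyBasisInput K σ w d with hs
  have hB₀ : Bounded M s := homologyBasisInput_bounded hM hsn (by omega) hdM
  have hw0 : s.word 0 = n := rfl
  -- the size of the matrices is found by the first command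
  have hsizes := (prepareSizes_ok hM hw0 rfl hnM).bounded hM hB₀
  obtain ⟨L, hL⟩ : ∃ L, 2 ^ L ≤ 6 * n + 1 ∧ Ok M prepareSizes s fun s' => Bounded M s' ∧ s'.word 3 = 2 ^ L ∧
      s'.word 4 = L ∧ s'.word 5 = 3 * n ∧ s'.word 6 = 2 * n ∧ s'.word 7 = n * n ∧
      s'.word 11 = 2 ^ L * 2 ^ L ∧ 3 * n ≤ 2 ^ L := by
    obtain ⟨hsafe, hb, L, h3, h4, h5, h6, h7, h11, hle, hL⟩ := hsizes
    exact ⟨L, hL, hsafe, hb, h3, h4, h5, h6, h7, h11, hle⟩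
  have hcost : prepareSizes.cost κ s ≤ 300 * (n + 1) := by
    simp [prepareSizes, Cmd.cost, Expr.cost, Cmd.den, hw0]
    omega
  have hspec := Spec.of_cost hL.2 hcost
  refine ⟨L, hL.1, Spec.mono (Spec.then (T := 300 * (n + 1)) (T' := C₂ * (6 * n + 1) ^ 3 +
    (n * (C₁ * (6 * n + 1) ^ 2 + 2 * eliminateCost κ (2 ^ L) L + 4) + 7 + (50 * (n * n) + 50)))
    hspec
    fun s₁ hs₁ ⟨hB₁, h3, h4, h5, h6, h7, h11, hle⟩ => ?_) ?_ fun _ h => h⟩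
  · have w0 : s₁.word 0 = n := hs₁.word 0 rfl
    have w1 : s₁.word 1 = v := hs₁.word 1 rfl
    refine Spec.then ((h₂ hB (fun m hm hmb => ?_) (prepareTables_ok (σ := σ) (w := w) hM w0 w1
      (hs₁.word 2 rfl) h7 (fun x => ?_) (fun i q => ?_) (fun i hi => ?_) hvv)).bounded hM hB₁)
      fun s₂ hs₂ ⟨hB₂, hd₂⟩ => ?_
    · have : m = 0 ∨ m = 1 ∨ m = 7 := by
        revert m
        decide
      rcases this with rfl | rfl | rfl
      · simp [weight, w0]
        omega
      · simp [weight, w1]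
        omega
      · simp [weight, h7]
        nlinarith
    · rw [hs₁.rarr 4 rfl]
      exact homologyBasisInput_realArray (by omega) x
    · rw [hs₁.arr 0 rfl]
      exact homologyBasisInput_incidence i q
    · rw [hs₁.rarr 0 rfl]
      exact homologyBasisInput_weight i hi
    have hl : Layout σ w d M L s₂ := ⟨hd₂, (hs₂.word 3 rfl).trans h3, (hs₂.word 4 rfl).trans h4,
      (hs₂.word 5 rfl).trans h5, (hs₂.word 6 rfl).trans h6, (hs₂.word 7 rfl).trans h7,
      (hs₂.word 11 rfl).trans h11, hle, (Nat.mul_le_mul hL.1 hL.1).trans_lt hnM⟩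
    have hinit : State σ w d M L 0 s₂ := by
      refine .init hl hB₂ (fun x => ?_) (fun x => ?_) (fun x => ?_) (fun x => ?_) (fun x => ?_) ?_
      · rw [hs₂.rarr 1 rfl, hs₁.rarr 1 rfl]
        exact homologyBasisInput_realArray (by omega) x
      · rw [hs₂.rarr 2 rfl, hs₁.rarr 2 rfl]
        exact homologyBasisInput_realArray (by omega) x
      · rw [hs₂.arr 4 rfl, hs₁.arr 4 rfl]
        exact homologyBasisInput_wordArray (by omega) x
      · rw [hs₂.arr 14 rfl, hs₁.arr 14 rfl]
        exact homologyBasisInput_wordArray (by omega) x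
      · rw [hs₂.arr 17 rfl, hs₁.arr 17 rfl]
        exact homologyBasisInput_wordArray (by omega) x
      · rw [hs₂.word 25 rfl, hs₁.word 25 rfl]
        rfl
    refine Spec.then (Q := State σ w d M L v) (Spec.mono (Spec.loop' (fun k s' => State σ w d M L k s')
      (fun _ => C₁ * (6 * n + 1) ^ 2 + 2 * eliminateCost κ (2 ^ L) L) hinit
      (fun k hk s' hs' h => ?_) fun s' _ h => ?_) ?_ fun _ h => h) fun s₃ hs₃ h₃ => ?_
    · rw [hd₂.v_eq] at hk
      refine (h₁ (p := ⟨k, hk⟩) hM hvn hL.1 (h.of_word (by omega)) (by simp)).mono le_rfl fun s'' h'' =>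
        h''.of_word (hB₂.word 40)
    · rwa [hd₂.v_eq] at h
    · rw [Finset.sum_const, Finset.card_range, smul_eq_mul, hd₂.v_eq]
      gcongr
    · obtain ⟨hsafe, hQ⟩ := writeBasis_ok h₃
      refine ⟨hsafe, ?_, hQ⟩
      simp [writeBasis, fill, fillAt, Cmd.cost, Expr.cost, h₃.layout.square]
      omega
  · generalize hE : eliminateCost κ (2 ^ L) L = E
    have e1 : n * n ≤ (6 * n + 1) ^ 3 := by nlinarith
    have e2 : n * (6 * n + 1) ^ 2 ≤ (6 * n + 1) ^ 3 := by
      rw [pow_succ _ 2, mul_comm]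
      exact Nat.mul_le_mul_left _ (by omega)
    have e3 : n + 1 ≤ (6 * n + 1) ^ 3 :=
      (show n + 1 ≤ 6 * n + 1 by omega).trans (Nat.le_self_pow (by omega) _)
    have e4 : C₁ * (n * (6 * n + 1) ^ 2) ≤ C₁ * (6 * n + 1) ^ 3 := Nat.mul_le_mul_left _ e2
    generalize (6 * n + 1) ^ 3 = B₃ at *
    generalize (6 * n + 1) ^ 2 = B₂ at *
    calc _ = 300 * (n + 1) + C₂ * B₃ + C₁ * (n * B₂) + 4 * n + 50 * (n * n) + 57 + n * (2 * E) := by ring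
      _ ≤ 300 * B₃ + C₂ * B₃ + C₁ * B₃ + 200 * B₃ + n * (2 * E) := by omega
      _ = _ := by ring

end RAM

/-! ### The running time -/

namespace RAM

/-- The running time of a multiplication, and hence the number of logged writes, fits into a
word. -/
theorem ceil_mul_rpow_lt {C ω : ℝ} {N M b : ℕ} (hω : 0 ≤ ω) (hN : |C| + 1 < 2 ^ N) (hb : b < M) :
    ⌈C * (b : ℝ) ^ ω⌉₊ < 2 ^ N * M ^ ⌈ω⌉₊ := by
  have hM : (1 : ℝ) ≤ M := by exact_mod_cast (by omega : 1 ≤ M)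
  have hbM : (b : ℝ) ≤ M := by exact_mod_cast hb.le
  set Y : ℝ := (M : ℝ) ^ ⌈ω⌉₊ with hY
  have hY1 : 1 ≤ Y := one_le_pow₀ hM
  have h1 : (b : ℝ) ^ ω ≤ Y := by
    rw [hY, ← Real.rpow_natCast]
    exact (Real.rpow_le_rpow (by positivity) hbM hω).trans
      (Real.rpow_le_rpow_of_exponent_le hM (Nat.le_ceil ω))
  have h2 : C * (b : ℝ) ^ ω ≤ |C| * Y :=
    (mul_le_mul_of_nonneg_right (le_abs_self C) (by positivity)).trans
      (mul_le_mul_of_nonneg_left h1 (abs_nonneg C))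
  have h3 : (⌈C * (b : ℝ) ^ ω⌉₊ : ℝ) < |C| * Y + 1 :=
    lt_of_le_of_lt (by exact_mod_cast Nat.ceil_mono h2) (Nat.ceil_lt_add_one (by positivity))
  have h4 : (⌈C * (b : ℝ) ^ ω⌉₊ : ℝ) < 2 ^ N * (M : ℝ) ^ ⌈ω⌉₊ := by
    rw [← hY]
    nlinarith
  exact_mod_cast h4

theorem natCast_pow_le_rpow {b : ℕ} {ω : ℝ} {k : ℕ} (hb : 0 < b) (h : (k : ℝ) ≤ ω) :
    ((b ^ k : ℕ) : ℝ) ≤ (b : ℝ) ^ ω := by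
  rw [Nat.cast_pow, ← Real.rpow_natCast]
  exact Real.rpow_le_rpow_of_exponent_le (by exact_mod_cast hb) h

/-- The time for a call of the multiplication program, with the copying, is of the order `b ^ ω`. -/
theorem callCost_le {C ω : ℝ} (hω : 2 < ω) (R : ℕ) {b : ℕ} (hb : 0 < b) :
    (((R + 20) * (b * b + ⌈C * (b : ℝ) ^ ω⌉₊ + 1) : ℕ) : ℝ) ≤
      (R + 20) * (|C| + 3) * (b : ℝ) ^ ω := by
  have h1 : (b * b : ℝ) ≤ (b : ℝ) ^ ω := by
    have := natCast_pow_le_rpow (k := 2) hb (by exact_mod_cast hω.le)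
    rwa [Nat.cast_pow, sq] at this
  have h2 : (1 : ℝ) ≤ (b : ℝ) ^ ω :=
    Real.one_le_rpow (by exact_mod_cast hb) (by linarith)
  have h3 : (⌈C * (b : ℝ) ^ ω⌉₊ : ℝ) ≤ |C| * (b : ℝ) ^ ω + 1 :=
    (Nat.cast_le.2 (Nat.ceil_mono
      (mul_le_mul_of_nonneg_right (le_abs_self C) (by positivity)))).trans
      (Nat.ceil_lt_add_one (by positivity)).le
  push_cast
  rw [mul_assoc]
  refine mul_le_mul_of_nonneg_left ?_ (by positivity)
  linarith

/-- The cubic term is of lower order, as `2 < ω`. -/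
theorem totalCost_le {ω K : ℝ} (hω : 2 < ω) (hK : 0 ≤ K) {n C E S : ℕ}
    (hS : S ≤ 6 * n + 1) (hE : (E : ℝ) ≤ K * (S : ℝ) ^ ω) :
    ((C * (6 * n + 1) ^ 3 + n * (2 * E) : ℕ) : ℝ) ≤
      (C + 2 * K) * 6 ^ (ω + 1) * ((n : ℝ) + 1) ^ (ω + 1) := by
  have hn : (0 : ℝ) ≤ n := Nat.cast_nonneg n
  set B : ℝ := ((6 * n + 1 : ℕ) : ℝ) with hB
  have hB1 : 1 ≤ B := by rw [hB]; exact_mod_cast (by omega : 1 ≤ 6 * n + 1)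
  have hB6 : B ≤ 6 * ((n : ℝ) + 1) := by rw [hB]; push_cast; linarith
  have h1 : (((6 * n + 1) ^ 3 : ℕ) : ℝ) ≤ B ^ (ω + 1) :=
    natCast_pow_le_rpow (by omega) (by push_cast; linarith)
  have h2 : (E : ℝ) ≤ K * B ^ ω :=
    hE.trans (mul_le_mul_of_nonneg_left (Real.rpow_le_rpow (by positivity)
      (by rw [hB]; exact_mod_cast hS) (by linarith)) hK)
  have h3 : (n : ℝ) * (2 * E) ≤ 2 * K * B ^ (ω + 1) := by
    rw [Real.rpow_add_one (by positivity)]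
    have hnB : (n : ℝ) ≤ B := by rw [hB]; exact_mod_cast (by omega : n ≤ 6 * n + 1)
    calc (n : ℝ) * (2 * E) ≤ B * (2 * (K * B ^ ω)) :=
          mul_le_mul hnB (by linarith) (by positivity) (by positivity)
      _ = _ := by ring
  have h4 : B ^ (ω + 1) ≤ 6 ^ (ω + 1) * ((n : ℝ) + 1) ^ (ω + 1) := by
    rw [← Real.mul_rpow (by norm_num) (by positivity)]
    exact Real.rpow_le_rpow (by positivity) hB6 (by linarith)
  calc ((C * (6 * n + 1) ^ 3 + n * (2 * E) : ℕ) : ℝ)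
      = C * (((6 * n + 1) ^ 3 : ℕ) : ℝ) + n * (2 * E) := by push_cast; ring
    _ ≤ C * B ^ (ω + 1) + 2 * K * B ^ (ω + 1) :=
      add_le_add (mul_le_mul_of_nonneg_left h1 (Nat.cast_nonneg C)) h3
    _ = (C + 2 * K) * B ^ (ω + 1) := by ring
    _ ≤ _ := by
      rw [mul_assoc]
      exact mul_le_mul_of_nonneg_left h4 (by positivity)

end RAM

theorem mainTheorem7 (ω : ℝ) (hω : 2 < ω) (hmul : MatMulInTime ω) :
    ∃ (P : Program) (k : ℕ) (C : ℝ),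
      ∀ (v n d : ℕ) (K : AbstractSimplicialComplex (Fin v)) (σ : Fin n ≃ K.faces)
        (w : Finset (Fin v) → ℝ≥0),
        ∃ (s : Memory) (t : ℕ),
          Exec ((n + d + 2) ^ k) P (homologyBasisInput K σ w d) s t ∧
          (t : ℝ) ≤ C * ((n : ℝ) + 1) ^ (ω + 1) ∧
          ∃ (g : ℕ) (c : Fin g → cycles K d),
            IsMinimalHomologyBasis K w d c ∧ OutputsCycles σ c s := by
  obtain ⟨P, k₀, C₀, hP⟩ := hmul
  have hPμ : MultipliesWithin P k₀ fun m => ⌈C₀ * (m : ℝ) ^ ω⌉₊ := by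
    intro m A B hm
    obtain ⟨s, t, h1, h2, h3⟩ := hP m A B hm
    exact ⟨s, t, h1, by exact_mod_cast h2.trans (Nat.le_ceil _), h3⟩
  set R := max P.width 2 with hR
  obtain ⟨K₁, hK₁, helim⟩ := RAM.exists_eliminateCost_le (c := (R + 20) * (|C₀| + 3)) hω (by positivity)
  obtain ⟨C₁, hspec⟩ := RAM.exists_homologyBasis_spec
  obtain ⟨N, hN⟩ := pow_unbounded_of_one_lt (|C₀| + 1) (one_lt_two (α := ℝ))
  set D := RAM.homologyBasis.deg with hD
  -- the intermediate words are below `X ^ 10`, where `X = n + d + 2`, and the exponent of the word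
  -- bound suffices for expressions of degree `D` in them and for the multiplication program
  set k := 11 * k₀ + N + 10 * ⌈ω⌉₊ + 10 * (D + 1) + 1 with hk
  refine ⟨RAM.homologyBasis.compile P R 0, k, (C₁ + 2 * K₁) * 6 ^ (ω + 1),
    fun v n d K σ w => ?_⟩
  set X := n + d + 2 with hX
  have hX2 : 2 ≤ X := by omega
  have hmono : ∀ {a b : ℕ}, a ≤ b → X ^ a ≤ X ^ b := fun h => Nat.pow_le_pow_right (by omega) h
  have hX4 : 6 * n + 1 < X ^ 4 := by
    have h1 : 2 ^ 3 * X ≤ X ^ 3 * X := Nat.mul_le_mul_right X (Nat.pow_le_pow_left hX2 3)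
    rw [pow_succ X 3]
    omega
  have hM1 : (6 * n + 1) * (6 * n + 1) < X ^ 10 :=
    (Nat.mul_lt_mul'' hX4 hX4).trans_le (by rw [← pow_add]; exact hmono (by omega))
  have hM2 : n * (n * n) < X ^ 10 := by
    have : n * (n * n) < X ^ 3 := by
      have := Nat.pow_lt_pow_left (show n < X by omega) (n := 3) (by omega)
      linarith [pow_succ n 2, sq n, mul_comm (n ^ 2) n]
    exact this.trans_le (hmono (by omega))
  have hXM : X ≤ X ^ 10 := Nat.le_self_pow (by omega) X
  have hM3 : d < X ^ 10 := (show d < X by omega).trans_le hXM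
  obtain ⟨L, hL, hsafe, hcost, hQ⟩ := hspec σ w
    (fun b => (R + 20) * (b * b + ⌈C₀ * (b : ℝ) ^ ω⌉₊ + 1)) hM1 hM2 hM3
  have hnM : n < X ^ 10 := (show n < X by omega).trans_le hXM
  have hM : 2 ≤ X ^ 10 := hX2.trans hXM
  have hWk : ∀ b < X ^ 10, (b + 2) ^ k₀ ≤ X ^ k := by
    intro b hb
    have h1 : b + 2 ≤ X ^ 11 := by
      have := Nat.mul_le_mul_left (X ^ 10) hX2
      rw [pow_succ X 10]
      omega
    calc (b + 2) ^ k₀ ≤ (X ^ 11) ^ k₀ := Nat.pow_le_pow_left h1 k₀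
      _ = X ^ (11 * k₀) := (pow_mul X 11 k₀).symm
      _ ≤ X ^ k := hmono (by omega)
  have hWμ : ∀ b < X ^ 10, ⌈C₀ * (b : ℝ) ^ ω⌉₊ < X ^ k := by
    intro b hb
    calc ⌈C₀ * (b : ℝ) ^ ω⌉₊ < 2 ^ N * (X ^ 10) ^ ⌈ω⌉₊ := RAM.ceil_mul_rpow_lt (by linarith) hN hb
      _ ≤ X ^ N * X ^ (10 * ⌈ω⌉₊) := by
        rw [← pow_mul]
        exact Nat.mul_le_mul_right _ (Nat.pow_le_pow_left hX2 N)
      _ = X ^ (N + 10 * ⌈ω⌉₊) := (pow_add _ _ _).symm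
      _ ≤ X ^ k := hmono (by omega)
  have hWD : (X ^ 10) ^ (D + 1) < X ^ k := by
    rw [← pow_mul]
    exact Nat.pow_lt_pow_right (by omega) (by omega)
  obtain ⟨s, t, hexec, ht, hs, -⟩ := RAM.homologyBasis.compile_halts (h := 0) hPμ
    (le_max_left _ _) (le_max_right _ _) hM hWk hWμ rfl hsafe
    (RAM.homologyBasisInput_bounded hM hnM ((RAM.card_le_of_equiv σ).trans_lt hnM) hM3)
    (RAM.homologyBasisInput_represents σ w) hWD
  obtain ⟨g, c, hc, h0, hrow⟩ := hQ
  refine ⟨s, t, hexec, ?_, g, c, hc, (hs.word 0 (by omega)).trans h0, fun j i => ?_⟩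
  · exact (Nat.cast_le.2 (ht.trans hcost)).trans (RAM.totalCost_le hω hK₁ hL
      (helim _ (fun b hb => RAM.callCost_le hω R hb) L))
  · rw [hs.array 0 (by omega)]
    exact hrow j i
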